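/- **Setting.** Let $n,d\ge 1$ and consider $n$ workers linked by an undirected graph with edge set $\mathcal E$, each edge $(i,j)\in\mathcal E$ having a frequency $\lambda^{ij}>0$. Let $\Lambda=\sum_{(i,j)\in\mathcal E}\lambda^{ij}(e_i-e_j)(e_i-e_j)^{\mathsf T}$ (each undirected edge counted once), let $\Lambda^+$ be its Moore–Penrose pseudo-inverse, and $$\chi_1=\sup_{\|x\|=1,\ x\perp\mathbf 1}\frac1{x^{\mathsf T}\Lambda x},\qquad \chi_2=\tfrac12\sup_{(i,j)\in\mathcal E}(e_i-e_j)^{\mathsf T}\Lambda^+(e_i-e_j).$$ Assume that $\chi_1<\infty$ (the network is connected). Let $f=\frac1n\sum_{i=1}^n f_i$ with $f_i:\mathbb R^d\to\mathbb R$, let $x^*$ be a minimizer of $f$, and let $\nabla F_i(x,\xi)$, with $\xi$ of law $\mathcal P$ on a probability space $\Xi$, be stochastic gradients of finite variance with $\mathbb E_\xi[\nabla F_i(x,\xi)]=\nabla f_i(x)$. The processes $x_t=(x_t^1,\dots,x_t^n)$ and $\tilde x_t=(\tilde x_t^1,\dots,\tilde x_t^n)$ in $(\mathbb R^d)^n$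 follow, for $i=1,\dots,n$, the dynamic $$dx^i_t=\eta(\tilde x^i_t-x^i_t)\,dt-\gamma\int_\Xi\nabla F_i(x^i_{t^-},\xi)\,dN^i_t(\xi)-\alpha\sum_{j:(i,j)\in\mathcal E}(x^i_{t^-}-x^j_{t^-})\,dM^{ij}_t,$$ $$d\tilde x^i_t=\eta(x^i_t-\tilde x^i_t)\,dt-\gamma\int_\Xi\nabla F_i(x^i_{t^-},\xi)\,dN^i_t(\xi)-\tilde\alpha\sum_{j:(i,j)\in\mathcal E}(x^i_{t^-}-x^j_{t^-})\,dM^{ij}_t,$$ where the $N^i$ are Poisson point processes on $\mathbb R_+\times\Xi$ of intensity $dt\otimes d\mathcal P$, the $M^{ij}=M^{ji}$ are Poisson processes of rate $\lambda^{ij}$, and all these processes are independent. It starts at consensus: $x^i_0=\tilde x^i_0=\bar x_0$ for all $i$, with $\bar x_0$ deterministic. Write $\bar x_t=\frac1n\sum_i x^i_t$. Two settings are considered: * non-accelerated: $\eta=0$, $\alpha=\tilde\alpha=\frac12$, and $\chi=\chi_1$; * accelerated (A²CiD²): $\eta=\frac1{2\sqrt{\chi_1\chi_2}}$, $\alpha=\frac12$,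 $\tilde\alpha=\frac12\sqrt{\frac{\chi_1}{\chi_2}}$, and $\chi=\sqrt{\chi_1\chi_2}\le\chi_1$ (for $n=1$, where $\chi_1=\chi_2=0$ and the network plays no role, put $\eta=\tilde\alpha=0$). **Claim.** There are an absolute constant $C$ and functions $c>0$ and $B$ of two variables such that the following holds in both settings, for all $L>0$ and every total running time $T>0$. 1. *(Strong convexity)* Let $\mu>0$. Suppose that each $f_i$ is $\mu$-strongly convex and $L$-smooth, that $\frac1n\sum_i\mathbb E_\xi\|\nabla F_i(x,\xi)-\nabla f_i(x)\|^2\le\sigma^2$ for all $x\in\mathbb R^d$, and that $\frac1n\sum_i\|\nabla f_i(x^*)-\nabla f(x^*)\|^2\le\zeta^2$. Let $r_0=\|\bar x_0-x^*\|^2$ and $S=\sigma^2+\zeta^2(1+\chi)$. Then there is a constant step size $0<\gamma\le\frac1{16L(1+\chi)}$ for which $$\mathbb E\|\bar x_T-x^*\|^2\le C\,n\left(r_0\,e^{-\frac{\mu T}{16L(1+\chi)}}+\frac{S}{\mu^2T}\,\log\max\Big\{2,\frac{\mu^2r_0T}{S}\Big\}\right)$$ (the last term is $0$ if $S=0$).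 If moreover $\frac1n\sum_i\mathbb E_\xi\|\nabla F_i(x_i,\xi)-\nabla f_i(x_i)\|^2\le\sigma^2$ for all $x_1,\dots,x_n\in\mathbb R^d$, then there is such a $\gamma$ for which the bound holds without the factor $n$. 2. *(Non-convexity)* Let $P,M\ge0$. Suppose that each $f_i$ is $L$-smooth, that $\frac1n\sum_i\|\nabla f_i(x)-\nabla f(x)\|^2\le\zeta^2+P\|\nabla f(x)\|^2$ for all $x\in\mathbb R^d$, and that $\frac1n\sum_i\mathbb E_\xi\|\nabla F_i(x_i,\xi)-\nabla f_i(x_i)\|^2\le\sigma^2+\frac Mn\sum_i\|\nabla f_i(x_i)\|^2$ for all $x_1,\dots,x_n\in\mathbb R^d$. Let $f_0=f(\bar x_0)-f(x^*)$, and suppose that $f_0>0$ unless $\sigma=\zeta=0$. Then there is a constant step size $0<\gamma\le\frac{c(P,M)}{L(1+\chi)}$ for which $$\frac1T\int_0^T\mathbb E\|\nabla f(\bar x_t)\|^2\,dt\le B(P,M)\left(\frac{L(1+\chi)}Tf_0+\sqrt{\frac{Lf_0}T\big(\sigma^2+(1+\chi)\zeta^2\big)}\right).$$ 3. The expected number of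 gradient steps up to time $T$ is $nT$, and the expected number of communications up to time $T$ is $\frac{\mathrm{Tr}(\Lambda)}2T$. -/

import Mathlib

open MeasureTheory ProbabilityTheory Filter Topology
open scoped ENNReal Matrix Gradient

universe u v

namespace Gossip

/-! ### The communication network and its constants -/

/-- A network of `n` workers: an undirected graph together with the instantaneous expected
frequency `rate s(i, j)` of each of its edges (values of `rate` outside the edge set are never
used). -/
structure Network (n : ℕ) where
  /-- which workers are linked -/
  graph : SimpleGraph (Fin n)
  /-- the frequency of each edge -/
  rate : Sym2 (Fin n) → ℝ
  rate_pos : ∀ e ∈ graph.edgeSet, 0 < rate e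

/-- The vector `e_i - e_j`. -/
def edgeVec {n : ℕ} (i j : Fin n) : Fin n → ℝ := Pi.single i 1 - Pi.single j 1

theorem edgeVec_swap {n : ℕ} (i j : Fin n) : edgeVec i j = -edgeVec j i := by
  simp [edgeVec]

/-- The matrix `(e_i - e_j)(e_i - e_j)ᵀ`, which depends only on the unordered pair `{i, j}`. -/
def edgeMatrix {n : ℕ} : Sym2 (Fin n) → Matrix (Fin n) (Fin n) ℝ :=
  Sym2.lift ⟨fun i j => Matrix.vecMulVec (edgeVec i j) (edgeVec i j), fun i j => by
    dsimp only
    rw [edgeVec_swap i j, Matrix.neg_vecMulVec, Matrix.vecMulVec_neg, neg_neg]⟩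

/-- The quadratic form `(e_i - e_j)ᵀ A (e_i - e_j)`, which depends only on `{i, j}`. -/
def edgeForm {n : ℕ} (A : Matrix (Fin n) (Fin n) ℝ) : Sym2 (Fin n) → ℝ :=
  Sym2.lift ⟨fun i j => edgeVec i j ⬝ᵥ (A *ᵥ edgeVec i j), fun i j => by
    dsimp only
    rw [edgeVec_swap i j, Matrix.mulVec_neg, neg_dotProduct_neg]⟩

open Classical in
/-- The instantaneous expected Laplacian `Λ = ∑_{(i,j) ∈ ℰ} λ^{ij} (e_i - e_j)(e_i - e_j)ᵀ`, each
undirected edge being counted once. -/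
noncomputable def laplacian {n : ℕ} (N : Network n) : Matrix (Fin n) (Fin n) ℝ :=
  ∑ e ∈ N.graph.edgeFinset, N.rate e • edgeMatrix e

theorem laplacian_isHermitian {n : ℕ} (N : Network n) : (laplacian N).IsHermitian := by
  classical
  unfold laplacian Matrix.IsHermitian
  rw [Matrix.conjTranspose_sum]
  refine Finset.sum_congr rfl fun e _ => ?_
  rw [Matrix.conjTranspose_smul, star_trivial]
  congr 1
  induction e with
  | _ i j => ext a b; simp [edgeMatrix, Matrix.vecMulVec_apply, mul_comm]

/-- `B` is a Moore-Penrose pseudo-inverse of the real square matrix `A`. -/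
structure IsMoorePenrose {n : ℕ} (A B : Matrix (Fin n) (Fin n) ℝ) : Prop where
  mul_mul_self : A * B * A = A
  self_mul_mul : B * A * B = B
  left_symm : (A * B)ᵀ = A * B
  right_symm : (B * A)ᵀ = B * A

theorem exists_isMoorePenrose {n : ℕ} {A : Matrix (Fin n) (Fin n) ℝ} (hA : A.IsHermitian) :
    ∃ B, IsMoorePenrose A B := by
  have hU : star (hA.eigenvectorUnitary : Matrix (Fin n) (Fin n) ℝ) * hA.eigenvectorUnitary = 1 :=
    Unitary.coe_star_mul_self _
  have hS := hA.spectral_theorem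
  rw [Unitary.conjStarAlgAut_apply] at hS
  generalize (hA.eigenvectorUnitary : Matrix (Fin n) (Fin n) ℝ) = U at hU hS
  generalize (RCLike.ofReal ∘ hA.eigenvalues : Fin n → ℝ) = v at hS
  have key : ∀ a b : Fin n → ℝ, U * Matrix.diagonal a * star U * (U * Matrix.diagonal b * star U)
      = U * Matrix.diagonal (fun i => a i * b i) * star U := fun a b => by
    rw [← Matrix.diagonal_mul_diagonal]
    calc _ = U * Matrix.diagonal a * (star U * U) * Matrix.diagonal b * star U := by
          simp only [mul_assoc]
      _ = _ := by rw [hU]; simp only [mul_one, mul_assoc]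
  have symm : ∀ a : Fin n → ℝ, (U * Matrix.diagonal a * star U)ᵀ = U * Matrix.diagonal a * star U :=
    fun a => by
      rw [Matrix.star_eq_conjTranspose, Matrix.conjTranspose_eq_transpose_of_trivial]
      simp [Matrix.transpose_mul, mul_assoc]
  refine ⟨U * Matrix.diagonal (fun i => (v i)⁻¹) * star U, ?_, ?_, ?_, ?_⟩
  · rw [hS, key, key]; congr 3; ext i; by_cases h : v i = 0 <;> simp [h]
  · rw [hS, key, key]; congr 3; ext i; by_cases h : v i = 0 <;> simp [h]
  · rw [hS, key, symm]
  · rw [hS, key, symm]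

/-- The Moore-Penrose pseudo-inverse `Λ⁺` of the Laplacian. -/
noncomputable def laplacianPinv {n : ℕ} (N : Network n) : Matrix (Fin n) (Fin n) ℝ :=
  (exists_isMoorePenrose (laplacian_isHermitian N)).choose

/-- `χ₁ = sup_{‖x‖ = 1, x ⊥ 𝟏} 1 / (xᵀ Λ x)`, with values in `[0, ∞]` (here `1 / 0 = ∞`). -/
noncomputable def chi1 {n : ℕ} (N : Network n) : ℝ≥0∞ :=
  ⨆ (x : Fin n → ℝ) (_ : x ⬝ᵥ x = 1) (_ : x ⬝ᵥ 1 = 0),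
    (ENNReal.ofReal (x ⬝ᵥ (laplacian N *ᵥ x)))⁻¹

/-- The maximal resistance `χ₂ = ½ sup_{(i,j) ∈ ℰ} (e_i - e_j)ᵀ Λ⁺ (e_i - e_j)`. -/
noncomputable def chi2 {n : ℕ} (N : Network n) : ℝ :=
  1 / 2 * ⨆ e : N.graph.edgeSet, edgeForm (laplacianPinv N) e

/-! ### The parameters of the dynamic -/

/-- The parameters `η, α, α̃` of the dynamic, and the complexity `χ` that comes with them. -/
structure Params where
  /-- momentum -/
  eta : ℝ
  /-- gossip weight on `x` -/
  alpha : ℝ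
  /-- gossip weight on `x̃` -/
  alphaTilde : ℝ
  /-- the network complexity -/
  chi : ℝ

/-- The non-accelerated setting. -/
noncomputable def nonAccelerated {n : ℕ} (N : Network n) : Params where
  eta := 0
  alpha := 1 / 2
  alphaTilde := 1 / 2
  chi := (chi1 N).toReal

/-- The accelerated setting. -/
noncomputable def accelerated {n : ℕ} (N : Network n) : Params where
  eta := 1 / (2 * √((chi1 N).toReal * chi2 N))
  alpha := 1 / 2
  alphaTilde := 1 / 2 * √((chi1 N).toReal / chi2 N)
  chi := √((chi1 N).toReal * chi2 N)

/-! ### Poisson processes -/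

section Poisson

variable {Ω Ξ : Type*} [MeasurableSpace Ω] [MeasurableSpace Ξ]

/-- The waiting times of a sequence of arrival times: `τ 0`, `τ 1 - τ 0`, `τ 2 - τ 1`, … -/
def gap (τ : ℕ → Ω → ℝ) : ℕ → Ω → ℝ
  | 0 => τ 0
  | k + 1 => τ (k + 1) - τ k

/-- `τ 0 < τ 1 < ⋯` are the arrival times of a (homogeneous) Poisson process of rate `r` on
`[0, ∞)`: the waiting times are independent exponential variables of parameter `r`. -/
structure IsPoisson (Pr : Measure Ω) (r : ℝ) (τ : ℕ → Ω → ℝ) : Prop where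
  measurable : ∀ k, Measurable (τ k)
  law : ∀ k, Pr.map (gap τ k) = expMeasure r
  indep : iIndepFun (gap τ) Pr

/-- The points `(τ k, ξ k)` are those of a Poisson point process on `[0, ∞) × Ξ` of intensity
`dt ⊗ Q`: Poisson arrivals of rate one, carrying independent marks of law `Q`. -/
structure IsMarkedPoisson (Pr : Measure Ω) (Q : Measure Ξ) (τ : ℕ → Ω → ℝ) (ξ : ℕ → Ω → Ξ) :
    Prop where
  times : IsPoisson Pr 1 τ
  measurable : ∀ k, Measurable (ξ k)
  law : ∀ k, Pr.map (ξ k) = Q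
  indep : iIndepFun ξ Pr
  indep_times : IndepFun (fun ω k => τ k ω) (fun ω k => ξ k ω) Pr

/-- The number of arrivals up to time `t`. -/
noncomputable def arrivals (τ : ℕ → Ω → ℝ) (t : ℝ) (ω : Ω) : ℕ∞ := {k | τ k ω ≤ t}.encard

/-- The sum of the vectors `v k` over the arrivals up to time `t`. There are almost surely finitely
many of them, so that this is the integral over `(0, t]` against the point process. -/
noncomputable def sumArrivals {E : Type*} [AddCommMonoid E] [TopologicalSpace E]
    (τ : ℕ → Ω → ℝ) (v : ℕ → E) (t : ℝ) (ω : Ω) : E :=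
  ∑' k, {k | τ k ω ≤ t}.indicator v k

/-- The processes that drive the dynamic: the gradient steps `N^i`, with times `τ i` and samples
`ξ i`, are Poisson point processes of intensity `dt ⊗ Q`; the communications `M^{ij}`, with times
`θ s(i, j)`, are Poisson processes of rate `λ^{ij}`; and all these processes are independent. -/
structure IsDriving {n : ℕ} (Pr : Measure Ω) (Q : Measure Ξ) (N : Network n)
    (τ : Fin n → ℕ → Ω → ℝ) (ξ : Fin n → ℕ → Ω → Ξ) (θ : Sym2 (Fin n) → ℕ → Ω → ℝ) : Prop where
  grad : ∀ i, IsMarkedPoisson Pr Q (τ i) (ξ i)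
  comm : ∀ e ∈ N.graph.edgeSet, IsPoisson Pr (N.rate e) (θ e)
  indep : iIndep (Sum.elim
    (fun i : Fin n =>
      MeasurableSpace.comap (fun (ω : Ω) (k : ℕ) => (τ i k ω, ξ i k ω)) inferInstance)
    (fun e : N.graph.edgeSet =>
      MeasurableSpace.comap (fun (ω : Ω) (k : ℕ) => θ e k ω) inferInstance)) Pr

end Poisson

/-! ### The dynamic -/

/-- The average `x̄` of the workers' parameters. -/
noncomputable def mean {n d : ℕ} (x : Fin n → EuclideanSpace ℝ (Fin d)) :
    EuclideanSpace ℝ (Fin d) := (1 / n : ℝ) • ∑ i, x i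

/-- The objective `f = (1/n) ∑ i, f_i`. -/
noncomputable def objective {n d : ℕ} (f : Fin n → EuclideanSpace ℝ (Fin d) → ℝ)
    (y : EuclideanSpace ℝ (Fin d)) : ℝ := 1 / n * ∑ i, f i y

/-- Right-continuous paths on `[0, ∞)` with left limits. -/
def IsCadlag {E : Type*} [TopologicalSpace E] (y : ℝ → E) : Prop :=
  ∀ t, 0 ≤ t → ContinuousWithinAt y (Set.Ici t) t ∧ (0 < t → ∃ l, Tendsto y (𝓝[<] t) (𝓝 l))

section Dynamic

variable {Ω Ξ : Type*} [MeasurableSpace Ω] [MeasurableSpace Ξ] {n d : ℕ}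

/-- `g i y ξ` is the stochastic gradient `∇F_i(y, ξ)`: an unbiased estimate of `∇f_i(y)` with a
finite variance, when `ξ` has law `Q`. -/
structure IsOracle (Q : Measure Ξ) (f : Fin n → EuclideanSpace ℝ (Fin d) → ℝ)
    (g : Fin n → EuclideanSpace ℝ (Fin d) → Ξ → EuclideanSpace ℝ (Fin d)) : Prop where
  measurable : ∀ i, Measurable (Function.uncurry (g i))
  memLp : ∀ i y, MemLp (g i y) 2 Q
  unbiased : ∀ i y, ∫ ξ, g i y ξ ∂Q = ∇ (f i) y

/-- `∫₀ᵗ ∇F_i(x^i_{s-}, ξ) dN^i_s(ξ)`: the sum of the stochastic gradients that worker `i` has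
computed up to time `t`, each at the value of its parameter just before. -/
noncomputable def gradSum (g : Fin n → EuclideanSpace ℝ (Fin d) → Ξ → EuclideanSpace ℝ (Fin d))
    (τ : Fin n → ℕ → Ω → ℝ) (ξ : Fin n → ℕ → Ω → Ξ)
    (x : ℝ → Ω → Fin n → EuclideanSpace ℝ (Fin d)) (i : Fin n) (t : ℝ) (ω : Ω) :
    EuclideanSpace ℝ (Fin d) :=
  sumArrivals (τ i) (fun k => g i (Function.leftLim (fun s => x s ω i) (τ i k ω)) (ξ i k ω)) t ω

open Classical in
/-- `∑_{j, (i,j) ∈ ℰ} ∫₀ᵗ (x^i_{s-} - x^j_{s-}) dM^{ij}_s`: the `i`-th component of the sum of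
`(e_i - e_j)(e_i - e_j)ᵀ x` over the communications of worker `i` up to time `t`. -/
noncomputable def gossipSum (N : Network n) (θ : Sym2 (Fin n) → ℕ → Ω → ℝ)
    (x : ℝ → Ω → Fin n → EuclideanSpace ℝ (Fin d)) (i : Fin n) (t : ℝ) (ω : Ω) :
    EuclideanSpace ℝ (Fin d) :=
  ∑ j with N.graph.Adj i j, sumArrivals (θ s(i, j))
    (fun k => Function.leftLim (fun s => x s ω i) (θ s(i, j) k ω)
      - Function.leftLim (fun s => x s ω j) (θ s(i, j) k ω)) t ω

/-- `(x, x̃)` is a solution on `[0, ∞)` of the stochastic differential equation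
`dx^i = η (x̃^i - x^i) dt - γ ∫ ∇F_i(x^i, ξ) dN^i(ξ) - α ∑_{j, (i,j) ∈ ℰ} (x^i - x^j) dM^{ij}`,
`dx̃^i = η (x^i - x̃^i) dt - γ ∫ ∇F_i(x^i, ξ) dN^i(ξ) - α̃ ∑_{j, (i,j) ∈ ℰ} (x^i - x^j) dM^{ij}`. -/
structure IsSolution (Pr : Measure Ω) (N : Network n) (p : Params) (γ : ℝ)
    (g : Fin n → EuclideanSpace ℝ (Fin d) → Ξ → EuclideanSpace ℝ (Fin d))
    (τ : Fin n → ℕ → Ω → ℝ) (ξ : Fin n → ℕ → Ω → Ξ) (θ : Sym2 (Fin n) → ℕ → Ω → ℝ)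
    (x xt : ℝ → Ω → Fin n → EuclideanSpace ℝ (Fin d)) : Prop where
  aemeasurable : ∀ t, 0 ≤ t → AEMeasurable (x t) Pr ∧ AEMeasurable (xt t) Pr
  cadlag : ∀ᵐ ω ∂Pr, IsCadlag (fun t => x t ω) ∧ IsCadlag (fun t => xt t ω)
  eq_x : ∀ᵐ ω ∂Pr, ∀ t, 0 ≤ t → ∀ i, x t ω i = x 0 ω i
    + p.eta • (∫ s in (0 : ℝ)..t, (xt s ω i - x s ω i))
    - γ • gradSum g τ ξ x i t ω - p.alpha • gossipSum N θ x i t ω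
  eq_xt : ∀ᵐ ω ∂Pr, ∀ t, 0 ≤ t → ∀ i, xt t ω i = xt 0 ω i
    + p.eta • (∫ s in (0 : ℝ)..t, (x s ω i - xt s ω i))
    - γ • gradSum g τ ξ x i t ω - p.alphaTilde • gossipSum N θ x i t ω

/-- `(x, x̃)` follows the dynamic with parameters `p` and constant step size `γ`, driven by
independent Poisson processes, and starts at consensus: `x^i_0 = x̃^i_0 = x₀` for every `i`. -/
def IsRun (Pr : Measure Ω) (Q : Measure Ξ) (N : Network n) (p : Params) (γ : ℝ)
    (g : Fin n → EuclideanSpace ℝ (Fin d) → Ξ → EuclideanSpace ℝ (Fin d))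
    (x₀ : EuclideanSpace ℝ (Fin d)) (x xt : ℝ → Ω → Fin n → EuclideanSpace ℝ (Fin d)) : Prop :=
  ∃ (τ : Fin n → ℕ → Ω → ℝ) (ξ : Fin n → ℕ → Ω → Ξ) (θ : Sym2 (Fin n) → ℕ → Ω → ℝ),
    IsDriving Pr Q N τ ξ θ ∧ IsSolution Pr N p γ g τ ξ θ x xt ∧
      ∀ᵐ ω ∂Pr, ∀ i, x 0 ω i = x₀ ∧ xt 0 ω i = x₀

end Dynamic

/-! ### The two sets of assumptions on the objective -/

section Assumptions

variable {Ξ : Type*} [MeasurableSpace Ξ] {n d : ℕ}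

/-- `h` is `L`-smooth: it is differentiable and its gradient is `L`-Lipschitz. -/
def IsSmooth (L : ℝ) (h : EuclideanSpace ℝ (Fin d) → ℝ) : Prop :=
  Differentiable ℝ h ∧ ∀ y z, ‖∇ h y - ∇ h z‖ ≤ L * ‖y - z‖

/-- `(1/n) ∑ i, E ‖∇F_i(y_i, ξ_i) - ∇f_i(y_i)‖²`. -/
noncomputable def noise (Q : Measure Ξ) (f : Fin n → EuclideanSpace ℝ (Fin d) → ℝ)
    (g : Fin n → EuclideanSpace ℝ (Fin d) → Ξ → EuclideanSpace ℝ (Fin d))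
    (y : Fin n → EuclideanSpace ℝ (Fin d)) : ℝ :=
  1 / n * ∑ i, ∫ ξ, ‖g i (y i) ξ - ∇ (f i) (y i)‖ ^ 2 ∂Q

/-- `(1/n) ∑ i, ‖∇f_i(y) - ∇f(y)‖²`. -/
noncomputable def heterogeneity (f : Fin n → EuclideanSpace ℝ (Fin d) → ℝ)
    (y : EuclideanSpace ℝ (Fin d)) : ℝ :=
  1 / n * ∑ i, ‖∇ (f i) y - ∇ (objective f) y‖ ^ 2

/-- The strongly convex setting. -/
structure StronglyConvexSetting (Q : Measure Ξ) (f : Fin n → EuclideanSpace ℝ (Fin d) → ℝ)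
    (g : Fin n → EuclideanSpace ℝ (Fin d) → Ξ → EuclideanSpace ℝ (Fin d))
    (xs : EuclideanSpace ℝ (Fin d)) (μ L σ ζ : ℝ) : Prop where
  strongConvex : ∀ i, StrongConvexOn Set.univ μ (f i)
  smooth : ∀ i, IsSmooth L (f i)
  noise_le : ∀ y : EuclideanSpace ℝ (Fin d), noise Q f g (fun _ => y) ≤ σ ^ 2
  heterogeneity_le : heterogeneity f xs ≤ ζ ^ 2

/-- The non-convex setting. -/
structure NonConvexSetting (Q : Measure Ξ) (f : Fin n → EuclideanSpace ℝ (Fin d) → ℝ)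
    (g : Fin n → EuclideanSpace ℝ (Fin d) → Ξ → EuclideanSpace ℝ (Fin d))
    (L σ ζ P M : ℝ) : Prop where
  smooth : ∀ i, IsSmooth L (f i)
  heterogeneity_le : ∀ y, heterogeneity f y ≤ ζ ^ 2 + P * ‖∇ (objective f) y‖ ^ 2
  noise_le : ∀ y : Fin n → EuclideanSpace ℝ (Fin d),
    noise Q f g y ≤ σ ^ 2 + M / n * ∑ i, ‖∇ (f i) (y i)‖ ^ 2

end Assumptions

/-! ### The two guarantees -/

section Guarantees

variable {Ω : Type*} [MeasurableSpace Ω] {n d : ℕ}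

/-- The guarantee at time `T` in the strongly convex setting:
`E ‖x̄_T - x*‖² ≤ C (r₀ exp (-μ T / (16 L (1 + χ))) + S / (μ² T) · log (max {2, μ² r₀ T / S}))` with
`r₀ = ‖x₀ - x*‖²` and `S = σ² + ζ² (1 + χ)`. -/
def StronglyConvexGuarantee (C : ℝ) (Pr : Measure Ω)
    (x : ℝ → Ω → Fin n → EuclideanSpace ℝ (Fin d)) (x₀ xs : EuclideanSpace ℝ (Fin d))
    (μ L σ ζ χ T : ℝ) : Prop :=
  Integrable (fun ω => ‖mean (x T ω) - xs‖ ^ 2) Pr ∧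
    ∫ ω, ‖mean (x T ω) - xs‖ ^ 2 ∂Pr ≤
      C * (‖x₀ - xs‖ ^ 2 * Real.exp (-(μ * T / (16 * L * (1 + χ))))
        + (σ ^ 2 + ζ ^ 2 * (1 + χ)) / (μ ^ 2 * T)
          * Real.log (max 2 (μ ^ 2 * ‖x₀ - xs‖ ^ 2 * T / (σ ^ 2 + ζ ^ 2 * (1 + χ)))))

/-- The guarantee on `[0, T]` in the non-convex setting:
`(1/T) ∫₀ᵀ E ‖∇f(x̄_t)‖² dt ≤ C (L (1 + χ) f₀ / T + √(L f₀ / T · (σ² + (1 + χ) ζ²)))` with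
`f₀ = f(x₀) - f(x*)`. -/
def NonConvexGuarantee (C : ℝ) (Pr : Measure Ω) (f : Fin n → EuclideanSpace ℝ (Fin d) → ℝ)
    (x : ℝ → Ω → Fin n → EuclideanSpace ℝ (Fin d)) (x₀ xs : EuclideanSpace ℝ (Fin d))
    (L σ ζ χ T : ℝ) : Prop :=
  (∀ t ∈ Set.Icc 0 T, Integrable (fun ω => ‖∇ (objective f) (mean (x t ω))‖ ^ 2) Pr) ∧
  IntervalIntegrable (fun t => ∫ ω, ‖∇ (objective f) (mean (x t ω))‖ ^ 2 ∂Pr) volume 0 T ∧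
    1 / T * ∫ t in (0 : ℝ)..T, ∫ ω, ‖∇ (objective f) (mean (x t ω))‖ ^ 2 ∂Pr ≤
      C * (L * (1 + χ) / T * (objective f x₀ - objective f xs)
        + √(L * (objective f x₀ - objective f xs) / T * (σ ^ 2 + (1 + χ) * ζ ^ 2)))

end Guarantees

end Gossip

open Gossip

/-!
The proof has a probabilistic half, which turns the stochastic differential equation into a formula
for expectations, and a deterministic half, which exhibits Lyapunov functions.

Almost surely the driving clocks have positive waiting times, ring finitely often in finite time and
never ring together. Then the jump equation has a single solution: between two arrivals it follows
the linear flow of the momentum, and at an arrival it jumps. The state just before a given time is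
therefore an explicit function `JumpFlow.leftState` of the waiting times and of the marks, and a
solution agrees with it almost surely (`IsSolution.ae_eq_leftState`). The hazard rate of the
exponential law is constant (`lintegral_exp_shift`), and the state before an arrival does not depend
on the waiting time that leads to it once the arrival time is given. Integrating that waiting time
out, one arrival after the other, gives the compensation formula
(`IsClockData.lintegral_tsum_leftState`), hence the expected numbers of steps, and with the
fundamental theorem of calculus along the flow, Dynkin's formula
(`JumpFlow.IsTest.integral_leftState`). Dynkin's formula needs integrability: it is applied to the
bounded functions `v / (1 + ε v)` of a quadratic weight `v`, which bounds the second moments of the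
state, and then to every function of quadratic growth
(`JumpFlow.IsTest.integral_leftState_of_weight`).

The disagreement of the workers is measured by the consensus energy `‖π x‖² + β ⟨x̃, Λ⁺ x̃⟩`, where
`π` is the projection on the orthogonal of `𝟏`, and `β` is `0` without acceleration and `1 / χ₁` with
it. The momentum and the communications contract it at rate `1 / (2 (1 + χ))`
(`IsEnergyWeight.consensus_drift_le`). In the accelerated setting the values of `η` and `α̃` are
those for which the cross terms `⟨π x, π x̃⟩` cancel, and for which the increase of the dual part by
a communication, which the maximal resistance `2 χ₂` bounds, is paid by the decrease of `‖π x‖²`.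

The Lyapunov functions are `‖x̄ - x*‖²`, for strongly convex functions, or `f(x̄) - f(x*)`, in
general, plus a multiple of the energy. The gradient steps move the average by the mean of the
gradients at the workers, which differs from the gradient at the average by an amount that the
energy controls. With the right multiple the contraction of the energy pays for this, and the
generator is at most `-γ μ` times the function (`gen_lyapunov_le_of_strongConvexOn`), respectively
`-γ/4 ‖∇ f(x̄)‖²` (`gen_lyapunov_le_of_isSmooth`), plus a residual of order `γ²`. Integrating in time
leaves a bound that is a decreasing function of `γ` plus a multiple of `γ`, and the step size
balances the two (`exists_stepSize_of_strongConvexOn`, `exists_stepSize_of_isSmooth`). The factor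
`n` appears when the noise is bounded at consensus only (`noise_le_mul`).
-/

namespace Gossip

local notation "⟪" x ", " y "⟫" => inner ℝ x y

/-! ### Smooth and strongly convex functions -/

section Convex

variable {d : ℕ} {L μ : ℝ} {h : EuclideanSpace ℝ (Fin d) → ℝ}

theorem hasDerivAt_line (hd : Differentiable ℝ h) (y u : EuclideanSpace ℝ (Fin d)) (t : ℝ) :
    HasDerivAt (fun t : ℝ => h (y + t • u)) ⟪∇ h (y + t • u), u⟫ t := by
  have h1 : HasFDerivAt h _ (y + t • u) := (hd (y + t • u)).hasGradientAt
  have h2 : HasDerivAt (fun t : ℝ => y + t • u) u t := by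
    simpa using ((hasDerivAt_id t).smul_const u).const_add y
  exact h1.comp_hasDerivAt t h2

theorem IsSmooth.continuous_gradient (hs : IsSmooth L h) : Continuous (∇ h) :=
  (LipschitzWith.of_dist_le_mul (K := L.toNNReal) fun y z => by
    rw [dist_eq_norm, dist_eq_norm]
    exact (hs.2 y z).trans (mul_le_mul_of_nonneg_right (Real.le_coe_toNNReal L)
      (norm_nonneg _))).continuous

/-- The quadratic bounds of an `L`-smooth function, `s = 1` for the upper one and `s = -1` for the
lower one. -/
theorem IsSmooth.mul_sub_le (hs : IsSmooth L h) {s : ℝ} (hs1 : |s| = 1)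
    (y u : EuclideanSpace ℝ (Fin d)) : s * (h (y + u) - h y - ⟪∇ h y, u⟫) ≤ L / 2 * ‖u‖ ^ 2 := by
  set g : ℝ → ℝ := fun t => s * (h (y + t • u) - t * ⟪∇ h y, u⟫) - L / 2 * ‖u‖ ^ 2 * t ^ 2 with hg
  have hder : ∀ t, HasDerivAt g (s * (⟪∇ h (y + t • u), u⟫ - ⟪∇ h y, u⟫) - L * ‖u‖ ^ 2 * t) t :=
    fun t => by
      have h1 := ((hasDerivAt_line hs.1 y u t).sub
        ((hasDerivAt_id t).mul_const ⟪∇ h y, u⟫)).const_mul s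
      have h2 := ((hasDerivAt_id t).pow 2).const_mul (L / 2 * ‖u‖ ^ 2)
      refine (h1.sub h2).congr_deriv ?_
      simp
      ring
  have hanti : AntitoneOn g (Set.Icc 0 1) := by
    refine antitoneOn_of_deriv_nonpos (convex_Icc 0 1)
      (fun t _ => (hder t).continuousAt.continuousWithinAt)
      (fun t _ => (hder t).differentiableAt.differentiableWithinAt) fun t ht => ?_
    rw [interior_Icc] at ht
    rw [(hder t).deriv, ← inner_sub_left, sub_nonpos]
    have h1 := hs.2 (y + t • u) y
    rw [add_sub_cancel_left, norm_smul, Real.norm_of_nonneg ht.1.le] at h1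
    calc s * ⟪∇ h (y + t • u) - ∇ h y, u⟫ ≤ |s * ⟪∇ h (y + t • u) - ∇ h y, u⟫| := le_abs_self _
      _ = |⟪∇ h (y + t • u) - ∇ h y, u⟫| := by rw [abs_mul, hs1, one_mul]
      _ ≤ ‖∇ h (y + t • u) - ∇ h y‖ * ‖u‖ := abs_real_inner_le_norm _ _
      _ ≤ L * (t * ‖u‖) * ‖u‖ := mul_le_mul_of_nonneg_right h1 (norm_nonneg _)
      _ = L * ‖u‖ ^ 2 * t := by ring
  have := hanti (by simp) (by simp) (zero_le_one (α := ℝ))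
  simp only [hg, one_smul, zero_smul, add_zero] at this
  linarith

theorem IsSmooth.le_add (hs : IsSmooth L h) (y u : EuclideanSpace ℝ (Fin d)) :
    h (y + u) ≤ h y + ⟪∇ h y, u⟫ + L / 2 * ‖u‖ ^ 2 := by
  have := hs.mul_sub_le (s := 1) (by simp) y u
  linarith

/-- The first-order lower bound of a strongly convex function, from the limit `t → 0` of the
definition at `y + t (z - y)`. -/
theorem StrongConvexOn.add_le (hc : StrongConvexOn Set.univ μ h) (hd : Differentiable ℝ h)
    (y z : EuclideanSpace ℝ (Fin d)) :
    h y + ⟪∇ h y, z - y⟫ + μ / 2 * ‖z - y‖ ^ 2 ≤ h z := by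
  have hder := hasDerivAt_line hd y (z - y) 0
  rw [zero_smul, add_zero] at hder
  have h1 := hder.tendsto_slope_zero_right
  have h2 : Tendsto (fun t : ℝ => h z - h y - (1 - t) * (μ / 2 * ‖z - y‖ ^ 2)) (𝓝[>] 0)
      (𝓝 (h z - h y - (1 - 0) * (μ / 2 * ‖z - y‖ ^ 2))) := by
    refine Tendsto.mono_left ?_ nhdsWithin_le_nhds
    exact (by fun_prop : Continuous fun t : ℝ =>
      h z - h y - (1 - t) * (μ / 2 * ‖z - y‖ ^ 2)).tendsto 0
  have h3 := le_of_tendsto_of_tendsto h1 h2 (by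
    have hmem : ∀ᶠ t : ℝ in 𝓝[>] 0, t ∈ Set.Ioo (0 : ℝ) 1 := Ioo_mem_nhdsGT one_pos
    filter_upwards [hmem] with t ht
    have hcv := hc.2 (Set.mem_univ z) (Set.mem_univ y) ht.1.le (by linarith [ht.2] : 0 ≤ 1 - t)
      (by ring)
    have he : t • z + (1 - t) • y = y + t • (z - y) := by
      rw [smul_sub, sub_smul, one_smul]; abel
    rw [he] at hcv
    simp only [smul_eq_mul, zero_add, zero_smul, add_zero] at hcv ⊢
    rw [inv_mul_le_iff₀ ht.1]
    linarith)
  linarith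

theorem StrongConvexOn.le_inner (hc : StrongConvexOn Set.univ μ h) (hd : Differentiable ℝ h)
    (y z : EuclideanSpace ℝ (Fin d)) : μ * ‖y - z‖ ^ 2 ≤ ⟪∇ h y - ∇ h z, y - z⟫ := by
  have h1 := StrongConvexOn.add_le hc hd y z
  have h2 := StrongConvexOn.add_le hc hd z y
  rw [inner_sub_left]
  rw [← neg_sub y z, inner_neg_right, norm_neg] at h1
  linarith

/-- Co-coercivity of the gradient of a smooth convex function. -/
theorem IsSmooth.cocoercive (hs : IsSmooth L h) (hL : 0 < L) (hμ : 0 ≤ μ)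
    (hc : StrongConvexOn Set.univ μ h) (y z : EuclideanSpace ℝ (Fin d)) :
    1 / L * ‖∇ h y - ∇ h z‖ ^ 2 ≤ ⟪∇ h y - ∇ h z, y - z⟫ := by
  -- compare the two bounds of `h` at the end `z - (∇ h z - ∇ h y) / L` of a gradient step
  have key : ∀ y z, h y + ⟪∇ h y, z - y⟫ + 1 / (2 * L) * ‖∇ h z - ∇ h y‖ ^ 2 ≤ h z := fun y z => by
    set D := ∇ h z - ∇ h y with hD
    have h1 := StrongConvexOn.add_le hc hs.1 y (z + (-(1 / L)) • D)
    have h2 := hs.le_add z ((-(1 / L)) • D)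
    rw [add_sub_right_comm, inner_add_right, inner_smul_right] at h1
    rw [inner_smul_right, norm_smul, mul_pow, Real.norm_eq_abs, sq_abs] at h2
    have h3 : ⟪∇ h z, D⟫ - ⟪∇ h y, D⟫ = ‖D‖ ^ 2 := by
      rw [← inner_sub_left, real_inner_self_eq_norm_sq]
    have h4 : 0 ≤ μ / 2 * ‖z - y + (-(1 / L)) • D‖ ^ 2 := by positivity
    have h5 : L / 2 * ((-(1 / L)) ^ 2 * ‖D‖ ^ 2) = 1 / (2 * L) * ‖D‖ ^ 2 := by
      field_simp
    have h6 : 1 / L * ‖D‖ ^ 2 = 2 * (1 / (2 * L) * ‖D‖ ^ 2) := by field_simp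
    have h7 : 1 / L * (⟪∇ h z, D⟫ - ⟪∇ h y, D⟫) = 1 / L * ‖D‖ ^ 2 := by rw [h3]
    rw [h5] at h2
    linarith
  have h1 := key y z
  have h2 := key z y
  rw [inner_sub_left]
  rw [← neg_sub y z, inner_neg_right, norm_sub_rev] at h1
  have h6 : 1 / L * ‖∇ h y - ∇ h z‖ ^ 2 = 2 * (1 / (2 * L) * ‖∇ h y - ∇ h z‖ ^ 2) := by field_simp
  linarith

variable {n : ℕ} {f : Fin n → EuclideanSpace ℝ (Fin d) → ℝ}

theorem hasGradientAt_objective (hf : ∀ i, Differentiable ℝ (f i)) (y : EuclideanSpace ℝ (Fin d)) :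
    HasGradientAt (objective f) ((1 / n : ℝ) • ∑ i, ∇ (f i) y) y := by
  rw [hasGradientAt_iff_hasFDerivAt, map_smul, map_sum]
  exact (HasFDerivAt.fun_sum fun i _ => (hf i y).hasGradientAt.hasFDerivAt).const_mul (1 / n : ℝ)

theorem gradient_objective (hf : ∀ i, Differentiable ℝ (f i)) (y : EuclideanSpace ℝ (Fin d)) :
    ∇ (objective f) y = (1 / n : ℝ) • ∑ i, ∇ (f i) y :=
  (hasGradientAt_objective hf y).gradient

theorem isSmooth_objective (hn : 0 < n) (hf : ∀ i, IsSmooth L (f i)) :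
    IsSmooth L (objective f) := by
  refine ⟨fun y => (hasGradientAt_objective (fun i => (hf i).1) y).differentiableAt, fun y z => ?_⟩
  rw [gradient_objective (fun i => (hf i).1), gradient_objective (fun i => (hf i).1), ← smul_sub,
    ← Finset.sum_sub_distrib, norm_smul]
  have h1 : ‖∑ i, (∇ (f i) y - ∇ (f i) z)‖ ≤ ∑ _i : Fin n, L * ‖y - z‖ :=
    norm_sum_le_of_le _ fun i _ => (hf i).2 y z
  have hn' : (0 : ℝ) < n := Nat.cast_pos.2 hn
  rw [Finset.sum_const, Finset.card_univ, Fintype.card_fin, nsmul_eq_mul] at h1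
  rw [Real.norm_of_nonneg (by positivity), one_div, inv_mul_le_iff₀ hn']
  exact h1

theorem gradient_eq_zero_of_forall_le {xs : EuclideanSpace ℝ (Fin d)} (h' : ∀ y, h xs ≤ h y) :
    ∇ h xs = 0 := by
  have : IsLocalMin h xs := Eventually.of_forall h'
  simp [gradient, this.fderiv_eq_zero]

end Convex

/-! ### The Laplacian and its pseudo-inverse -/

section Laplacian

variable {n : ℕ}

theorem dotProduct_edgeVec (u : Fin n → ℝ) (i j : Fin n) : u ⬝ᵥ edgeVec i j = u i - u j := by
  simp [edgeVec, dotProduct_sub]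

theorem edgeMatrix_mulVec (i j : Fin n) (u : Fin n → ℝ) :
    edgeMatrix s(i, j) *ᵥ u = (u i - u j) • edgeVec i j := by
  show Matrix.vecMulVec (edgeVec i j) (edgeVec i j) *ᵥ u = _
  rw [Matrix.vecMulVec_mulVec, dotProduct_comm, dotProduct_edgeVec, op_smul_eq_smul]

/-- The matrix of an edge has rank one, so that it sees a quadratic form through its value at the
edge only. This is where the resistances of the edges come from. -/
theorem edgeMatrix_form (e : Sym2 (Fin n)) (A : Matrix (Fin n) (Fin n) ℝ) (u : Fin n → ℝ) :
    edgeMatrix e *ᵥ u ⬝ᵥ (A *ᵥ (edgeMatrix e *ᵥ u)) =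
      (u ⬝ᵥ (edgeMatrix e *ᵥ u)) * edgeForm A e := by
  induction e with
  | _ i j =>
    show _ = _ * (edgeVec i j ⬝ᵥ (A *ᵥ edgeVec i j))
    simp only [edgeMatrix_mulVec, Matrix.mulVec_smul, smul_dotProduct, dotProduct_smul,
      dotProduct_edgeVec, smul_eq_mul]
    ring

theorem edgeMatrix_self (e : Sym2 (Fin n)) (u : Fin n → ℝ) :
    edgeMatrix e *ᵥ u ⬝ᵥ (edgeMatrix e *ᵥ u) = 2 * (u ⬝ᵥ (edgeMatrix e *ᵥ u)) := by
  induction e with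
  | _ i j =>
    simp only [edgeMatrix_mulVec, smul_dotProduct, dotProduct_smul, dotProduct_edgeVec, smul_eq_mul]
    by_cases h : i = j
    · simp [h]
    · simp [edgeVec, h, Ne.symm h]
      ring

theorem edgeMatrix_nonneg (e : Sym2 (Fin n)) (u : Fin n → ℝ) :
    0 ≤ u ⬝ᵥ (edgeMatrix e *ᵥ u) := by
  have := edgeMatrix_self e u
  have h2 : 0 ≤ edgeMatrix e *ᵥ u ⬝ᵥ (edgeMatrix e *ᵥ u) :=
    Finset.sum_nonneg fun _ _ => mul_self_nonneg _
  linarith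

theorem edgeMatrix_dotProduct_one (e : Sym2 (Fin n)) (u : Fin n → ℝ) :
    edgeMatrix e *ᵥ u ⬝ᵥ 1 = 0 := by
  induction e with
  | _ i j =>
    rw [edgeMatrix_mulVec, smul_dotProduct, dotProduct_comm, dotProduct_edgeVec]
    simp

theorem edgeMatrix_mulVec_one (e : Sym2 (Fin n)) : edgeMatrix e *ᵥ (1 : Fin n → ℝ) = 0 := by
  induction e with
  | _ i j => simp [edgeMatrix_mulVec]

theorem edgeMatrix_trace {e : Sym2 (Fin n)} (he : ¬ e.IsDiag) : (edgeMatrix e).trace = 2 := by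
  induction e with
  | _ i j =>
    have hij : i ≠ j := fun h => he (by simp [h])
    show (Matrix.vecMulVec (edgeVec i j) (edgeVec i j)).trace = 2
    rw [Matrix.trace_vecMulVec, dotProduct_edgeVec]
    simp [edgeVec, hij, hij.symm]
    norm_num

variable (N : Network n)

open Classical in
theorem laplacian_form (u w : Fin n → ℝ) : u ⬝ᵥ (laplacian N *ᵥ w) =
    ∑ e ∈ N.graph.edgeFinset, N.rate e * (u ⬝ᵥ (edgeMatrix e *ᵥ w)) := by
  simp [laplacian, Matrix.sum_mulVec, dotProduct_sum, Matrix.smul_mulVec, dotProduct_smul]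

theorem laplacian_nonneg (u : Fin n → ℝ) : 0 ≤ u ⬝ᵥ (laplacian N *ᵥ u) := by
  classical
  rw [laplacian_form]
  exact Finset.sum_nonneg fun e he => mul_nonneg
    (N.rate_pos e (by simpa using he)).le (edgeMatrix_nonneg e u)

theorem laplacian_transpose : (laplacian N)ᵀ = laplacian N := by
  rw [← Matrix.conjTranspose_eq_transpose_of_trivial]
  exact laplacian_isHermitian N

theorem laplacian_mulVec_one : laplacian N *ᵥ 1 = 0 := by
  classical
  simp [laplacian, Matrix.sum_mulVec, Matrix.smul_mulVec, edgeMatrix_mulVec_one]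

theorem laplacian_symm (u w : Fin n → ℝ) :
    u ⬝ᵥ (laplacian N *ᵥ w) = laplacian N *ᵥ u ⬝ᵥ w := by
  rw [Matrix.dotProduct_mulVec, ← Matrix.mulVec_transpose, laplacian_transpose]

/-- Centering: the projection on the orthogonal of `𝟏`. -/
noncomputable def center (u : Fin n → ℝ) : Fin n → ℝ := fun i => u i - (u ⬝ᵥ 1) / n

theorem center_of_dotProduct_one {u : Fin n → ℝ} (h : u ⬝ᵥ 1 = 0) : center u = u := by
  funext _; simp [center, h]

theorem center_add (u w : Fin n → ℝ) : center (u + w) = center u + center w := by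
  funext i; simp only [center, add_dotProduct, Pi.add_apply]; ring

theorem center_smul (c : ℝ) (u : Fin n → ℝ) : center (c • u) = c • center u := by
  funext i; simp only [center, smul_dotProduct, Pi.smul_apply, smul_eq_mul]; ring

theorem center_sub (u w : Fin n → ℝ) : center (u - w) = center u - center w := by
  funext i; simp only [center, sub_dotProduct, Pi.sub_apply]; ring

theorem center_dotProduct_one (u : Fin n → ℝ) : center u ⬝ᵥ 1 = 0 := by
  rcases Nat.eq_zero_or_pos n with h | h
  · subst h; simp [dotProduct]
  · have : (n : ℝ) ≠ 0 := by positivity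
    simp only [center, dotProduct, Pi.one_apply, mul_one, Finset.sum_sub_distrib, Finset.sum_const,
      Finset.card_univ, Fintype.card_fin, nsmul_eq_mul]
    field_simp
    ring

theorem center_eq (u : Fin n → ℝ) : center u = u - ((u ⬝ᵥ 1) / n) • (1 : Fin n → ℝ) := by
  funext _; simp [center]

theorem center_dotProduct_center (u w : Fin n → ℝ) : center u ⬝ᵥ center w = center u ⬝ᵥ w := by
  rw [center_eq w, dotProduct_sub, dotProduct_smul, center_dotProduct_one]; simp

theorem dotProduct_self_nonneg' (u : Fin n → ℝ) : 0 ≤ u ⬝ᵥ u :=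
  Finset.sum_nonneg fun _ _ => mul_self_nonneg _

theorem center_self_le (u : Fin n → ℝ) : center u ⬝ᵥ center u ≤ u ⬝ᵥ u := by
  have h := dotProduct_self_nonneg' (u - center u)
  have h2 := center_dotProduct_center u u
  rw [sub_dotProduct, dotProduct_sub, dotProduct_sub, dotProduct_comm u (center u)] at h
  linarith

theorem laplacian_mulVec_center (u : Fin n → ℝ) : laplacian N *ᵥ center u = laplacian N *ᵥ u := by
  rw [center_eq, Matrix.mulVec_sub, Matrix.mulVec_smul, laplacian_mulVec_one]; simp

theorem laplacian_mulVec_dotProduct_one (u : Fin n → ℝ) : laplacian N *ᵥ u ⬝ᵥ 1 = 0 := by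
  rw [← laplacian_symm, laplacian_mulVec_one, dotProduct_zero]

/-! ### The spectral gap -/

variable {N}

/-- Poincaré inequality of a connected network. -/
theorem le_chi1_mul (h : chi1 N < ∞) {x : Fin n → ℝ} (hx : x ⬝ᵥ 1 = 0) :
    x ⬝ᵥ x ≤ (chi1 N).toReal * (x ⬝ᵥ (laplacian N *ᵥ x)) := by
  rcases (dotProduct_self_nonneg' x).eq_or_lt with h0 | hpos
  · rw [← h0]; exact mul_nonneg ENNReal.toReal_nonneg (laplacian_nonneg N x)
  -- normalize `x`
  set s := √(x ⬝ᵥ x) with hs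
  have hs0 : 0 < s := Real.sqrt_pos.2 hpos
  have hs2 : s ^ 2 = x ⬝ᵥ x := Real.sq_sqrt hpos.le
  set y := s⁻¹ • x with hy
  have hyy : y ⬝ᵥ y = 1 := by
    rw [hy, smul_dotProduct, dotProduct_smul, ← hs2]
    simp only [smul_eq_mul]; field_simp
  have hy1 : y ⬝ᵥ 1 = 0 := by rw [hy, smul_dotProduct, hx, smul_zero]
  have hle : (ENNReal.ofReal (y ⬝ᵥ (laplacian N *ᵥ y)))⁻¹ ≤ chi1 N :=
    le_iSup_of_le y (le_iSup_of_le hyy (le_iSup_of_le hy1 le_rfl))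
  have hyL : y ⬝ᵥ (laplacian N *ᵥ y) = (s ^ 2)⁻¹ * (x ⬝ᵥ (laplacian N *ᵥ x)) := by
    rw [hy, Matrix.mulVec_smul, smul_dotProduct, dotProduct_smul]
    simp only [smul_eq_mul]; field_simp
  set q := y ⬝ᵥ (laplacian N *ᵥ y) with hq
  -- a form that vanishes at a unit vector would make `chi1 N` infinite
  have hq0 : 0 < q := by
    by_contra! hq0
    rw [ENNReal.ofReal_of_nonpos hq0, ENNReal.inv_zero] at hle
    exact absurd (hle.trans_lt h) (lt_irrefl _)
  rw [← ENNReal.ofReal_inv_of_pos hq0] at hle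
  have h1 : q⁻¹ ≤ (chi1 N).toReal := (ENNReal.ofReal_le_iff_le_toReal h.ne).1 hle
  have h2 : 1 ≤ (chi1 N).toReal * q := by
    calc 1 = q⁻¹ * q := (inv_mul_cancel₀ hq0.ne').symm
      _ ≤ _ := mul_le_mul_of_nonneg_right h1 hq0.le
  rw [hyL, ← mul_assoc, mul_comm _ ((s ^ 2)⁻¹), mul_assoc, inv_mul_eq_div,
    le_div_iff₀ (by positivity), one_mul, hs2] at h2
  exact h2

theorem center_self_le_chi1_mul (h : chi1 N < ∞) (u : Fin n → ℝ) :
    center u ⬝ᵥ center u ≤ (chi1 N).toReal * (u ⬝ᵥ (laplacian N *ᵥ u)) := by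
  refine (le_chi1_mul h (center_dotProduct_one u)).trans_eq ?_
  rw [laplacian_mulVec_center, laplacian_symm, laplacian_mulVec_center, ← laplacian_symm]

/-! ### The pseudo-inverse -/

theorem laplacianPinv_spec (N : Network n) : IsMoorePenrose (laplacian N) (laplacianPinv N) :=
  (exists_isMoorePenrose (laplacian_isHermitian N)).choose_spec

/-- A symmetric matrix commutes with its pseudo-inverse. -/
theorem laplacian_mul_pinv_comm (N : Network n) :
    laplacian N * laplacianPinv N = laplacianPinv N * laplacian N := by
  have h := laplacianPinv_spec N
  have hL := laplacian_transpose N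
  set A := laplacian N
  set B := laplacianPinv N
  have h1 : A * (A * B) = A := by
    have := congrArg Matrix.transpose h.mul_mul_self
    rwa [Matrix.transpose_mul, h.left_symm, hL] at this
  have h2 : B * A * A = A := by
    have := congrArg Matrix.transpose
      (show A * (B * A) = A by rw [← mul_assoc]; exact h.mul_mul_self)
    rwa [Matrix.transpose_mul, h.right_symm, hL] at this
  calc A * B = B * A * A * B := by rw [h2]
    _ = B * (A * (A * B)) := by simp only [mul_assoc]
    _ = B * A := by rw [h1]

theorem laplacianPinv_transpose (N : Network n) : (laplacianPinv N)ᵀ = laplacianPinv N := by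
  have h := laplacianPinv_spec N
  have hc := laplacian_mul_pinv_comm N
  have hL := laplacian_transpose N
  set A := laplacian N
  set B := laplacianPinv N
  have h1 : Bᵀ * A = A * B := by
    have := h.left_symm
    rwa [Matrix.transpose_mul, hL] at this
  have h2 : Bᵀ * A * B = B := by rw [h1, hc, h.self_mul_mul]
  calc Bᵀ = (Bᵀ * A * B)ᵀ := by rw [h2]
    _ = Bᵀ * A * B := by
        rw [Matrix.transpose_mul, Matrix.transpose_mul, hL, Matrix.transpose_transpose, mul_assoc]
    _ = B := h2

theorem pinv_symm (u w : Fin n → ℝ) :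
    u ⬝ᵥ (laplacianPinv N *ᵥ w) = laplacianPinv N *ᵥ u ⬝ᵥ w := by
  rw [Matrix.dotProduct_mulVec, ← Matrix.mulVec_transpose, laplacianPinv_transpose]

theorem pinv_mulVec_one (N : Network n) : laplacianPinv N *ᵥ 1 = 0 := by
  rw [← (laplacianPinv_spec N).self_mul_mul, mul_assoc, laplacian_mul_pinv_comm,
    ← Matrix.mulVec_mulVec, ← Matrix.mulVec_mulVec, laplacian_mulVec_one]
  simp

/-- On a connected network, `Λ Λ⁺` is the projection on the orthogonal of `𝟏`. -/
theorem laplacian_mulVec_pinv (h : chi1 N < ∞) (u : Fin n → ℝ) :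
    laplacian N *ᵥ (laplacianPinv N *ᵥ u) = center u := by
  have hs := laplacianPinv_spec N
  set w := u - laplacian N *ᵥ (laplacianPinv N *ᵥ u) with hw
  have hLw : laplacian N *ᵥ w = 0 := by
    rw [hw, Matrix.mulVec_sub, Matrix.mulVec_mulVec, Matrix.mulVec_mulVec,
      mul_assoc, laplacian_mul_pinv_comm, ← mul_assoc, hs.mul_mul_self, sub_self]
  have h1 := center_self_le_chi1_mul h w
  rw [hLw, dotProduct_zero, mul_zero] at h1
  have h2 : center w = 0 := dotProduct_self_eq_zero.1 (le_antisymm h1 (dotProduct_self_nonneg' _))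
  rw [hw, center_sub, center_of_dotProduct_one (laplacian_mulVec_dotProduct_one N _),
    sub_eq_zero] at h2
  exact h2.symm

theorem pinv_form_eq (N : Network n) (u : Fin n → ℝ) : u ⬝ᵥ (laplacianPinv N *ᵥ u) =
    laplacianPinv N *ᵥ u ⬝ᵥ (laplacian N *ᵥ (laplacianPinv N *ᵥ u)) := by
  rw [← pinv_symm, Matrix.mulVec_mulVec, Matrix.mulVec_mulVec,
    (laplacianPinv_spec N).self_mul_mul]

theorem pinv_nonneg (N : Network n) (u : Fin n → ℝ) : 0 ≤ u ⬝ᵥ (laplacianPinv N *ᵥ u) := by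
  rw [pinv_form_eq]; exact laplacian_nonneg N _

theorem pinv_mulVec_dotProduct_one (N : Network n) (u : Fin n → ℝ) :
    laplacianPinv N *ᵥ u ⬝ᵥ 1 = 0 := by
  rw [← pinv_symm, pinv_mulVec_one, dotProduct_zero]

/-- The eigenvalues of the pseudo-inverse are at most `χ₁`. -/
theorem pinv_mulVec_self_le (h : chi1 N < ∞) (u : Fin n → ℝ) :
    laplacianPinv N *ᵥ u ⬝ᵥ (laplacianPinv N *ᵥ u) ≤
      (chi1 N).toReal * (u ⬝ᵥ (laplacianPinv N *ᵥ u)) := by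
  rw [pinv_form_eq N u]
  exact le_chi1_mul h (pinv_mulVec_dotProduct_one N u)

theorem pinv_form_le (h : chi1 N < ∞) (u : Fin n → ℝ) :
    u ⬝ᵥ (laplacianPinv N *ᵥ u) ≤ (chi1 N).toReal * (center u ⬝ᵥ center u) := by
  set c := (chi1 N).toReal
  have hc : 0 ≤ c := ENNReal.toReal_nonneg
  set y := laplacianPinv N *ᵥ u with hy
  have h1 : u ⬝ᵥ y = center u ⬝ᵥ y := by
    rw [← center_dotProduct_center, center_of_dotProduct_one (pinv_mulVec_dotProduct_one N u),
      center_eq, sub_dotProduct, smul_dotProduct, dotProduct_comm 1, pinv_mulVec_dotProduct_one]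
    simp [hy]
  have h2 : y ⬝ᵥ y ≤ c * (u ⬝ᵥ y) := pinv_mulVec_self_le h u
  -- `0 ≤ ‖c • center u - y‖²`
  have h3 := dotProduct_self_nonneg' (c • center u - y)
  rw [sub_dotProduct, dotProduct_sub, dotProduct_sub, dotProduct_comm y, smul_dotProduct,
    smul_dotProduct, dotProduct_smul, ← h1] at h3
  simp only [smul_eq_mul] at h3
  rcases hc.eq_or_lt with h0 | hpos
  · rw [← h0, zero_mul] at h2 ⊢
    have : y = 0 := dotProduct_self_eq_zero.1 (le_antisymm h2 (dotProduct_self_nonneg' _))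
    rw [this, dotProduct_zero]
  · nlinarith

/-! ### The maximal resistance -/

theorem edgeForm_le_chi2 {e : Sym2 (Fin n)} (he : e ∈ N.graph.edgeSet) :
    edgeForm (laplacianPinv N) e ≤ 2 * chi2 N := by
  have := le_ciSup (f := fun e : N.graph.edgeSet => edgeForm (laplacianPinv N) e)
    (Set.finite_range _).bddAbove ⟨e, he⟩
  unfold chi2
  linarith

theorem edgeForm_pinv_nonneg (e : Sym2 (Fin n)) : 0 ≤ edgeForm (laplacianPinv N) e := by
  induction e with
  | _ i j => exact pinv_nonneg N _

/-- Every edge has a resistance at most `2 χ₁`, because `e_i - e_j` has squared norm `2`. -/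
theorem chi2_le_chi1 (h : chi1 N < ∞) : chi2 N ≤ (chi1 N).toReal := by
  have hc : 0 ≤ (chi1 N).toReal := ENNReal.toReal_nonneg
  have : ⨆ e : N.graph.edgeSet, edgeForm (laplacianPinv N) e ≤ 2 * (chi1 N).toReal := by
    refine Real.iSup_le (fun ⟨e, he⟩ => ?_) (by positivity)
    induction e with
    | _ i j =>
      have hij : i ≠ j := N.graph.ne_of_adj he
      refine (pinv_form_le h (edgeVec i j)).trans ?_
      have h2 : edgeVec i j ⬝ᵥ edgeVec i j = 2 := by
        rw [dotProduct_edgeVec]; simp [edgeVec, hij, hij.symm]; norm_num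
      have h3 := center_self_le (edgeVec i j)
      nlinarith
  unfold chi2
  linarith

theorem chi2_pos (h : chi1 N < ∞) {e : Sym2 (Fin n)} (he : e ∈ N.graph.edgeSet) : 0 < chi2 N := by
  have hle := edgeForm_le_chi2 he
  suffices 0 < edgeForm (laplacianPinv N) e by linarith
  refine (edgeForm_pinv_nonneg e).lt_of_ne fun h0 => ?_
  induction e with
  | _ i j =>
    have hij : i ≠ j := N.graph.ne_of_adj he
    have h1 := pinv_mulVec_self_le h (edgeVec i j)
    have h2 : edgeVec i j ⬝ᵥ (laplacianPinv N *ᵥ edgeVec i j) = 0 := h0.symm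
    rw [h2, mul_zero] at h1
    have h3 : laplacianPinv N *ᵥ edgeVec i j = 0 :=
      dotProduct_self_eq_zero.1 (le_antisymm h1 (dotProduct_self_nonneg' _))
    have h4 := laplacian_mulVec_pinv h (edgeVec i j)
    rw [h3, Matrix.mulVec_zero, center_of_dotProduct_one (by
      rw [dotProduct_comm, dotProduct_edgeVec]; simp)] at h4
    have := congrFun h4 i
    simp [edgeVec, hij] at this

theorem accelerated_chi_le (h : chi1 N < ∞) : (accelerated N).chi ≤ (nonAccelerated N).chi := by
  have hc : 0 ≤ (chi1 N).toReal := ENNReal.toReal_nonneg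
  refine Real.sqrt_le_iff.2 ⟨hc, ?_⟩
  show _ ≤ (chi1 N).toReal ^ 2
  nlinarith [chi2_le_chi1 h]

theorem Params.chi_nonneg {p : Params} (hp : p = nonAccelerated N ∨ p = accelerated N) :
    0 ≤ p.chi := by
  rcases hp with rfl | rfl
  · exact ENNReal.toReal_nonneg
  · exact Real.sqrt_nonneg _

end Laplacian

/-! ### The consensus energy -/

section ScalarEnergy

variable {n : ℕ}

/-- The bilinear form `⟨π u, π u'⟩ + β ⟨v, Λ⁺ v'⟩`, where `π` is the projection on the orthogonal
of `𝟏`. -/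
noncomputable def energyForm (N : Network n) (β : ℝ) (u v u' v' : Fin n → ℝ) : ℝ :=
  center u ⬝ᵥ center u' + β * (v ⬝ᵥ (laplacianPinv N *ᵥ v'))

variable {N : Network n}

theorem energyForm_comm (β : ℝ) (u v u' v' : Fin n → ℝ) :
    energyForm N β u v u' v' = energyForm N β u' v' u v := by
  rw [energyForm, energyForm, pinv_symm, dotProduct_comm, dotProduct_comm v']

theorem energyForm_add_smul (β c : ℝ) (u v a b u' v' : Fin n → ℝ) :
    energyForm N β a b (u + c • u') (v + c • v') =
      energyForm N β a b u v + c * energyForm N β a b u' v' := by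
  simp only [energyForm, center_add, center_smul, dotProduct_add, dotProduct_smul, smul_eq_mul,
    Matrix.mulVec_add, Matrix.mulVec_smul]
  ring

theorem energyForm_self_nonneg {β : ℝ} (hβ : 0 ≤ β) (u v : Fin n → ℝ) :
    0 ≤ energyForm N β u v u v :=
  add_nonneg (dotProduct_self_nonneg' _) (mul_nonneg hβ (pinv_nonneg N _))

/-- The effect of a communication on the energy. -/
theorem energyForm_communication (α α' β : ℝ) (e : Sym2 (Fin n)) (u v : Fin n → ℝ) :
    2 * energyForm N β u v (-α • (edgeMatrix e *ᵥ u)) (-α' • (edgeMatrix e *ᵥ u)) +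
      energyForm N β (-α • (edgeMatrix e *ᵥ u)) (-α' • (edgeMatrix e *ᵥ u))
        (-α • (edgeMatrix e *ᵥ u)) (-α' • (edgeMatrix e *ᵥ u)) =
      (-2 * α + 2 * α ^ 2) * (u ⬝ᵥ (edgeMatrix e *ᵥ u))
        - 2 * β * α' * (laplacianPinv N *ᵥ v ⬝ᵥ (edgeMatrix e *ᵥ u))
        + β * α' ^ 2 * (u ⬝ᵥ (edgeMatrix e *ᵥ u)) * edgeForm (laplacianPinv N) e := by
  have h1 : center (edgeMatrix e *ᵥ u) = edgeMatrix e *ᵥ u :=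
    center_of_dotProduct_one (edgeMatrix_dotProduct_one e u)
  have h2 : center u ⬝ᵥ (edgeMatrix e *ᵥ u) = u ⬝ᵥ (edgeMatrix e *ᵥ u) := by
    rw [dotProduct_comm, ← h1, center_dotProduct_center, h1, dotProduct_comm]
  simp only [energyForm, center_smul, h1, Matrix.mulVec_smul, dotProduct_smul, smul_dotProduct,
    smul_eq_mul, h2, edgeMatrix_self, edgeMatrix_form, pinv_symm v]
  ring

open Classical in
/-- The infinitesimal change of the energy under the momentum and the communications. -/
noncomputable def energyDrift (N : Network n) (p : Params) (β : ℝ) (u v : Fin n → ℝ) : ℝ :=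
  2 * p.eta * energyForm N β u v (v - u) (u - v) + ∑ e ∈ N.graph.edgeFinset, N.rate e *
    (2 * energyForm N β u v (-p.alpha • (edgeMatrix e *ᵥ u)) (-p.alphaTilde • (edgeMatrix e *ᵥ u)) +
      energyForm N β (-p.alpha • (edgeMatrix e *ᵥ u)) (-p.alphaTilde • (edgeMatrix e *ᵥ u))
        (-p.alpha • (edgeMatrix e *ᵥ u)) (-p.alphaTilde • (edgeMatrix e *ᵥ u)))

/-- For `α = 1/2` a communication removes half of its edge's share of the Dirichlet form from
`‖π u‖²`. Its quadratic effect on the dual part `v ⬝ᵥ Λ⁺ v` is `α̃²` times that share times the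
resistance of the edge, which is at most `2 χ₂`. Since `Λ⁺ Λ = π`, the cross terms of the edges sum
up to `π u ⬝ᵥ π v`. -/
theorem energyDrift_le (h : chi1 N < ∞) {p : Params} (hα : p.alpha = 1 / 2) {β : ℝ} (hβ : 0 ≤ β)
    (u v : Fin n → ℝ) :
    energyDrift N p β u v ≤
      2 * p.eta * (center u ⬝ᵥ center v - center u ⬝ᵥ center u
          + β * (v ⬝ᵥ (laplacianPinv N *ᵥ u)) - β * (v ⬝ᵥ (laplacianPinv N *ᵥ v)))
        - 1 / 2 * (u ⬝ᵥ (laplacian N *ᵥ u))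
        - 2 * β * p.alphaTilde * (center u ⬝ᵥ center v)
        + 2 * β * p.alphaTilde ^ 2 * chi2 N * (u ⬝ᵥ (laplacian N *ᵥ u)) := by
  classical
  have hX : laplacianPinv N *ᵥ v ⬝ᵥ (laplacian N *ᵥ u) = center u ⬝ᵥ center v := by
    rw [laplacian_symm, laplacian_mulVec_pinv h, dotProduct_comm (center u),
      center_dotProduct_center]
  have hsum : ∑ e ∈ N.graph.edgeFinset, N.rate e *
      ((-2 * p.alpha + 2 * p.alpha ^ 2) * (u ⬝ᵥ (edgeMatrix e *ᵥ u))
        - 2 * β * p.alphaTilde * (laplacianPinv N *ᵥ v ⬝ᵥ (edgeMatrix e *ᵥ u))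
        + β * p.alphaTilde ^ 2 * (u ⬝ᵥ (edgeMatrix e *ᵥ u)) * edgeForm (laplacianPinv N) e) ≤
      - (1 / 2) * (u ⬝ᵥ (laplacian N *ᵥ u)) - 2 * β * p.alphaTilde * (center u ⬝ᵥ center v)
        + 2 * β * p.alphaTilde ^ 2 * chi2 N * (u ⬝ᵥ (laplacian N *ᵥ u)) := by
    rw [← hX, laplacian_form, laplacian_form, Finset.mul_sum, Finset.mul_sum, Finset.mul_sum,
      ← Finset.sum_sub_distrib, ← Finset.sum_add_distrib]
    refine Finset.sum_le_sum fun e he => ?_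
    have he' : e ∈ N.graph.edgeSet := by simpa using he
    have h1 : (u ⬝ᵥ (edgeMatrix e *ᵥ u)) * edgeForm (laplacianPinv N) e ≤
        (u ⬝ᵥ (edgeMatrix e *ᵥ u)) * (2 * chi2 N) :=
      mul_le_mul_of_nonneg_left (edgeForm_le_chi2 he') (edgeMatrix_nonneg e u)
    have h2 := mul_le_mul_of_nonneg_left h1
      (mul_nonneg (N.rate_pos e he').le (mul_nonneg hβ (sq_nonneg p.alphaTilde)))
    rw [hα]
    linarith
  unfold energyDrift
  simp only [energyForm_communication]
  have hm : energyForm N β u v (v - u) (u - v) = center u ⬝ᵥ center v - center u ⬝ᵥ center u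
      + β * (v ⬝ᵥ (laplacianPinv N *ᵥ u)) - β * (v ⬝ᵥ (laplacianPinv N *ᵥ v)) := by
    simp only [energyForm, center_sub, dotProduct_sub, Matrix.mulVec_sub]
    ring
  rw [hm]
  linarith

/-- `2 vᵀ Λ⁺ u ≤ uᵀ Λ⁺ u + vᵀ Λ⁺ v`. -/
theorem two_mul_pinv_le (u v : Fin n → ℝ) : 2 * (v ⬝ᵥ (laplacianPinv N *ᵥ u)) ≤
    u ⬝ᵥ (laplacianPinv N *ᵥ u) + v ⬝ᵥ (laplacianPinv N *ᵥ v) := by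
  have h := pinv_nonneg N (u - v)
  rw [Matrix.mulVec_sub, sub_dotProduct, dotProduct_sub, dotProduct_sub, pinv_symm u v,
    dotProduct_comm _ v] at h
  linarith

/-- `β` is a weight for which the energy contracts at rate `1 / (2 (1 + χ))`, and is at most the
squared norm of the state. -/
structure IsEnergyWeight (N : Network n) (p : Params) (β : ℝ) : Prop where
  nonneg : 0 ≤ β
  mul_chi1_le : β * (chi1 N).toReal ≤ 1
  drift_le : ∀ u v : Fin n → ℝ,
    energyDrift N p β u v ≤ -(1 / (2 * (1 + p.chi))) * energyForm N β u v u v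

/-- Without momentum the variable `x̃` plays no role, and `‖π x‖²` contracts by itself. -/
theorem isEnergyWeight_nonAccelerated (h : chi1 N < ∞) :
    IsEnergyWeight N (nonAccelerated N) 0 := by
  have hc : 0 ≤ (chi1 N).toReal := ENNReal.toReal_nonneg
  refine ⟨le_rfl, by simp, fun u v => (energyDrift_le h rfl le_rfl u v).trans ?_⟩
  have h1 := center_self_le_chi1_mul h u
  have h2 := laplacian_nonneg N u
  have hf : energyForm N 0 u v u v = center u ⬝ᵥ center u := by simp [energyForm]
  show _ ≤ -(1 / (2 * (1 + (chi1 N).toReal))) * _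
  rw [hf, neg_mul]
  have : 1 / (2 * (1 + (chi1 N).toReal)) * (center u ⬝ᵥ center u) ≤
      1 / 2 * (u ⬝ᵥ (laplacian N *ᵥ u)) := by
    rw [one_div_mul_eq_div, div_le_iff₀ (by positivity)]
    nlinarith
  simp only [nonAccelerated]
  linarith

/-- With acceleration the weight `1 / χ₁` makes the cross terms of the momentum and of the
communications cancel, and the dual part absorbs the gain `uᵀ Λ u / 2` of the communications. -/
theorem isEnergyWeight_accelerated_of_pos (h : chi1 N < ∞) (h1 : 0 < (chi1 N).toReal)
    (h2 : 0 < chi2 N) : IsEnergyWeight N (accelerated N) (1 / (chi1 N).toReal) := by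
  set c₁ := (chi1 N).toReal with hc₁
  set c₂ := chi2 N with hc₂
  have hχ : 0 < √(c₁ * c₂) := Real.sqrt_pos.2 (by positivity)
  refine ⟨by positivity, by rw [one_div_mul_cancel h1.ne'], fun u v =>
    (energyDrift_le h rfl (by positivity) u v).trans ?_⟩
  have hη : (accelerated N).eta = 1 / (2 * √(c₁ * c₂)) := rfl
  have hα : (accelerated N).alphaTilde = 1 / 2 * √(c₁ / c₂) := rfl
  have hc : (accelerated N).chi = √(c₁ * c₂) := rfl
  -- the two identities that determine `η` and `α̃`
  have e1 : 1 / c₁ * (accelerated N).alphaTilde = (accelerated N).eta := by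
    rw [hη, hα, Real.sqrt_div h1.le, Real.sqrt_mul h1.le]
    have := Real.sqrt_pos.2 h1
    have := Real.sqrt_pos.2 h2
    have h3 := Real.mul_self_sqrt h1.le
    field_simp
    rw [sq, h3]
  have e2 : 2 * (1 / c₁) * (accelerated N).alphaTilde ^ 2 * c₂ = 1 / 2 := by
    rw [hα, mul_pow, Real.sq_sqrt (by positivity)]
    field_simp
  have e3 : 2 * (1 / c₁) * (accelerated N).alphaTilde = 2 * (accelerated N).eta := by
    rw [mul_assoc, e1]
  rw [e2, e3]
  have hη0 : 0 < (accelerated N).eta := by rw [hη]; positivity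
  have hrate : 1 / (2 * (1 + (accelerated N).chi)) ≤ (accelerated N).eta := by
    rw [hη, hc]; gcongr; linarith
  have hW : energyForm N (1 / c₁) u v u v =
    center u ⬝ᵥ center u + 1 / c₁ * (v ⬝ᵥ (laplacianPinv N *ᵥ v)) := rfl
  have hWn : 0 ≤ energyForm N (1 / c₁) u v u v := energyForm_self_nonneg (by positivity) u v
  have hY := two_mul_pinv_le (N := N) u v
  have hP := pinv_form_le h u
  have hY2 : 1 / c₁ * (2 * (v ⬝ᵥ (laplacianPinv N *ᵥ u))) ≤
      center u ⬝ᵥ center u + 1 / c₁ * (v ⬝ᵥ (laplacianPinv N *ᵥ v)) := by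
    have := mul_le_mul_of_nonneg_left (hY.trans (add_le_add hP le_rfl))
      (show (0 : ℝ) ≤ 1 / c₁ by positivity)
    refine this.trans_eq ?_
    rw [mul_add, ← mul_assoc, one_div_mul_cancel h1.ne', one_mul]
  have h4 := mul_le_mul_of_nonneg_left hY2 hη0.le
  have h5 := mul_le_mul_of_nonneg_right hrate hWn
  rw [hW] at h5 ⊢
  nlinarith

/-- On a network without edges, or with a single worker, every vector is at consensus. -/
theorem center_eq_zero (h : chi1 N < ∞) (h' : ¬(0 < (chi1 N).toReal ∧ 0 < chi2 N))
    (u : Fin n → ℝ) : center u = 0 := by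
  classical
  have h1 := center_self_le_chi1_mul h u
  refine dotProduct_self_eq_zero.1 (le_antisymm (h1.trans ?_) (dotProduct_self_nonneg' _))
  by_cases hc : 0 < (chi1 N).toReal
  · have h2 : ¬ 0 < chi2 N := fun h2 => h' ⟨hc, h2⟩
    rw [laplacian_form, Finset.sum_eq_zero, mul_zero]
    intro e he
    exact absurd (chi2_pos h (by simpa using he)) h2
  · rw [le_antisymm (not_lt.1 hc) ENNReal.toReal_nonneg, zero_mul]

/-- If `χ₁ χ₂ = 0`, so that `η` and `α̃` of the accelerated setting are divisions by zero, there is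
no disagreement for the energy to measure. -/
theorem exists_isEnergyWeight (h : chi1 N < ∞) {p : Params}
    (hp : p = nonAccelerated N ∨ p = accelerated N) : ∃ β, IsEnergyWeight N p β := by
  rcases hp with rfl | rfl
  · exact ⟨0, isEnergyWeight_nonAccelerated h⟩
  by_cases h' : 0 < (chi1 N).toReal ∧ 0 < chi2 N
  · exact ⟨_, isEnergyWeight_accelerated_of_pos h h'.1 h'.2⟩
  refine ⟨0, le_rfl, by simp, fun u v => (energyDrift_le h rfl le_rfl u v).trans ?_⟩
  have h0 := center_eq_zero h h'
  have h2 := laplacian_nonneg N u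
  simp [energyForm, h0]
  linarith

end ScalarEnergy

section Energy

variable {n d : ℕ}

/-- The states `(x, x̃)` of the network. -/
abbrev State (n d : ℕ) : Type :=
  (Fin n → EuclideanSpace ℝ (Fin d)) × (Fin n → EuclideanSpace ℝ (Fin d))

/-- The vector of the `k`-th coordinates. -/
def coord (k : Fin d) (x : Fin n → EuclideanSpace ℝ (Fin d)) : Fin n → ℝ := fun i => x i k

/-- `(e_i - e_j)(e_i - e_j)ᵀ x` for the edge `e = {i, j}`. -/
noncomputable def difference (e : Sym2 (Fin n)) (x : Fin n → EuclideanSpace ℝ (Fin d)) :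
    Fin n → EuclideanSpace ℝ (Fin d) := fun i => ∑ j, edgeMatrix e i j • x j

theorem coord_difference (k : Fin d) (e : Sym2 (Fin n)) (x : Fin n → EuclideanSpace ℝ (Fin d)) :
    coord k (difference e x) = edgeMatrix e *ᵥ coord k x := by
  funext i
  simp [coord, difference, Matrix.mulVec, dotProduct]

theorem continuous_coord (k : Fin d) :
    Continuous (coord k : (Fin n → EuclideanSpace ℝ (Fin d)) → Fin n → ℝ) := by
  unfold coord; fun_prop

theorem continuous_difference (e : Sym2 (Fin n)) :
    Continuous (difference e : (Fin n → EuclideanSpace ℝ (Fin d)) → _) := by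
  unfold difference; fun_prop

theorem mean_difference (e : Sym2 (Fin n)) (x : Fin n → EuclideanSpace ℝ (Fin d)) :
    mean (difference e x) = 0 := by
  ext k
  have h := edgeMatrix_dotProduct_one e (coord k x)
  rw [← coord_difference, dotProduct_one] at h
  simp only [coord] at h
  simp [mean, h]

/-- The energy form, summed over the coordinates. -/
noncomputable def consensusForm (N : Network n) (β : ℝ) (z w : State n d) : ℝ :=
  ∑ k, energyForm N β (coord k z.1) (coord k z.2) (coord k w.1) (coord k w.2)

/-- The consensus energy `‖π x‖² + β ⟨x̃, Λ⁺ x̃⟩`. -/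
noncomputable def consensusEnergy (N : Network n) (β : ℝ) (z : State n d) : ℝ :=
  consensusForm N β z z

variable {N : Network n} {β : ℝ}

theorem consensusForm_comm (z w : State n d) :
    consensusForm N β z w = consensusForm N β w z :=
  Finset.sum_congr rfl fun _ _ => energyForm_comm _ _ _ _ _

theorem consensusForm_add_smul (c : ℝ) (a z w : State n d) :
    consensusForm N β a (z + c • w) = consensusForm N β a z + c * consensusForm N β a w := by
  unfold consensusForm
  rw [Finset.mul_sum, ← Finset.sum_add_distrib]
  exact Finset.sum_congr rfl fun k _ => energyForm_add_smul β c _ _ _ _ _ _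

theorem consensusEnergy_add_smul (c : ℝ) (z w : State n d) :
    consensusEnergy N β (z + c • w) = consensusEnergy N β z
      + 2 * c * consensusForm N β z w + c ^ 2 * consensusForm N β w w := by
  unfold consensusEnergy
  rw [consensusForm_add_smul, consensusForm_comm _ z, consensusForm_comm _ w,
    consensusForm_add_smul, consensusForm_add_smul, consensusForm_comm w z]
  ring

theorem consensusEnergy_nonneg (hβ : 0 ≤ β) (z : State n d) : 0 ≤ consensusEnergy N β z := by
  unfold consensusEnergy consensusForm
  exact Finset.sum_nonneg fun _ _ => energyForm_self_nonneg hβ _ _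

theorem continuous_center : Continuous (center : (Fin n → ℝ) → Fin n → ℝ) := by
  unfold center dotProduct; fun_prop

theorem continuous_consensusForm {X : Type*} [TopologicalSpace X] {f g : X → State n d}
    (hf : Continuous f) (hg : Continuous g) :
    Continuous fun z => consensusForm N β (f z) (g z) := by
  have hd : Continuous fun q : (Fin n → ℝ) × (Fin n → ℝ) => q.1 ⬝ᵥ q.2 := by
    unfold dotProduct; fun_prop
  have hm : Continuous fun q : Fin n → ℝ => laplacianPinv N *ᵥ q := by
    unfold Matrix.mulVec dotProduct; fun_prop
  unfold consensusForm energyForm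
  refine continuous_finsetSum _ fun k _ => ?_
  have hk := continuous_coord (n := n) k
  have hc := continuous_center (n := n)
  exact (hd.comp (.prodMk (hc.comp (hk.comp (continuous_fst.comp hf)))
    (hc.comp (hk.comp (continuous_fst.comp hg))))).add (continuous_const.mul
    (hd.comp (.prodMk (hk.comp (continuous_snd.comp hf))
      (hm.comp (hk.comp (continuous_snd.comp hg))))))

theorem continuous_consensusEnergy :
    Continuous (consensusEnergy N β : State n d → ℝ) :=
  continuous_consensusForm continuous_id continuous_id

theorem sum_norm_sq_eq (x : Fin n → EuclideanSpace ℝ (Fin d)) :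
    ∑ i, ‖x i‖ ^ 2 = ∑ k, coord k x ⬝ᵥ coord k x := by
  simp only [EuclideanSpace.norm_sq_eq, Real.norm_eq_abs, sq_abs, dotProduct, coord]
  rw [Finset.sum_comm]
  simp only [sq]

theorem coord_sub_mean (k : Fin d) (x : Fin n → EuclideanSpace ℝ (Fin d)) :
    coord k (fun i => x i - mean x) = center (coord k x) := by
  funext i
  simp [coord, center, mean, dotProduct, div_eq_inv_mul]

theorem consensusEnergy_eq_zero (y : EuclideanSpace ℝ (Fin d)) :
    consensusEnergy N β ((fun _ => y, fun _ => y) : State n d) = 0 := by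
  unfold consensusEnergy consensusForm
  refine Finset.sum_eq_zero fun k _ => ?_
  have h1 : coord k (fun _ : Fin n => y) = y k • (1 : Fin n → ℝ) := by funext i; simp [coord]
  rcases Nat.eq_zero_or_pos n with rfl | hn
  · simp [energyForm, dotProduct]
  have hn' : (n : ℝ) ≠ 0 := by positivity
  have h2 : center (1 : Fin n → ℝ) = 0 := by
    funext i; simp [center, dotProduct, hn']
  simp only [energyForm, h1, center_smul, h2, Matrix.mulVec_smul, pinv_mulVec_one]
  simp

/-- The energy controls the distance of the workers to their average. -/
theorem sum_norm_sub_mean_le (hβ : 0 ≤ β) (z : State n d) :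
    ∑ i, ‖z.1 i - mean z.1‖ ^ 2 ≤ consensusEnergy N β z := by
  rw [sum_norm_sq_eq]
  unfold consensusEnergy consensusForm
  refine Finset.sum_le_sum fun k _ => ?_
  rw [coord_sub_mean]
  exact le_add_of_nonneg_right (mul_nonneg hβ (pinv_nonneg N _))

theorem weighted_pinv_form_le (h : chi1 N < ∞) (hβ : 0 ≤ β) (hβ1 : β * (chi1 N).toReal ≤ 1)
    (w : Fin n → ℝ) : β * (w ⬝ᵥ (laplacianPinv N *ᵥ w)) ≤ w ⬝ᵥ w := by
  have h1 := mul_le_mul_of_nonneg_left (pinv_form_le h w) hβ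
  have h2 := mul_le_mul_of_nonneg_right hβ1 (dotProduct_self_nonneg' (center w))
  have h3 := center_self_le w
  linarith

theorem consensusEnergy_le (h : chi1 N < ∞) (hβ : 0 ≤ β) (hβ1 : β * (chi1 N).toReal ≤ 1)
    (z : State n d) : consensusEnergy N β z ≤ ∑ i, ‖z.1 i‖ ^ 2 + ∑ i, ‖z.2 i‖ ^ 2 := by
  rw [sum_norm_sq_eq, sum_norm_sq_eq, ← Finset.sum_add_distrib]
  unfold consensusEnergy consensusForm
  exact Finset.sum_le_sum fun k _ =>
    add_le_add ((center_self_le (coord k z.1))) (weighted_pinv_form_le h hβ hβ1 (coord k z.2))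

/-- Half the gradient of the energy in the diagonal directions `(v, v)`. -/
noncomputable def energyGradient (N : Network n) (β : ℝ) (z : State n d) (i : Fin n) :
    EuclideanSpace ℝ (Fin d) :=
  WithLp.toLp 2 fun k => center (coord k z.1) i + β * (laplacianPinv N *ᵥ coord k z.2) i

/-- The energy controls its own gradient, which bounds how much the gradient steps increase it. -/
theorem sum_norm_energyGradient_le (h : chi1 N < ∞) (hβ : 0 ≤ β)
    (hβ1 : β * (chi1 N).toReal ≤ 1) (z : State n d) :
    ∑ i, ‖energyGradient N β z i‖ ^ 2 ≤ 2 * consensusEnergy N β z := by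
  rw [sum_norm_sq_eq, consensusEnergy, consensusForm, Finset.mul_sum]
  refine Finset.sum_le_sum fun k _ => ?_
  set a := center (coord k z.1)
  set b := laplacianPinv N *ᵥ coord k z.2 with hb
  have h1 : coord k (energyGradient N β z) = a + β • b := by
    funext i; simp [coord, energyGradient, a, b]
  have h2 := dotProduct_self_nonneg' (a - β • b)
  have h3 : b ⬝ᵥ b ≤ (chi1 N).toReal * (coord k z.2 ⬝ᵥ b) := pinv_mulVec_self_le h _
  have h5 : 0 ≤ coord k z.2 ⬝ᵥ b := pinv_nonneg N _
  have h4 : β * (β * (b ⬝ᵥ b)) ≤ β * (coord k z.2 ⬝ᵥ b) := by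
    refine mul_le_mul_of_nonneg_left ?_ hβ
    have := mul_le_mul_of_nonneg_left h3 hβ
    have := mul_le_mul_of_nonneg_right hβ1 h5
    linarith
  rw [h1]
  show _ ≤ 2 * (a ⬝ᵥ a + β * (coord k z.2 ⬝ᵥ b))
  simp only [add_dotProduct, dotProduct_add, sub_dotProduct, dotProduct_sub, smul_dotProduct,
    dotProduct_smul, smul_eq_mul] at h2 ⊢
  linarith

theorem coord_single (k : Fin d) (i : Fin n) (v : EuclideanSpace ℝ (Fin d)) :
    coord k (Pi.single i v) = v k • Pi.single i 1 := by
  funext j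
  by_cases hj : j = i
  · subst hj; simp [coord]
  · simp [coord, hj]

/-- The effect on the energy of a gradient step, which moves `x i` and `x̃ i` by the same vector. -/
theorem consensusEnergy_sub_single_le (h : chi1 N < ∞) (hβ : 0 ≤ β)
    (hβ1 : β * (chi1 N).toReal ≤ 1) (z : State n d) (i : Fin n) (v : EuclideanSpace ℝ (Fin d)) :
    consensusEnergy N β (z - (Pi.single i v, Pi.single i v)) - consensusEnergy N β z ≤
      -2 * inner ℝ (energyGradient N β z i) v + 2 * ‖v‖ ^ 2 := by
  set w : State n d := (Pi.single i v, Pi.single i v)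
  have h1 : consensusForm N β z w = inner ℝ (energyGradient N β z i) v := by
    rw [PiLp.inner_apply]
    refine Finset.sum_congr rfl fun k _ => ?_
    simp only [w, coord_single, energyForm, center_smul, dotProduct_smul, center_dotProduct_center,
      Matrix.mulVec_smul, pinv_symm (coord k z.2), smul_eq_mul, energyGradient]
    simp
    ring
  have h2 : consensusForm N β w w ≤ 2 * ‖v‖ ^ 2 := by
    rw [EuclideanSpace.norm_sq_eq, Finset.mul_sum]
    refine Finset.sum_le_sum fun k _ => ?_
    have h3 := center_self_le (Pi.single i 1 : Fin n → ℝ)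
    have h4 := weighted_pinv_form_le h hβ hβ1 (Pi.single i 1 : Fin n → ℝ)
    have h5 : (Pi.single i 1 : Fin n → ℝ) ⬝ᵥ Pi.single i 1 = 1 := by simp
    rw [h5] at h3 h4
    have h6 := mul_le_mul_of_nonneg_left (add_le_add h3 h4) (sq_nonneg (v k))
    simp only [w, coord_single, energyForm, center_smul, dotProduct_smul, smul_dotProduct,
      Matrix.mulVec_smul, smul_eq_mul, Real.norm_eq_abs, sq_abs]
    linarith
  have h3 := consensusEnergy_add_smul (N := N) (β := β) (-1) z w
  rw [neg_one_smul, ← sub_eq_add_neg] at h3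
  rw [h3, h1]
  linarith

open Classical in
/-- The consensus energy contracts at rate `1 / (2 (1 + χ))` under the momentum and the
communications. -/
theorem IsEnergyWeight.consensus_drift_le {p : Params} (hβ : IsEnergyWeight N p β)
    (z : State n d) :
    2 * p.eta * consensusForm N β z (z.2 - z.1, z.1 - z.2) +
      ∑ e ∈ N.graph.edgeFinset, N.rate e * (consensusEnergy N β
        (z.1 - p.alpha • difference e z.1, z.2 - p.alphaTilde • difference e z.1)
          - consensusEnergy N β z) ≤
    -(1 / (2 * (1 + p.chi))) * consensusEnergy N β z := by
  have hk : ∀ e, consensusEnergy N β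
        (z.1 - p.alpha • difference e z.1, z.2 - p.alphaTilde • difference e z.1)
          - consensusEnergy N β z = ∑ k, (2 * energyForm N β (coord k z.1) (coord k z.2)
            (-p.alpha • (edgeMatrix e *ᵥ coord k z.1))
            (-p.alphaTilde • (edgeMatrix e *ᵥ coord k z.1)) +
      energyForm N β (-p.alpha • (edgeMatrix e *ᵥ coord k z.1))
        (-p.alphaTilde • (edgeMatrix e *ᵥ coord k z.1))
        (-p.alpha • (edgeMatrix e *ᵥ coord k z.1))
        (-p.alphaTilde • (edgeMatrix e *ᵥ coord k z.1))) := by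
    intro e
    have h1 := consensusEnergy_add_smul (N := N) (β := β) 1 z
      (-p.alpha • difference e z.1, -p.alphaTilde • difference e z.1)
    have h2 : z + (1 : ℝ) • ((-p.alpha • difference e z.1, -p.alphaTilde • difference e z.1) :
        State n d) = (z.1 - p.alpha • difference e z.1, z.2 - p.alphaTilde • difference e z.1) := by
      ext <;> simp [sub_eq_add_neg]
    rw [h2] at h1
    rw [h1]
    have hs : ∀ (c : ℝ) k, coord k (c • difference e z.1) = c • (edgeMatrix e *ᵥ coord k z.1) :=
      fun c k => by rw [← coord_difference]; rfl
    simp only [consensusForm, hs, Finset.sum_add_distrib, ← Finset.mul_sum]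
    ring
  calc _ = ∑ k, energyDrift N p β (coord k z.1) (coord k z.2) := by
        simp only [hk, energyDrift, Finset.sum_add_distrib]
        rw [consensusForm, Finset.mul_sum]
        congr 1
        rw [Finset.sum_comm]
        exact Finset.sum_congr rfl fun e _ => by
          simp only [Finset.mul_sum, mul_add, Finset.sum_add_distrib]
    _ ≤ ∑ k, -(1 / (2 * (1 + p.chi))) *
          energyForm N β (coord k z.1) (coord k z.2) (coord k z.1) (coord k z.2) :=
        Finset.sum_le_sum fun k _ => hβ.drift_le _ _
    _ = _ := by rw [consensusEnergy, consensusForm, Finset.mul_sum]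

end Energy

/-! ### Marked clocks and the order in which they ring -/

section Clocks

variable {ι Ξ : Type*}

/-- The `c`-th arrival time (counting from `0`) of the clock `k`, when `D k j` holds the `j`-th
waiting time of this clock and the mark of its `j`-th arrival. -/
noncomputable def arr (D : ι → ℕ → ℝ × Ξ) (k : ι) (c : ℕ) : ℝ :=
  ∑ j ∈ Finset.range (c + 1), (D k j).1

/-- The arrival time that precedes the `c`-th one, and `0` for `c = 0`. -/
noncomputable def prevArr (D : ι → ℕ → ℝ × Ξ) (k : ι) (c : ℕ) : ℝ :=
  ∑ j ∈ Finset.range c, (D k j).1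

theorem arr_eq_prevArr_add (D : ι → ℕ → ℝ × Ξ) (k : ι) (c : ℕ) :
    arr D k c = prevArr D k c + (D k c).1 := by
  simp [arr, prevArr, Finset.sum_range_succ]

theorem prevArr_succ (D : ι → ℕ → ℝ × Ξ) (k : ι) (c : ℕ) : prevArr D k (c + 1) = arr D k c := rfl

@[simp] theorem prevArr_zero (D : ι → ℕ → ℝ × Ξ) (k : ι) : prevArr D k 0 = 0 := by simp [prevArr]

/-- The almost sure properties of the clocks: waiting times are positive, every clock rings finitely
often in finite time, and two clocks never ring together. -/
structure GoodClocks (D : ι → ℕ → ℝ × Ξ) : Prop where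
  gap_pos : ∀ k c, 0 < (D k c).1
  unbounded : ∀ k (T : ℝ), ∃ c, T < arr D k c
  no_tie : ∀ k k' c c', arr D k c = arr D k' c' → k = k'

theorem GoodClocks.arr_strictMono {D : ι → ℕ → ℝ × Ξ} (hD : GoodClocks D) (k : ι) :
    StrictMono (arr D k) :=
  strictMono_nat_of_lt_succ fun c => by
    rw [arr_eq_prevArr_add D k (c + 1), prevArr_succ]
    linarith [hD.gap_pos k (c + 1)]

theorem GoodClocks.arr_pos {D : ι → ℕ → ℝ × Ξ} (hD : GoodClocks D) (k : ι) (c : ℕ) :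
    0 < arr D k c :=
  Finset.sum_pos (fun j _ => hD.gap_pos k j) ⟨0, by simp⟩

theorem GoodClocks.prevArr_nonneg {D : ι → ℕ → ℝ × Ξ} (hD : GoodClocks D) (k : ι) (c : ℕ) :
    0 ≤ prevArr D k c :=
  Finset.sum_nonneg fun j _ => (hD.gap_pos k j).le

variable [DecidableEq ι]

/-- A word lists the clocks in the order in which they have rung, the latest first. This is the time
of its latest event, and `0` for the empty word. -/
noncomputable def wordTime (D : ι → ℕ → ℝ × Ξ) : List ι → ℝ
  | [] => 0
  | k :: w => arr D k (w.count k)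

/-- The events of the word are in chronological order. -/
def WordSorted (D : ι → ℕ → ℝ × Ξ) : List ι → Prop
  | [] => True
  | k :: w => wordTime D w < wordTime D (k :: w) ∧ WordSorted D w

/-- The word `w` lists, in chronological order, exactly the events before the time `s`. -/
structure IsHistory (D : ι → ℕ → ℝ × Ξ) (w : List ι) (s : ℝ) : Prop where
  sorted : WordSorted D w
  time_lt : wordTime D w < s
  le_next : ∀ k, s ≤ arr D k (w.count k)

variable {D : ι → ℕ → ℝ × Ξ} {w : List ι} {s : ℝ}

theorem GoodClocks.wordTime_nonneg (hD : GoodClocks D) (w : List ι) : 0 ≤ wordTime D w := by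
  cases w with
  | nil => simp [wordTime]
  | cons k w => exact (hD.arr_pos k _).le

theorem GoodClocks.arr_le_wordTime (hD : GoodClocks D) {k : ι} {c : ℕ} :
    ∀ {w : List ι}, WordSorted D w → c < w.count k → arr D k c ≤ wordTime D w
  | [], _, h => by simp at h
  | k' :: w, hw, h => by
    by_cases hc : c < w.count k
    · exact (hD.arr_le_wordTime hw.2 hc).trans hw.1.le
    · rw [List.count_cons] at h
      have hk : k' = k := by by_contra hk; simp [hk] at h; omega
      subst hk
      have : c = w.count k' := by simp at h; omega
      subst this
      rfl

theorem GoodClocks.lt_count_iff (hD : GoodClocks D) (h : IsHistory D w s) (k : ι) (c : ℕ) :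
    c < w.count k ↔ arr D k c < s := by
  refine ⟨fun hc => (hD.arr_le_wordTime h.sorted hc).trans_lt h.time_lt, fun hc => ?_⟩
  by_contra! hle
  exact absurd (((h.le_next k).trans ((hD.arr_strictMono k).monotone hle)).trans_lt hc)
    (lt_irrefl _)

theorem IsHistory.tail {k : ι} (h : IsHistory D (k :: w) s) :
    IsHistory D w (wordTime D (k :: w)) := by
  refine ⟨h.sorted.2, h.sorted.1, fun k' => ?_⟩
  by_cases hk : k = k'
  · subst hk; rfl
  · have := h.le_next k'
    rw [List.count_cons_of_ne hk] at this
    exact h.time_lt.le.trans this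

/-- The history up to `s` is still the history at the earlier times after its latest event. -/
theorem IsHistory.of_le {u : ℝ} (h : IsHistory D w s) (hu : wordTime D w < u) (hus : u ≤ s) :
    IsHistory D w u :=
  ⟨h.sorted, hu, fun k => hus.trans (h.le_next k)⟩

/-- Without ties, the events before `s` can be listed in one chronological order only. -/
theorem GoodClocks.history_unique (hD : GoodClocks D) :
    ∀ {w w' : List ι} {s : ℝ}, IsHistory D w s → IsHistory D w' s → w = w' := by
  have hcount : ∀ {w w' : List ι} {s : ℝ}, IsHistory D w s → IsHistory D w' s →
      ∀ k, w.count k = w'.count k := fun {w w' s} h h' k => by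
    refine le_antisymm ?_ ?_ <;> by_contra! hlt
    · exact lt_irrefl _ ((hD.lt_count_iff h' k _).2 ((hD.lt_count_iff h k _).1 hlt))
    · exact lt_irrefl _ ((hD.lt_count_iff h k _).2 ((hD.lt_count_iff h' k _).1 hlt))
  intro w
  induction w with
  | nil =>
    intro w' s h h'
    cases w' with
    | nil => rfl
    | cons k w' => simpa using hcount h h' k
  | cons k w ih =>
    intro w' s h h'
    cases w' with
    | nil => simpa using hcount h h' k
    | cons k' w' =>
      have hc := hcount h h'
      have ht : arr D k (w.count k) = arr D k' (w'.count k') := by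
        refine le_antisymm ?_ ?_
        · exact hD.arr_le_wordTime h'.sorted (by rw [← hc k]; simp)
        · exact hD.arr_le_wordTime h.sorted (by rw [hc k']; simp)
      have hk := hD.no_tie _ _ _ _ ht
      subst hk
      have h2 := h'.tail
      rw [wordTime, ← ht] at h2
      rw [ih h.tail h2]

/-- The history up to `s` is built by induction on the number of events before `s`, by removing the
latest one. -/
theorem GoodClocks.exists_history [Fintype ι] (hD : GoodClocks D) (hs : 0 < s) :
    ∃ w, IsHistory D w s := by
  have hex : ∀ (s : ℝ) (k : ι), ∃ c, s ≤ arr D k c := fun s k =>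
    (hD.unbounded k s).imp fun _ h => h.le
  -- the number of arrivals of each clock before `s`
  let N : ℝ → ι → ℕ := fun s k => Nat.find (hex s k)
  have hN : ∀ s k c, c < N s k ↔ arr D k c < s := fun s k c => by
    refine ⟨fun h => not_le.1 (Nat.find_min (hex s k) h), fun h => ?_⟩
    by_contra! hle
    have := (Nat.find_spec (hex s k)).trans ((hD.arr_strictMono k).monotone hle)
    linarith
  suffices ∀ (m : ℕ) (s : ℝ), 0 < s → ∑ k, N s k = m → ∃ w, IsHistory D w s from
    this _ s hs rfl
  intro m
  induction m using Nat.strong_induction_on with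
  | _ m ih =>
  intro s hs hm
  by_cases h0 : ∀ k, N s k = 0
  · refine ⟨[], trivial, hs, fun k => ?_⟩
    by_contra! hlt
    have := (hN s k _).2 hlt
    simp [h0 k] at this
  · push Not at h0
    obtain ⟨k0, hk0⟩ := h0
    -- the latest event before `s`
    obtain ⟨k, hk, hmax⟩ := Finset.exists_max_image (Finset.univ.filter fun k => N s k ≠ 0)
      (fun k => arr D k (N s k - 1)) ⟨k0, by simp [hk0]⟩
    simp only [Finset.mem_filter, Finset.mem_univ, true_and] at hk hmax
    set t := arr D k (N s k - 1) with ht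
    have hts : t < s := (hN s k _).1 (by omega)
    have hle : ∀ k', N t k' ≤ N s k' := fun k' => by
      by_contra! hlt
      exact lt_irrefl _ ((hN s k' _).2 (((hN t k' _).1 hlt).trans hts))
    have hNk : N t k = N s k - 1 := by
      refine le_antisymm ?_ ?_ <;> by_contra! hlt
      · exact lt_irrefl _ ((hN t k _).1 hlt)
      · have : ¬ arr D k (N t k) < t := fun h => lt_irrefl _ ((hN t k _).2 h)
        exact this ((hD.arr_strictMono k) hlt)
    have hsum : ∑ k, N t k < m := by
      rw [← hm]
      exact Finset.sum_lt_sum (fun k' _ => hle k') ⟨k, Finset.mem_univ _, by omega⟩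
    obtain ⟨w, hw⟩ := ih _ hsum t (hD.arr_pos _ _) rfl
    have hcw : ∀ k', w.count k' = N t k' := fun k' => by
      refine le_antisymm ?_ ?_ <;> by_contra! hlt
      · exact lt_irrefl _ ((hN t k' _).2 ((hD.lt_count_iff hw k' _).1 hlt))
      · exact lt_irrefl _ ((hD.lt_count_iff hw k' _).2 ((hN t k' _).1 hlt))
    have htime : wordTime D (k :: w) = t := by rw [wordTime, hcw, hNk]
    refine ⟨k :: w, ⟨by rw [htime]; exact hw.time_lt, hw.sorted⟩, by rw [htime]; exact hts,
      fun k' => ?_⟩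
    by_cases hkk : k = k'
    · subst hkk
      rw [List.count_cons_self, hcw, hNk]
      by_contra! hlt
      have := (hN s k _).2 hlt
      omega
    · rw [List.count_cons_of_ne hkk]
      by_contra! hlt
      have h1 := (hN s k' _).2 hlt
      have h2 := hmax k' (by omega)
      have h3 : arr D k' (w.count k') ≤ arr D k' (N s k' - 1) :=
        (hD.arr_strictMono k').monotone (by omega)
      exact hkk (hD.no_tie _ _ _ _ (le_antisymm (hw.le_next k') (h3.trans h2)))

end Clocks

theorem measurable_arr {ι Ξ : Type*} [MeasurableSpace Ξ] (k : ι) (c : ℕ) :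
    Measurable fun D : ι → ℕ → ℝ × Ξ => arr D k c :=
  Finset.measurable_sum _ fun j _ => by fun_prop

theorem measurable_prevArr {ι Ξ : Type*} [MeasurableSpace Ξ] (k : ι) (c : ℕ) :
    Measurable fun D : ι → ℕ → ℝ × Ξ => prevArr D k c :=
  Finset.measurable_sum _ fun j _ => by fun_prop

/-! ### The state reached after the events of a word -/

/-- A dynamic on `E` that follows the flow `flow` and jumps from `z` to `jump k z ξ` when the clock
`k` rings with the mark `ξ`. -/
structure JumpFlow (ι E Ξ : Type*) [TopologicalSpace E] [MeasurableSpace E]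
    [MeasurableSpace Ξ] where
  /-- the motion between two events -/
  flow : ℝ → E → E
  /-- the effect of an event -/
  jump : ι → E → Ξ → E
  /-- the initial state -/
  init : E
  flow_zero : ∀ z, flow 0 z = z
  flow_add : ∀ s t z, flow (s + t) z = flow s (flow t z)
  continuous_flow : Continuous (Function.uncurry flow)
  measurable_jump : ∀ k, Measurable (Function.uncurry (jump k))

section Value

variable {ι E Ξ : Type*} [TopologicalSpace E] [MeasurableSpace E] [MeasurableSpace Ξ]
  [DecidableEq ι] (F : JumpFlow ι E Ξ)

namespace JumpFlow

/-- The state right after the latest event of the word. -/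
noncomputable def wordState (D : ι → ℕ → ℝ × Ξ) : List ι → E
  | [] => F.init
  | k :: w => F.jump k (F.flow (wordTime D (k :: w) - wordTime D w) (wordState D w))
      (D k (w.count k)).2

/-- The state at the time `s`, after the events of the word. -/
noncomputable def stateAt (D : ι → ℕ → ℝ × Ξ) (w : List ι) (s : ℝ) : E :=
  F.flow (s - wordTime D w) (F.wordState D w)

theorem wordState_cons (D : ι → ℕ → ℝ × Ξ) (k : ι) (w : List ι) :
    F.wordState D (k :: w) = F.jump k (F.stateAt D w (wordTime D (k :: w))) (D k (w.count k)).2 :=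
  rfl

/-- `K` is stable under the flow and the jumps, and holds the initial state. -/
structure IsInvariant (K : Set E) : Prop where
  init : F.init ∈ K
  flow : ∀ t, ∀ z ∈ K, F.flow t z ∈ K
  jump : ∀ k ξ, ∀ z ∈ K, F.jump k z ξ ∈ K

theorem IsInvariant.wordState_mem {F : JumpFlow ι E Ξ} {K : Set E} (hK : F.IsInvariant K)
    (D : ι → ℕ → ℝ × Ξ) : ∀ w, F.wordState D w ∈ K
  | [] => hK.init
  | _ :: w => hK.jump _ _ _ (hK.flow _ _ (hK.wordState_mem D w))

theorem IsInvariant.stateAt_mem {F : JumpFlow ι E Ξ} {K : Set E} (hK : F.IsInvariant K)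
    (D : ι → ℕ → ℝ × Ξ) (w : List ι) (s : ℝ) : F.stateAt D w s ∈ K :=
  hK.flow _ _ (hK.wordState_mem D w)

end JumpFlow

/-- The clock data `D` and `D'` agree on the events listed by the word. -/
def AgreeOn (D D' : ι → ℕ → ℝ × Ξ) (w : List ι) : Prop := ∀ k, ∀ j < w.count k, D k j = D' k j

omit [MeasurableSpace Ξ] in
theorem AgreeOn.tail {D D' : ι → ℕ → ℝ × Ξ} {k : ι} {w : List ι} (h : AgreeOn D D' (k :: w)) :
    AgreeOn D D' w :=
  fun k' j hj => h k' j (hj.trans_le (List.count_le_count_cons))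

omit [MeasurableSpace Ξ] in
theorem AgreeOn.wordTime_eq {D D' : ι → ℕ → ℝ × Ξ} {w : List ι} (h : AgreeOn D D' w) :
    wordTime D w = wordTime D' w := by
  cases w with
  | nil => rfl
  | cons k w =>
    unfold wordTime arr
    refine Finset.sum_congr rfl fun j hj => ?_
    rw [h k j]
    simpa using hj

omit [MeasurableSpace Ξ] in
theorem AgreeOn.wordSorted_iff {D D' : ι → ℕ → ℝ × Ξ} :
    ∀ {w : List ι}, AgreeOn D D' w → (WordSorted D w ↔ WordSorted D' w)
  | [], _ => Iff.rfl
  | k :: w, h => by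
    rw [WordSorted, WordSorted, h.wordTime_eq, h.tail.wordTime_eq, h.tail.wordSorted_iff]

theorem AgreeOn.wordState_eq {D D' : ι → ℕ → ℝ × Ξ} :
    ∀ {w : List ι}, AgreeOn D D' w → F.wordState D w = F.wordState D' w
  | [], _ => rfl
  | k :: w, h => by
    rw [JumpFlow.wordState, JumpFlow.wordState, h.wordTime_eq, h.tail.wordTime_eq,
      h.tail.wordState_eq, h k _ (by simp)]

/-- The state after the events of a word depends on the waiting times and the marks of these events
only. -/
theorem AgreeOn.stateAt_eq {D D' : ι → ℕ → ℝ × Ξ} {w : List ι} (h : AgreeOn D D' w) (s : ℝ) :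
    F.stateAt D w s = F.stateAt D' w s := by
  rw [JumpFlow.stateAt, JumpFlow.stateAt, h.wordTime_eq, h.wordState_eq]

end Value

/-! ### Picking a word measurably -/

section Pick

variable {ι E : Type*} [Countable ι]

/-- An enumeration of the words. -/
noncomputable def wordEnum (ι : Type*) [Countable ι] : ℕ → List ι :=
  (exists_surjective_nat (List ι)).choose

theorem wordEnum_surjective (ι : Type*) [Countable ι] : Function.Surjective (wordEnum ι) :=
  (exists_surjective_nat (List ι)).choose_spec

open Classical in
/-- The value `v w` at the first word `w` that satisfies `p`, and `z` if there is none. -/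
noncomputable def pick (p : List ι → Prop) (v : List ι → E) (z : E) : E :=
  if h : ∃ m, p (wordEnum ι m) then v (wordEnum ι (Nat.find h)) else z

theorem pick_eq {p : List ι → Prop} {v : List ι → E} {z y : E} (hex : ∃ w, p w)
    (h : ∀ w, p w → v w = y) : pick p v z = y := by
  have hex' : ∃ m, p (wordEnum ι m) := by
    obtain ⟨w, hw⟩ := hex
    obtain ⟨m, rfl⟩ := wordEnum_surjective ι w
    exact ⟨m, hw⟩
  rw [pick, dif_pos hex']
  classical
  exact h _ (Nat.find_spec hex')

theorem pick_mem {p : List ι → Prop} {v : List ι → E} {z : E} {K : Set E} (hz : z ∈ K)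
    (h : ∀ w, v w ∈ K) : pick p v z ∈ K := by
  unfold pick
  split_ifs
  · exact h _
  · exact hz

theorem pick_congr {p p' : List ι → Prop} {v v' : List ι → E} {z : E} (hp : ∀ w, p w ↔ p' w)
    (h : ∀ w, p w → v w = v' w) : pick p v z = pick p' v' z := by
  have : p = p' := funext fun w => propext (hp w)
  subst this
  unfold pick
  split_ifs with hex
  · classical
    exact h _ (Nat.find_spec hex)
  · rfl

theorem measurable_pick {S : Type*} [MeasurableSpace S] [MeasurableSpace E] {p : S → List ι → Prop}
    {v : S → List ι → E} (z : E) (hp : ∀ w, MeasurableSet {x | p x w})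
    (hv : ∀ w, Measurable fun x => v x w) : Measurable fun x => pick (p x) (v x) z := by
  classical
  have hnone : MeasurableSet {x | ∀ m, ¬ p x (wordEnum ι m)} := by
    rw [Set.ofPred_forall]
    exact MeasurableSet.iInter fun m => (hp _).compl
  have hex : ∀ x, ∃ m, p x (wordEnum ι m) ∨ ∀ j, ¬ p x (wordEnum ι j) := fun x => by
    by_cases h : ∃ m, p x (wordEnum ι m)
    · exact h.imp fun _ => Or.inl
    · exact ⟨0, Or.inr (not_exists.1 h)⟩
  have := Measurable.find
    (f := fun m x => if p x (wordEnum ι m) then v x (wordEnum ι m) else z)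
    (p := fun m x => p x (wordEnum ι m) ∨ ∀ j, ¬ p x (wordEnum ι j))
    (fun m => Measurable.ite (hp _) (hv _) measurable_const) (fun m => (hp _).union hnone) hex
  convert this using 2 with x
  unfold pick
  split_ifs with h h' h'
  · have : Nat.find h = Nat.find (hex x) := by
      refine le_antisymm (Nat.find_min' _ h') (Nat.find_min' _ (Or.inl (Nat.find_spec h)))
    rw [this]
  · exact absurd (Nat.find_spec (hex x)) (by
      rintro (h1 | h1)
      · exact h' h1
      · exact h1 _ h.choose_spec)
  · exact absurd ⟨_, h'⟩ h
  · rfl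

end Pick

/-! ### The state just before a time -/

section LeftValue

variable {ι E Ξ : Type*} [TopologicalSpace E] [MeasurableSpace E] [MeasurableSpace Ξ]
  [DecidableEq ι]

theorem measurable_wordTime (w : List ι) : Measurable fun D : ι → ℕ → ℝ × Ξ => wordTime D w := by
  cases w with
  | nil => exact measurable_const
  | cons k w => exact measurable_arr k _

theorem measurableSet_wordSorted (w : List ι) :
    MeasurableSet {D : ι → ℕ → ℝ × Ξ | WordSorted D w} := by
  induction w with
  | nil => simp [WordSorted]
  | cons k w ih =>
    exact (measurableSet_lt (measurable_wordTime w) (measurable_wordTime (k :: w))).inter ih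

variable [Countable ι]

namespace JumpFlow

/-- The state just before the time `s`, for the clock data `D`. -/
noncomputable def leftState (F : JumpFlow ι E Ξ) (s : ℝ) (D : ι → ℕ → ℝ × Ξ) : E :=
  pick (fun w => IsHistory D w s) (fun w => F.stateAt D w s) F.init

/-- The state just before the time `s`, if the clock `k` has rung `c` times before `s`. It does not
depend on the `c`-th waiting time of the clock `k`, nor on its mark. -/
noncomputable def leftStateExcept (F : JumpFlow ι E Ξ) (k : ι) (c : ℕ) (s : ℝ)
    (D : ι → ℕ → ℝ × Ξ) : E :=
  pick (fun w => w.count k = c ∧ WordSorted D w ∧ wordTime D w < s ∧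
    ∀ k', k' ≠ k → s ≤ arr D k' (w.count k')) (fun w => F.stateAt D w s) F.init

variable {F : JumpFlow ι E Ξ} {D : ι → ℕ → ℝ × Ξ} {s : ℝ}

theorem leftState_eq (hD : GoodClocks D) {w : List ι} (hw : IsHistory D w s) :
    F.leftState s D = F.stateAt D w s :=
  pick_eq ⟨w, hw⟩ fun w' hw' => by rw [hD.history_unique hw' hw]

theorem IsInvariant.leftState_mem {K : Set E} (hK : F.IsInvariant K) (s : ℝ)
    (D : ι → ℕ → ℝ × Ξ) : F.leftState s D ∈ K :=
  pick_mem hK.init fun w => hK.stateAt_mem D w s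

theorem leftStateExcept_eq (hD : GoodClocks D) {k : ι} {c : ℕ} (h1 : prevArr D k c < s)
    (h2 : s ≤ arr D k c) : F.leftStateExcept k c s D = F.leftState s D := by
  refine pick_congr (fun w => ⟨?_, fun h => ?_⟩) fun _ _ => rfl
  · rintro ⟨hc, hs, ht, hn⟩
    refine ⟨hs, ht, fun k' => ?_⟩
    by_cases hk : k' = k
    · rw [hk, hc]; exact h2
    · exact hn k' hk
  · refine ⟨?_, h.sorted, h.time_lt, fun k' _ => h.le_next k'⟩
    refine le_antisymm ?_ ?_
    · by_contra! hlt
      exact absurd ((hD.lt_count_iff h k c).1 hlt) (not_lt.2 h2)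
    · cases c with
      | zero => exact Nat.zero_le _
      | succ c => exact (hD.lt_count_iff h k c).2 h1

theorem leftStateExcept_congr (F : JumpFlow ι E Ξ) {k : ι} {c : ℕ} {D D' : ι → ℕ → ℝ × Ξ}
    (h : ∀ k' j, (k', j) ≠ (k, c) → D k' j = D' k' j) (s : ℝ) :
    F.leftStateExcept k c s D = F.leftStateExcept k c s D' := by
  have hag : ∀ {w : List ι}, w.count k = c → AgreeOn D D' w := fun {w} hw k' j hj =>
    h k' j fun he => by
      obtain ⟨rfl, rfl⟩ := Prod.mk.inj he
      omega
  refine pick_congr (fun w => and_congr_right fun hc => ?_) fun w hw =>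
    AgreeOn.stateAt_eq F (hag hw.1) s
  rw [(hag hc).wordTime_eq, (hag hc).wordSorted_iff]
  refine and_congr_right fun _ => and_congr_right fun _ => forall_congr' fun k' =>
    forall_congr' fun hk => ?_
  have : arr D k' (w.count k') = arr D' k' (w.count k') :=
    Finset.sum_congr rfl fun j _ => by rw [h k' j fun he => hk (Prod.mk.inj he).1]
  rw [this]

end JumpFlow

variable [SecondCountableTopology E] [BorelSpace E]

omit [Countable ι] in
theorem JumpFlow.measurable_wordState (F : JumpFlow ι E Ξ) (w : List ι) :
    Measurable fun D => F.wordState D w := by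
  induction w with
  | nil => exact measurable_const
  | cons k w ih =>
    refine (F.measurable_jump k).comp (Measurable.prodMk (F.continuous_flow.measurable.comp
      (Measurable.prodMk ((measurable_wordTime _).sub (measurable_wordTime _)) ih)) ?_)
    fun_prop

omit [Countable ι] in
theorem JumpFlow.measurable_stateAt (F : JumpFlow ι E Ξ) (w : List ι) :
    Measurable fun x : ℝ × (ι → ℕ → ℝ × Ξ) => F.stateAt x.2 w x.1 :=
  F.continuous_flow.measurable.comp (Measurable.prodMk
    (measurable_fst.sub ((measurable_wordTime w).comp measurable_snd))
    ((F.measurable_wordState w).comp measurable_snd))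

theorem JumpFlow.measurable_leftState (F : JumpFlow ι E Ξ) :
    Measurable (Function.uncurry F.leftState) := by
  refine measurable_pick (p := fun (x : ℝ × (ι → ℕ → ℝ × Ξ)) w => IsHistory x.2 w x.1)
    (v := fun (x : ℝ × (ι → ℕ → ℝ × Ξ)) w => F.stateAt x.2 w x.1) F.init (fun w => ?_)
    fun w => F.measurable_stateAt w
  have : {x : ℝ × (ι → ℕ → ℝ × Ξ) | IsHistory x.2 w x.1} =
      {x | WordSorted x.2 w} ∩ {x | wordTime x.2 w < x.1} ∩
        ⋂ k, {x | x.1 ≤ arr x.2 k (w.count k)} := by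
    ext x
    simp only [Set.mem_ofPred_eq, Set.mem_inter_iff, Set.mem_iInter]
    exact ⟨fun h => ⟨⟨h.1, h.2⟩, h.3⟩, fun h => ⟨h.1.1, h.1.2, h.2⟩⟩
  rw [this]
  refine MeasurableSet.inter (MeasurableSet.inter (measurable_snd (measurableSet_wordSorted w))
    (measurableSet_lt ((measurable_wordTime w).comp measurable_snd) measurable_fst))
    (MeasurableSet.iInter fun k =>
      measurableSet_le measurable_fst ((measurable_arr k _).comp measurable_snd))

theorem JumpFlow.measurable_leftStateExcept (F : JumpFlow ι E Ξ) (k : ι) (c : ℕ) :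
    Measurable (Function.uncurry (F.leftStateExcept k c)) := by
  refine measurable_pick (p := fun (x : ℝ × (ι → ℕ → ℝ × Ξ)) w => w.count k = c ∧ WordSorted x.2 w ∧
      wordTime x.2 w < x.1 ∧ ∀ k', k' ≠ k → x.1 ≤ arr x.2 k' (w.count k'))
    (v := fun (x : ℝ × (ι → ℕ → ℝ × Ξ)) w => F.stateAt x.2 w x.1) F.init (fun w => ?_)
    fun w => F.measurable_stateAt w
  have : {x : ℝ × (ι → ℕ → ℝ × Ξ) | w.count k = c ∧ WordSorted x.2 w ∧ wordTime x.2 w < x.1 ∧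
      ∀ k', k' ≠ k → x.1 ≤ arr x.2 k' (w.count k')} =
      {x | w.count k = c} ∩ ({x | WordSorted x.2 w} ∩ ({x | wordTime x.2 w < x.1} ∩
        ⋂ k', ⋂ _ : k' ≠ k, {x | x.1 ≤ arr x.2 k' (w.count k')})) := by
    ext x
    simp only [Set.mem_ofPred_eq, Set.mem_inter_iff, Set.mem_iInter]
  rw [this]
  refine MeasurableSet.inter (MeasurableSet.const _) (MeasurableSet.inter
    (measurable_snd (measurableSet_wordSorted w)) (MeasurableSet.inter
    (measurableSet_lt ((measurable_wordTime w).comp measurable_snd) measurable_fst)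
    (MeasurableSet.iInter fun k' => MeasurableSet.iInter fun _ =>
      measurableSet_le measurable_fst ((measurable_arr k' _).comp measurable_snd))))

end LeftValue

/-! ### The exponential law -/

section Exponential

instance nullSingletonClass_expMeasure (r : ℝ) : NullSingletonClass (expMeasure r) := by
  unfold expMeasure gammaMeasure
  infer_instance

theorem expMeasure_Ici {r : ℝ} (hr : 0 < r) {v : ℝ} (hv : 0 ≤ v) :
    expMeasure r (Set.Ici v) = ENNReal.ofReal (Real.exp (-(r * v))) := by
  have := isProbabilityMeasure_expMeasure hr
  have h := cdf_expMeasure_eq hr v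
  rw [if_pos hv, cdf_eq_real] at h
  rw [← Set.compl_Iio, prob_compl_eq_one_sub measurableSet_Iio, measure_congr Iio_ae_eq_Iic,
    ← ofReal_measureReal, h, ← ENNReal.ofReal_one, ← ENNReal.ofReal_sub 1
      (by rw [sub_nonneg, Real.exp_le_one_iff]; nlinarith)]
  simp

theorem lintegral_expMeasure {r : ℝ} (f : ℝ → ℝ≥0∞) (hf : Measurable f) :
    ∫⁻ u, f u ∂(expMeasure r) = ∫⁻ u, exponentialPDF r u * f u := by
  have hm : Measurable (gammaPDF 1 r) := (measurable_gammaPDFReal 1 r).ennreal_ofReal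
  unfold expMeasure gammaMeasure
  rw [lintegral_withDensity_eq_lintegral_mul _ hm hf]
  rfl

/-- The hazard rate of the exponential law is constant: integrating `f` at an exponential time after
`a` amounts to integrating it at the rate `r` until that time. -/
theorem lintegral_exp_shift {r : ℝ} (hr : 0 < r) (a : ℝ) (f : ℝ → ℝ≥0∞) (hf : Measurable f) :
    ∫⁻ u, f (a + u) ∂(expMeasure r) =
      ENNReal.ofReal r * ∫⁻ u, (∫⁻ s in Set.Ioc a (a + u), f s) ∂(expMeasure r) := by
  have := isProbabilityMeasure_expMeasure hr
  have hset : MeasurableSet {p : ℝ × ℝ | a < p.2 ∧ p.2 ≤ a + p.1} :=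
    (measurableSet_lt measurable_const measurable_snd).inter
      (measurableSet_le measurable_snd (measurable_const.add measurable_fst))
  have h1 : ∀ u, ∫⁻ s in Set.Ioc a (a + u), f s =
      ∫⁻ s, {p : ℝ × ℝ | a < p.2 ∧ p.2 ≤ a + p.1}.indicator (fun p => f p.2) (u, s) := fun u => by
    rw [← lintegral_indicator measurableSet_Ioc]
    refine lintegral_congr fun s => ?_
    simp [Set.indicator_apply]
  simp_rw [h1]
  rw [lintegral_lintegral_swap (f := fun u s => {p : ℝ × ℝ | a < p.2 ∧ p.2 ≤ a + p.1}.indicator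
    (fun p => f p.2) (u, s)) (((hf.comp measurable_snd).indicator hset).aemeasurable)]
  have h2 : ∀ s, ∫⁻ u, {p : ℝ × ℝ | a < p.2 ∧ p.2 ≤ a + p.1}.indicator (fun p => f p.2) (u, s)
      ∂(expMeasure r) = (Set.Ioi a).indicator
        (fun s => ENNReal.ofReal (Real.exp (-(r * (s - a)))) * f s) s := fun s => by
    by_cases hs : a < s
    · have : ∀ u, {p : ℝ × ℝ | a < p.2 ∧ p.2 ≤ a + p.1}.indicator (fun p => f p.2) (u, s) =
          (Set.Ici (s - a)).indicator (fun _ => f s) u := fun u => by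
        simp [Set.indicator_apply, hs, add_comm]
      simp_rw [this]
      rw [lintegral_indicator_const measurableSet_Ici, expMeasure_Ici hr (by linarith),
        Set.indicator_of_mem (by exact hs), mul_comm]
    · simp [hs]
  simp_rw [h2]
  rw [lintegral_expMeasure (fun u => f (a + u)) (hf.comp (measurable_const.add measurable_id)),
    ← lintegral_const_mul _ (Measurable.indicator (by fun_prop) measurableSet_Ioi),
    ← lintegral_sub_right_eq_self (μ := volume)
      (fun u => exponentialPDF r u * f (a + u)) a]
  refine lintegral_congr_ae ?_
  have hne : ∀ᵐ s : ℝ, s ≠ a := by simp [ae_iff]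
  filter_upwards [hne] with s hs
  rcases lt_or_gt_of_ne hs with h | h
  · rw [exponentialPDF_of_neg (by linarith), Set.indicator_of_notMem (by simp [h.le])]
    simp
  · rw [exponentialPDF_of_nonneg (by linarith), Set.indicator_of_mem (by exact h), ← mul_assoc,
      ← ENNReal.ofReal_mul hr.le]
    simp

end Exponential

/-! ### The compensation formula for one arrival -/

section Compensation

variable {Ω ι Ξ : Type*} [MeasurableSpace Ω] [MeasurableSpace Ξ] [DecidableEq ι]

/-- The clock data with the `c`-th waiting time of the clock `k` and its mark replaced by `d`. -/
def resetClock (k : ι) (c : ℕ) (d : ℝ × Ξ) (D : ι → ℕ → ℝ × Ξ) : ι → ℕ → ℝ × Ξ :=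
  Function.update D k (Function.update (D k) c d)

omit [MeasurableSpace Ξ] in
theorem resetClock_of_ne {k k' : ι} {c j : ℕ} (d : ℝ × Ξ) (D : ι → ℕ → ℝ × Ξ)
    (h : (k', j) ≠ (k, c)) : resetClock k c d D k' j = D k' j := by
  unfold resetClock
  by_cases hk : k' = k
  · subst hk
    have : j ≠ c := fun hj => h (by rw [hj])
    simp [this]
  · simp [hk]

omit [MeasurableSpace Ξ] in
theorem prevArr_resetClock (k : ι) (c : ℕ) (d : ℝ × Ξ) (D : ι → ℕ → ℝ × Ξ) :
    prevArr (resetClock k c d D) k c = prevArr D k c :=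
  Finset.sum_congr rfl fun j hj => by
    rw [resetClock_of_ne]
    have := Finset.mem_range.1 hj
    simp only [ne_eq, Prod.mk.injEq, true_and]
    omega

/-- The clocks `k` ring at the times of independent Poisson processes of rates `r k`, and carry
independent marks of laws `Q k`: each waiting time is exponential, its mark is independent of it,
and both are independent of all the other waiting times and marks. -/
structure IsClockData (P : Measure Ω) (r : ι → ℝ) (Q : ι → Measure Ξ) (D : Ω → ι → ℕ → ℝ × Ξ) :
    Prop where
  measurable : Measurable D
  law : ∀ k c, P.map (fun ω => D ω k c) = (expMeasure (r k)).prod (Q k)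
  indep : ∀ k c d, IndepFun (fun ω => D ω k c) (fun ω => resetClock k c d (D ω)) P

variable {P : Measure Ω} [IsProbabilityMeasure P] {r : ι → ℝ} {Q : ι → Measure Ξ}
  [∀ k, IsProbabilityMeasure (Q k)] {D : Ω → ι → ℕ → ℝ × Ξ}

omit [IsProbabilityMeasure P] [∀ k, IsProbabilityMeasure (Q k)] in
theorem IsClockData.measurable_apply (h : IsClockData P r Q D) (k : ι) (c : ℕ) :
    Measurable fun ω => D ω k c :=
  measurable_pi_iff.1 (measurable_pi_iff.1 h.measurable k) c

omit [MeasurableSpace Ω] in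
theorem measurable_resetClock (k : ι) (c : ℕ) (d : ℝ × Ξ) :
    Measurable (resetClock k c d : (ι → ℕ → ℝ × Ξ) → _) := by
  refine measurable_pi_iff.2 fun k' => measurable_pi_iff.2 fun j => ?_
  by_cases h : (k', j) = (k, c)
  · obtain ⟨rfl, rfl⟩ := Prod.mk.inj h
    simp [resetClock]
  · simp_rw [resetClock_of_ne d _ h]
    fun_prop

/-- Integrating out one waiting time and its mark, given all the others. -/
theorem IsClockData.lintegral_resetClock (h : IsClockData P r Q D) (hr : ∀ k, 0 < r k) (k : ι)
    (c : ℕ) (d : ℝ × Ξ) {f : (ℝ × Ξ) × (ι → ℕ → ℝ × Ξ) → ℝ≥0∞} (hf : Measurable f) :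
    ∫⁻ ω, f (D ω k c, resetClock k c d (D ω)) ∂P =
      ∫⁻ ω, ∫⁻ p, f (p, resetClock k c d (D ω)) ∂((expMeasure (r k)).prod (Q k)) ∂P := by
  have := isProbabilityMeasure_expMeasure (hr k)
  have hY : Measurable fun ω => resetClock k c d (D ω) :=
    (measurable_resetClock k c d).comp h.measurable
  have hU := h.measurable_apply k c
  have hmap := (indepFun_iff_map_prod_eq_prod_map_map hU.aemeasurable hY.aemeasurable).1
    (h.indep k c d)
  have := Measure.isProbabilityMeasure_map (μ := P) hY.aemeasurable
  rw [← lintegral_map (f := f) hf (hU.prodMk hY), hmap, h.law, lintegral_prod_symm' _ hf,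
    lintegral_map hf.lintegral_prod_left' hY]

/-- Compensation formula for the `c`-th arrival of the clock `k`. The integrand may depend on the
clock data, but not on the waiting time and the mark of this arrival. -/
theorem IsClockData.lintegral_arr (h : IsClockData P r Q D) (hr : ∀ k, 0 < r k) (k : ι)
    (c : ℕ) {f : ℝ × Ξ × (ι → ℕ → ℝ × Ξ) → ℝ≥0∞} (hf : Measurable f)
    (hdep : ∀ s ξ d D, f (s, ξ, resetClock k c d D) = f (s, ξ, D)) :
    ∫⁻ ω, f (arr (D ω) k c, (D ω k c).2, D ω) ∂P = ENNReal.ofReal (r k) *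
      ∫⁻ ω, (∫⁻ s in Set.Ioc (prevArr (D ω) k c) (arr (D ω) k c),
        ∫⁻ ξ, f (s, ξ, D ω) ∂(Q k)) ∂P := by
  have := isProbabilityMeasure_expMeasure (hr k)
  obtain ⟨ξ₀⟩ : Nonempty Ξ := (Q k).nonempty_of_neZero
  set d : ℝ × Ξ := (0, ξ₀)
  set g : ℝ × (ι → ℕ → ℝ × Ξ) → ℝ≥0∞ := fun x => ∫⁻ ξ, f (x.1, ξ, x.2) ∂(Q k) with hg
  have hgm : Measurable g := by
    have : Measurable fun y : (ℝ × (ι → ℕ → ℝ × Ξ)) × Ξ => f (y.1.1, y.2, y.1.2) :=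
      hf.comp (by fun_prop)
    exact this.lintegral_prod_right'
  have hgdep : ∀ s D, g (s, resetClock k c d D) = g (s, D) := fun s D => by
    simp only [hg, hdep]
  have hset : MeasurableSet {y : ((ℝ × Ξ) × (ι → ℕ → ℝ × Ξ)) × ℝ |
      prevArr y.1.2 k c < y.2 ∧ y.2 ≤ prevArr y.1.2 k c + y.1.1.1} := by
    have hp : Measurable fun y : ((ℝ × Ξ) × (ι → ℕ → ℝ × Ξ)) × ℝ => prevArr y.1.2 k c :=
      (measurable_prevArr k c).comp (by fun_prop)
    exact (measurableSet_lt hp measurable_snd).inter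
      (measurableSet_le measurable_snd (hp.add (by fun_prop)))
  set f1 : (ℝ × Ξ) × (ι → ℕ → ℝ × Ξ) → ℝ≥0∞ := fun x => f (prevArr x.2 k c + x.1.1, x.1.2, x.2)
  have hf1 : Measurable f1 := by
    refine hf.comp (Measurable.prodMk (Measurable.add ?_ (by fun_prop)) (by fun_prop))
    exact (measurable_prevArr k c).comp measurable_snd
  set f2 : (ℝ × Ξ) × (ι → ℕ → ℝ × Ξ) → ℝ≥0∞ := fun x =>
    ∫⁻ s in Set.Ioc (prevArr x.2 k c) (prevArr x.2 k c + x.1.1), g (s, x.2)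
  have hf2eq : ∀ x, f2 x = ∫⁻ s, {y : ((ℝ × Ξ) × (ι → ℕ → ℝ × Ξ)) × ℝ |
      prevArr y.1.2 k c < y.2 ∧ y.2 ≤ prevArr y.1.2 k c + y.1.1.1}.indicator
        (fun y => g (y.2, y.1.2)) (x, s) := fun x => by
    simp only [f2]
    rw [← lintegral_indicator measurableSet_Ioc]
    refine lintegral_congr fun s => ?_
    simp [Set.indicator_apply]
  have hf2 : Measurable f2 := by
    rw [funext hf2eq]
    exact Measurable.lintegral_prod_right' (Measurable.indicator (hgm.comp (by fun_prop)) hset)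
  have e1 : ∀ ω, f (arr (D ω) k c, (D ω k c).2, D ω) = f1 (D ω k c, resetClock k c d (D ω)) :=
    fun ω => by simp only [f1, prevArr_resetClock, hdep, arr_eq_prevArr_add]
  have e2 : ∀ ω, ∫⁻ s in Set.Ioc (prevArr (D ω) k c) (arr (D ω) k c), ∫⁻ ξ, f (s, ξ, D ω) ∂(Q k) =
      f2 (D ω k c, resetClock k c d (D ω)) := fun ω => by
    simp only [f2, prevArr_resetClock, hgdep, arr_eq_prevArr_add]
    rfl
  simp_rw [e1, e2]
  rw [h.lintegral_resetClock hr k c d hf1, h.lintegral_resetClock hr k c d hf2,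
    ← lintegral_const_mul _ ?_]
  swap
  · have : Measurable fun y : (ι → ℕ → ℝ × Ξ) => ∫⁻ p, f2 (p, y) ∂((expMeasure (r k)).prod (Q k)) :=
      hf2.lintegral_prod_left'
    exact this.comp ((measurable_resetClock k c d).comp h.measurable)
  refine lintegral_congr fun ω => ?_
  set D' := resetClock k c d (D ω)
  have hpair : Measurable fun p : ℝ × Ξ => (p, D') := by fun_prop
  rw [lintegral_prod (fun p => f1 (p, D')) (hf1.comp hpair).aemeasurable,
    lintegral_prod (fun p => f2 (p, D')) (hf2.comp hpair).aemeasurable]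
  have := lintegral_exp_shift (hr k) (prevArr D' k c) (fun s => g (s, D'))
    (hgm.comp (by fun_prop))
  simp only [f1, f2, lintegral_const, measure_univ, mul_one]
  exact this

end Compensation

/-! ### Almost sure properties of the clocks and the compensation formula -/

section Campbell

variable {Ω ι Ξ : Type*} [MeasurableSpace Ω] [MeasurableSpace Ξ] [DecidableEq ι]
  {P : Measure Ω} [IsProbabilityMeasure P] {r : ι → ℝ} {Q : ι → Measure Ξ}
  [∀ k, IsProbabilityMeasure (Q k)] {D : Ω → ι → ℕ → ℝ × Ξ}

omit [DecidableEq ι] [MeasurableSpace Ξ] in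
theorem lintegral_tsum_Ioc {D : ι → ℕ → ℝ × Ξ} {k : ι} (hD : ∀ c, 0 < (D k c).1) (f : ℝ → ℝ≥0∞) :
    ∑' c, ∫⁻ s in Set.Ioc (prevArr D k c) (arr D k c), f s =
      ∫⁻ s in ⋃ c, Set.Ioc (prevArr D k c) (arr D k c), f s := by
  have hmono : Monotone (prevArr D k) := monotone_nat_of_le_succ fun c => by
    rw [prevArr_succ, arr_eq_prevArr_add]; linarith [hD c]
  exact (lintegral_iUnion (fun c => measurableSet_Ioc) hmono.pairwise_disjoint_on_Ioc_succ _).symm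

omit [DecidableEq ι] [MeasurableSpace Ξ] in
theorem GoodClocks.iUnion_Ioc {D : ι → ℕ → ℝ × Ξ} (hD : GoodClocks D) (k : ι) :
    ⋃ c, Set.Ioc (prevArr D k c) (arr D k c) = Set.Ioi 0 := by
  ext s
  simp only [Set.mem_iUnion, Set.mem_Ioc, Set.mem_Ioi]
  refine ⟨fun ⟨c, h, _⟩ => (hD.prevArr_nonneg k c).trans_lt h, fun hs => ?_⟩
  have hex : ∃ c, s ≤ arr D k c := (hD.unbounded k s).imp fun _ h => h.le
  classical
  refine ⟨Nat.find hex, ?_, Nat.find_spec hex⟩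
  rcases h : Nat.find hex with _ | c
  · simpa using hs
  · exact not_le.1 (Nat.find_min hex (by omega : c < Nat.find hex))

omit [IsProbabilityMeasure P] [∀ k, IsProbabilityMeasure (Q k)] in
theorem IsClockData.ae_gap_pos [Countable ι] (h : IsClockData P r Q D) (hr : ∀ k, 0 < r k) :
    ∀ᵐ ω ∂P, ∀ k c, 0 < (D ω k c).1 := by
  refine ae_all_iff.2 fun k => ae_all_iff.2 fun c => ?_
  have := isProbabilityMeasure_expMeasure (hr k)
  have hm := h.measurable_apply k c
  have h1 : ∀ᵐ u ∂(expMeasure (r k)), 0 < u := by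
    rw [ae_iff]
    have := cdf_expMeasure_eq (hr k) 0
    rw [cdf_eq_real] at this
    simp only [le_refl, mul_zero, neg_zero, Real.exp_zero, sub_self, ite_true] at this
    simpa [measureReal_def, ENNReal.toReal_eq_zero_iff, Set.Iic_def] using this
  have h2 : ∀ᵐ p ∂((expMeasure (r k)).prod (Q k)), 0 < p.1 :=
    Measure.quasiMeasurePreserving_fst.ae h1
  rw [← h.law k c] at h2
  exact ae_of_ae_map hm.aemeasurable h2

/-- An arrival time has no atom, given the other waiting times. -/
theorem IsClockData.ae_arr_ne (h : IsClockData P r Q D) (hr : ∀ k, 0 < r k) {k : ι} (c : ℕ)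
    {Y : (ι → ℕ → ℝ × Ξ) → ℝ} (hY : Measurable Y) (hdep : ∀ d D, Y (resetClock k c d D) = Y D) :
    ∀ᵐ ω ∂P, arr (D ω) k c ≠ Y (D ω) := by
  have := isProbabilityMeasure_expMeasure (hr k)
  obtain ⟨ξ₀⟩ : Nonempty Ξ := (Q k).nonempty_of_neZero
  have hS : MeasurableSet {x : (ℝ × Ξ) × (ι → ℕ → ℝ × Ξ) | prevArr x.2 k c + x.1.1 = Y x.2} :=
    measurableSet_eq_fun (((measurable_prevArr k c).comp measurable_snd).add (by fun_prop))
      (hY.comp measurable_snd)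
  have key := h.lintegral_resetClock hr k c (0, ξ₀)
    (f := {x | prevArr x.2 k c + x.1.1 = Y x.2}.indicator 1) (measurable_one.indicator hS)
  have hz : ∀ D' : ι → ℕ → ℝ × Ξ, ∫⁻ p, ({x | prevArr x.2 k c + x.1.1 = Y x.2}.indicator 1
      (p, D') : ℝ≥0∞) ∂((expMeasure (r k)).prod (Q k)) = 0 := fun D' => by
    have hne : ∀ᵐ p ∂((expMeasure (r k)).prod (Q k)), p.1 ≠ Y D' - prevArr D' k c := by
      refine Measure.quasiMeasurePreserving_fst.ae
        (p := fun u => u ≠ Y D' - prevArr D' k c) ?_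
      simp [ae_iff]
    rw [← lintegral_zero (μ := (expMeasure (r k)).prod (Q k))]
    refine lintegral_congr_ae ?_
    filter_upwards [hne] with p hp
    refine Set.indicator_of_notMem (fun hmem => hp ?_) _
    simp only [Set.mem_ofPred_eq] at hmem
    linarith
  simp_rw [hz, lintegral_zero] at key
  rw [lintegral_eq_zero_iff] at key
  · filter_upwards [key] with ω hω heq
    have : (D ω k c, resetClock k c (0, ξ₀) (D ω)) ∈
        {x : (ℝ × Ξ) × (ι → ℕ → ℝ × Ξ) | prevArr x.2 k c + x.1.1 = Y x.2} := by
      simp only [Set.mem_ofPred_eq, prevArr_resetClock, hdep]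
      rw [← heq, arr_eq_prevArr_add]
    rw [Set.indicator_of_mem this] at hω
    simp at hω
  · exact (measurable_one.indicator hS).comp ((h.measurable_apply k c).prodMk
      ((measurable_resetClock k c _).comp h.measurable))

/-- The expected number of arrivals up to `T`, in terms of the part of `(0, T]` that the waiting
times cover. -/
theorem IsClockData.lintegral_tsum_arr (h : IsClockData P r Q D) (hr : ∀ k, 0 < r k)
    (k : ι) (T : ℝ) (hpos : ∀ᵐ ω ∂P, ∀ c, 0 < (D ω k c).1) :
    ∫⁻ ω, ∑' c, {c | arr (D ω) k c ≤ T}.indicator 1 c ∂P = ENNReal.ofReal (r k) *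
      ∫⁻ ω, volume ((⋃ c, Set.Ioc (prevArr (D ω) k c) (arr (D ω) k c)) ∩ Set.Iic T) ∂P := by
  have hf : Measurable fun x : ℝ × Ξ × (ι → ℕ → ℝ × Ξ) =>
      ((Set.Iic T).indicator 1 x.1 : ℝ≥0∞) :=
    (measurable_one.indicator measurableSet_Iic).comp measurable_fst
  have hind : ∀ ω c, ({c | arr (D ω) k c ≤ T}.indicator 1 c : ℝ≥0∞) =
    (Set.Iic T).indicator 1 (arr (D ω) k c) := fun ω c => by simp [Set.indicator_apply]
  simp_rw [hind]
  have hmeas : ∀ c, Measurable fun ω => ((Set.Iic T).indicator 1 (arr (D ω) k c) : ℝ≥0∞) :=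
    fun c => (measurable_one.indicator measurableSet_Iic).comp
      ((measurable_arr k c).comp h.measurable)
  rw [lintegral_tsum fun c => (hmeas c).aemeasurable]
  have hc := fun c => h.lintegral_arr hr k c hf fun _ _ _ _ => rfl
  simp only [lintegral_const, measure_univ, mul_one] at hc
  simp_rw [hc]
  rw [ENNReal.tsum_mul_left, ← lintegral_tsum]
  · congr 1
    refine lintegral_congr_ae ?_
    filter_upwards [hpos] with ω hω
    rw [lintegral_tsum_Ioc hω, lintegral_indicator_one measurableSet_Iic,
      Measure.restrict_apply measurableSet_Iic, Set.inter_comm]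
  · intro c
    have hm : Measurable fun ω =>
        volume (Set.Ioc (prevArr (D ω) k c) (arr (D ω) k c) ∩ Set.Iic T) := by
      simp_rw [Set.Ioc_inter_Iic, Real.volume_Ioc]
      have h1 : Measurable fun ω => arr (D ω) k c := (measurable_arr k c).comp h.measurable
      have h2 : Measurable fun ω => prevArr (D ω) k c := (measurable_prevArr k c).comp h.measurable
      exact ((h1.min measurable_const).sub h2).ennreal_ofReal
    convert hm.aemeasurable using 2 with ω
    rw [lintegral_indicator_one measurableSet_Iic,
      Measure.restrict_apply measurableSet_Iic, Set.inter_comm]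

/-- The waiting times are disjoint parts of `(0, T]`, so that the expected number of arrivals up to
`T` is finite. In particular there are almost surely finitely many. -/
theorem IsClockData.ae_unbounded [Countable ι] (h : IsClockData P r Q D) (hr : ∀ k, 0 < r k) :
    ∀ᵐ ω ∂P, ∀ k (T : ℝ), ∃ c, T < arr (D ω) k c := by
  refine ae_all_iff.2 fun k => ?_
  have hpos := h.ae_gap_pos hr
  have hn : ∀ m : ℕ, ∀ᵐ ω ∂P, ∃ c, (m : ℝ) < arr (D ω) k c := fun m => by
    have key := h.lintegral_tsum_arr hr k m (hpos.mono fun ω hω => hω k)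
    have hfin : ∫⁻ ω, ∑' c, ({c | arr (D ω) k c ≤ m}.indicator 1 c : ℝ≥0∞) ∂P ≠ ∞ := by
      rw [key]
      refine ENNReal.mul_ne_top ENNReal.ofReal_ne_top (ne_top_of_le_ne_top
        (b := ∫⁻ ω, volume (Set.Ioc (0 : ℝ) m) ∂P) (by simp) (lintegral_mono_ae ?_))
      filter_upwards [hpos] with ω hω
      refine measure_mono ?_
      rintro s ⟨hs, hsm⟩
      obtain ⟨c, hc, -⟩ := Set.mem_iUnion.1 hs
      exact ⟨(Finset.sum_nonneg fun j _ => (hω k j).le).trans_lt hc, hsm⟩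
    have hae := ae_lt_top' (Measurable.aemeasurable (by
      refine Measurable.tsum fun c => ?_
      have : ∀ ω, ({c | arr (D ω) k c ≤ m}.indicator 1 c : ℝ≥0∞) =
        (Set.Iic (m : ℝ)).indicator 1 (arr (D ω) k c) := fun ω => by simp [Set.indicator_apply]
      simp_rw [this]
      exact (measurable_one.indicator measurableSet_Iic).comp
        ((measurable_arr k c).comp h.measurable))) hfin
    filter_upwards [hae] with ω hω
    by_contra! hle
    have : ∀ c, ({c | arr (D ω) k c ≤ m}.indicator 1 c : ℝ≥0∞) = 1 := fun c => by simp [hle c]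
    simp_rw [this] at hω
    simp at hω
  filter_upwards [ae_all_iff.2 hn] with ω hω T
  obtain ⟨m, hm⟩ := exists_nat_gt T
  exact (hω m).imp fun c hc => hm.trans hc

theorem IsClockData.ae_goodClocks [Countable ι] (h : IsClockData P r Q D) (hr : ∀ k, 0 < r k) :
    ∀ᵐ ω ∂P, GoodClocks (D ω) := by
  have htie : ∀ᵐ ω ∂P, ∀ k k' c c', k ≠ k' → arr (D ω) k c ≠ arr (D ω) k' c' := by
    refine ae_all_iff.2 fun k => ae_all_iff.2 fun k' => ae_all_iff.2 fun c => ae_all_iff.2 fun c' =>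
      ?_
    by_cases hk : k = k'
    · simp [hk]
    · filter_upwards [h.ae_arr_ne hr c (Y := fun D => arr D k' c') (measurable_arr k' c')
        fun d D => Finset.sum_congr rfl fun j _ => by
          rw [resetClock_of_ne d D (fun he => hk (Prod.mk.inj he).1.symm)]] with ω hω _
      exact hω
  filter_upwards [h.ae_gap_pos hr, h.ae_unbounded hr, htie] with ω h1 h2 h3
  exact ⟨h1, h2, fun k k' c c' he => by_contra fun hk => h3 k k' c c' hk he⟩

theorem IsClockData.ae_arr_ne_const [Countable ι] (h : IsClockData P r Q D) (hr : ∀ k, 0 < r k)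
    (T : ℝ) : ∀ᵐ ω ∂P, ∀ k c, arr (D ω) k c ≠ T :=
  ae_all_iff.2 fun _ => ae_all_iff.2 fun c =>
    h.ae_arr_ne hr c (Y := fun _ => T) measurable_const fun _ _ => rfl

/-- The expected number of arrivals up to the time `T` is `r T`. -/
theorem IsClockData.lintegral_tsum_arr_eq [Countable ι] (h : IsClockData P r Q D)
    (hr : ∀ k, 0 < r k) (k : ι) (T : ℝ) :
    ∫⁻ ω, ∑' c, {c | arr (D ω) k c ≤ T}.indicator 1 c ∂P = ENNReal.ofReal (r k * T) := by
  rw [h.lintegral_tsum_arr hr k T ((h.ae_gap_pos hr).mono fun ω hω => hω k),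
    ENNReal.ofReal_mul (hr k).le]
  congr 1
  have : ∀ᵐ ω ∂P, volume ((⋃ c, Set.Ioc (prevArr (D ω) k c) (arr (D ω) k c)) ∩ Set.Iic T) =
      ENNReal.ofReal T := by
    filter_upwards [h.ae_goodClocks hr] with ω hω
    rw [hω.iUnion_Ioc, Set.Ioi_inter_Iic, Real.volume_Ioc, sub_zero]
  rw [lintegral_congr_ae this]
  simp

variable {E : Type*} [TopologicalSpace E] [MeasurableSpace E] [SecondCountableTopology E]
  [BorelSpace E] [Countable ι] (F : JumpFlow ι E Ξ)

/-- Compensation formula: the jumps of the clock `k` occur, given the past, at the rate `r k` and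
with marks of law `Q k`. -/
theorem IsClockData.lintegral_tsum_leftState (h : IsClockData P r Q D) (hr : ∀ k, 0 < r k) (k : ι)
    {H : ℝ × E × Ξ → ℝ≥0∞} (hH : Measurable H) :
    ∫⁻ ω, ∑' c, H (arr (D ω) k c, F.leftState (arr (D ω) k c) (D ω), (D ω k c).2) ∂P =
      ENNReal.ofReal (r k) *
        ∫⁻ ω, (∫⁻ s in Set.Ioi 0, ∫⁻ ξ, H (s, F.leftState s (D ω), ξ) ∂(Q k)) ∂P := by
  have hgood := h.ae_goodClocks hr
  -- on the event that matters, the state does not depend on the waiting time that is averaged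
  set f : ℕ → ℝ × Ξ × (ι → ℕ → ℝ × Ξ) → ℝ≥0∞ := fun c x =>
    H (x.1, F.leftStateExcept k c x.1 x.2.2, x.2.1) with hfdef
  have hf : ∀ c, Measurable (f c) := fun c => by
    refine hH.comp (measurable_fst.prodMk (Measurable.prodMk ?_ (by fun_prop)))
    exact (F.measurable_leftStateExcept k c).comp (by fun_prop :
      Measurable fun x : ℝ × Ξ × (ι → ℕ → ℝ × Ξ) => (x.1, x.2.2))
  have hdep : ∀ c s ξ d D, f c (s, ξ, resetClock k c d D) = f c (s, ξ, D) := fun c s ξ d D => by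
    simp only [hfdef]
    rw [F.leftStateExcept_congr fun k' j hne => resetClock_of_ne d D hne]
  have hL : ∫⁻ ω, ∑' c, H (arr (D ω) k c, F.leftState (arr (D ω) k c) (D ω), (D ω k c).2) ∂P =
      ∫⁻ ω, ∑' c, f c (arr (D ω) k c, (D ω k c).2, D ω) ∂P := by
    refine lintegral_congr_ae ?_
    filter_upwards [hgood] with ω hω
    refine tsum_congr fun c => ?_
    simp only [hfdef]
    rw [JumpFlow.leftStateExcept_eq hω
      (by rw [arr_eq_prevArr_add]; linarith [hω.gap_pos k c]) le_rfl]
  rw [hL, lintegral_tsum]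
  swap
  · intro c
    refine ((hf c).comp (Measurable.prodMk ((measurable_arr k c).comp h.measurable)
      (Measurable.prodMk ?_ h.measurable))).aemeasurable
    exact measurable_snd.comp (h.measurable_apply k c)
  simp_rw [fun c => h.lintegral_arr hr k c (hf c) (hdep c)]
  rw [ENNReal.tsum_mul_left, ← lintegral_tsum]
  · congr 1
    refine lintegral_congr_ae ?_
    filter_upwards [hgood] with ω hω
    have : ∀ c, ∫⁻ s in Set.Ioc (prevArr (D ω) k c) (arr (D ω) k c),
        ∫⁻ ξ, f c (s, ξ, D ω) ∂(Q k) = ∫⁻ s in Set.Ioc (prevArr (D ω) k c) (arr (D ω) k c),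
        ∫⁻ ξ, H (s, F.leftState s (D ω), ξ) ∂(Q k) := fun c => by
      refine setLIntegral_congr_fun measurableSet_Ioc fun s hs => ?_
      simp only [hfdef, JumpFlow.leftStateExcept_eq hω hs.1 hs.2]
    simp_rw [this]
    rw [lintegral_tsum_Ioc (hω.gap_pos k), hω.iUnion_Ioc]
  · intro c
    have hg : Measurable fun x : ℝ × (ι → ℕ → ℝ × Ξ) => ∫⁻ ξ, f c (x.1, ξ, x.2) ∂(Q k) := by
      have : Measurable fun y : (ℝ × (ι → ℕ → ℝ × Ξ)) × Ξ => f c (y.1.1, y.2, y.1.2) :=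
        (hf c).comp (by fun_prop)
      exact this.lintegral_prod_right'
    have hset : MeasurableSet {y : (ι → ℕ → ℝ × Ξ) × ℝ |
        prevArr y.1 k c < y.2 ∧ y.2 ≤ arr y.1 k c} :=
      (measurableSet_lt ((measurable_prevArr k c).comp measurable_fst) measurable_snd).inter
        (measurableSet_le measurable_snd ((measurable_arr k c).comp measurable_fst))
    have hm : Measurable fun D : ι → ℕ → ℝ × Ξ => ∫⁻ s, {y : (ι → ℕ → ℝ × Ξ) × ℝ |
        prevArr y.1 k c < y.2 ∧ y.2 ≤ arr y.1 k c}.indicator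
          (fun y => ∫⁻ ξ, f c (y.2, ξ, y.1) ∂(Q k)) (D, s) :=
      Measurable.lintegral_prod_right' (Measurable.indicator (hg.comp measurable_swap) hset)
    convert (hm.comp h.measurable).aemeasurable using 2 with ω
    simp only [Function.comp]
    rw [← lintegral_indicator measurableSet_Ioc]
    refine lintegral_congr fun s => ?_
    simp [Set.indicator_apply]

end Campbell

/-! ### The change of a function along a trajectory -/

section Path

variable {ι E Ξ : Type*} [TopologicalSpace E] [MeasurableSpace E] [MeasurableSpace Ξ]

/-- `ψ` is the derivative of the continuous function `φ` along the flow, on `K`. -/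
structure JumpFlow.IsTest (F : JumpFlow ι E Ξ) (K : Set E) (φ ψ : E → ℝ) : Prop where
  continuous : Continuous φ
  continuous_deriv : Continuous ψ
  hasDerivAt : ∀ z ∈ K, HasDerivAt (fun t => φ (F.flow t z)) (ψ z) 0

variable {F : JumpFlow ι E Ξ} {K : Set E} {φ ψ : E → ℝ}

theorem JumpFlow.IsTest.hasDerivAt_flow (hφ : F.IsTest K φ ψ) (hK : F.IsInvariant K) {z : E}
    (hz : z ∈ K) (t : ℝ) : HasDerivAt (fun t => φ (F.flow t z)) (ψ (F.flow t z)) t := by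
  have h := hφ.hasDerivAt _ (hK.flow t z hz)
  have h2 := HasDerivAt.comp_sub_const (f := fun u => φ (F.flow u (F.flow t z))) t t
    (by simpa using h)
  refine h2.congr_of_eventuallyEq (Eventually.of_forall fun u => ?_)
  simp only [← F.flow_add, sub_add_cancel]

/-- The fundamental theorem of calculus along the flow that starts from `z` at the time `t₀`. -/
theorem JumpFlow.IsTest.integral_flow (hφ : F.IsTest K φ ψ) (hK : F.IsInvariant K) {z : E}
    (hz : z ∈ K) (a t₀ s : ℝ) :
    IntervalIntegrable (fun u => Real.exp (a * u) *
      (a * φ (F.flow (u - t₀) z) + ψ (F.flow (u - t₀) z))) volume t₀ s ∧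
    ∫ u in t₀..s, Real.exp (a * u) * (a * φ (F.flow (u - t₀) z) + ψ (F.flow (u - t₀) z)) =
      Real.exp (a * s) * φ (F.flow (s - t₀) z) - Real.exp (a * t₀) * φ z := by
  have hc : Continuous fun u => F.flow (u - t₀) z :=
    F.continuous_flow.comp (by fun_prop : Continuous fun u : ℝ => (u - t₀, z))
  have hcont : Continuous fun u => Real.exp (a * u) *
      (a * φ (F.flow (u - t₀) z) + ψ (F.flow (u - t₀) z)) := by
    have h1 := hφ.continuous.comp hc
    have h2 := hφ.continuous_deriv.comp hc
    exact (Real.continuous_exp.comp (continuous_const.mul continuous_id)).mul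
      ((continuous_const.mul h1).add h2)
  refine ⟨hcont.intervalIntegrable _ _, ?_⟩
  rw [intervalIntegral.integral_eq_sub_of_hasDerivAt
    (f := fun u => Real.exp (a * u) * φ (F.flow (u - t₀) z)) ?_ (hcont.intervalIntegrable _ _)]
  · simp [F.flow_zero]
  · intro u _
    have h1 := HasDerivAt.comp_sub_const (f := fun u => φ (F.flow u z)) u t₀
      (hφ.hasDerivAt_flow hK hz (u - t₀))
    have h2 : HasDerivAt (fun u => Real.exp (a * u)) (Real.exp (a * u) * a) u := by
      simpa using ((hasDerivAt_id u).const_mul a).exp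
    have h3 := h2.mul h1
    rw [show Real.exp (a * u) * (a * φ (F.flow (u - t₀) z) + ψ (F.flow (u - t₀) z)) =
      Real.exp (a * u) * a * φ (F.flow (u - t₀) z) + Real.exp (a * u) * ψ (F.flow (u - t₀) z) by
        ring]
    exact h3

variable [DecidableEq ι]

/-- The sum of `h k c` over the events listed by the word, `c` being the number of earlier events of
the clock `k`. -/
def wordSum (h : ι → ℕ → ℝ) : List ι → ℝ
  | [] => 0
  | k :: w => h k (w.count k) + wordSum h w

theorem wordSum_eq [Fintype ι] (h : ι → ℕ → ℝ) (w : List ι) :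
    wordSum h w = ∑ k, ∑ c ∈ Finset.range (w.count k), h k c := by
  induction w with
  | nil => simp [wordSum]
  | cons k w ih =>
    rw [wordSum, ih, ← Finset.add_sum_erase _ _ (Finset.mem_univ k),
      ← Finset.add_sum_erase _ _ (Finset.mem_univ k), List.count_cons_self,
      Finset.sum_range_succ_comm, add_assoc]
    congr 2
    refine Finset.sum_congr rfl fun k' hk' => ?_
    rw [List.count_cons_of_ne (Finset.ne_of_mem_erase hk').symm]

variable [Countable ι] {D : ι → ℕ → ℝ × Ξ}

/-- The jump of `exp (a t) φ` at the `c`-th arrival of the clock `k`. -/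
noncomputable def jumpTerm (F : JumpFlow ι E Ξ) (φ : E → ℝ) (a : ℝ) (D : ι → ℕ → ℝ × Ξ) (k : ι)
    (c : ℕ) : ℝ :=
  Real.exp (a * arr D k c) * (φ (F.jump k (F.leftState (arr D k c) D) (D k c).2)
    - φ (F.leftState (arr D k c) D))

/-- Change of variables along a trajectory, by induction on the word: the flow accounts for the
integral, and the events for the sum. -/
theorem JumpFlow.IsTest.exp_mul_stateAt (hφ : F.IsTest K φ ψ) (hK : F.IsInvariant K)
    (hD : GoodClocks D) (a : ℝ) : ∀ {w : List ι} {s : ℝ}, IsHistory D w s →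
    IntervalIntegrable (fun u => Real.exp (a * u) *
      (a * φ (F.leftState u D) + ψ (F.leftState u D))) volume 0 s ∧
    Real.exp (a * s) * φ (F.stateAt D w s) = φ F.init +
      (∫ u in (0 : ℝ)..s, Real.exp (a * u) * (a * φ (F.leftState u D) + ψ (F.leftState u D))) +
      wordSum (jumpTerm F φ a D) w := by
  -- the part of the trajectory that follows the latest event
  have piece : ∀ {w : List ι} {s : ℝ}, IsHistory D w s →
      IntervalIntegrable (fun u => Real.exp (a * u) *
        (a * φ (F.leftState u D) + ψ (F.leftState u D))) volume (wordTime D w) s ∧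
      ∫ u in (wordTime D w)..s, Real.exp (a * u) *
        (a * φ (F.leftState u D) + ψ (F.leftState u D)) =
        Real.exp (a * s) * φ (F.stateAt D w s)
          - Real.exp (a * wordTime D w) * φ (F.wordState D w) := fun {w s} h => by
    obtain ⟨h1, h2⟩ := hφ.integral_flow hK (hK.wordState_mem D w) a (wordTime D w) s
    have heq : Set.EqOn (fun u => Real.exp (a * u) *
        (a * φ (F.flow (u - wordTime D w) (F.wordState D w))
          + ψ (F.flow (u - wordTime D w) (F.wordState D w))))
        (fun u => Real.exp (a * u) * (a * φ (F.leftState u D) + ψ (F.leftState u D)))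
        (Set.uIoc (wordTime D w) s) := fun u hu => by
      rw [Set.uIoc_of_le h.time_lt.le] at hu
      simp only [leftState_eq hD (h.of_le hu.1 hu.2), JumpFlow.stateAt]
    refine ⟨h1.congr heq, ?_⟩
    rw [← intervalIntegral.integral_congr_ae (Eventually.of_forall heq), h2]
    rfl
  intro w
  induction w with
  | nil =>
    intro s h
    obtain ⟨h1, h2⟩ := piece h
    refine ⟨h1, ?_⟩
    simp only [wordTime] at h2
    rw [h2]
    simp [wordSum, wordState]
  | cons k w ih =>
    intro s h
    obtain ⟨h1, h2⟩ := piece h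
    obtain ⟨h3, h4⟩ := ih h.tail
    refine ⟨h3.trans h1, ?_⟩
    rw [← intervalIntegral.integral_add_adjacent_intervals h3 h1, h2, wordSum]
    have hl : F.leftState (arr D k (w.count k)) D = F.stateAt D w (wordTime D (k :: w)) :=
      leftState_eq hD h.tail
    rw [jumpTerm, hl, F.wordState_cons]
    have ht : arr D k (w.count k) = wordTime D (k :: w) := rfl
    rw [ht]
    linarith

/-- Change of variables along a trajectory: `exp (a t) φ` changes by its derivative along the flow
and by its jumps at the events. -/
theorem JumpFlow.IsTest.exp_mul_leftState [Fintype ι] (hφ : F.IsTest K φ ψ) (hK : F.IsInvariant K)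
    (hD : GoodClocks D) (a : ℝ) {s : ℝ} (hs : 0 < s) (hne : ∀ k c, arr D k c ≠ s) :
    Real.exp (a * s) * φ (F.leftState s D) = φ F.init +
      (∫ u in (0 : ℝ)..s, Real.exp (a * u) * (a * φ (F.leftState u D) + ψ (F.leftState u D))) +
      ∑ k, ∑' c, {c | arr D k c ≤ s}.indicator (jumpTerm F φ a D k) c := by
  obtain ⟨w, hw⟩ := hD.exists_history hs
  rw [leftState_eq hD hw, (hφ.exp_mul_stateAt hK hD a hw).2, wordSum_eq]
  congr 1
  refine Finset.sum_congr rfl fun k _ => ?_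
  have hiff : ∀ c, c ∈ Finset.range (w.count k) ↔ arr D k c ≤ s := fun c => by
    rw [Finset.mem_range, hD.lt_count_iff hw, lt_iff_le_and_ne]
    exact and_iff_left (hne k c)
  rw [tsum_eq_sum (s := Finset.range (w.count k))]
  · refine Finset.sum_congr rfl fun c hc => ?_
    rw [Set.indicator_of_mem]
    exact (hiff c).1 hc
  · intro c hc
    rw [Set.indicator_of_notMem]
    exact fun h => hc ((hiff c).2 h)

end Path

/-! ### The expectation of a function of the state -/

section Dynkin

variable {Ω ι E Ξ : Type*} [MeasurableSpace Ω] [MeasurableSpace Ξ] [DecidableEq ι] [Fintype ι]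
  [TopologicalSpace E] [MeasurableSpace E] [SecondCountableTopology E] [BorelSpace E]
  {P : Measure Ω} [IsProbabilityMeasure P] {r : ι → ℝ} {Q : ι → Measure Ξ}
  [∀ k, IsProbabilityMeasure (Q k)] {D : Ω → ι → ℕ → ℝ × Ξ} {F : JumpFlow ι E Ξ} {K : Set E}
  {φ ψ : E → ℝ}

/-- The generator of the dynamic, for a function `φ` with derivative `ψ` along the flow. -/
noncomputable def JumpFlow.gen (F : JumpFlow ι E Ξ) (r : ι → ℝ) (Q : ι → Measure Ξ) (φ ψ : E → ℝ)
    (z : E) : ℝ :=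
  ψ z + ∑ k, r k * ∫ ξ, (φ (F.jump k z ξ) - φ z) ∂(Q k)

/-- Product of the Lebesgue measure on `(0, T]` and of the probability. -/
noncomputable abbrev timeProd (P : Measure Ω) (T : ℝ) : Measure (ℝ × Ω) :=
  (volume.restrict (Set.Ioc 0 T)).prod P

omit [Fintype ι] [IsProbabilityMeasure P] [∀ k, IsProbabilityMeasure (Q k)] in
theorem IsClockData.measurable_leftState [Countable ι] (h : IsClockData P r Q D) :
    Measurable fun x : ℝ × Ω => F.leftState x.1 (D x.2) :=
  F.measurable_leftState.comp (measurable_fst.prodMk (h.measurable.comp measurable_snd))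

omit [Fintype ι] in
/-- Compensation formula, up to the time `T`, for a signed function of the state and the mark. -/
theorem IsClockData.integral_tsum_leftState [Countable ι] (h : IsClockData P r Q D)
    (hr : ∀ k, 0 < r k) (k : ι) (T : ℝ) {H : ℝ × E × Ξ → ℝ} (hH : Measurable H)
    (hint : Integrable (fun x : (ℝ × Ω) × Ξ => H (x.1.1, F.leftState x.1.1 (D x.1.2), x.2))
      ((timeProd P T).prod (Q k))) :
    Integrable (fun ω => ∑' c, {c | arr (D ω) k c ≤ T}.indicator
      (fun c => H (arr (D ω) k c, F.leftState (arr (D ω) k c) (D ω), (D ω k c).2)) c) P ∧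
    ∫ ω, ∑' c, {c | arr (D ω) k c ≤ T}.indicator
      (fun c => H (arr (D ω) k c, F.leftState (arr (D ω) k c) (D ω), (D ω k c).2)) c ∂P =
      r k * ∫ x : (ℝ × Ω) × Ξ, H (x.1.1, F.leftState x.1.1 (D x.1.2), x.2)
        ∂((timeProd P T).prod (Q k)) := by
  set N : ℕ × Ω → ℝ × E × Ξ := fun x =>
    (arr (D x.2) k x.1, F.leftState (arr (D x.2) k x.1) (D x.2), (D x.2 k x.1).2) with hN
  have hNm : Measurable N := by
    refine measurable_from_prod_countable_right fun c => ?_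
    have ha : Measurable fun ω => arr (D ω) k c := (measurable_arr k c).comp h.measurable
    exact ha.prodMk ((F.measurable_leftState.comp (ha.prodMk h.measurable)).prodMk
      (measurable_snd.comp (h.measurable_apply k c)))
  set Θ : (ℝ × Ω) × Ξ → ℝ × E × Ξ := fun x => (x.1.1, F.leftState x.1.1 (D x.1.2), x.2) with hΘ
  have hΘm : Measurable Θ :=
    (measurable_fst.comp measurable_fst).prodMk
      ((h.measurable_leftState.comp measurable_fst).prodMk measurable_snd)
  set S : Set (ℝ × E × Ξ) := {y | y.1 ≤ T} with hS
  have hSm : MeasurableSet S := measurableSet_le measurable_fst measurable_const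
  -- the law of the jumps, as a measure on times, states and marks
  have hmap : (((Measure.count : Measure ℕ).prod P).map N).restrict S = ENNReal.ofReal (r k) •
      ((timeProd P T).prod (Q k)).map Θ := by
    refine Measure.ext_of_lintegral _ fun f hf => ?_
    rw [← lintegral_indicator hSm, lintegral_map (hf.indicator hSm) hNm, lintegral_smul_measure,
      lintegral_map hf hΘm, lintegral_prod_symm' (fun x => S.indicator f (N x))
        ((hf.indicator hSm).comp hNm)]
    simp only [lintegral_count]
    have key := h.lintegral_tsum_leftState F hr k (hf.indicator hSm)
    simp only [hN, hΘ, smul_eq_mul]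
    rw [key]
    congr 1
    have hf' : Measurable fun x : (ℝ × Ω) × Ξ => f (x.1.1, F.leftState x.1.1 (D x.1.2), x.2) :=
      hf.comp hΘm
    have hf'' : Measurable fun x : ℝ × Ω => ∫⁻ ξ, f (x.1, F.leftState x.1 (D x.2), ξ) ∂(Q k) :=
      hf'.lintegral_prod_right'
    rw [lintegral_prod _ hf'.aemeasurable, lintegral_prod_symm' _ hf'']
    refine lintegral_congr fun ω => ?_
    rw [← Set.Ioi_inter_Iic, Set.inter_comm, ← Measure.restrict_restrict measurableSet_Iic,
      ← lintegral_indicator measurableSet_Iic]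
    refine lintegral_congr fun s => ?_
    by_cases hs : s ≤ T
    · simp [hS, hs]
    · simp [hS, hs]
  have hI : Integrable (fun x => S.indicator H (N x)) ((Measure.count : Measure ℕ).prod P) := by
    have hHS := (hH.indicator hSm).aestronglyMeasurable
      (μ := ((Measure.count : Measure ℕ).prod P).map N)
    refine (integrable_map_measure hHS hNm.aemeasurable).1 ?_
    rw [integrable_indicator_iff hSm, IntegrableOn, hmap]
    refine Integrable.smul_measure ?_ ENNReal.ofReal_ne_top
    exact (integrable_map_measure hH.aestronglyMeasurable hΘm.aemeasurable).2 hint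
  have htsum : ∀ᵐ ω ∂P, ∫ c, S.indicator H (N (c, ω)) ∂(Measure.count : Measure ℕ) =
      ∑' c, {c | arr (D ω) k c ≤ T}.indicator
      (fun c => H (arr (D ω) k c, F.leftState (arr (D ω) k c) (D ω), (D ω k c).2)) c := by
    filter_upwards [hI.prod_left_ae] with ω hω
    rw [integral_countable hω]
    refine tsum_congr fun c => ?_
    simp [hN, hS, Measure.real, Set.indicator_apply]
  refine ⟨(hI.integral_prod_right).congr htsum, ?_⟩
  rw [← integral_congr_ae htsum, ← integral_prod_symm _ hI]
  have := integral_map hNm.aemeasurable ((hH.indicator hSm).aestronglyMeasurable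
    (μ := ((Measure.count : Measure ℕ).prod P).map N))
  rw [← this, integral_indicator hSm, hmap, integral_smul_measure,
    integral_map hΘm.aemeasurable hH.aestronglyMeasurable,
    ENNReal.toReal_ofReal (hr k).le, smul_eq_mul]

/-- Dynkin's formula, for `exp (a t) φ`, when the function, its derivative along the flow and the
mean size of its jumps are dominated by a function `V` with integrable values along the
trajectory. -/
theorem JumpFlow.IsTest.integral_leftState (hφ : F.IsTest K φ ψ) (hK : F.IsInvariant K)
    (h : IsClockData P r Q D) (hr : ∀ k, 0 < r k) (a : ℝ) {T : ℝ} (hT : 0 < T) {V : E → ℝ}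
    (hφV : ∀ z ∈ K, |φ z| ≤ V z) (hψV : ∀ z ∈ K, |ψ z| ≤ V z)
    (hJ : ∀ k, ∀ z ∈ K, Integrable (fun ξ => φ (F.jump k z ξ)) (Q k))
    (hJV : ∀ k, ∀ z ∈ K, ∫ ξ, |φ (F.jump k z ξ) - φ z| ∂(Q k) ≤ V z)
    (hint : Integrable (fun x : ℝ × Ω => V (F.leftState x.1 (D x.2))) (timeProd P T)) :
    Integrable (fun ω => φ (F.leftState T (D ω))) P ∧
    Integrable (fun x : ℝ × Ω => Real.exp (a * x.1) * (a * φ (F.leftState x.1 (D x.2)) +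
      F.gen r Q φ ψ (F.leftState x.1 (D x.2)))) (timeProd P T) ∧
    Real.exp (a * T) * ∫ ω, φ (F.leftState T (D ω)) ∂P = φ F.init +
      ∫ x : ℝ × Ω, Real.exp (a * x.1) * (a * φ (F.leftState x.1 (D x.2)) +
        F.gen r Q φ ψ (F.leftState x.1 (D x.2))) ∂(timeProd P T) := by
  have hX : Measurable fun x : ℝ × Ω => F.leftState x.1 (D x.2) := h.measurable_leftState
  have hXK : ∀ x : ℝ × Ω, F.leftState x.1 (D x.2) ∈ K := fun x => hK.leftState_mem _ _
  have hVnn : ∀ z ∈ K, 0 ≤ V z := fun z hz => (abs_nonneg _).trans (hφV z hz)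
  have hexp : ∀ s ∈ Set.Ioc 0 T, Real.exp (a * s) ≤ Real.exp (|a| * T) := fun s hs => by
    refine Real.exp_le_exp.2 ((mul_le_mul_of_nonneg_right (le_abs_self a) hs.1.le).trans ?_)
    exact mul_le_mul_of_nonneg_left hs.2 (abs_nonneg a)
  have hmem : ∀ᵐ x ∂(timeProd P T), x.1 ∈ Set.Ioc 0 T :=
    Measure.quasiMeasurePreserving_fst.ae (ae_restrict_mem measurableSet_Ioc)
  -- the part that comes from the flow
  have hflow : Integrable (fun x : ℝ × Ω => Real.exp (a * x.1) *
      (a * φ (F.leftState x.1 (D x.2)) + ψ (F.leftState x.1 (D x.2)))) (timeProd P T) := by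
    refine (hint.const_mul (Real.exp (|a| * T) * (|a| + 1))).mono' ?_ ?_
    · have h1 := hφ.continuous.measurable.comp hX
      have h2 := hφ.continuous_deriv.measurable.comp hX
      exact ((Real.measurable_exp.comp (measurable_const.mul measurable_fst)).mul
        ((measurable_const.mul h1).add h2)).aestronglyMeasurable
    · filter_upwards [hmem] with x hx
      have h1 := hφV _ (hXK x)
      have h2 := hψV _ (hXK x)
      rw [norm_mul, Real.norm_of_nonneg (Real.exp_nonneg _), mul_assoc]
      refine mul_le_mul (hexp _ hx) ?_ (norm_nonneg _) (Real.exp_nonneg _)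
      calc |a * φ (F.leftState x.1 (D x.2)) + ψ (F.leftState x.1 (D x.2))|
          ≤ |a| * |φ (F.leftState x.1 (D x.2))| + |ψ (F.leftState x.1 (D x.2))| := by
            rw [← abs_mul]; exact abs_add_le _ _
        _ ≤ |a| * V (F.leftState x.1 (D x.2)) + V (F.leftState x.1 (D x.2)) := by gcongr
        _ = _ := by ring
  -- the part that comes from the jumps
  set H : ι → ℝ × E × Ξ → ℝ := fun k y => Real.exp (a * y.1) *
    (φ (F.jump k y.2.1 y.2.2) - φ y.2.1) with hH
  have hjm : ∀ k, Measurable fun y : E × Ξ => φ (F.jump k y.1 y.2) - φ y.1 := fun k =>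
    (hφ.continuous.measurable.comp (F.measurable_jump k)).sub
      (hφ.continuous.measurable.comp measurable_fst)
  have hem : Measurable fun y : ℝ => Real.exp (a * y) :=
    Real.measurable_exp.comp (measurable_const.mul measurable_id)
  have hHm : ∀ k, Measurable (H k) := fun k =>
    (hem.comp measurable_fst).mul ((hjm k).comp measurable_snd)
  set j : ι → E → ℝ := fun k z => ∫ ξ, (φ (F.jump k z ξ) - φ z) ∂(Q k) with hj
  have hjmeas : ∀ k, Measurable (j k) := fun k =>
    ((hjm k).stronglyMeasurable.integral_prod_right (ν := Q k)).measurable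
  have hjint : ∀ k, Integrable (fun x : ℝ × Ω => Real.exp (a * x.1) *
      j k (F.leftState x.1 (D x.2))) (timeProd P T) := fun k => by
    refine (hint.const_mul (Real.exp (|a| * T))).mono' ?_ ?_
    · exact ((hem.comp measurable_fst).mul ((hjmeas k).comp hX)).aestronglyMeasurable
    · filter_upwards [hmem] with x hx
      rw [norm_mul, Real.norm_of_nonneg (Real.exp_nonneg _)]
      refine mul_le_mul (hexp _ hx) ?_ (norm_nonneg _) (Real.exp_nonneg _)
      exact (norm_integral_le_integral_norm _).trans (hJV k _ (hXK x))
  have hHint : ∀ k, Integrable (fun x : (ℝ × Ω) × Ξ =>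
      H k (x.1.1, F.leftState x.1.1 (D x.1.2), x.2)) ((timeProd P T).prod (Q k)) := fun k => by
    have hm : Measurable fun x : (ℝ × Ω) × Ξ => H k (x.1.1, F.leftState x.1.1 (D x.1.2), x.2) :=
      (hHm k).comp ((measurable_fst.comp measurable_fst).prodMk
        ((hX.comp measurable_fst).prodMk measurable_snd))
    refine (integrable_prod_iff hm.aestronglyMeasurable).2 ⟨Eventually.of_forall fun x => ?_, ?_⟩
    · exact ((hJ k _ (hXK x)).sub (integrable_const (φ (F.leftState x.1 (D x.2))))).const_mul
        (Real.exp (a * x.1))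
    · refine (hint.const_mul (Real.exp (|a| * T))).mono'
        (hm.norm.stronglyMeasurable.integral_prod_right (ν := Q k)).aestronglyMeasurable ?_
      filter_upwards [hmem] with x hx
      simp only [hH, norm_mul, Real.norm_of_nonneg (Real.exp_nonneg _)]
      rw [integral_const_mul, Real.norm_of_nonneg (by positivity)]
      exact mul_le_mul (hexp _ hx) (hJV k _ (hXK x)) (by positivity) (Real.exp_nonneg _)
  have hHval : ∀ k, ∫ x : (ℝ × Ω) × Ξ, H k (x.1.1, F.leftState x.1.1 (D x.1.2), x.2)
      ∂((timeProd P T).prod (Q k)) =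
      ∫ x, Real.exp (a * x.1) * j k (F.leftState x.1 (D x.2)) ∂(timeProd P T) := fun k => by
    rw [integral_prod _ (hHint k)]
    simp only [hH, hj, integral_const_mul]
  have hcomp := fun k => h.integral_tsum_leftState hr k T (hHm k) (hHint k)
  have hG : ∀ x : ℝ × Ω, Real.exp (a * x.1) * (a * φ (F.leftState x.1 (D x.2)) +
      F.gen r Q φ ψ (F.leftState x.1 (D x.2))) = Real.exp (a * x.1) *
      (a * φ (F.leftState x.1 (D x.2)) + ψ (F.leftState x.1 (D x.2))) +
      ∑ k, r k * (Real.exp (a * x.1) * j k (F.leftState x.1 (D x.2))) := fun x => by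
    simp only [JumpFlow.gen, hj]
    rw [← add_assoc, mul_add, Finset.mul_sum]
    congr 1
    exact Finset.sum_congr rfl fun k _ => by ring
  have hsumint : Integrable (fun x : ℝ × Ω => ∑ k, r k * (Real.exp (a * x.1) *
      j k (F.leftState x.1 (D x.2)))) (timeProd P T) :=
    integrable_finsetSum _ fun k _ => (hjint k).const_mul _
  simp_rw [hG]
  have hflow' := hflow.integral_prod_right
  have hjumps : Integrable (fun ω => ∑ k, ∑' c, {c | arr (D ω) k c ≤ T}.indicator
      (fun c => H k (arr (D ω) k c, F.leftState (arr (D ω) k c) (D ω), (D ω k c).2)) c) P :=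
    integrable_finsetSum _ fun k _ => (hcomp k).1
  have hae : ∀ᵐ ω ∂P, φ F.init + (∫ s in Set.Ioc 0 T, Real.exp (a * s) *
      (a * φ (F.leftState s (D ω)) + ψ (F.leftState s (D ω)))) +
      ∑ k, ∑' c, {c | arr (D ω) k c ≤ T}.indicator
      (fun c => H k (arr (D ω) k c, F.leftState (arr (D ω) k c) (D ω), (D ω k c).2)) c =
      Real.exp (a * T) * φ (F.leftState T (D ω)) := by
    filter_upwards [h.ae_goodClocks hr, h.ae_arr_ne_const hr T] with ω hω hne
    rw [hφ.exp_mul_leftState hK hω a hT hne, intervalIntegral.integral_of_le hT.le]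
    rfl
  have hall := ((integrable_const (μ := P) (φ F.init)).add hflow').add hjumps
  have hend : Integrable (fun ω => φ (F.leftState T (D ω))) P := by
    have h1 := (hall.congr hae).const_mul (Real.exp (a * T))⁻¹
    refine h1.congr (Eventually.of_forall fun ω => ?_)
    simp only
    rw [inv_mul_cancel_left₀ (Real.exp_ne_zero _)]
  refine ⟨hend, hflow.add hsumint, ?_⟩
  rw [integral_add hflow hsumint, integral_finsetSum _ fun k _ => (hjint k).const_mul _]
  simp_rw [integral_const_mul, ← hHval, ← (hcomp _).2]
  rw [integral_prod_symm _ hflow, ← integral_const_mul,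
    ← integral_finsetSum _ fun k _ => (hcomp k).1, ← add_assoc, ← integral_congr_ae hae]
  have h1 := integral_add ((integrable_const (μ := P) (φ F.init)).add hflow') hjumps
  have h2 := integral_add (integrable_const (μ := P) (φ F.init)) hflow'
  simp only [Pi.add_apply] at h1
  rw [h1, h2]
  simp

end Dynkin

/-! ### Functions dominated by a weight -/

section Weight

variable {Ω ι E Ξ : Type*} [MeasurableSpace Ω] [MeasurableSpace Ξ] [DecidableEq ι] [Fintype ι]
  [TopologicalSpace E] [MeasurableSpace E] [SecondCountableTopology E] [BorelSpace E]
  {P : Measure Ω} [IsProbabilityMeasure P] {r : ι → ℝ} {Q : ι → Measure Ξ}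
  [∀ k, IsProbabilityMeasure (Q k)] {D : Ω → ι → ℕ → ℝ × Ξ} {F : JumpFlow ι E Ξ} {K : Set E}
  {v v' φ ψ : E → ℝ} {C : ℝ}

/-- `v`, with derivative `v'` along the flow, is a nonnegative weight that the flow and the jumps
increase by a factor at most, on average. -/
structure JumpFlow.IsWeight (F : JumpFlow ι E Ξ) (K : Set E) (Q : ι → Measure Ξ) (v v' : E → ℝ)
    (C : ℝ) : Prop where
  test : F.IsTest K v v'
  nonneg : ∀ z, 0 ≤ v z
  const_nonneg : 0 ≤ C
  flow_le : ∀ z ∈ K, |v' z| ≤ C * v z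
  integrable : ∀ k, ∀ z ∈ K, Integrable (fun ξ => v (F.jump k z ξ)) (Q k)
  jump_le : ∀ k, ∀ z ∈ K, ∫ ξ, v (F.jump k z ξ) ∂(Q k) ≤ C * v z

omit [MeasurableSpace Ω] [DecidableEq ι] [Fintype ι] [SecondCountableTopology E]
  [∀ k, IsProbabilityMeasure (Q k)] in
theorem JumpFlow.measurable_comp_jump (hφ : Continuous φ) (k : ι) (z : E) :
    Measurable fun ξ => φ (F.jump k z ξ) :=
  hφ.measurable.comp ((F.measurable_jump k).comp measurable_prodMk_left)

/-- The bounded functions `v / (1 + ε v)` of the state grow at most exponentially on average, at a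
rate that does not depend on `ε`. -/
theorem JumpFlow.IsWeight.integral_truncation_le (hv : F.IsWeight K Q v v' C)
    (hK : F.IsInvariant K) (h : IsClockData P r Q D) (hr : ∀ k, 0 < r k) {T : ℝ} (hT : 0 < T)
    {ε : ℝ} (hε : 0 < ε) :
    Integrable (fun ω => v (F.leftState T (D ω)) / (1 + ε * v (F.leftState T (D ω)))) P ∧
    ∫ ω, v (F.leftState T (D ω)) / (1 + ε * v (F.leftState T (D ω))) ∂P ≤
      Real.exp ((C + ∑ k, r k * C) * T) * v F.init := by
  set A := C + ∑ k, r k * C with hA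
  set φ : E → ℝ := fun z => v z / (1 + ε * v z) with hφdef
  set ψ : E → ℝ := fun z => v' z / (1 + ε * v z) ^ 2 with hψdef
  have hden : ∀ z, 1 ≤ 1 + ε * v z := fun z => by nlinarith [hv.nonneg z]
  have hden0 : ∀ z, 0 < 1 + ε * v z := fun z => by linarith [hden z]
  have hφnn : ∀ z, 0 ≤ φ z := fun z => div_nonneg (hv.nonneg z) (hden0 z).le
  have hφle : ∀ z, φ z ≤ ε⁻¹ := fun z => by
    rw [hφdef, div_le_iff₀ (hden0 z), mul_add, inv_mul_cancel_left₀ hε.ne']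
    linarith [inv_pos.2 hε]
  have hφv : ∀ z, φ z ≤ v z := fun z => div_le_self (hv.nonneg z) (hden z)
  have hψφ : ∀ z ∈ K, |ψ z| ≤ C * φ z := fun z hz => by
    rw [hψdef, hφdef]
    simp only
    rw [abs_div, abs_of_pos (pow_pos (hden0 z) 2), ← mul_div_assoc, div_le_div_iff₀
      (pow_pos (hden0 z) 2) (hden0 z)]
    have h1 := hv.flow_le z hz
    have h2 : 0 ≤ C * v z := mul_nonneg hv.const_nonneg (hv.nonneg z)
    calc |v' z| * (1 + ε * v z) ≤ C * v z * (1 + ε * v z) :=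
          mul_le_mul_of_nonneg_right h1 (hden0 z).le
      _ ≤ C * v z * (1 + ε * v z) ^ 2 := by
          refine mul_le_mul_of_nonneg_left ?_ h2
          nlinarith [hden z]
  have hφc : Continuous φ := hv.test.continuous.div (by
    exact continuous_const.add (continuous_const.mul hv.test.continuous)) fun z => (hden0 z).ne'
  have htest : F.IsTest K φ ψ := by
    refine ⟨hφc, hv.test.continuous_deriv.div ?_ fun z => (pow_pos (hden0 z) 2).ne', fun z hz => ?_⟩
    · exact (continuous_const.add (continuous_const.mul hv.test.continuous)).pow 2
    · have h1 := hv.test.hasDerivAt z hz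
      have h2 := h1.div ((h1.const_mul ε).const_add 1) (hden0 (F.flow 0 z)).ne'
      simp only [F.flow_zero] at h2
      rw [show ψ z = (v' z * (1 + ε * v z) - v z * (ε * v' z)) / (1 + ε * v z) ^ 2 by
        rw [hψdef]; simp only; congr 1; ring]
      exact h2
  have hjint : ∀ k z, Integrable (fun ξ => φ (F.jump k z ξ)) (Q k) := fun k z =>
    Integrable.of_bound (JumpFlow.measurable_comp_jump hφc k z).aestronglyMeasurable ε⁻¹
      (Eventually.of_forall fun ξ => by rw [Real.norm_of_nonneg (hφnn _)]; exact hφle _)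
  have hjabs : ∀ k z ξ, |φ (F.jump k z ξ) - φ z| ≤ ε⁻¹ := fun k z ξ => by
    rw [abs_le]
    constructor <;> linarith [hφnn z, hφle z, hφnn (F.jump k z ξ), hφle (F.jump k z ξ)]
  have hCε : 0 ≤ C * ε⁻¹ := mul_nonneg hv.const_nonneg (inv_pos.2 hε).le
  obtain ⟨h1, h2, h3⟩ := htest.integral_leftState hK h hr (-A) hT (V := fun _ => ε⁻¹ + C * ε⁻¹)
    (fun z _ => by rw [abs_of_nonneg (hφnn z)]; linarith [hφle z])
    (fun z hz => (hψφ z hz).trans (by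
      linarith [mul_le_mul_of_nonneg_left (hφle z) hv.const_nonneg, inv_pos.2 hε]))
    (fun k z _ => hjint k z)
    (fun k z _ => by
      have := integral_mono_of_nonneg (μ := Q k) (Eventually.of_forall fun ξ => abs_nonneg _)
        (integrable_const ε⁻¹) (Eventually.of_forall fun ξ => hjabs k z ξ)
      simp only [integral_const, probReal_univ, one_smul] at this
      linarith) (integrable_const _)
  refine ⟨h1, ?_⟩
  -- the truncation inherits the growth bounds of `v`, since `φ y - φ z ≤ v y / (1 + ε v z)`
  have hgen : ∀ z ∈ K, -A * φ z + F.gen r Q φ ψ z ≤ 0 := fun z hz => by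
    have hj : ∀ k, ∫ ξ, (φ (F.jump k z ξ) - φ z) ∂(Q k) ≤ C * φ z := fun k => by
      have hle : ∀ ξ, φ (F.jump k z ξ) - φ z ≤ v (F.jump k z ξ) / (1 + ε * v z) := fun ξ => by
        set y := F.jump k z ξ
        have : φ y - φ z = (v y - v z) / (1 + ε * v y) / (1 + ε * v z) := by
          rw [hφdef]
          simp only
          rw [div_sub_div _ _ (hden0 y).ne' (hden0 z).ne', div_div]
          congr 1
          ring
        rw [this]
        refine div_le_div_of_nonneg_right ?_ (hden0 z).le
        rw [div_le_iff₀ (hden0 y)]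
        nlinarith [hv.nonneg y, hv.nonneg z, mul_nonneg hε.le (mul_self_nonneg (v y))]
      calc ∫ ξ, (φ (F.jump k z ξ) - φ z) ∂(Q k)
          ≤ ∫ ξ, v (F.jump k z ξ) / (1 + ε * v z) ∂(Q k) :=
            integral_mono ((hjint k z).sub (integrable_const _))
              ((hv.integrable k z hz).div_const _) hle
        _ = (∫ ξ, v (F.jump k z ξ) ∂(Q k)) / (1 + ε * v z) := integral_div _ _
        _ ≤ C * v z / (1 + ε * v z) :=
            div_le_div_of_nonneg_right (hv.jump_le k z hz) (hden0 z).le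
        _ = C * φ z := mul_div_assoc _ _ _
    have hs : ∑ k, r k * ∫ ξ, (φ (F.jump k z ξ) - φ z) ∂(Q k) ≤ ∑ k, r k * (C * φ z) :=
      Finset.sum_le_sum fun k _ => mul_le_mul_of_nonneg_left (hj k) (hr k).le
    have hs2 : ∑ k, r k * (C * φ z) = (∑ k, r k * C) * φ z := by
      rw [Finset.sum_mul]
      exact Finset.sum_congr rfl fun k _ => by ring
    have := (le_abs_self _).trans (hψφ z hz)
    unfold JumpFlow.gen
    rw [hA]
    linarith
  have hneg : ∫ x : ℝ × Ω, Real.exp (-A * x.1) * (-A * φ (F.leftState x.1 (D x.2)) +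
      F.gen r Q φ ψ (F.leftState x.1 (D x.2))) ∂(timeProd P T) ≤ 0 :=
    integral_nonpos fun x => mul_nonpos_of_nonneg_of_nonpos (Real.exp_nonneg _)
      (hgen _ (hK.leftState_mem _ _))
  have h4 : Real.exp (-A * T) * ∫ ω, φ (F.leftState T (D ω)) ∂P ≤ v F.init := by
    linarith [hφv F.init]
  calc ∫ ω, φ (F.leftState T (D ω)) ∂P
      = Real.exp (A * T) * (Real.exp (-A * T) * ∫ ω, φ (F.leftState T (D ω)) ∂P) := by
        rw [← mul_assoc, ← Real.exp_add]; simp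
    _ ≤ _ := mul_le_mul_of_nonneg_left h4 (Real.exp_nonneg _)

/-- The weight of the state has a finite expectation, which grows at most exponentially: let
`ε → 0` in the bound of the truncations, with Fatou's lemma. -/
theorem JumpFlow.IsWeight.integral_le (hv : F.IsWeight K Q v v' C) (hK : F.IsInvariant K)
    (h : IsClockData P r Q D) (hr : ∀ k, 0 < r k) {T : ℝ} (hT : 0 < T) :
    Integrable (fun ω => v (F.leftState T (D ω))) P ∧
    ∫ ω, v (F.leftState T (D ω)) ∂P ≤ Real.exp ((C + ∑ k, r k * C) * T) * v F.init := by
  set B := Real.exp ((C + ∑ k, r k * C) * T) * v F.init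
  set X : Ω → E := fun ω => F.leftState T (D ω)
  have hX : Measurable X :=
    h.measurable_leftState.comp (by fun_prop : Measurable fun ω : Ω => (T, ω))
  have hvX : Measurable fun ω => v (X ω) := hv.test.continuous.measurable.comp hX
  set φ : ℕ → Ω → ℝ := fun m ω => v (X ω) / (1 + (1 / ((m : ℝ) + 1)) * v (X ω))
  have hpos : ∀ m : ℕ, (0 : ℝ) < 1 / ((m : ℝ) + 1) := fun m => Nat.one_div_pos_of_nat
  have hφnn : ∀ m ω, 0 ≤ φ m ω := fun m ω => div_nonneg (hv.nonneg _)
    (by nlinarith [hv.nonneg (X ω), hpos m])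
  have hlim : ∀ ω, Tendsto (fun m => ENNReal.ofReal (φ m ω)) atTop
      (𝓝 (ENNReal.ofReal (v (X ω)))) := fun ω => by
    refine (ENNReal.continuous_ofReal.tendsto _).comp ?_
    have h1 : Tendsto (fun m : ℕ => 1 + (1 / ((m : ℝ) + 1)) * v (X ω)) atTop
        (𝓝 (1 + 0 * v (X ω))) :=
      tendsto_const_nhds.add (tendsto_one_div_add_atTop_nhds_zero_nat.mul_const _)
    have h2 := (tendsto_const_nhds (x := v (X ω))).div h1 (by simp)
    simp only [zero_mul, add_zero, div_one] at h2
    exact h2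
  have hle : ∫⁻ ω, ENNReal.ofReal (v (X ω)) ∂P ≤ ENNReal.ofReal B := by
    calc ∫⁻ ω, ENNReal.ofReal (v (X ω)) ∂P
        = ∫⁻ ω, liminf (fun m => ENNReal.ofReal (φ m ω)) atTop ∂P :=
          lintegral_congr fun ω => (hlim ω).liminf_eq.symm
      _ ≤ liminf (fun m => ∫⁻ ω, ENNReal.ofReal (φ m ω) ∂P) atTop :=
          lintegral_liminf_le fun m => (hvX.div (measurable_const.add
            (measurable_const.mul hvX))).ennreal_ofReal
      _ ≤ ENNReal.ofReal B := by
          refine liminf_le_of_le (by isBoundedDefault) fun b hb => ?_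
          obtain ⟨m, hm⟩ := hb.exists
          obtain ⟨h1, h2⟩ := hv.integral_truncation_le hK h hr hT (hpos m)
          refine hm.trans ?_
          rw [← ofReal_integral_eq_lintegral_ofReal h1 (Eventually.of_forall (hφnn m))]
          exact ENNReal.ofReal_le_ofReal h2
  have hint : Integrable (fun ω => v (X ω)) P := by
    refine ⟨hvX.aestronglyMeasurable, ?_⟩
    rw [hasFiniteIntegral_iff_ofReal (Eventually.of_forall fun ω => hv.nonneg _)]
    exact hle.trans_lt ENNReal.ofReal_lt_top
  refine ⟨hint, ?_⟩
  rw [← ofReal_integral_eq_lintegral_ofReal hint (Eventually.of_forall fun ω => hv.nonneg _)] at hle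
  exact (ENNReal.ofReal_le_ofReal_iff (mul_nonneg (Real.exp_nonneg _) (hv.nonneg _))).1 hle

theorem JumpFlow.IsWeight.integrable_timeProd (hv : F.IsWeight K Q v v' C) (hK : F.IsInvariant K)
    (h : IsClockData P r Q D) (hr : ∀ k, 0 < r k) (T : ℝ) :
    Integrable (fun x : ℝ × Ω => v (F.leftState x.1 (D x.2))) (timeProd P T) := by
  have hm : Measurable fun x : ℝ × Ω => v (F.leftState x.1 (D x.2)) :=
    hv.test.continuous.measurable.comp h.measurable_leftState
  set A := C + ∑ k, r k * C
  have hA : 0 ≤ A := add_nonneg hv.const_nonneg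
    (Finset.sum_nonneg fun k _ => mul_nonneg (hr k).le hv.const_nonneg)
  refine (integrable_prod_iff hm.aestronglyMeasurable).2 ⟨?_, ?_⟩
  · filter_upwards [ae_restrict_mem measurableSet_Ioc] with s hs
    exact (hv.integral_le hK h hr hs.1).1
  · refine Integrable.of_bound
      (hm.norm.stronglyMeasurable.integral_prod_right (ν := P)).aestronglyMeasurable
      (Real.exp (A * T) * v F.init) ?_
    filter_upwards [ae_restrict_mem measurableSet_Ioc] with s hs
    simp only [Real.norm_of_nonneg (hv.nonneg _)]
    rw [Real.norm_of_nonneg (integral_nonneg fun ω => hv.nonneg _)]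
    refine (hv.integral_le hK h hr hs.1).2.trans ?_
    refine mul_le_mul_of_nonneg_right (Real.exp_le_exp.2 ?_) (hv.nonneg _)
    exact mul_le_mul_of_nonneg_left hs.2 hA

/-- Dynkin's formula for a function that is dominated by a weight. -/
theorem JumpFlow.IsTest.integral_leftState_of_weight (hφ : F.IsTest K φ ψ)
    (hv : F.IsWeight K Q v v' C) (hK : F.IsInvariant K) (h : IsClockData P r Q D)
    (hr : ∀ k, 0 < r k) {A : ℝ} (hφv : ∀ z ∈ K, |φ z| ≤ A * v z) (hψv : ∀ z ∈ K, |ψ z| ≤ A * v z)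
    (a : ℝ) {T : ℝ} (hT : 0 < T) :
    Integrable (fun ω => φ (F.leftState T (D ω))) P ∧
    Integrable (fun x : ℝ × Ω => Real.exp (a * x.1) * (a * φ (F.leftState x.1 (D x.2)) +
      F.gen r Q φ ψ (F.leftState x.1 (D x.2)))) (timeProd P T) ∧
    Real.exp (a * T) * ∫ ω, φ (F.leftState T (D ω)) ∂P = φ F.init +
      ∫ x : ℝ × Ω, Real.exp (a * x.1) * (a * φ (F.leftState x.1 (D x.2)) +
        F.gen r Q φ ψ (F.leftState x.1 (D x.2))) ∂(timeProd P T) := by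
  have hAv : ∀ z ∈ K, 0 ≤ A * v z := fun z hz => (abs_nonneg _).trans (hφv z hz)
  have hCv : ∀ z ∈ K, 0 ≤ C * (A * v z) := fun z hz => mul_nonneg hv.const_nonneg (hAv z hz)
  have hJ : ∀ k, ∀ z ∈ K, Integrable (fun ξ => φ (F.jump k z ξ)) (Q k) := fun k z hz =>
    ((hv.integrable k z hz).const_mul A).mono'
      (JumpFlow.measurable_comp_jump hφ.continuous k z).aestronglyMeasurable
      (Eventually.of_forall fun ξ => hφv _ (hK.jump k ξ z hz))
  refine hφ.integral_leftState hK h hr a hT (V := fun z => A * v z + C * (A * v z))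
    (fun z hz => (hφv z hz).trans (by linarith [hCv z hz]))
    (fun z hz => (hψv z hz).trans (by linarith [hCv z hz])) hJ (fun k z hz => ?_)
    (((hv.integrable_timeProd hK h hr T).const_mul A).add
      (((hv.integrable_timeProd hK h hr T).const_mul A).const_mul C))
  calc ∫ ξ, |φ (F.jump k z ξ) - φ z| ∂(Q k)
      ≤ ∫ ξ, (A * v (F.jump k z ξ) + A * v z) ∂(Q k) :=
        integral_mono ((hJ k z hz).sub (integrable_const _)).abs
          (((hv.integrable k z hz).const_mul A).add (integrable_const _)) fun ξ =>
          (abs_sub _ _).trans (add_le_add (hφv _ (hK.jump k ξ z hz)) (hφv z hz))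
    _ = A * ∫ ξ, v (F.jump k z ξ) ∂(Q k) + A * v z := by
        rw [integral_add ((hv.integrable k z hz).const_mul A) (integrable_const _),
          integral_const_mul]
        simp
    _ ≤ A * v z + C * (A * v z) := by
        have := hv.jump_le k z hz
        by_cases hA : 0 ≤ A
        · nlinarith
        · have h0 : v z = 0 := le_antisymm (by nlinarith [hAv z hz, hv.nonneg z]) (hv.nonneg z)
          have h1 : 0 ≤ ∫ ξ, v (F.jump k z ξ) ∂(Q k) := integral_nonneg fun ξ => hv.nonneg _
          rw [h0] at this ⊢
          nlinarith

end Weight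

/-! ### The driving processes as clock data -/

section Independence

variable {Ω κ β : Type*} [MeasurableSpace Ω] {P : Measure Ω} [MeasurableSpace β]

/-- One variable of an independent family is independent of all the others. -/
theorem indepFun_update [IsProbabilityMeasure P] [DecidableEq κ] {X : κ → Ω → β}
    (h : iIndepFun X P) (hX : ∀ k, Measurable (X k)) (c : κ) (d : β) :
    IndepFun (X c) (fun ω => Function.update (fun j => X j ω) c d) P := by
  have hle : ∀ k, MeasurableSpace.comap (X k) inferInstance ≤ (inferInstance : MeasurableSpace Ω) :=
    fun k => (hX k).comap_le
  have hd : Disjoint ({c} : Set κ) {c}ᶜ := disjoint_compl_right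
  have key := indep_iSup_of_disjoint hle h hd
  refine indep_of_indep_of_le key (by simp) ?_
  refine Measurable.comap_le ?_
  refine (@measurable_pi_iff _ _ _ (_) _ _).2 fun j => ?_
  by_cases hj : j = c
  · subst hj; simp
  · simp only [Function.update_of_ne hj]
    have : MeasurableSpace.comap (X j) inferInstance ≤
        ⨆ i ∈ ({c}ᶜ : Set κ), MeasurableSpace.comap (X i) inferInstance :=
      le_iSup₂_of_le j hj le_rfl
    exact measurable_iff_comap_le.2 this

variable {β₁ β₂ β₃ : Type*} [MeasurableSpace β₁] [MeasurableSpace β₂] [MeasurableSpace β₃]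

/-- Regrouping: if `f` is independent of `g`, and `(f, g)` of `h`, then `f` is independent of
`(g, h)`. -/
theorem indepFun_assoc [IsProbabilityMeasure P] {f : Ω → β₁} {g : Ω → β₂} {h : Ω → β₃}
    (hf : Measurable f) (hg : Measurable g) (hh : Measurable h) (hfg : IndepFun f g P)
    (hfgh : IndepFun (fun ω => (f ω, g ω)) h P) : IndepFun f (fun ω => (g ω, h ω)) P := by
  have := Measure.isProbabilityMeasure_map (μ := P) hf.aemeasurable
  have := Measure.isProbabilityMeasure_map (μ := P) hg.aemeasurable
  have := Measure.isProbabilityMeasure_map (μ := P) hh.aemeasurable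
  have hgh : IndepFun g h P := hfgh.comp measurable_snd measurable_id
  rw [indepFun_iff_map_prod_eq_prod_map_map hf.aemeasurable (hg.prodMk hh).aemeasurable,
    (indepFun_iff_map_prod_eq_prod_map_map hg.aemeasurable hh.aemeasurable).1 hgh,
    ← Measure.prodAssoc_prod,
    ← (indepFun_iff_map_prod_eq_prod_map_map hf.aemeasurable hg.aemeasurable).1 hfg,
    ← (indepFun_iff_map_prod_eq_prod_map_map (hf.prodMk hg).aemeasurable hh.aemeasurable).1 hfgh,
    Measure.map_map (MeasurableEquiv.measurable _) (by fun_prop)]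
  rfl

/-- If the two sequences are independent of each other and have independent terms, a pair of terms
of the same rank is independent of all the other terms. -/
theorem indepFun_prodMk_update [IsProbabilityMeasure P] [DecidableEq κ] {X : κ → Ω → β₁}
    {Y : κ → Ω → β₂} (hX : ∀ k, Measurable (X k)) (hY : ∀ k, Measurable (Y k))
    (hXi : iIndepFun X P) (hYi : iIndepFun Y P)
    (hXY : IndepFun (fun ω k => X k ω) (fun ω k => Y k ω) P) (c : κ) (a : β₁) (b : β₂) :
    IndepFun (fun ω => (X c ω, Y c ω))
      (fun ω => (Function.update (fun j => X j ω) c a,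
        Function.update (fun j => Y j ω) c b)) P := by
  have hup1 : Measurable fun u : κ → β₁ => Function.update u c a := measurable_update_left
  have hup2 : Measurable fun u : κ → β₂ => Function.update u c b := measurable_update_left
  have mX : Measurable fun ω k => X k ω := measurable_pi_iff.2 hX
  have mY : Measurable fun ω k => Y k ω := measurable_pi_iff.2 hY
  have hA := indepFun_update hXi hX c a
  have hB := indepFun_update hYi hY c b
  have h1 : IndepFun (fun ω => (X c ω, Function.update (fun j => X j ω) c a))
      (fun ω => (Y c ω, Function.update (fun j => Y j ω) c b)) P :=
    hXY.comp (φ := fun u => (u c, Function.update u c a))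
      (ψ := fun u => (u c, Function.update u c b)) (by fun_prop) (by fun_prop)
  have h2 := indepFun_assoc (hX c) (hup1.comp mX) ((hY c).prodMk (hup2.comp mY)) hA h1
  have h3 : IndepFun (Y c) (fun ω => (Function.update (fun j => Y j ω) c b,
      Function.update (fun j => X j ω) c a)) P :=
    indepFun_assoc (hY c) (hup2.comp mY) (hup1.comp mX) hB
      (h1.symm.comp measurable_id measurable_snd)
  have h4 := indepFun_assoc ((hup2.comp mY).prodMk (hup1.comp mX)) (hY c) (hX c) h3.symm
    (h2.symm.comp (φ := fun u : (κ → β₁) × (β₂ × (κ → β₂)) => ((u.2.2, u.1), u.2.1))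
      (ψ := id) (by fun_prop) measurable_id)
  exact (h4.comp (φ := fun u : (κ → β₂) × (κ → β₁) => (u.2, u.1))
    (ψ := fun u : β₂ × β₁ => (u.2, u.1))
    (by fun_prop) (by fun_prop)).symm

end Independence

section Clocks

variable {Ω Ξ : Type*} [MeasurableSpace Ω] [MeasurableSpace Ξ] {n : ℕ}

/-- The clocks of the dynamic: one for the gradient steps of each worker, and one for the
communications along each edge. -/
abbrev Clock (N : Network n) : Type := Fin n ⊕ N.graph.edgeSet

/-- The rates of the clocks. -/
def clockRate (N : Network n) : Clock N → ℝ := Sum.elim (fun _ => 1) fun e => N.rate e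

theorem clockRate_pos (N : Network n) (k : Clock N) : 0 < clockRate N k := by
  rcases k with i | e
  · exact one_pos
  · exact N.rate_pos e e.2

/-- The laws of the marks: the communications carry a dummy mark. -/
noncomputable def markLaw (N : Network n) (Q : Measure Ξ) (ξ₀ : Ξ) : Clock N → Measure Ξ :=
  Sum.elim (fun _ => Q) fun _ => Measure.dirac ξ₀

instance isProbabilityMeasure_markLaw (N : Network n) (Q : Measure Ξ) [IsProbabilityMeasure Q] (ξ₀ : Ξ) (k : Clock N) :
    IsProbabilityMeasure (markLaw N Q ξ₀ k) := by
  rcases k with i | e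
  · exact (inferInstance : IsProbabilityMeasure Q)
  · exact (inferInstance : IsProbabilityMeasure (Measure.dirac ξ₀))

/-- The waiting times and the marks of the driving processes. -/
def clockData (N : Network n) (τ : Fin n → ℕ → Ω → ℝ) (ξ : Fin n → ℕ → Ω → Ξ)
    (θ : Sym2 (Fin n) → ℕ → Ω → ℝ) (ξ₀ : Ξ) (ω : Ω) : Clock N → ℕ → ℝ × Ξ :=
  Sum.elim (fun i c => (gap (τ i) c ω, ξ i c ω)) fun e c => (gap (θ e) c ω, ξ₀)

omit [MeasurableSpace Ω] in
theorem sum_gap (τ : ℕ → Ω → ℝ) (c : ℕ) (ω : Ω) :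
    ∑ j ∈ Finset.range (c + 1), gap τ j ω = τ c ω := by
  induction c with
  | zero => simp [gap]
  | succ c ih => rw [Finset.sum_range_succ, ih]; simp [gap]

variable {N : Network n} {τ : Fin n → ℕ → Ω → ℝ} {ξ : Fin n → ℕ → Ω → Ξ}
  {θ : Sym2 (Fin n) → ℕ → Ω → ℝ} {ξ₀ : Ξ}

omit [MeasurableSpace Ω] [MeasurableSpace Ξ] in
theorem arr_clockData_inl (ω : Ω) (i : Fin n) (c : ℕ) :
    arr (clockData N τ ξ θ ξ₀ ω) (.inl i) c = τ i c ω :=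
  sum_gap (τ i) c ω

omit [MeasurableSpace Ω] [MeasurableSpace Ξ] in
theorem arr_clockData_inr (ω : Ω) (e : N.graph.edgeSet) (c : ℕ) :
    arr (clockData N τ ξ θ ξ₀ ω) (.inr e) c = θ e c ω :=
  sum_gap (θ e) c ω

theorem measurable_gap {τ : ℕ → Ω → ℝ} (h : ∀ k, Measurable (τ k)) (c : ℕ) :
    Measurable (gap τ c) := by
  cases c with
  | zero => exact h 0
  | succ c => exact (h (c + 1)).sub (h c)

/-- The waiting times, as a function of the arrival times. -/
def gaps (u : ℕ → ℝ) : ℕ → ℝ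
  | 0 => u 0
  | c + 1 => u (c + 1) - u c

theorem measurable_gaps : Measurable gaps := by
  refine measurable_pi_iff.2 fun c => ?_
  cases c with
  | zero => exact measurable_pi_apply 0
  | succ c => exact (measurable_pi_apply (c + 1)).sub (measurable_pi_apply c)

omit [MeasurableSpace Ω] in
theorem gap_eq_gaps (τ : ℕ → Ω → ℝ) (c : ℕ) (ω : Ω) : gap τ c ω = gaps (fun k => τ k ω) c := by
  cases c <;> rfl

variable {P : Measure Ω} [IsProbabilityMeasure P] {Q : Measure Ξ} [IsProbabilityMeasure Q]

omit [IsProbabilityMeasure P] [IsProbabilityMeasure Q] in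
theorem IsDriving.measurable_clockData (h : IsDriving P Q N τ ξ θ) (k : Clock N) (c : ℕ) :
    Measurable fun ω => clockData N τ ξ θ ξ₀ ω k c := by
  rcases k with i | e
  · exact (measurable_gap (h.grad i).times.measurable c).prodMk ((h.grad i).measurable c)
  · exact (measurable_gap (h.comm e e.2).measurable c).prodMk measurable_const

omit [IsProbabilityMeasure P] [IsProbabilityMeasure Q] in
theorem IsDriving.iIndepFun_clockData (h : IsDriving P Q N τ ξ θ) :
    iIndepFun (fun (k : Clock N) ω => clockData N τ ξ θ ξ₀ ω k) P := by
  refine iIndep_of_iIndep_of_le h.indep fun k => ?_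
  rcases k with i | e
  · have hm : Measurable fun u : ℕ → ℝ × Ξ => fun c => (gaps (fun k => (u k).1) c, (u c).2) := by
      refine measurable_pi_iff.2 fun c => ?_
      have h1 : Measurable fun u : ℕ → ℝ × Ξ => fun k => (u k).1 := by fun_prop
      have h2 : Measurable fun u : ℕ → ℝ × Ξ => (u c).2 := by fun_prop
      exact ((measurable_pi_iff.1 measurable_gaps c).comp h1).prodMk h2
    have he : (fun ω => clockData N τ ξ θ ξ₀ ω (.inl i)) =
        (fun u : ℕ → ℝ × Ξ => fun c => (gaps (fun k => (u k).1) c, (u c).2)) ∘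
          fun ω k => (τ i k ω, ξ i k ω) := by
      funext ω c
      simp [clockData, gap_eq_gaps]
    show MeasurableSpace.comap (fun ω => clockData N τ ξ θ ξ₀ ω (.inl i)) _ ≤ _
    rw [he, ← MeasurableSpace.comap_comp]
    exact MeasurableSpace.comap_mono hm.comap_le
  · have hm : Measurable fun u : ℕ → ℝ => fun c => (gaps u c, ξ₀) := by
      refine measurable_pi_iff.2 fun c => ?_
      exact (measurable_pi_iff.1 measurable_gaps c).prodMk measurable_const
    have he : (fun ω => clockData N τ ξ θ ξ₀ ω (.inr e)) =
        (fun u : ℕ → ℝ => fun c => (gaps u c, ξ₀)) ∘ fun ω k => θ e k ω := by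
      funext ω c
      simp [clockData, gap_eq_gaps]
    show MeasurableSpace.comap (fun ω => clockData N τ ξ θ ξ₀ ω (.inr e)) _ ≤ _
    rw [he, ← MeasurableSpace.comap_comp]
    exact MeasurableSpace.comap_mono hm.comap_le

omit [IsProbabilityMeasure P] [IsProbabilityMeasure Q] in
theorem IsMarkedPoisson.indep_gap {τ : ℕ → Ω → ℝ} {ξ : ℕ → Ω → Ξ} (h : IsMarkedPoisson P Q τ ξ) :
    IndepFun (fun ω c => gap τ c ω) (fun ω c => ξ c ω) P := by
  have he : (fun ω c => gap τ c ω) = gaps ∘ fun ω c => τ c ω := by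
    funext ω c; exact gap_eq_gaps τ c ω
  rw [he]
  exact h.indep_times.comp measurable_gaps measurable_id

omit [IsProbabilityMeasure Q] in
/-- A waiting time and its mark are independent of the other ones of the same clock. -/
theorem IsDriving.indep_own (h : IsDriving P Q N τ ξ θ) (k : Clock N) (c : ℕ) (d : ℝ × Ξ) :
    IndepFun (fun ω => clockData N τ ξ θ ξ₀ ω k c)
      (fun ω => Function.update (clockData N τ ξ θ ξ₀ ω k) c d) P := by
  rcases k with i | e
  · have hi := h.grad i
    have h1 := indepFun_prodMk_update (measurable_gap hi.times.measurable) hi.measurable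
      hi.times.indep hi.indep hi.indep_gap c d.1 d.2
    have h2 := h1.comp (φ := id) (ψ := fun u : (ℕ → ℝ) × (ℕ → Ξ) => fun j => (u.1 j, u.2 j))
      measurable_id (measurable_pi_iff.2 fun j => by fun_prop)
    convert h2 using 1
    · rfl
    funext ω j
    by_cases hj : j = c
    · subst hj; simp
    · simp [hj, clockData]
  · have he := h.comm e e.2
    have h1 := indepFun_update he.indep (measurable_gap he.measurable) c d.1
    have h2 := h1.comp (φ := fun u => (u, ξ₀))
      (ψ := fun u : ℕ → ℝ => fun j => (u j, if j = c then d.2 else ξ₀))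
      (by fun_prop) (measurable_pi_iff.2 fun j => by fun_prop)
    convert h2 using 1
    · rfl
    funext ω j
    by_cases hj : j = c
    · subst hj; simp
    · simp [hj, clockData]

omit [IsProbabilityMeasure Q] in
/-- The independence of a waiting time and its mark from all the others combines the independence
within a clock and the independence of the clocks. -/
theorem IsDriving.isClockData [DecidableEq (Clock N)] (h : IsDriving P Q N τ ξ θ) :
    IsClockData P (clockRate N) (markLaw N Q ξ₀) (clockData N τ ξ θ ξ₀) where
  measurable := measurable_pi_iff.2 fun k => measurable_pi_iff.2 fun c => h.measurable_clockData k c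
  law k c := by
    rcases k with i | e
    · have hi := h.grad i
      have h1 : IndepFun (gap (τ i) c) (ξ i c) P :=
        hi.indep_gap.comp (measurable_pi_apply c) (measurable_pi_apply c)
      have h2 := (indepFun_iff_map_prod_eq_prod_map_map
        (measurable_gap hi.times.measurable c).aemeasurable (hi.measurable c).aemeasurable).1 h1
      rw [hi.times.law c, hi.law c] at h2
      exact h2
    · have he := h.comm e e.2
      show P.map (fun ω => (gap (θ e) c ω, ξ₀)) = (expMeasure (N.rate e)).prod (Measure.dirac ξ₀)
      have := isProbabilityMeasure_expMeasure (N.rate_pos e e.2)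
      rw [Measure.prod_dirac, ← he.law c, Measure.map_map (by fun_prop)
        (measurable_gap he.measurable c)]
      rfl
  indep k c d := by
    have hm : ∀ k, Measurable fun ω => clockData N τ ξ θ ξ₀ ω k := fun k =>
      measurable_pi_iff.2 fun c => h.measurable_clockData k c
    have h1 := indepFun_update (h.iIndepFun_clockData (ξ₀ := ξ₀)) hm k fun _ => d
    have hup : Measurable fun u : ℕ → ℝ × Ξ => Function.update u c d := measurable_update_left
    have hup' : Measurable fun u : Clock N → ℕ → ℝ × Ξ => Function.update u k fun _ => d :=
      measurable_update_left
    have h2 := indepFun_assoc (h.measurable_clockData k c) (hup.comp (hm k))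
      (hup'.comp (measurable_pi_iff.2 hm)) (h.indep_own k c d)
      (h1.comp (φ := fun u => (u c, Function.update u c d)) (ψ := id)
        ((measurable_pi_apply c).prodMk hup) measurable_id)
    have h3 := h2.comp (φ := id)
      (ψ := fun u : (ℕ → ℝ × Ξ) × (Clock N → ℕ → ℝ × Ξ) => Function.update u.2 k u.1)
      measurable_id (measurable_pi_iff.2 fun k' => by
        by_cases hk : k' = k
        · subst hk; simpa using measurable_fst
        · simp only [Function.update_of_ne hk]; fun_prop)
    convert h3 using 1
    · rfl
    funext ω
    simp [resetClock]

end Clocks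

/-! ### Càdlàg paths -/

section Cadlag

variable {E : Type*} [NormedAddCommGroup E]

/-- A càdlàg path is only constrained at the times `t ≥ 0`, hence the `max`. -/
theorem IsCadlag.measurable [MeasurableSpace E] [BorelSpace E] {y : ℝ → E} (hy : IsCadlag y) :
    Measurable fun t => y (max t 0) := by
  -- approximate from the right by step functions
  have hlim : ∀ t : ℝ, Tendsto (fun m : ℕ => ((⌊(m + 1 : ℝ) * t⌋ : ℝ) + 1) / (m + 1 : ℝ)) atTop
      (𝓝[≥] t) := fun t => by
    refine tendsto_nhdsWithin_iff.2 ⟨?_, Eventually.of_forall fun m => ?_⟩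
    · have h1 : Tendsto (fun m : ℕ => t + 1 / ((m : ℝ) + 1)) atTop (𝓝 (t + 0)) :=
        tendsto_const_nhds.add tendsto_one_div_add_atTop_nhds_zero_nat
      rw [add_zero] at h1
      refine tendsto_of_tendsto_of_tendsto_of_le_of_le tendsto_const_nhds h1 (fun m => ?_)
        fun m => ?_
      · have : (0 : ℝ) < m + 1 := by positivity
        rw [le_div_iff₀ this, mul_comm]
        exact (Int.lt_floor_add_one _).le
      · have : (0 : ℝ) < m + 1 := by positivity
        show _ ≤ t + 1 / ((m : ℝ) + 1)
        have h2 : (t + 1 / ((m : ℝ) + 1)) * (m + 1) = (m + 1) * t + 1 := by field_simp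
        rw [div_le_iff₀ this, h2]
        linarith [Int.floor_le (((m : ℝ) + 1) * t)]
    · have : (0 : ℝ) < m + 1 := by positivity
      rw [Set.mem_Ici, le_div_iff₀ this, mul_comm]
      exact (Int.lt_floor_add_one _).le
  have hright : ∀ t : ℝ, ContinuousWithinAt (fun t => y (max t 0)) (Set.Ici t) t := fun t => by
    have hc : ContinuousWithinAt (fun t : ℝ => max t 0) (Set.Ici t) t :=
      (continuous_id.max continuous_const).continuousWithinAt
    exact ContinuousWithinAt.comp (g := y) (t := Set.Ici (max t 0))
      (hy (max t 0) (le_max_right _ _)).1 hc fun u hu =>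
        Set.mem_Ici.2 (max_le_max_right 0 hu)
  refine measurable_of_tendsto_metrizable (f := fun (m : ℕ) t =>
    y (max (((⌊(m + 1 : ℝ) * t⌋ : ℝ) + 1) / (m + 1 : ℝ)) 0)) (fun m => ?_)
    (tendsto_pi_nhds.2 fun t => (hright t).tendsto.comp (hlim t))
  have h1 : Measurable fun k : ℤ => y (max (((k : ℝ) + 1) / (m + 1 : ℝ)) 0) :=
    measurable_of_countable _
  exact h1.comp (Int.measurable_floor.comp (measurable_const.mul measurable_id))

theorem IsCadlag.isBounded {y : ℝ → E} (hy : IsCadlag y) (T : ℝ) :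
    Bornology.IsBounded (y '' Set.Icc 0 T) := by
  refine isCompact_Icc.induction_on (p := fun s => Bornology.IsBounded (y '' s)) (by simp)
    (fun s t hst ht => ht.subset (Set.image_mono hst))
    (fun s t hs ht => by rw [Set.image_union]; exact hs.union ht) fun t ht => ?_
  have hnear : ∀ {l : Filter ℝ} {b : E}, Tendsto y l (𝓝 b) →
      ∃ s ∈ l, Bornology.IsBounded (y '' s) := fun {l b} h =>
    ⟨y ⁻¹' Metric.ball b 1, h (Metric.ball_mem_nhds b one_pos),
      Metric.isBounded_ball.subset (Set.image_preimage_subset _ _)⟩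
  obtain ⟨s, hs, hsb⟩ := hnear (hy t ht.1).1
  rcases ht.1.eq_or_lt with h0 | hpos
  · refine ⟨s, ?_, hsb⟩
    refine nhdsWithin_mono t (fun u hu => ?_) hs
    rw [← h0]; exact hu.1
  · obtain ⟨l, hl⟩ := (hy t ht.1).2 hpos
    obtain ⟨s', hs', hsb'⟩ := hnear hl
    refine ⟨s' ∪ s, mem_nhdsWithin_of_mem_nhds ?_, by rw [Set.image_union]; exact hsb'.union hsb⟩
    rw [← nhdsLT_sup_nhdsGE]
    exact Filter.union_mem_sup hs' hs

theorem IsCadlag.intervalIntegrable [NormedSpace ℝ E] [MeasurableSpace E] [BorelSpace E]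
    [SecondCountableTopology E] {y : ℝ → E} (hy : IsCadlag y) {s t : ℝ} (hs : 0 ≤ s) (ht : 0 ≤ t) :
    IntervalIntegrable y volume s t := by
  suffices h : ∀ {T : ℝ}, 0 ≤ T → IntervalIntegrable y volume 0 T from (h hs).symm.trans (h ht)
  intro T hT
  rw [intervalIntegrable_iff_integrableOn_Ioc_of_le hT]
  obtain ⟨C, hC⟩ := (hy.isBounded T).exists_norm_le
  have hm : AEStronglyMeasurable y (volume.restrict (Set.Ioc 0 T)) := by
    refine (hy.measurable.aestronglyMeasurable).congr ?_
    filter_upwards [ae_restrict_mem measurableSet_Ioc] with t ht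
    rw [max_eq_left ht.1.le]
  refine Integrable.mono' (integrableOn_const (C := C) (by simp)) hm ?_
  filter_upwards [ae_restrict_mem measurableSet_Ioc] with t ht
  exact hC _ ⟨t, ⟨ht.1.le, ht.2⟩, rfl⟩

end Cadlag

/-! ### The linear flow -/

section Flow

variable {E : Type*} [NormedAddCommGroup E] [NormedSpace ℝ E]

/-- The part of the difference `x̃ - x` that the momentum has moved after a time `t`. -/
noncomputable def mixing (η t : ℝ) : ℝ := (1 - Real.exp (-(2 * η * t))) / 2

/-- The momentum moves `(x, x̃)` in the direction `(x̃ - x, x - x̃)`. -/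
def momentum (z : E × E) : E × E := (z.2 - z.1, z.1 - z.2)

theorem momentum_momentum (z : E × E) : momentum (momentum z) = (-2 : ℝ) • momentum z := by
  refine Prod.ext ?_ ?_ <;> simp only [momentum, Prod.smul_mk] <;> module

theorem momentum_add_smul (c : ℝ) (z w : E × E) :
    momentum (z + c • w) = momentum z + c • momentum w := by
  refine Prod.ext ?_ ?_ <;> simp only [momentum, Prod.fst_add, Prod.snd_add, Prod.smul_fst,
    Prod.smul_snd] <;> module

omit [NormedSpace ℝ E] in
theorem continuous_momentum : Continuous (momentum : E × E → E × E) := by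
  unfold momentum; fun_prop

/-- The solution of `z' = η (x̃ - x, x - x̃)`. -/
noncomputable def momentumFlow (η t : ℝ) (z : E × E) : E × E := z + mixing η t • momentum z

theorem mixing_zero (η : ℝ) : mixing η 0 = 0 := by simp [mixing]

theorem mixing_add (η s t : ℝ) :
    mixing η (s + t) = mixing η t + mixing η s * (1 - 2 * mixing η t) := by
  have : Real.exp (-(2 * η * (s + t))) =
      Real.exp (-(2 * η * s)) * Real.exp (-(2 * η * t)) := by
    rw [← Real.exp_add]; congr 1; ring
  simp only [mixing, this]
  ring

theorem momentumFlow_add (η s t : ℝ) (z : E × E) :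
    momentumFlow η (s + t) z = momentumFlow η s (momentumFlow η t z) := by
  simp only [momentumFlow, momentum_add_smul, momentum_momentum, mixing_add]
  module

theorem continuous_mixing (η : ℝ) : Continuous (mixing η) := by
  unfold mixing; fun_prop

theorem hasDerivAt_mixing (η : ℝ) : HasDerivAt (mixing η) η 0 := by
  have h1 : HasDerivAt (fun t : ℝ => -(2 * η * t)) (-(2 * η)) 0 := by
    simpa using ((hasDerivAt_id (0 : ℝ)).const_mul (2 * η)).fun_neg
  have h2 := ((h1.exp.const_sub 1).div_const 2)
  refine h2.congr_deriv ?_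
  simp

/-- The flow is the only solution of its equation in integral form. -/
theorem eq_momentumFlow [CompleteSpace E] {η : ℝ} {z : ℝ → E × E} {u t : ℝ} (hut : u ≤ t)
    (hint : IntervalIntegrable (fun s => momentum (z s)) volume u t)
    (hcont : ∀ s ∈ Set.Ico u t, ContinuousWithinAt z (Set.Ici s) s)
    (hmeas : ∀ s ∈ Set.Ico u t,
      StronglyMeasurableAtFilter (fun s => momentum (z s)) (𝓝[>] s) volume)
    (hz : ∀ s ∈ Set.Icc u t, z s = z u + η • ∫ v in u..s, momentum (z v)) :
    z t = momentumFlow η (t - u) (z u) := by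
  have hzc : ContinuousOn z (Set.Icc u t) := by
    have h1 : ContinuousOn (fun s => z u + η • ∫ v in u..s, momentum (z v)) (Set.Icc u t) := by
      refine continuousOn_const.add (ContinuousOn.const_smul ?_ η)
      have := intervalIntegral.continuousOn_primitive_interval' hint Set.left_mem_uIcc
      rwa [Set.uIcc_of_le hut] at this
    exact h1.congr hz
  have hzd : ∀ s ∈ Set.Ico u t, HasDerivWithinAt z (η • momentum (z s)) (Set.Ici s) s := by
    intro s hs
    have hint' : IntervalIntegrable (fun s => momentum (z s)) volume u s :=
      hint.mono_set (by
        rw [Set.uIcc_of_le hs.1, Set.uIcc_of_le hut]; exact Set.Icc_subset_Icc_right hs.2.le)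
    have h1 := intervalIntegral.integral_hasDerivWithinAt_right (s := Set.Ici s) (t := Set.Ioi s)
      hint' (hmeas s hs) ((continuous_momentum.continuousAt.comp_continuousWithinAt
        (hcont s hs)).mono Set.Ioi_subset_Ici_self)
    have h2 := (h1.const_smul η).const_add (z u)
    refine h2.congr_of_eventuallyEq ?_ (hz s ⟨hs.1, hs.2.le⟩)
    filter_upwards [Ico_mem_nhdsGE hs.2] with v hv
    exact hz v ⟨hs.1.trans hv.1, hv.2.le⟩
  -- the inverse flow applied to the path is constant
  have hmc : ∀ s, HasDerivAt (fun s => mixing η (u - s)) (-(η * (1 - 2 * mixing η (u - s)))) s := by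
    intro s
    have h1 : HasDerivAt (fun s : ℝ => -(2 * η * (u - s))) (2 * η) s := by
      simpa using (((hasDerivAt_id s).const_sub u).const_mul (2 * η)).fun_neg
    have h2 := ((h1.exp.const_sub 1).div_const 2)
    refine h2.congr_deriv ?_
    simp only [mixing]
    ring
  have hconst := constant_of_has_deriv_right_zero
    (f := fun s => momentumFlow η (u - s) (z s)) (a := u) (b := t) ?_ ?_ t ⟨hut, le_rfl⟩
  · rw [sub_self] at hconst
    have h3 := congrArg (momentumFlow η (t - u)) hconst
    rw [← momentumFlow_add] at h3
    simpa [momentumFlow, mixing_zero] using h3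
  · unfold momentumFlow
    refine hzc.add (ContinuousOn.fun_smul ?_ (continuous_momentum.comp_continuousOn hzc))
    exact ((continuous_mixing η).comp (continuous_const.sub continuous_id)).continuousOn
  · intro s hs
    have h1 := hzd s hs
    have h2 : HasDerivWithinAt (fun s => momentum (z s)) (η • momentum (momentum (z s)))
        (Set.Ici s) s := by
      have h3 : HasDerivWithinAt (fun s => (z s).1) (η • momentum (z s)).1 (Set.Ici s) s := h1.fst
      have h4 : HasDerivWithinAt (fun s => (z s).2) (η • momentum (z s)).2 (Set.Ici s) s := h1.snd
      refine ((h4.sub h3).prodMk (h3.sub h4)).congr_deriv ?_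
      refine Prod.ext ?_ ?_ <;> simp only [momentum, Prod.smul_mk] <;> module
    have h5 := h1.add ((hmc s).hasDerivWithinAt.smul h2)
    refine h5.congr_deriv ?_
    rw [momentum_momentum]
    module

end Flow

/-! ### Paths that follow a flow and jump -/

section Path

variable {ι E Ξ : Type*} [TopologicalSpace E] [MeasurableSpace E] [MeasurableSpace Ξ]
  [DecidableEq ι] {F : JumpFlow ι E Ξ} {D : ι → ℕ → ℝ × Ξ} {z : ℝ → E}

/-- A path that follows the flow between the arrivals and jumps at the arrivals is the one computed
from the words. -/
theorem JumpFlow.eq_stateAt (hD : GoodClocks D) (h0 : z 0 = F.init)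
    (hflow : ∀ u t, 0 ≤ u → u ≤ t → (∀ k c, u < arr D k c → t < arr D k c) →
      z t = F.flow (t - u) (z u))
    (hjump : ∀ k c l, Tendsto z (𝓝[<] arr D k c) (𝓝 l) →
      z (arr D k c) = F.jump k l (D k c).2) {w : List ι} {s : ℝ} (hw : IsHistory D w s)
    (hs : ∀ k c, arr D k c ≠ s) : z s = F.stateAt D w s := by
  -- no arrival between the latest event of the word and the time `s`
  have hno : ∀ {w : List ι} {s : ℝ}, IsHistory D w s → ∀ k c, wordTime D w < arr D k c →
      s ≤ arr D k c := fun {w s} hw k c hc => by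
    by_contra! hlt
    exact absurd (hD.arr_le_wordTime hw.sorted ((hD.lt_count_iff hw k c).2 hlt)) (not_le.2 hc)
  have key : ∀ (w : List ι) (s : ℝ), IsHistory D w s → z (wordTime D w) = F.wordState D w := by
    intro w
    induction w with
    | nil => intro s _; exact h0
    | cons k w ih =>
      intro s hw
      have ht := hw.tail
      have hz := ih _ ht
      rw [F.wordState_cons]
      refine hjump k (w.count k) _ ?_
      have h1 : ∀ᶠ t in 𝓝[<] (wordTime D (k :: w)), F.stateAt D w t = z t := by
        filter_upwards [Ioo_mem_nhdsLT ht.time_lt] with t ht'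
        rw [JumpFlow.stateAt, ← hz]
        exact (hflow _ _ (hD.wordTime_nonneg w) ht'.1.le fun k' c' hc =>
          ht'.2.trans_le (hno ht k' c' hc)).symm
      refine Tendsto.congr' h1 (tendsto_nhdsWithin_of_tendsto_nhds ?_)
      have hc : Continuous fun t => F.stateAt D w t :=
        F.continuous_flow.comp ((continuous_id.sub continuous_const).prodMk continuous_const)
      exact hc.tendsto _
  rw [JumpFlow.stateAt, ← key w s hw]
  exact hflow _ _ (hD.wordTime_nonneg w) hw.time_lt.le fun k c hc =>
    (hno hw k c hc).lt_of_ne (hs k c).symm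

end Path

/-! ### The solutions of the stochastic differential equation -/

open Classical in
theorem difference_apply {n d : ℕ} {e : Sym2 (Fin n)} (he : ¬ e.IsDiag)
    (y : Fin n → EuclideanSpace ℝ (Fin d)) (i : Fin n) :
    difference e y i = ∑ j, if e = s(i, j) then y i - y j else 0 := by
  induction e with
  | _ a b =>
    have hab : a ≠ b := fun h => he (by simp [h])
    have h1 : difference s(a, b) y i = edgeVec a b i • (y a - y b) := by
      show ∑ j, Matrix.vecMulVec (edgeVec a b) (edgeVec a b) i j • y j = _
      simp only [Matrix.vecMulVec_apply, mul_smul, ← Finset.smul_sum]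
      congr 1
      simp [edgeVec, sub_smul, Finset.sum_sub_distrib, Pi.single_apply, ite_smul]
    rw [h1]
    by_cases hia : i = a
    · subst hia
      have : ∀ j, s(i, b) = s(i, j) ↔ b = j := fun j =>
        ⟨fun h => (Sym2.eq_iff.1 h).elim And.right fun h => h.2.trans h.1, fun h => by rw [h]⟩
      simp [this, edgeVec, hab]
    · by_cases hib : i = b
      · subst hib
        have : ∀ j, s(a, i) = s(i, j) ↔ a = j := fun j =>
          ⟨fun h => (Sym2.eq_iff.1 h).elim (fun h => h.1.trans h.2) And.left,
            fun h => by rw [h, Sym2.eq_swap]⟩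
        simp [this, edgeVec, hab.symm]
      · have : ∀ j, s(a, b) ≠ s(i, j) := fun j h => by
          rcases Sym2.eq_iff.1 h with ⟨h, _⟩ | ⟨_, h⟩
          · exact hia h.symm
          · exact hib h.symm
        simp [this, edgeVec, hia, hib]

section Dynamic

variable {Ω Ξ : Type*} [MeasurableSpace Ω] [MeasurableSpace Ξ] {n d : ℕ}

/-- The effect of an event on the state: a gradient step of a worker moves its `x` and its `x̃` by the
same vector, and a communication moves the two ends of its edge. -/
noncomputable def networkJump (N : Network n) (p : Params) (γ : ℝ)
    (g : Fin n → EuclideanSpace ℝ (Fin d) → Ξ → EuclideanSpace ℝ (Fin d)) :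
    Clock N → State n d → Ξ → State n d :=
  Sum.elim
    (fun i z ξ => z - (Pi.single i (γ • g i (z.1 i) ξ), Pi.single i (γ • g i (z.1 i) ξ)))
    fun e z _ => (z.1 - p.alpha • difference e z.1, z.2 - p.alphaTilde • difference e z.1)

theorem measurable_single (i : Fin n) : Measurable fun v : EuclideanSpace ℝ (Fin d) =>
    (Pi.single i v : Fin n → EuclideanSpace ℝ (Fin d)) :=
  (continuous_single (A := fun _ : Fin n => EuclideanSpace ℝ (Fin d)) i).measurable

/-- The dynamic of the network, as a flow with jumps. -/
noncomputable def networkFlow (N : Network n) (p : Params) (γ : ℝ)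
    (g : Fin n → EuclideanSpace ℝ (Fin d) → Ξ → EuclideanSpace ℝ (Fin d))
    (hg : ∀ i, Measurable (Function.uncurry (g i))) (x₀ : EuclideanSpace ℝ (Fin d)) :
    JumpFlow (Clock N) (State n d) Ξ where
  flow t z := momentumFlow p.eta t z
  jump := networkJump N p γ g
  init := (fun _ => x₀, fun _ => x₀)
  flow_zero z := by simp [momentumFlow, mixing_zero]
  flow_add s t z := momentumFlow_add p.eta s t z
  continuous_flow := by
    have h1 : Continuous fun q : ℝ × State n d => mixing p.eta q.1 :=
      (continuous_mixing p.eta).comp continuous_fst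
    have h2 : Continuous fun q : ℝ × State n d => momentum q.2 :=
      continuous_momentum.comp continuous_snd
    exact continuous_snd.add (h1.smul h2)
  measurable_jump k := by
    rcases k with i | e
    · have h1 : Measurable fun q : State n d × Ξ => γ • g i (q.1.1 i) q.2 :=
        ((hg i).comp (Measurable.prodMk (by fun_prop) measurable_snd)).const_smul γ
      have h2 := (measurable_single i).comp h1
      exact measurable_fst.sub (h2.prodMk h2)
    · have h1 : Continuous fun q : State n d => (q.1 - p.alpha • difference e q.1,
          q.2 - p.alphaTilde • difference e q.1) := by
        have := continuous_difference (d := d) (e : Sym2 (Fin n))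
        fun_prop
      exact h1.measurable.comp measurable_fst

variable {N : Network n} {τ : Fin n → ℕ → Ω → ℝ} {ξ : Fin n → ℕ → Ω → Ξ}
  {θ : Sym2 (Fin n) → ℕ → Ω → ℝ} {ξ₀ : Ξ} {ω : Ω}
  {g : Fin n → EuclideanSpace ℝ (Fin d) → Ξ → EuclideanSpace ℝ (Fin d)}
  {x xt : ℝ → Ω → Fin n → EuclideanSpace ℝ (Fin d)}

/-- The change of the state at the `c`-th arrival of a clock, from the left limit of the path `y` of
`x`. The change does not depend on `x̃`, which is set to `0`. -/
noncomputable def pathJump (N : Network n) (p : Params) (γ : ℝ)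
    (g : Fin n → EuclideanSpace ℝ (Fin d) → Ξ → EuclideanSpace ℝ (Fin d))
    (D : Clock N → ℕ → ℝ × Ξ) (y : ℝ → Fin n → EuclideanSpace ℝ (Fin d)) (k : Clock N) (c : ℕ) :
    State n d :=
  networkJump N p γ g k (Function.leftLim y (arr D k c), 0) (D k c).2
    - (Function.leftLim y (arr D k c), 0)

omit [MeasurableSpace Ω] [MeasurableSpace Ξ] in
theorem IsCadlag.leftLim_apply {y : ℝ → Fin n → EuclideanSpace ℝ (Fin d)} (hy : IsCadlag y)
    {t : ℝ} (ht : 0 < t) (i : Fin n) :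
    Function.leftLim (fun s => y s i) t = Function.leftLim y t i := by
  obtain ⟨l, hl⟩ := (hy t ht.le).2 ht
  rw [leftLim_eq_of_tendsto hl, leftLim_eq_of_tendsto (tendsto_pi_nhds.1 hl i)]

omit [MeasurableSpace Ω] in
theorem sumArrivals_eq {E : Type*} [AddCommMonoid E] [TopologicalSpace E] {τ : ℕ → Ω → ℝ}
    {v : ℕ → E} {t : ℝ} {M : ℕ} (hM : ∀ c, M ≤ c → t < τ c ω) :
    sumArrivals τ v t ω = ∑ c ∈ Finset.range M, if τ c ω ≤ t then v c else 0 := by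
  rw [sumArrivals, tsum_eq_sum (s := Finset.range M)]
  · exact Finset.sum_congr rfl fun c _ => by simp [Set.indicator_apply]
  · intro c hc
    have := hM c (by simpa using hc)
    simp [this]

omit [MeasurableSpace Ω] [MeasurableSpace Ξ] in
theorem gradSum_eq (hD : GoodClocks (clockData N τ ξ θ ξ₀ ω)) (hy : IsCadlag fun t => x t ω)
    {t : ℝ} {M : ℕ} (hM : ∀ k c, M ≤ c → t < arr (clockData N τ ξ θ ξ₀ ω) k c) (i : Fin n) :
    gradSum g τ ξ x i t ω = ∑ c ∈ Finset.range M,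
      if arr (clockData N τ ξ θ ξ₀ ω) (.inl i) c ≤ t then
        g i (Function.leftLim (fun t => x t ω) (arr (clockData N τ ξ θ ξ₀ ω) (.inl i) c) i)
          (clockData N τ ξ θ ξ₀ ω (.inl i) c).2 else 0 := by
  rw [gradSum, sumArrivals_eq (M := M) fun c hc => by
    rw [← arr_clockData_inl (N := N) (τ := τ) (ξ := ξ) (θ := θ) (ξ₀ := ξ₀)]; exact hM _ c hc]
  refine Finset.sum_congr rfl fun c _ => ?_
  rw [← hy.leftLim_apply (hD.arr_pos _ _), arr_clockData_inl]
  rfl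

open Classical in
omit [MeasurableSpace Ω] [MeasurableSpace Ξ] in
theorem gossipSum_eq (hD : GoodClocks (clockData N τ ξ θ ξ₀ ω)) (hy : IsCadlag fun t => x t ω)
    {t : ℝ} {M : ℕ} (hM : ∀ k c, M ≤ c → t < arr (clockData N τ ξ θ ξ₀ ω) k c) (i : Fin n) :
    gossipSum N θ x i t ω = ∑ e : N.graph.edgeSet, ∑ c ∈ Finset.range M,
      if arr (clockData N τ ξ θ ξ₀ ω) (.inr e) c ≤ t then
        difference e (Function.leftLim (fun t => x t ω)
          (arr (clockData N τ ξ θ ξ₀ ω) (.inr e) c)) i else 0 := by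
  set y := fun t => x t ω with hydef
  -- the contribution of the neighbour `j` through the edge `e`
  set Φ : Sym2 (Fin n) → Fin n → EuclideanSpace ℝ (Fin d) := fun e j =>
    ∑ c ∈ Finset.range M, if θ e c ω ≤ t then
      Function.leftLim y (θ e c ω) i - Function.leftLim y (θ e c ω) j else 0 with hΦ
  have hR : ∀ e : N.graph.edgeSet, ∑ c ∈ Finset.range M,
      (if arr (clockData N τ ξ θ ξ₀ ω) (.inr e) c ≤ t then
        difference e (Function.leftLim y (arr (clockData N τ ξ θ ξ₀ ω) (.inr e) c)) i else 0) =
      ∑ j, if (e : Sym2 (Fin n)) = s(i, j) then Φ e j else 0 := fun e => by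
    have hdiag : ¬ (e : Sym2 (Fin n)).IsDiag := N.graph.not_isDiag_of_mem_edgeSet e.2
    simp only [difference_apply hdiag, arr_clockData_inr]
    have : ∀ j, (if (e : Sym2 (Fin n)) = s(i, j) then Φ e j else 0) =
        ∑ c ∈ Finset.range M, if θ e c ω ≤ t then (if (e : Sym2 (Fin n)) = s(i, j) then
          Function.leftLim y (θ e c ω) i - Function.leftLim y (θ e c ω) j else 0) else 0 := by
      intro j
      by_cases h : (e : Sym2 (Fin n)) = s(i, j) <;> simp [h, hΦ]
    simp only [this]
    rw [Finset.sum_comm]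
    refine Finset.sum_congr rfl fun c _ => ?_
    by_cases h : θ e c ω ≤ t <;> simp [h]
  rw [Finset.sum_congr rfl fun e _ => hR e, Finset.sum_comm, gossipSum, Finset.sum_filter]
  refine Finset.sum_congr rfl fun j _ => ?_
  by_cases hij : N.graph.Adj i j
  · have hmem : s(i, j) ∈ N.graph.edgeSet := hij
    have harr : ∀ c, θ s(i, j) c ω = arr (clockData N τ ξ θ ξ₀ ω) (.inr ⟨s(i, j), hmem⟩) c :=
      fun c => (arr_clockData_inr ω ⟨s(i, j), hmem⟩ c).symm
    rw [if_pos hij, Finset.sum_eq_single ⟨s(i, j), hmem⟩ (fun e _ he => if_neg fun h =>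
      he (Subtype.ext h)) (by simp), if_pos rfl, sumArrivals_eq (M := M) fun c hc => by
        rw [harr]; exact hM _ c hc]
    refine Finset.sum_congr rfl fun c _ => ?_
    have hpos : 0 < θ s(i, j) c ω := by rw [harr]; exact hD.arr_pos _ _
    rw [← hy.leftLim_apply hpos, ← hy.leftLim_apply hpos]
  · rw [if_neg hij]
    refine (Finset.sum_eq_zero fun e _ => if_neg fun h => hij ?_).symm
    have := e.2
    rwa [h] at this

theorem IsCadlag.comp_continuous {E F : Type*} [TopologicalSpace E] [TopologicalSpace F]
    {y : ℝ → E} (hy : IsCadlag y) {h : E → F} (hh : Continuous h) : IsCadlag fun t => h (y t) :=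
  fun t ht => ⟨hh.continuousAt.comp_continuousWithinAt (hy t ht).1,
    fun h0 => ((hy t ht).2 h0).elim fun l hl => ⟨h l, (hh.tendsto l).comp hl⟩⟩

theorem IsCadlag.prodMk {E F : Type*} [TopologicalSpace E] [TopologicalSpace F] {y : ℝ → E}
    {y' : ℝ → F} (hy : IsCadlag y) (hy' : IsCadlag y') : IsCadlag fun t => (y t, y' t) :=
  fun t ht => ⟨(hy t ht).1.prodMk (hy' t ht).1, fun h0 => by
    obtain ⟨l, hl⟩ := (hy t ht).2 h0
    obtain ⟨l', hl'⟩ := (hy' t ht).2 h0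
    exact ⟨(l, l'), hl.prodMk_nhds hl'⟩⟩

open Classical in
omit [MeasurableSpace Ω] [MeasurableSpace Ξ] in
/-- The changes of the state up to `t` add up to the sums over the arrivals in the equations of `x`
and of `x̃`. -/
theorem sum_pathJump {p : Params} {γ : ℝ} (hD : GoodClocks (clockData N τ ξ θ ξ₀ ω))
    (hx : IsCadlag fun t => x t ω) {t : ℝ} {M : ℕ}
    (hM : ∀ k c, M ≤ c → t < arr (clockData N τ ξ θ ξ₀ ω) k c) :
    ∑ k, ∑ c ∈ Finset.range M, (if arr (clockData N τ ξ θ ξ₀ ω) k c ≤ t then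
      pathJump N p γ g (clockData N τ ξ θ ξ₀ ω) (fun t => x t ω) k c else 0) =
    (fun i => -(γ • gradSum g τ ξ x i t ω) - p.alpha • gossipSum N θ x i t ω,
      fun i => -(γ • gradSum g τ ξ x i t ω) - p.alphaTilde • gossipSum N θ x i t ω) := by
  -- `A` is a coordinate of `x`, for `a = α`, or of `x̃`, for `a = α̃`
  have key : ∀ (A : State n d →+ EuclideanSpace ℝ (Fin d)) (i : Fin n) (a : ℝ),
      (∀ i' v, A (Pi.single i' v, Pi.single i' v) = if i' = i then v else 0) →
      (∀ y : Fin n → EuclideanSpace ℝ (Fin d),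
        A (p.alpha • y, p.alphaTilde • y) = a • y i) →
      A (∑ k, ∑ c ∈ Finset.range M, (if arr (clockData N τ ξ θ ξ₀ ω) k c ≤ t then
        pathJump N p γ g (clockData N τ ξ θ ξ₀ ω) (fun t => x t ω) k c else 0)) =
      -(γ • gradSum g τ ξ x i t ω) - a • gossipSum N θ x i t ω := by
    intro A i a h1 h2
    rw [Fintype.sum_sum_type, map_add, map_sum, map_sum, gradSum_eq hD hx hM, gossipSum_eq hD hx hM,
      sub_eq_add_neg]
    congr 1
    · rw [Finset.sum_eq_single i]
      · rw [map_sum, Finset.smul_sum, ← Finset.sum_neg_distrib]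
        refine Finset.sum_congr rfl fun c _ => ?_
        split_ifs
        · simp only [pathJump, networkJump, Sum.elim_inl, sub_sub_cancel_left, map_neg, h1]
          simp
        · simp
      · intro i' _ hi'
        rw [map_sum]
        refine Finset.sum_eq_zero fun c _ => ?_
        split_ifs
        · simp only [pathJump, networkJump, Sum.elim_inl, sub_sub_cancel_left, map_neg, h1]
          simp [hi']
        · simp
      · simp
    · rw [Finset.smul_sum, ← Finset.sum_neg_distrib]
      refine Finset.sum_congr rfl fun e _ => ?_
      rw [map_sum, Finset.smul_sum, ← Finset.sum_neg_distrib]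
      refine Finset.sum_congr rfl fun c _ => ?_
      split_ifs
      · have : pathJump N p γ g (clockData N τ ξ θ ξ₀ ω) (fun t => x t ω) (.inr e) c =
            -(p.alpha • difference e (Function.leftLim (fun t => x t ω)
              (arr (clockData N τ ξ θ ξ₀ ω) (.inr e) c)), p.alphaTilde • difference e
              (Function.leftLim (fun t => x t ω) (arr (clockData N τ ξ θ ξ₀ ω) (.inr e) c))) := by
          refine Prod.ext ?_ ?_ <;> simp [pathJump, networkJump]
        rw [this, map_neg, h2]
      · simp
  refine Prod.ext (funext fun i => ?_) (funext fun i => ?_)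
  · exact key ((Pi.evalAddMonoidHom _ i).comp (AddMonoidHom.fst _ _)) i _
      (fun i' v => by simp [Pi.single_apply, eq_comm]) (fun y => by simp)
  · exact key ((Pi.evalAddMonoidHom _ i).comp (AddMonoidHom.snd _ _)) i _
      (fun i' v => by simp [Pi.single_apply, eq_comm]) (fun y => by simp)

open Classical in
omit [MeasurableSpace Ω] [MeasurableSpace Ξ] in
/-- The equation of the dynamic at the time `t`, in the space of states. -/
theorem state_eq {p : Params} {γ : ℝ} (hD : GoodClocks (clockData N τ ξ θ ξ₀ ω))
    (hx : IsCadlag fun t => x t ω) (hxt : IsCadlag fun t => xt t ω)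
    (eqx : ∀ t, 0 ≤ t → ∀ i, x t ω i = x 0 ω i
      + p.eta • (∫ s in (0 : ℝ)..t, (xt s ω i - x s ω i))
      - γ • gradSum g τ ξ x i t ω - p.alpha • gossipSum N θ x i t ω)
    (eqxt : ∀ t, 0 ≤ t → ∀ i, xt t ω i = xt 0 ω i
      + p.eta • (∫ s in (0 : ℝ)..t, (x s ω i - xt s ω i))
      - γ • gradSum g τ ξ x i t ω - p.alphaTilde • gossipSum N θ x i t ω)
    {t : ℝ} (ht : 0 ≤ t) {M : ℕ} (hM : ∀ k c, M ≤ c → t < arr (clockData N τ ξ θ ξ₀ ω) k c) :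
    ((x t ω, xt t ω) : State n d) = (x 0 ω, xt 0 ω)
      + p.eta • (∫ s in (0 : ℝ)..t, momentum (x s ω, xt s ω))
      + ∑ k, ∑ c ∈ Finset.range M, if arr (clockData N τ ξ θ ξ₀ ω) k c ≤ t then
          pathJump N p γ g (clockData N τ ξ θ ξ₀ ω) (fun t => x t ω) k c else 0 := by
  have hint : IntervalIntegrable (fun s => momentum ((x s ω, xt s ω) : State n d)) volume 0 t :=
    ((hx.prodMk hxt).comp_continuous continuous_momentum).intervalIntegrable le_rfl ht
  rw [sum_pathJump hD hx hM]
  refine Prod.ext (funext fun i => ?_) (funext fun i => ?_)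
  · have h1 := ContinuousLinearMap.intervalIntegral_comp_comm
      ((ContinuousLinearMap.proj (R := ℝ) (φ := fun _ : Fin n => EuclideanSpace ℝ (Fin d)) i).comp
        (ContinuousLinearMap.fst ℝ _ (Fin n → EuclideanSpace ℝ (Fin d)))) hint
    have h2 : (∫ s in (0 : ℝ)..t, momentum ((x s ω, xt s ω) : State n d)).1 i =
      ∫ s in (0 : ℝ)..t, (xt s ω i - x s ω i) := h1.symm
    simp only [Prod.fst_add, Pi.add_apply, Prod.smul_fst, Pi.smul_apply, h2]
    rw [eqx t ht i]
    abel
  · have h1 := ContinuousLinearMap.intervalIntegral_comp_comm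
      ((ContinuousLinearMap.proj (R := ℝ) (φ := fun _ : Fin n => EuclideanSpace ℝ (Fin d)) i).comp
        (ContinuousLinearMap.snd ℝ (Fin n → EuclideanSpace ℝ (Fin d)) _)) hint
    have h2 : (∫ s in (0 : ℝ)..t, momentum ((x s ω, xt s ω) : State n d)).2 i =
      ∫ s in (0 : ℝ)..t, (x s ω i - xt s ω i) := h1.symm
    simp only [Prod.snd_add, Pi.add_apply, Prod.smul_snd, Pi.smul_apply, h2]
    rw [eqxt t ht i]
    abel

open Classical in
omit [MeasurableSpace Ω] in
/-- A solution is the path computed from the words: it follows the momentum flow between the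
arrivals, and its jumps at the arrivals are those of `networkJump`. -/
theorem solution_eq_stateAt {p : Params} {γ : ℝ} {x₀ : EuclideanSpace ℝ (Fin d)}
    (hg : ∀ i, Measurable (Function.uncurry (g i)))
    (hD : GoodClocks (clockData N τ ξ θ ξ₀ ω))
    (hx : IsCadlag fun t => x t ω) (hxt : IsCadlag fun t => xt t ω)
    (eqx : ∀ t, 0 ≤ t → ∀ i, x t ω i = x 0 ω i
      + p.eta • (∫ s in (0 : ℝ)..t, (xt s ω i - x s ω i))
      - γ • gradSum g τ ξ x i t ω - p.alpha • gossipSum N θ x i t ω)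
    (eqxt : ∀ t, 0 ≤ t → ∀ i, xt t ω i = xt 0 ω i
      + p.eta • (∫ s in (0 : ℝ)..t, (x s ω i - xt s ω i))
      - γ • gradSum g τ ξ x i t ω - p.alphaTilde • gossipSum N θ x i t ω)
    (h0 : ∀ i, x 0 ω i = x₀ ∧ xt 0 ω i = x₀) {w : List (Clock N)} {s : ℝ}
    (hw : IsHistory (clockData N τ ξ θ ξ₀ ω) w s)
    (hs : ∀ k c, arr (clockData N τ ξ θ ξ₀ ω) k c ≠ s) :
    ((x s ω, xt s ω) : State n d) =
      (networkFlow N p γ g hg x₀).stateAt (clockData N τ ξ θ ξ₀ ω) w s := by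
  set D := clockData N τ ξ θ ξ₀ ω with hDdef
  set z : ℝ → State n d := fun t => (x t ω, xt t ω) with hz
  have hzc : IsCadlag z := hx.prodMk hxt
  have hmc : IsCadlag fun t => momentum (z t) := hzc.comp_continuous continuous_momentum
  -- finitely many arrivals up to a given time
  have hM : ∀ t, ∃ M, ∀ k c, M ≤ c → t < arr D k c := fun t => by
    choose c hc using fun k => hD.unbounded k t
    refine ⟨∑ k, c k, fun k m hm => (hc k).trans_le ((hD.arr_strictMono k).monotone ?_)⟩
    exact (Finset.single_le_sum (f := c) (fun _ _ => Nat.zero_le _) (Finset.mem_univ k)).trans hm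
  refine JumpFlow.eq_stateAt (z := z) hD ?_ ?_ ?_ hw hs
  -- the initial state
  · exact Prod.ext (funext fun i => (h0 i).1) (funext fun i => (h0 i).2)
  -- between the arrivals
  · intro u t hu hut hno
    have ht : 0 ≤ t := hu.trans hut
    obtain ⟨M, hM⟩ := hM t
    refine eq_momentumFlow hut (hmc.intervalIntegrable hu ht)
      (fun v hv => (hzc v (hu.trans hv.1)).1) (fun v hv => ?_) fun v hv => ?_
    · refine ⟨Set.Ioi v, self_mem_nhdsWithin, ?_⟩
      refine (hmc.measurable.aestronglyMeasurable).congr ?_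
      filter_upwards [ae_restrict_mem measurableSet_Ioi] with r hr
      rw [max_eq_left (hu.trans (hv.1.trans (le_of_lt hr)))]
    · have h1 := state_eq hD hx hxt eqx eqxt (hu.trans hv.1)
        (M := M) fun k c hc => hv.2.trans_lt (hM k c hc)
      have h2 := state_eq hD hx hxt eqx eqxt hu (M := M) fun k c hc => hut.trans_lt (hM k c hc)
      have h3 : ∀ k c, arr D k c ≤ v ↔ arr D k c ≤ u := fun k c =>
        ⟨fun h => not_lt.1 fun h' => absurd (hno k c h') (not_lt.2 (h.trans hv.2)),
          fun h => h.trans hv.1⟩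
      have h4 := intervalIntegral.integral_add_adjacent_intervals
        (hmc.intervalIntegrable le_rfl hu) (hmc.intervalIntegrable hu (hu.trans hv.1))
      rw [← hDdef] at h1 h2
      simp only [h3] at h1
      show ((x v ω, xt v ω) : State n d) = (x u ω, xt u ω) + _
      rw [h1, h2, ← h4, smul_add]
      abel
  -- at an arrival
  · intro k c l hl
    set s := arr D k c with hsdef
    have hs0 : 0 < s := hD.arr_pos k c
    obtain ⟨M, hM⟩ := hM s
    set J := pathJump N p γ g D fun t => x t ω with hJ
    have h1 := state_eq hD hx hxt eqx eqxt hs0.le (M := M) hM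
    rw [← hDdef] at h1
    -- the limit from the left of the equation
    have hlim : Tendsto z (𝓝[<] s) (𝓝 (z 0 + p.eta • (∫ r in (0 : ℝ)..s, momentum (z r)) +
        ∑ k, ∑ c ∈ Finset.range M, if arr D k c < s then J k c else 0)) := by
      have hI : Tendsto (fun t => ∫ r in (0 : ℝ)..t, momentum (z r)) (𝓝[<] s)
          (𝓝 (∫ r in (0 : ℝ)..s, momentum (z r))) := by
        have hc := intervalIntegral.continuousOn_primitive_interval'
          (hmc.intervalIntegrable le_rfl hs0.le) Set.left_mem_uIcc
        rw [Set.uIcc_of_le hs0.le] at hc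
        exact (hc s ⟨hs0.le, le_rfl⟩).mono_left (nhdsWithin_le_of_mem (Icc_mem_nhdsLT hs0))
      have hS : Tendsto (fun t => ∑ k, ∑ c ∈ Finset.range M, if arr D k c ≤ t then J k c else 0)
          (𝓝[<] s) (𝓝 (∑ k, ∑ c ∈ Finset.range M, if arr D k c < s then J k c else 0)) := by
        refine tendsto_finsetSum _ fun k _ => tendsto_finsetSum _ fun c _ => ?_
        refine Tendsto.congr' ?_ tendsto_const_nhds
        by_cases h : arr D k c < s
        · filter_upwards [Ioo_mem_nhdsLT h] with t ht
          rw [if_pos h, if_pos ht.1.le]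
        · filter_upwards [self_mem_nhdsWithin] with t ht
          rw [if_neg h, if_neg (not_le.2 (lt_of_lt_of_le ht (not_lt.1 h)))]
      refine Tendsto.congr' ?_ (((tendsto_const_nhds (x := z 0)).add (hI.const_smul p.eta)).add hS)
      filter_upwards [Ioo_mem_nhdsLT hs0] with t ht
      exact (state_eq hD hx hxt eqx eqxt ht.1.le (M := M)
        fun k c hc => ht.2.trans (hM k c hc)).symm
    have hleft := tendsto_nhds_unique hl hlim
    have hjump : z s = l + J k c := by
      -- the only event at the time `s` is the `c`-th arrival of the clock `k`
      have hsplit : ∀ k' c', (if arr D k' c' ≤ s then J k' c' else 0) =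
          (if arr D k' c' < s then J k' c' else 0) +
            if k' = k then (if c' = c then J k' c' else 0) else 0 := by
        intro k' c'
        rcases lt_trichotomy (arr D k' c') s with h | h | h
        · have : ¬ (k' = k ∧ c' = c) := by rintro ⟨rfl, rfl⟩; exact h.ne rfl
          by_cases hk : k' = k
          · have hc : c' ≠ c := fun hc => this ⟨hk, hc⟩
            simp [h, h.le, hc]
          · simp [h, h.le, hk]
        · have hk := hD.no_tie _ _ _ _ h
          subst hk
          have hc := (hD.arr_strictMono k').injective h
          subst hc
          simp [h]
        · have : ¬ (k' = k ∧ c' = c) := by rintro ⟨rfl, rfl⟩; exact h.ne rfl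
          by_cases hk : k' = k
          · have hc : c' ≠ c := fun hc => this ⟨hk, hc⟩
            simp [not_lt.2 h.le, not_le.2 h, hc]
          · simp [not_lt.2 h.le, not_le.2 h, hk]
      have hcM : c < M := by
        by_contra! h
        exact lt_irrefl _ (hM k c h)
      rw [show z s = (x s ω, xt s ω) from rfl, h1, hleft]
      simp only [← hJ, hsplit, Finset.sum_add_distrib]
      have : ∑ k', ∑ c' ∈ Finset.range M, (if k' = k then (if c' = c then J k' c' else 0) else 0)
          = J k c := by
        rw [Finset.sum_eq_single k (fun k' _ hk => by simp [hk]) (by simp)]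
        simp [hcM]
      rw [this]
      exact (add_assoc _ _ _).symm
    rw [hjump]
    have hll : Function.leftLim (fun t => x t ω) s = l.1 :=
      leftLim_eq_of_tendsto ((continuous_fst.tendsto l).comp hl)
    show l + J k c = networkJump N p γ g k l (D k c).2
    rcases k with i | e
    · rw [hJ]
      simp only [pathJump, networkJump, Sum.elim_inl, sub_sub_cancel_left]
      rw [← hsdef, hll, sub_eq_add_neg]
    · rw [hJ]
      refine Prod.ext ?_ ?_
      · simp only [pathJump, networkJump, Sum.elim_inr, Prod.fst_add, Prod.fst_sub]
        rw [← hsdef, hll]; abel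
      · simp only [pathJump, networkJump, Sum.elim_inr, Prod.snd_add, Prod.snd_sub]
        rw [← hsdef, hll]; abel

open Classical in
/-- At a given time, a solution is almost surely the state computed from the clock data. -/
theorem IsSolution.ae_eq_leftState {P : Measure Ω} [IsProbabilityMeasure P] {Q : Measure Ξ}
    [IsProbabilityMeasure Q] {p : Params} {γ : ℝ} {x₀ : EuclideanSpace ℝ (Fin d)}
    (hg : ∀ i, Measurable (Function.uncurry (g i))) (ξ₀ : Ξ) (hd : IsDriving P Q N τ ξ θ)
    (h : IsSolution P N p γ g τ ξ θ x xt) (h0 : ∀ᵐ ω ∂P, ∀ i, x 0 ω i = x₀ ∧ xt 0 ω i = x₀)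
    {T : ℝ} (hT : 0 < T) :
    ∀ᵐ ω ∂P, ((x T ω, xt T ω) : State n d) =
      (networkFlow N p γ g hg x₀).leftState T (clockData N τ ξ θ ξ₀ ω) := by
  have hc := hd.isClockData (ξ₀ := ξ₀)
  filter_upwards [hc.ae_goodClocks (clockRate_pos N), hc.ae_arr_ne_const (clockRate_pos N) T,
    h.cadlag, h.eq_x, h.eq_xt, h0] with ω hD hne hcad eqx eqxt h0
  obtain ⟨w, hw⟩ := hD.exists_history hT
  rw [JumpFlow.leftState_eq hD hw]
  exact solution_eq_stateAt hg hD hcad.1 hcad.2 eqx eqxt h0 hw hne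

end Dynamic

/-! ### The average of the workers -/

section Mean

variable {n d : ℕ}

theorem mean_add (x y : Fin n → EuclideanSpace ℝ (Fin d)) : mean (x + y) = mean x + mean y := by
  simp [mean, Finset.sum_add_distrib]

theorem mean_smul (c : ℝ) (x : Fin n → EuclideanSpace ℝ (Fin d)) : mean (c • x) = c • mean x := by
  simp only [mean, Pi.smul_apply, ← Finset.smul_sum]
  rw [smul_comm]

theorem mean_sub (x y : Fin n → EuclideanSpace ℝ (Fin d)) : mean (x - y) = mean x - mean y := by
  simp [mean, Finset.sum_sub_distrib, smul_sub]

theorem mean_single (i : Fin n) (v : EuclideanSpace ℝ (Fin d)) :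
    mean (Pi.single i v) = (1 / n : ℝ) • v := by
  simp [mean]

theorem mean_const (hn : 0 < n) (y : EuclideanSpace ℝ (Fin d)) :
    mean (fun _ : Fin n => y) = y := by
  have : (n : ℝ) ≠ 0 := by positivity
  simp [mean, ← Nat.cast_smul_eq_nsmul ℝ, smul_smul, this]

theorem continuous_mean :
    Continuous (mean : (Fin n → EuclideanSpace ℝ (Fin d)) → EuclideanSpace ℝ (Fin d)) := by
  unfold mean; fun_prop

/-- Jensen's inequality for the squared norm. -/
theorem norm_mean_sq_le (x : Fin n → EuclideanSpace ℝ (Fin d)) :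
    ‖mean x‖ ^ 2 ≤ 1 / n * ∑ i, ‖x i‖ ^ 2 := by
  have h1 : ‖mean x‖ ≤ 1 / n * ∑ i, ‖x i‖ := by
    rw [mean, norm_smul, Real.norm_of_nonneg (by positivity)]
    exact mul_le_mul_of_nonneg_left (norm_sum_le _ _) (by positivity)
  have h2 : (∑ i, ‖x i‖) ^ 2 ≤ n * ∑ i, ‖x i‖ ^ 2 := by
    simpa using sq_sum_le_card_mul_sum_sq (s := Finset.univ) (f := fun i => ‖x i‖)
  calc ‖mean x‖ ^ 2 ≤ (1 / n * ∑ i, ‖x i‖) ^ 2 := by gcongr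
    _ = (1 / n) ^ 2 * (∑ i, ‖x i‖) ^ 2 := by ring
    _ ≤ (1 / n) ^ 2 * (n * ∑ i, ‖x i‖ ^ 2) := by gcongr
    _ = 1 / n * ∑ i, ‖x i‖ ^ 2 := by
        rcases Nat.eq_zero_or_pos n with rfl | hn
        · simp
        · field_simp

end Mean

/-! ### Moments of the stochastic gradients -/

section Moments

variable {Ξ : Type*} [MeasurableSpace Ξ] {n d : ℕ} {Q : Measure Ξ} [IsProbabilityMeasure Q]
  {f : Fin n → EuclideanSpace ℝ (Fin d) → ℝ}
  {g : Fin n → EuclideanSpace ℝ (Fin d) → Ξ → EuclideanSpace ℝ (Fin d)}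

theorem IsOracle.integrable (h : IsOracle Q f g) (i : Fin n) (y : EuclideanSpace ℝ (Fin d)) :
    Integrable (g i y) Q := (h.memLp i y).integrable one_le_two

omit [IsProbabilityMeasure Q] in
theorem IsOracle.integrable_sq (h : IsOracle Q f g) (i : Fin n) (y : EuclideanSpace ℝ (Fin d)) :
    Integrable (fun ξ => ‖g i y ξ‖ ^ 2) Q := (h.memLp i y).integrable_norm_pow (by simp)

theorem IsOracle.integral_inner (h : IsOracle Q f g) (i : Fin n) (y a : EuclideanSpace ℝ (Fin d)) :
    ∫ ξ, ⟪a, g i y ξ⟫ ∂Q = ⟪a, ∇ (f i) y⟫ := by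
  rw [_root_.integral_inner (h.integrable i y), h.unbiased]

/-- The decomposition of the second moment into variance and bias. -/
theorem IsOracle.integral_sq (h : IsOracle Q f g) (i : Fin n) (y : EuclideanSpace ℝ (Fin d)) :
    ∫ ξ, ‖g i y ξ‖ ^ 2 ∂Q = ∫ ξ, ‖g i y ξ - ∇ (f i) y‖ ^ 2 ∂Q + ‖∇ (f i) y‖ ^ 2 := by
  have h1 := h.integrable_sq i y
  have h2 : Integrable (fun ξ => ⟪∇ (f i) y, g i y ξ⟫) Q := (h.integrable i y).const_inner _
  have h3 : ∀ ξ, ‖g i y ξ - ∇ (f i) y‖ ^ 2 =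
      ‖g i y ξ‖ ^ 2 - 2 * ⟪∇ (f i) y, g i y ξ⟫ + ‖∇ (f i) y‖ ^ 2 := fun ξ => by
    rw [norm_sub_sq_real, real_inner_comm]
  simp_rw [h3]
  rw [integral_add (f := fun ξ => ‖g i y ξ‖ ^ 2 - 2 * ⟪∇ (f i) y, g i y ξ⟫)
    (h1.sub (h2.const_mul 2)) (integrable_const _), integral_sub h1 (h2.const_mul 2),
    integral_const_mul, h.integral_inner, real_inner_self_eq_norm_sq]
  simp
  ring

theorem IsOracle.sum_integral_sq (h : IsOracle Q f g) (hn : 0 < n)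
    (x : Fin n → EuclideanSpace ℝ (Fin d)) :
    ∑ i, ∫ ξ, ‖g i (x i) ξ‖ ^ 2 ∂Q = n * (noise Q f g x + 1 / n * ∑ i, ‖∇ (f i) (x i)‖ ^ 2) := by
  have hn' : (n : ℝ) ≠ 0 := by positivity
  simp_rw [h.integral_sq, Finset.sum_add_distrib, noise]
  field_simp

theorem IsSmooth.norm_gradient_sq_le {L : ℝ} {h : EuclideanSpace ℝ (Fin d) → ℝ} (hs : IsSmooth L h)
    (y : EuclideanSpace ℝ (Fin d)) :
    ‖∇ h y‖ ^ 2 ≤ (2 * ‖∇ h 0‖ ^ 2 + 2 * L ^ 2) * (1 + ‖y‖ ^ 2) := by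
  have h1 := hs.2 y 0
  rw [sub_zero] at h1
  have h2 : ‖∇ h y‖ ≤ ‖∇ h 0‖ + ‖∇ h y - ∇ h 0‖ := by
    simpa using norm_add_le (∇ h 0) (∇ h y - ∇ h 0)
  have h3 : ‖∇ h y‖ ^ 2 ≤ (‖∇ h 0‖ + L * ‖y‖) ^ 2 := by gcongr; linarith
  nlinarith [sq_nonneg (‖∇ h 0‖ - L * ‖y‖), sq_nonneg (‖∇ h 0‖ * ‖y‖), sq_nonneg L]

/-- The second moment of the stochastic gradients grows at most quadratically. -/
theorem IsOracle.exists_integral_sq_le (h : IsOracle Q f g) (hn : 0 < n) {L s M : ℝ} (hM : 0 ≤ M)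
    (hs : ∀ i, IsSmooth L (f i)) (hnoise : ∀ y : Fin n → EuclideanSpace ℝ (Fin d),
      noise Q f g y ≤ s + M / n * ∑ i, ‖∇ (f i) (y i)‖ ^ 2) :
    ∃ C, 0 ≤ C ∧ ∀ x : Fin n → EuclideanSpace ℝ (Fin d),
      ∑ i, ∫ ξ, ‖g i (x i) ξ‖ ^ 2 ∂Q ≤ C * (1 + ∑ i, ‖x i‖ ^ 2) := by
  set A := ∑ i, (2 * ‖∇ (f i) 0‖ ^ 2 + 2 * L ^ 2) with hA
  have hA0 : 0 ≤ A := Finset.sum_nonneg fun i _ => by positivity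
  have hgrad : ∀ x : Fin n → EuclideanSpace ℝ (Fin d),
      ∑ i, ‖∇ (f i) (x i)‖ ^ 2 ≤ A * (1 + ∑ i, ‖x i‖ ^ 2) := fun x => by
    rw [hA, Finset.sum_mul]
    refine Finset.sum_le_sum fun i _ => ((hs i).norm_gradient_sq_le (x i)).trans ?_
    gcongr
    exact Finset.single_le_sum (f := fun i => ‖x i‖ ^ 2) (fun _ _ => by positivity)
      (Finset.mem_univ i)
  refine ⟨n * |s| + (M + 1) * A, by positivity, fun x => ?_⟩
  rw [h.sum_integral_sq hn]
  have hn' : (0 : ℝ) < n := by positivity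
  have h1 := hnoise x
  have h2 := hgrad x
  have h3 : (0 : ℝ) ≤ ∑ i, ‖x i‖ ^ 2 := Finset.sum_nonneg fun i _ => by positivity
  set G := ∑ i, ‖∇ (f i) (x i)‖ ^ 2
  set X := ∑ i, ‖x i‖ ^ 2
  calc n * (noise Q f g x + 1 / n * G) ≤ n * (|s| + M / n * G + 1 / n * G) := by
        gcongr; exact h1.trans (by gcongr; exact le_abs_self s)
    _ = n * |s| + (M + 1) * G := by field_simp; ring
    _ ≤ n * |s| * (1 + X) + (M + 1) * (A * (1 + X)) := by
        have h4 : (n : ℝ) * |s| ≤ n * |s| * (1 + X) :=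
          le_mul_of_one_le_right (by positivity) (by linarith)
        exact add_le_add h4 (mul_le_mul_of_nonneg_left h2 (by positivity))
    _ = _ := by ring

end Moments

/-! ### Test functions of the network -/

section Network

open Classical

variable {Ξ : Type*} [MeasurableSpace Ξ] {n d : ℕ} {N : Network n} {p : Params} {γ : ℝ}
  {g : Fin n → EuclideanSpace ℝ (Fin d) → Ξ → EuclideanSpace ℝ (Fin d)}
  {hg : ∀ i, Measurable (Function.uncurry (g i))} {x₀ : EuclideanSpace ℝ (Fin d)}

/-- The states for which the averages of `x` and `x̃` are the same. -/
def meanSet (n d : ℕ) : Set (State n d) := {z | mean z.1 = mean z.2}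

omit [MeasurableSpace Ξ] in
theorem mean_networkJump_inl (i : Fin n) (z : State n d) (ξ : Ξ) :
    mean (networkJump N p γ g (.inl i) z ξ).1 = mean z.1 - (γ / n) • g i (z.1 i) ξ := by
  simp only [networkJump, Sum.elim_inl, Prod.fst_sub, mean_sub, mean_single, smul_smul]
  congr 2; ring

omit [MeasurableSpace Ξ] in
theorem mean_networkJump_inr (e : N.graph.edgeSet) (z : State n d) (ξ : Ξ) :
    mean (networkJump N p γ g (.inr e) z ξ).1 = mean z.1 := by
  simp [networkJump, mean_sub, mean_smul, mean_difference]

/-- The events move the averages of `x` and of `x̃` by the same amount, and the momentum keeps them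
equal. -/
theorem isInvariant_meanSet : (networkFlow N p γ g hg x₀).IsInvariant (meanSet n d) where
  init := rfl
  flow t z hz := by
    show mean (z.1 + mixing p.eta t • (z.2 - z.1)) = mean (z.2 + mixing p.eta t • (z.1 - z.2))
    simp only [mean_add, mean_smul, mean_sub]
    rw [show mean z.1 = mean z.2 from hz]
  jump k ξ z hz := by
    have hz' : mean z.1 = mean z.2 := hz
    rcases k with i | e
    · show mean (z.1 - _) = mean (z.2 - _)
      rw [mean_sub, mean_sub, hz']
    · show mean (z.1 - _) = mean (z.2 - _)
      rw [mean_sub, mean_sub, hz', mean_smul, mean_smul, mean_difference, smul_zero, smul_zero]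

theorem hasDerivAt_mixing_quadratic (η a b c : ℝ) :
    HasDerivAt (fun t => a + 2 * mixing η t * b + mixing η t ^ 2 * c) (2 * η * b) 0 := by
  have h1 := hasDerivAt_mixing η
  have h2 := (((h1.const_mul 2).mul_const b).const_add a).add ((h1.pow 2).mul_const c)
  refine h2.congr_deriv ?_
  simp [mixing_zero]

/-- The weight that controls the moments of the state. -/
noncomputable def weight (z : State n d) : ℝ := 1 + (∑ i, ‖z.1 i‖ ^ 2 + ∑ i, ‖z.2 i‖ ^ 2)

/-- The derivative of the weight along the momentum. -/
noncomputable def weightDeriv (p : Params) (z : State n d) : ℝ :=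
  2 * p.eta * (∑ i, ⟪z.1 i, z.2 i - z.1 i⟫ + ∑ i, ⟪z.2 i, z.1 i - z.2 i⟫)

theorem one_le_weight (z : State n d) : 1 ≤ weight z :=
  le_add_of_nonneg_right (by positivity)

theorem weight_sub_le (z w : State n d) : weight (z - w) ≤ 2 * weight z + 2 * (weight w - 1) := by
  have h : ∀ a b : EuclideanSpace ℝ (Fin d),
      ‖a - b‖ ^ 2 ≤ 2 * ‖a‖ ^ 2 + 2 * ‖b‖ ^ 2 := fun a b => by
    have := parallelogram_law_with_norm ℝ a b
    nlinarith [norm_nonneg (a + b)]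
  have h1 := Finset.sum_le_sum fun i (_ : i ∈ Finset.univ) => h (z.1 i) (w.1 i)
  have h2 := Finset.sum_le_sum fun i (_ : i ∈ Finset.univ) => h (z.2 i) (w.2 i)
  rw [Finset.sum_add_distrib, ← Finset.mul_sum, ← Finset.mul_sum] at h1 h2
  simp only [weight, Prod.fst_sub, Prod.snd_sub, Pi.sub_apply]
  linarith

theorem sum_norm_difference_le (e : Sym2 (Fin n)) (x : Fin n → EuclideanSpace ℝ (Fin d)) :
    ∑ i, ‖difference e x i‖ ^ 2 ≤ 4 * ∑ i, ‖x i‖ ^ 2 := by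
  rw [sum_norm_sq_eq, sum_norm_sq_eq, Finset.mul_sum]
  refine Finset.sum_le_sum fun k _ => ?_
  rw [coord_difference]
  have h1 := edgeMatrix_self e (coord k x)
  have h2 := dotProduct_self_nonneg' ((2 : ℝ) • coord k x - edgeMatrix e *ᵥ coord k x)
  simp only [sub_dotProduct, dotProduct_sub, smul_dotProduct, dotProduct_smul, smul_eq_mul,
    dotProduct_comm (edgeMatrix e *ᵥ coord k x) (coord k x)] at h2
  linarith

variable {Q : Measure Ξ} [IsProbabilityMeasure Q]
  {f : Fin n → EuclideanSpace ℝ (Fin d) → ℝ} {ξ₀ : Ξ}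

/-- Since the second moments of the stochastic gradients grow at most quadratically, every event
increases the weight by a factor at most, on average. The constant adds up the factors of the
momentum, of the gradient steps and of the communications. -/
theorem exists_isWeight (ho : IsOracle Q f g) (hn : 0 < n) {L s M : ℝ} (hM : 0 ≤ M)
    (hs : ∀ i, IsSmooth L (f i)) (hnoise : ∀ y : Fin n → EuclideanSpace ℝ (Fin d),
      noise Q f g y ≤ s + M / n * ∑ i, ‖∇ (f i) (y i)‖ ^ 2) :
    ∃ C, (networkFlow N p γ g hg x₀).IsWeight (meanSet n d) (markLaw N Q ξ₀) weight
      (weightDeriv p) C := by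
  obtain ⟨C₀, hC₀, hmom⟩ := ho.exists_integral_sq_le hn hM hs hnoise
  have hw1 : ∀ z : State n d, 0 ≤ weight z := fun z => zero_le_one.trans (one_le_weight z)
  -- the effect of a gradient step on the weight
  have hgrad : ∀ i (z : State n d) ξ, weight (networkJump N p γ g (.inl i) z ξ) ≤
      2 * weight z + 4 * (γ ^ 2 * ‖g i (z.1 i) ξ‖ ^ 2) := fun i z ξ => by
    refine (weight_sub_le _ _).trans ?_
    have : ∑ j, ‖(Pi.single i (γ • g i (z.1 i) ξ) : Fin n → EuclideanSpace ℝ (Fin d)) j‖ ^ 2 =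
        γ ^ 2 * ‖g i (z.1 i) ξ‖ ^ 2 := by
      rw [Finset.sum_eq_single i (fun j _ hj => by simp [hj]) (by simp)]
      simp [norm_smul, mul_pow]
    simp only [weight, this]
    linarith
  have hgradint : ∀ i (z : State n d),
      Integrable (fun ξ => 2 * weight z + 4 * (γ ^ 2 * ‖g i (z.1 i) ξ‖ ^ 2)) Q := fun i z =>
    (integrable_const _).add (((ho.integrable_sq i _).const_mul _).const_mul _)
  have hcont : Continuous (weight : State n d → ℝ) := by unfold weight; fun_prop
  have hmeas : ∀ k (z : State n d), Measurable fun ξ => weight (networkJump N p γ g k z ξ) :=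
    fun k z => JumpFlow.measurable_comp_jump (F := networkFlow N p γ g hg x₀) hcont k z
  have hint : ∀ k (z : State n d), Integrable (fun ξ => weight (networkJump N p γ g k z ξ))
      (markLaw N Q ξ₀ k) := fun k z => by
    rcases k with i | e
    · exact (hgradint i z).mono' (hmeas _ z).aestronglyMeasurable (Eventually.of_forall fun ξ => by
        rw [Real.norm_of_nonneg (hw1 _)]; exact hgrad i z ξ)
    · exact integrable_const (weight (networkJump N p γ g (.inr e) z ξ₀))
  refine ⟨4 * |p.eta| + (2 + 4 * γ ^ 2 * C₀) + (2 + 8 * (p.alpha ^ 2 + p.alphaTilde ^ 2)), ?_, hw1,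
    by positivity, ?_, fun k z _ => hint k z, ?_⟩
  · refine ⟨hcont, by unfold weightDeriv; fun_prop, fun z _ => ?_⟩
    have hsq : ∀ (r : ℝ) (a b : EuclideanSpace ℝ (Fin d)),
        ‖a + r • b‖ ^ 2 = ‖a‖ ^ 2 + 2 * r * ⟪a, b⟫ + r ^ 2 * ‖b‖ ^ 2 := fun r a b => by
      rw [norm_add_sq_real, inner_smul_right, norm_smul, mul_pow, Real.norm_eq_abs, sq_abs]; ring
    have he : ∀ t, weight ((networkFlow N p γ g hg x₀).flow t z) = weight z +
        2 * mixing p.eta t * (∑ i, ⟪z.1 i, z.2 i - z.1 i⟫ + ∑ i, ⟪z.2 i, z.1 i - z.2 i⟫) +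
        mixing p.eta t ^ 2 * (∑ i, ‖z.2 i - z.1 i‖ ^ 2 + ∑ i, ‖z.1 i - z.2 i‖ ^ 2) := fun t => by
      show 1 + (∑ i, ‖z.1 i + mixing p.eta t • (z.2 i - z.1 i)‖ ^ 2 +
        ∑ i, ‖z.2 i + mixing p.eta t • (z.1 i - z.2 i)‖ ^ 2) = _
      simp only [hsq, Finset.sum_add_distrib, ← Finset.mul_sum, weight]
      ring
    simp only [he]
    exact hasDerivAt_mixing_quadratic _ _ _ _
  -- the growth along the momentum
  · intro z _
    have h1 : ∑ i, ⟪z.1 i, z.2 i - z.1 i⟫ + ∑ i, ⟪z.2 i, z.1 i - z.2 i⟫ =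
        -∑ i, ‖z.1 i - z.2 i‖ ^ 2 := by
      rw [← Finset.sum_add_distrib, ← Finset.sum_neg_distrib]
      refine Finset.sum_congr rfl fun i _ => ?_
      rw [norm_sub_sq_real, inner_sub_right, inner_sub_right, real_inner_self_eq_norm_sq,
        real_inner_self_eq_norm_sq, real_inner_comm]
      ring
    have h2 : ∑ i, ‖z.1 i - z.2 i‖ ^ 2 ≤ 2 * weight z := by
      have : ∑ i, ‖z.1 i - z.2 i‖ ^ 2 ≤ ∑ i, (2 * ‖z.1 i‖ ^ 2 + 2 * ‖z.2 i‖ ^ 2) :=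
        Finset.sum_le_sum fun i _ => by
          have := parallelogram_law_with_norm ℝ (z.1 i) (z.2 i)
          nlinarith [norm_nonneg (z.1 i + z.2 i)]
      rw [Finset.sum_add_distrib, ← Finset.mul_sum, ← Finset.mul_sum] at this
      unfold weight; linarith
    have h3 : 0 ≤ ∑ i, ‖z.1 i - z.2 i‖ ^ 2 := by positivity
    have h4 := hw1 z
    rw [weightDeriv, h1, abs_mul, abs_mul, abs_neg, abs_of_nonneg h3, abs_two]
    have h5 : 2 * |p.eta| * ∑ i, ‖z.1 i - z.2 i‖ ^ 2 ≤ 2 * |p.eta| * (2 * weight z) := by gcongr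
    have h6 : 0 ≤
        ((2 + 4 * γ ^ 2 * C₀) + (2 + 8 * (p.alpha ^ 2 + p.alphaTilde ^ 2))) * weight z := by
      positivity
    linarith
  -- the growth at the events
  · intro k z _
    have h4 := hw1 z
    rcases k with i | e
    · have h1 : ∫ ξ, weight (networkJump N p γ g (.inl i) z ξ) ∂Q ≤
          2 * weight z + 4 * (γ ^ 2 * ∫ ξ, ‖g i (z.1 i) ξ‖ ^ 2 ∂Q) := by
        refine (integral_mono (hint (.inl i) z) (hgradint i z) (hgrad i z)).trans_eq ?_
        show ∫ ξ, 2 * weight z + 4 * (γ ^ 2 * ‖g i (z.1 i) ξ‖ ^ 2) ∂Q = _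
        rw [integral_add (integrable_const _) (((ho.integrable_sq i _).const_mul _).const_mul _),
          integral_const_mul, integral_const_mul]
        simp [integral_const_mul]
      have h2 : ∫ ξ, ‖g i (z.1 i) ξ‖ ^ 2 ∂Q ≤ C₀ * weight z := by
        refine (Finset.single_le_sum (f := fun i => ∫ ξ, ‖g i (z.1 i) ξ‖ ^ 2 ∂Q)
          (fun i _ => integral_nonneg fun ξ => by positivity) (Finset.mem_univ i)).trans
          ((hmom z.1).trans ?_)
        unfold weight
        gcongr
        exact le_add_of_nonneg_right (by positivity)
      have h3 : γ ^ 2 * ∫ ξ, ‖g i (z.1 i) ξ‖ ^ 2 ∂Q ≤ γ ^ 2 * (C₀ * weight z) := by gcongr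
      have h6 : 0 ≤ (4 * |p.eta| + (2 + 8 * (p.alpha ^ 2 + p.alphaTilde ^ 2))) * weight z := by
        positivity
      refine h1.trans ?_
      linarith
    · have h1 : ∫ ξ, weight (networkJump N p γ g (.inr e) z ξ) ∂(markLaw N Q ξ₀ (.inr e)) =
          weight (networkJump N p γ g (.inr e) z ξ₀) := by
        have h0 : ∀ ξ, weight (networkJump N p γ g (.inr e) z ξ) =
          weight (networkJump N p γ g (.inr e) z ξ₀) := fun _ => rfl
        simp only [h0]
        simp
      refine (h1.trans_le ?_)
      refine (weight_sub_le z
        (p.alpha • difference e z.1, p.alphaTilde • difference e z.1)).trans ?_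
      have h2 := sum_norm_difference_le (e : Sym2 (Fin n)) z.1
      have h3 : ∀ c : ℝ, ∑ i, ‖(c • difference (e : Sym2 (Fin n)) z.1) i‖ ^ 2 ≤
          c ^ 2 * (4 * ∑ i, ‖z.1 i‖ ^ 2) := fun c => by
        simp only [Pi.smul_apply, norm_smul, mul_pow, Real.norm_eq_abs, sq_abs, ← Finset.mul_sum]
        gcongr
      have h5 : ∑ i, ‖z.1 i‖ ^ 2 ≤ weight z := by
        unfold weight
        have : 0 ≤ ∑ i, ‖z.2 i‖ ^ 2 := by positivity
        linarith
      have h6 : 0 ≤ (4 * |p.eta| + (2 + 4 * γ ^ 2 * C₀)) * weight z := by positivity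
      have h7 : (p.alpha ^ 2 + p.alphaTilde ^ 2) * ∑ i, ‖z.1 i‖ ^ 2 ≤
        (p.alpha ^ 2 + p.alphaTilde ^ 2) * weight z := by gcongr
      have h8 := h3 p.alpha
      have h9 := h3 p.alphaTilde
      have h10 : weight ((p.alpha • difference (e : Sym2 (Fin n)) z.1,
        p.alphaTilde • difference (e : Sym2 (Fin n)) z.1) : State n d) =
        1 + (∑ i, ‖(p.alpha • difference (e : Sym2 (Fin n)) z.1) i‖ ^ 2 +
          ∑ i, ‖(p.alphaTilde • difference (e : Sym2 (Fin n)) z.1) i‖ ^ 2) := rfl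
      rw [h10]
      linarith

end Network

/-! ### The Lyapunov functions -/

section Lyapunov

open Classical

variable {Ξ : Type*} [MeasurableSpace Ξ] {n d : ℕ} {N : Network n} {p : Params} {γ β c : ℝ}
  {g : Fin n → EuclideanSpace ℝ (Fin d) → Ξ → EuclideanSpace ℝ (Fin d)}
  {hg : ∀ i, Measurable (Function.uncurry (g i))} {x₀ : EuclideanSpace ℝ (Fin d)}
  {h : EuclideanSpace ℝ (Fin d) → ℝ}

/-- The Lyapunov function: a function of the average, plus a multiple of the consensus energy. -/
noncomputable def lyapunov (N : Network n) (β c : ℝ) (h : EuclideanSpace ℝ (Fin d) → ℝ)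
    (z : State n d) : ℝ := h (mean z.1) + c * consensusEnergy N β z

/-- The derivative of the Lyapunov function along the momentum, which does not move the average. -/
noncomputable def lyapunovDeriv (N : Network n) (p : Params) (β c : ℝ) (z : State n d) : ℝ :=
  c * (2 * p.eta * consensusForm N β z (momentum z))

theorem isTest_lyapunov (hh : Continuous h) : (networkFlow N p γ g hg x₀).IsTest (meanSet n d)
    (lyapunov N β c h) (lyapunovDeriv N p β c) where
  continuous := by
    have h1 : Continuous fun z : State n d => h (mean z.1) :=
      hh.comp (continuous_mean.comp continuous_fst)
    have h2 := continuous_consensusEnergy (N := N) (β := β) (d := d)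
    exact h1.add (continuous_const.mul h2)
  continuous_deriv := by
    have h1 := continuous_consensusForm (N := N) (β := β) (X := State n d) continuous_id
      (continuous_momentum (E := Fin n → EuclideanSpace ℝ (Fin d)))
    exact continuous_const.mul (continuous_const.mul h1)
  hasDerivAt z hz := by
    have hmean : ∀ t, mean ((networkFlow N p γ g hg x₀).flow t z).1 = mean z.1 := fun t => by
      show mean (z.1 + mixing p.eta t • (z.2 - z.1)) = _
      rw [mean_add, mean_smul, mean_sub, show mean z.1 = mean z.2 from hz]
      simp
    have henergy : ∀ t, consensusEnergy N β ((networkFlow N p γ g hg x₀).flow t z) =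
        consensusEnergy N β z + 2 * mixing p.eta t * consensusForm N β z (momentum z) +
          mixing p.eta t ^ 2 * consensusForm N β (momentum z) (momentum z) := fun t =>
      consensusEnergy_add_smul _ _ _
    simp only [lyapunov, hmean, henergy]
    exact ((hasDerivAt_mixing_quadratic _ _ _ _).const_mul c).const_add _

theorem sum_norm_sq_le_weight (z : State n d) :
    ∑ i, ‖z.1 i‖ ^ 2 + ∑ i, ‖z.2 i‖ ^ 2 ≤ weight z := by
  unfold weight; linarith

theorem norm_mean_sq_le_weight (hn : 0 < n) (z : State n d) : ‖mean z.1‖ ^ 2 ≤ weight z := by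
  have hn' : (1 : ℝ) ≤ n := by exact_mod_cast hn
  have h1 : 0 ≤ ∑ i, ‖z.1 i‖ ^ 2 := by positivity
  have h2 : 0 ≤ ∑ i, ‖z.2 i‖ ^ 2 := by positivity
  have h3 : 1 / (n : ℝ) * ∑ i, ‖z.1 i‖ ^ 2 ≤ 1 * ∑ i, ‖z.1 i‖ ^ 2 := by
    gcongr
    rw [div_le_one (by linarith)]
    exact hn'
  have := norm_mean_sq_le z.1
  have := sum_norm_sq_le_weight z
  linarith

/-- A Lyapunov function of quadratic growth is dominated by the weight, and so is its derivative. -/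
theorem exists_lyapunov_le (hn : 0 < n) (hN : chi1 N < ∞) (hβ : IsEnergyWeight N p β) {A : ℝ}
    (hA : ∀ y, |h y| ≤ A * (1 + ‖y‖ ^ 2)) :
    ∃ B, (∀ z : State n d, |lyapunov N β c h z| ≤ B * weight z) ∧
      ∀ z : State n d, |lyapunovDeriv N p β c z| ≤ B * weight z := by
  have hA0 : 0 ≤ A := by
    have := (abs_nonneg _).trans (hA 0)
    simpa using this
  have hw : ∀ z : State n d, 1 ≤ weight z := one_le_weight
  have hW : ∀ z : State n d, consensusEnergy N β z ≤ weight z := fun z =>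
    (consensusEnergy_le hN hβ.nonneg hβ.mul_chi1_le z).trans (sum_norm_sq_le_weight z)
  have hW0 : ∀ z : State n d, 0 ≤ consensusEnergy N β z := consensusEnergy_nonneg hβ.nonneg
  have h1 : ∀ z : State n d, |h (mean z.1)| ≤ 2 * A * weight z := fun z => by
    refine (hA _).trans ?_
    have := norm_mean_sq_le_weight hn z
    have h2 : A * (1 + ‖mean z.1‖ ^ 2) ≤ A * (2 * weight z) := by
      gcongr; linarith [hw z]
    linarith
  refine ⟨2 * A + |c| + |c| * |p.eta| * 9, fun z => ?_, fun z => ?_⟩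
  · have h2 : |c * consensusEnergy N β z| ≤ |c| * weight z := by
      rw [abs_mul, abs_of_nonneg (hW0 z)]
      exact mul_le_mul_of_nonneg_left (hW z) (abs_nonneg c)
    have h3 : 0 ≤ |c| * |p.eta| * 9 * weight z := by
      have := hw z
      positivity
    refine (abs_add_le _ _).trans ?_
    linarith [h1 z]
  · -- the Cauchy-Schwarz inequality for the energy
    have hp := hW0 (z + (1 : ℝ) • momentum z)
    have hm := hW0 (z + (-1 : ℝ) • momentum z)
    rw [consensusEnergy_add_smul] at hp hm
    have hmm : consensusForm N β (momentum z) (momentum z) ≤ 8 * weight z := by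
      refine (consensusEnergy_le hN hβ.nonneg hβ.mul_chi1_le (momentum z)).trans ?_
      have hs : ∀ a b : EuclideanSpace ℝ (Fin d), ‖a - b‖ ^ 2 ≤ 2 * ‖a‖ ^ 2 + 2 * ‖b‖ ^ 2 :=
        fun a b => by
          have := parallelogram_law_with_norm ℝ a b
          nlinarith [norm_nonneg (a + b)]
      have h1 := Finset.sum_le_sum fun i (_ : i ∈ Finset.univ) => hs (z.2 i) (z.1 i)
      have h2 := Finset.sum_le_sum fun i (_ : i ∈ Finset.univ) => hs (z.1 i) (z.2 i)
      rw [Finset.sum_add_distrib, ← Finset.mul_sum, ← Finset.mul_sum] at h1 h2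
      have h3 := sum_norm_sq_le_weight z
      have h4 := hw z
      simp only [momentum, Pi.sub_apply]
      linarith
    have hb : |2 * consensusForm N β z (momentum z)| ≤ 9 * weight z := by
      rw [abs_le]
      have := hW z
      constructor <;> linarith
    have h3 : |lyapunovDeriv N p β c z| =
        |c| * |p.eta| * |2 * consensusForm N β z (momentum z)| := by
      rw [lyapunovDeriv, ← abs_mul, ← abs_mul]
      congr 1; ring
    rw [h3]
    have h4 : |c| * |p.eta| * |2 * consensusForm N β z (momentum z)| ≤
      |c| * |p.eta| * (9 * weight z) := by gcongr
    have h5 : 0 ≤ (2 * A + |c|) * weight z := by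
      have := hw z
      positivity
    linarith

variable {Q : Measure Ξ} [IsProbabilityMeasure Q]
  {f : Fin n → EuclideanSpace ℝ (Fin d) → ℝ} {ξ₀ : Ξ}

/-- The generator at a Lyapunov function whose part `h` has a quadratic upper bound of slope `a` and
curvature `2 b`. The first term is the contraction of the consensus energy by the momentum and
the communications, which do not move the average. The others come from the gradient steps: a
worker makes one per unit of time, which moves the average by `γ / n` times a stochastic
gradient. -/
theorem gen_lyapunov_le (ho : IsOracle Q f g) (hn : 0 < n) (hN : chi1 N < ∞)
    (hβ : IsEnergyWeight N p β) (hc : 0 ≤ c) (hh : Continuous h) {A : ℝ}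
    (hA : ∀ y, |h y| ≤ A * (1 + ‖y‖ ^ 2)) {L s M : ℝ} (hM : 0 ≤ M)
    (hs : ∀ i, IsSmooth L (f i)) (hnoise : ∀ y : Fin n → EuclideanSpace ℝ (Fin d),
      noise Q f g y ≤ s + M / n * ∑ i, ‖∇ (f i) (y i)‖ ^ 2) {b : ℝ}
    {a : EuclideanSpace ℝ (Fin d) → EuclideanSpace ℝ (Fin d)}
    (ha : ∀ y u, h (y - u) - h y ≤ -⟪a y, u⟫ + b * ‖u‖ ^ 2) {z : State n d}
    (hz : z ∈ meanSet n d) :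
    (networkFlow N p γ g hg x₀).gen (clockRate N) (markLaw N Q ξ₀) (lyapunov N β (c / n) h)
      (lyapunovDeriv N p β (c / n)) z ≤
    -(c / n) * (1 / (2 * (1 + p.chi))) * consensusEnergy N β z
      - γ / n * ∑ i, ⟪a (mean z.1), ∇ (f i) (z.1 i)⟫
      - 2 * (c / n) * γ * ∑ i, ⟪energyGradient N β z i, ∇ (f i) (z.1 i)⟫
      + (b * γ ^ 2 / n + 2 * c * γ ^ 2) *
        (noise Q f g z.1 + 1 / n * ∑ i, ‖∇ (f i) (z.1 i)‖ ^ 2) := by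
  have hn' : (0 : ℝ) < n := by positivity
  obtain ⟨C, hw⟩ := exists_isWeight (N := N) (p := p) (γ := γ) (hg := hg) (x₀ := x₀) (ξ₀ := ξ₀)
    ho hn hM hs hnoise
  obtain ⟨B, hB, -⟩ := exists_lyapunov_le (c := c / n) hn hN hβ hA
  set φ : State n d → ℝ := lyapunov N β (c / n) h with hφ
  have hφc : Continuous φ :=
    (isTest_lyapunov (N := N) (p := p) (γ := γ) (hg := hg) (x₀ := x₀) hh).continuous
  set G : Fin n → ℝ := fun i => ∫ ξ, ‖g i (z.1 i) ξ‖ ^ 2 ∂Q with hG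
  -- the gradient steps
  have hgrad : ∀ i, ∫ ξ, (φ (networkJump N p γ g (.inl i) z ξ) - φ z) ∂Q ≤
      -(γ / n) * ⟪a (mean z.1), ∇ (f i) (z.1 i)⟫
      - 2 * (c / n) * γ * ⟪energyGradient N β z i, ∇ (f i) (z.1 i)⟫
      + (b * (γ / n) ^ 2 + 2 * (c / n) * γ ^ 2) * G i := fun i => by
    have hint1 : Integrable (fun ξ => φ (networkJump N p γ g (.inl i) z ξ) - φ z) Q := by
      refine Integrable.sub ?_ (integrable_const _)
      refine ((hw.integrable (.inl i) z hz).const_mul B).mono'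
        (JumpFlow.measurable_comp_jump (F := networkFlow N p γ g hg x₀) hφc (.inl i)
          z).aestronglyMeasurable (Eventually.of_forall fun ξ => ?_)
      exact hB _
    have hI1 : Integrable (fun ξ => ⟪a (mean z.1), g i (z.1 i) ξ⟫) Q :=
      (ho.integrable i _).const_inner _
    have hI2 : Integrable (fun ξ => ⟪energyGradient N β z i, g i (z.1 i) ξ⟫) Q :=
      (ho.integrable i _).const_inner _
    have hI3 := ho.integrable_sq i (z.1 i)
    have hJ1 := hI1.const_mul (-(γ / n))
    have hJ2 := hI2.const_mul (2 * (c / n) * γ)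
    have hJ3 := hI3.const_mul (b * (γ / n) ^ 2 + 2 * (c / n) * γ ^ 2)
    have hle : ∀ ξ, φ (networkJump N p γ g (.inl i) z ξ) - φ z ≤
        -(γ / n) * ⟪a (mean z.1), g i (z.1 i) ξ⟫
        - 2 * (c / n) * γ * ⟪energyGradient N β z i, g i (z.1 i) ξ⟫
        + (b * (γ / n) ^ 2 + 2 * (c / n) * γ ^ 2) * ‖g i (z.1 i) ξ‖ ^ 2 := fun ξ => by
      have h1 := ha (mean z.1) ((γ / n) • g i (z.1 i) ξ)
      rw [← mean_networkJump_inl (N := N) (p := p) (γ := γ), inner_smul_right, norm_smul, mul_pow,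
        Real.norm_eq_abs, sq_abs] at h1
      have h2 := consensusEnergy_sub_single_le hN hβ.nonneg hβ.mul_chi1_le z i
        (γ • g i (z.1 i) ξ)
      rw [inner_smul_right, norm_smul, mul_pow, Real.norm_eq_abs, sq_abs] at h2
      have h3 := mul_le_mul_of_nonneg_left h2 (div_nonneg hc hn'.le)
      have h4 : φ (networkJump N p γ g (.inl i) z ξ) - φ z =
          (h (mean (networkJump N p γ g (.inl i) z ξ).1) - h (mean z.1)) +
          c / n * (consensusEnergy N β (z - (Pi.single i (γ • g i (z.1 i) ξ),
            Pi.single i (γ • g i (z.1 i) ξ))) - consensusEnergy N β z) := by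
        simp only [hφ, lyapunov, networkJump, Sum.elim_inl]
        ring
      rw [h4]
      linarith
    refine (integral_mono hint1 ((hJ1.sub hJ2).add hJ3) hle).trans_eq ?_
    show ∫ ξ, (-(γ / n) * ⟪a (mean z.1), g i (z.1 i) ξ⟫
        - 2 * (c / n) * γ * ⟪energyGradient N β z i, g i (z.1 i) ξ⟫
        + (b * (γ / n) ^ 2 + 2 * (c / n) * γ ^ 2) * ‖g i (z.1 i) ξ‖ ^ 2) ∂Q = _
    rw [integral_add (f := fun ξ => -(γ / n) * ⟪a (mean z.1), g i (z.1 i) ξ⟫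
        - 2 * (c / n) * γ * ⟪energyGradient N β z i, g i (z.1 i) ξ⟫) (hJ1.sub hJ2) hJ3,
      integral_sub hJ1 hJ2, integral_const_mul, integral_const_mul, integral_const_mul,
      ho.integral_inner, ho.integral_inner]
  -- the communications
  have hcomm : ∀ e : N.graph.edgeSet,
      ∫ ξ, (φ (networkJump N p γ g (.inr e) z ξ) - φ z) ∂(markLaw N Q ξ₀ (.inr e)) =
      c / n * (consensusEnergy N β (z.1 - p.alpha • difference e z.1,
        z.2 - p.alphaTilde • difference e z.1) - consensusEnergy N β z) := fun e => by
    have h1 : ∀ ξ, φ (networkJump N p γ g (.inr e) z ξ) - φ z =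
        c / n * (consensusEnergy N β (z.1 - p.alpha • difference e z.1,
          z.2 - p.alphaTilde • difference e z.1) - consensusEnergy N β z) := fun ξ => by
      simp only [hφ, lyapunov, mean_networkJump_inr]
      simp only [networkJump, Sum.elim_inr]
      ring
    simp only [h1]
    simp
  have hsum : ∑ e : N.graph.edgeSet, clockRate N (.inr e) *
      (c / n * (consensusEnergy N β (z.1 - p.alpha • difference (e : Sym2 (Fin n)) z.1,
        z.2 - p.alphaTilde • difference (e : Sym2 (Fin n)) z.1) - consensusEnergy N β z)) =
      c / n * ∑ e ∈ N.graph.edgeFinset, N.rate e * (consensusEnergy N β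
        (z.1 - p.alpha • difference e z.1, z.2 - p.alphaTilde • difference e z.1)
          - consensusEnergy N β z) := by
    rw [Finset.mul_sum, ← Finset.sum_coe_sort N.graph.edgeFinset]
    refine Fintype.sum_equiv (Equiv.subtypeEquivRight fun e => by simp) _ _ fun e => ?_
    simp only [clockRate, Sum.elim_inr, Equiv.subtypeEquivRight_apply_coe]
    ring
  have hdrift := mul_le_mul_of_nonneg_left (hβ.consensus_drift_le z) (div_nonneg hc hn'.le)
  have hgs : ∑ i, clockRate N (.inl i) *
      ∫ ξ, (φ (networkJump N p γ g (.inl i) z ξ) - φ z) ∂(markLaw N Q ξ₀ (.inl i)) ≤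
      - (γ / n) * ∑ i, ⟪a (mean z.1), ∇ (f i) (z.1 i)⟫
      - 2 * (c / n) * γ * ∑ i, ⟪energyGradient N β z i, ∇ (f i) (z.1 i)⟫
      + (b * γ ^ 2 / n + 2 * c * γ ^ 2) *
        (noise Q f g z.1 + 1 / n * ∑ i, ‖∇ (f i) (z.1 i)‖ ^ 2) := by
    have h1 := ho.sum_integral_sq hn z.1
    have h2 : (b * γ ^ 2 / n + 2 * c * γ ^ 2) *
        (noise Q f g z.1 + 1 / n * ∑ i, ‖∇ (f i) (z.1 i)‖ ^ 2) =
        (b * (γ / n) ^ 2 + 2 * (c / n) * γ ^ 2) * ∑ i, G i := by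
      rw [h1]; field_simp
    rw [h2, Finset.mul_sum, Finset.mul_sum, Finset.mul_sum, ← Finset.sum_sub_distrib,
      ← Finset.sum_add_distrib]
    refine Finset.sum_le_sum fun i _ => ?_
    rw [show clockRate N (.inl i) = 1 from rfl, one_mul]
    exact hgrad i
  unfold JumpFlow.gen
  rw [Fintype.sum_sum_type]
  show lyapunovDeriv N p β (c / n) z + (∑ i, clockRate N (.inl i) *
      ∫ ξ, (φ (networkJump N p γ g (.inl i) z ξ) - φ z) ∂(markLaw N Q ξ₀ (.inl i)) +
    ∑ e : N.graph.edgeSet, clockRate N (.inr e) *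
      ∫ ξ, (φ (networkJump N p γ g (.inr e) z ξ) - φ z) ∂(markLaw N Q ξ₀ (.inr e))) ≤ _
  rw [show ∑ e : N.graph.edgeSet, clockRate N (.inr e) *
      ∫ ξ, (φ (networkJump N p γ g (.inr e) z ξ) - φ z) ∂(markLaw N Q ξ₀ (.inr e)) = _ from
    (Finset.sum_congr rfl fun e _ => by rw [hcomm e]).trans hsum]
  have hd : lyapunovDeriv N p β (c / n) z =
    c / n * (2 * p.eta * consensusForm N β z (z.2 - z.1, z.1 - z.2)) := rfl
  rw [hd]
  linarith

end Lyapunov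

/-! ### Decrease of the Lyapunov function under strong convexity -/

section StronglyConvex

variable {Ξ : Type*} [MeasurableSpace Ξ] {n d : ℕ} {N : Network n} {p : Params} {γ β : ℝ}
  {g : Fin n → EuclideanSpace ℝ (Fin d) → Ξ → EuclideanSpace ℝ (Fin d)}
  {hg : ∀ i, Measurable (Function.uncurry (g i))} {x₀ : EuclideanSpace ℝ (Fin d)}
  {f : Fin n → EuclideanSpace ℝ (Fin d) → ℝ}

/-- Young's inequality. -/
theorem two_mul_inner_le {s : ℝ} (hs : 0 < s) (a b : EuclideanSpace ℝ (Fin d)) :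
    2 * ⟪a, b⟫ ≤ s * ‖a‖ ^ 2 + 1 / s * ‖b‖ ^ 2 := by
  have h1 := real_inner_le_norm a b
  have h2 : 0 ≤ 1 / s * (s * ‖a‖ - ‖b‖) ^ 2 := by positivity
  have h3 : 1 / s * (s * ‖a‖ - ‖b‖) ^ 2 = s * ‖a‖ ^ 2 + 1 / s * ‖b‖ ^ 2 - 2 * (‖a‖ * ‖b‖) := by
    field_simp; ring
  linarith

theorem noise_nonneg (Q : Measure Ξ) (y : Fin n → EuclideanSpace ℝ (Fin d)) :
    0 ≤ noise Q f g y := by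
  unfold noise
  exact mul_nonneg (by positivity)
    (Finset.sum_nonneg fun i _ => integral_nonneg fun ξ => by positivity)

/-- The strong convexity constant is at most the smoothness constant, unless the space is
trivial, in which case there is no consensus energy. -/
theorem mul_consensusEnergy_le {μ L : ℝ} {h : EuclideanSpace ℝ (Fin d) → ℝ}
    (hc : StrongConvexOn Set.univ μ h) (hs : IsSmooth L h) (hβ : 0 ≤ β) (z : State n d) :
    μ * consensusEnergy N β z ≤ L * consensusEnergy N β z := by
  rcases subsingleton_or_nontrivial (EuclideanSpace ℝ (Fin d)) with hsub | hnt
  · have : z = (fun _ => 0, fun _ => 0) := by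
      ext i <;> exact congrArg (fun v : EuclideanSpace ℝ (Fin d) => v _) (Subsingleton.elim _ _)
    rw [this, consensusEnergy_eq_zero]; simp
  · obtain ⟨y, hy⟩ := exists_ne (0 : EuclideanSpace ℝ (Fin d))
    have h1 := StrongConvexOn.le_inner hc hs.1 y 0
    have h2 := real_inner_le_norm (∇ h y - ∇ h 0) (y - 0)
    have h3 := mul_le_mul_of_nonneg_right (hs.2 y 0) (norm_nonneg (y - 0))
    rw [sub_zero] at h1 h2 h3
    have hpos : 0 < ‖y‖ ^ 2 := by positivity
    have h4 : μ ≤ L := by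
      by_contra hlt
      push Not at hlt
      nlinarith
    exact mul_le_mul_of_nonneg_right h4 (consensusEnergy_nonneg hβ z)

variable {Q : Measure Ξ} [IsProbabilityMeasure Q] {ξ₀ : Ξ}

/-- The numerical part of the estimate of the decrease of the Lyapunov function, for `κ = 1 + χ`: `W`
is the consensus energy, `E` and `H` are the sums of the squared norms of `∇ f_i(x_i) - ∇ f_i(x*)`
and of `∇ f_i(x_i)`, `I` is the progress of the average, `J` is the coupling of the gradient steps
with the consensus energy, and `r` is the squared distance of the average to the minimizer. For
`c = 32/3 θ` the consensus energy decays at the rate `16/3 γ L` per unit of `W / n`, which pays for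
its contributions to `I`, to `J` and to `γ μ` times the Lyapunov function. -/
theorem strongConvex_residual_le {n γ L μ κ θ c ζ s W E H I J ν r : ℝ} (hn1 : 1 ≤ n) (hκ1 : 1 ≤ κ)
    (hL : 0 < L) (hγ : 0 < γ) (hθ : θ = γ * L * κ) (hc : c = 32 / 3 * θ) (hγ1 : θ ≤ 1 / 16)
    (hE0 : 0 ≤ E) (hW0 : 0 ≤ W) (hH0 : 0 ≤ H) (hν0 : 0 ≤ ν) (hns : ν ≤ s)
    (hμW : μ * W ≤ L * W)
    (hprog : n * μ * r + 4 / (7 * L) * E - 7 / 3 * L * W ≤ I)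
    (hcons : -(2 * J) ≤ 10 / 3 * L * W + 3 / (5 * L) * E + L / (10 * c) * W
      + 20 * c / L * (n * ζ ^ 2))
    (hG : H ≤ 11 / 10 * E + 11 * (n * ζ ^ 2)) :
    -(c / n) * (1 / (2 * κ)) * W - γ / n * I - 2 * (c / n) * γ * J
      + (1 * γ ^ 2 / n + 2 * c * γ ^ 2) * (ν + 1 / n * H) + γ * μ * (r + c / n * W) ≤
      170 * γ ^ 2 * (s + ζ ^ 2 * κ) := by
  have hn' : 0 < n := by linarith
  have hθ0 : 0 < θ := by rw [hθ]; positivity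
  have hc0 : 0 < c := by rw [hc]; positivity
  have hs0 : 0 ≤ s := hν0.trans hns
  -- averages over the workers
  set q := 1 / n * E with hq
  set w := W / n with hw
  set G := 1 / n * H with hGdef
  have hw0 : 0 ≤ w := by positivity
  have hq0 : 0 ≤ q := by positivity
  have hc1 : c ≤ 2 / 3 := by rw [hc]; linarith
  have hcv : c * W / n = c * w := by rw [hw]; ring
  have hγn : γ ^ 2 / n ≤ γ ^ 2 := div_le_self (by positivity) hn1
  have k1 : -(γ / n * I) ≤
      -(γ * μ * r) - 4 / 7 * (γ * q / L) + 7 / 3 * (γ * L * w) := by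
    have := mul_le_mul_of_nonneg_left hprog (by positivity : 0 ≤ γ / n)
    have h2 : γ / n * (n * μ * r + 4 / (7 * L) * E - 7 / 3 * L * W) =
        γ * μ * r + 4 / 7 * (γ * q / L) - 7 / 3 * (γ * L * w) := by
      rw [hq, hw]; field_simp
    linarith
  have k2 : -(2 * (c / n) * γ * J) ≤
      (20 / 9 + 1 / 10) * (γ * L * w) + 2 / 5 * (γ * q / L) + 143 * (γ ^ 2 * (κ * ζ ^ 2)) := by
    have h1 := mul_le_mul_of_nonneg_left hcons (by positivity : 0 ≤ c / n * γ)
    have h2 : c / n * γ * (10 / 3 * L * W + 3 / (5 * L) * E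
      + L / (10 * c) * W + 20 * c / L * (n * ζ ^ 2)) = c * (10 / 3 * (γ * L * w)) +
        c * (3 / 5 * (γ * q / L)) + 1 / 10 * (γ * L * w) + 20 * (γ / L) * ζ ^ 2 * c ^ 2 := by
      rw [hq, hw]; field_simp
    have h3 : c * (10 / 3 * (γ * L * w)) ≤ 2 / 3 * (10 / 3 * (γ * L * w)) := by gcongr
    have h4 : c * (3 / 5 * (γ * q / L)) ≤ 2 / 3 * (3 / 5 * (γ * q / L)) := by gcongr
    have h5 : 20 * (γ / L) * ζ ^ 2 * c ^ 2 = 20480 / 9 * (γ ^ 2 * (κ * ζ ^ 2)) * θ := by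
      rw [hc, hθ]; field_simp; ring
    have h6 : 20480 / 9 * (γ ^ 2 * (κ * ζ ^ 2)) * θ ≤
      20480 / 9 * (γ ^ 2 * (κ * ζ ^ 2)) * (1 / 16) := by gcongr
    have h7 : 0 ≤ γ ^ 2 * (κ * ζ ^ 2) := by positivity
    linarith
  have k3 : (1 * γ ^ 2 / n + 2 * c * γ ^ 2) * (ν + G) ≤
      7 / 3 * γ ^ 2 * s + 77 / 480 * (γ * q / L) + 77 / 3 * (γ ^ 2 * (κ * ζ ^ 2)) := by
    have h1 : G ≤ 11 / 10 * q + 11 * ζ ^ 2 := by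
      have := mul_le_mul_of_nonneg_left hG (by positivity : 0 ≤ 1 / (n : ℝ))
      have h2 : 1 / (n : ℝ) * (11 / 10 * E + 11 * (n * ζ ^ 2)) =
        11 / 10 * q + 11 * ζ ^ 2 := by rw [hq]; field_simp
      linarith
    have h2 : 1 * γ ^ 2 / n + 2 * c * γ ^ 2 ≤ 7 / 3 * γ ^ 2 := by
      rw [one_mul]
      have : 2 * c * γ ^ 2 ≤ 2 * (2 / 3) * γ ^ 2 := by gcongr
      linarith
    have h3 : 0 ≤ ν + G := add_nonneg hν0 (by positivity)
    have h4 : γ ^ 2 * q ≤ 1 / 16 * (γ * q / L) := by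
      have : γ ^ 2 * q = (γ * L) * (γ * q / L) := by field_simp
      rw [this]
      refine mul_le_mul_of_nonneg_right ?_ (by positivity)
      have : γ * L * 1 ≤ θ := by rw [hθ]; gcongr
      linarith
    have h5 : γ ^ 2 * ζ ^ 2 ≤ γ ^ 2 * (κ * ζ ^ 2) := by
      have : 1 * ζ ^ 2 ≤ κ * ζ ^ 2 := by gcongr
      gcongr; linarith
    calc _ ≤ 7 / 3 * γ ^ 2 * (ν + G) := by gcongr
      _ ≤ 7 / 3 * γ ^ 2 * (s + (11 / 10 * q + 11 * ζ ^ 2)) := by gcongr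
      _ = 7 / 3 * γ ^ 2 * s + 77 / 30 * (γ ^ 2 * q) + 77 / 3 * (γ ^ 2 * ζ ^ 2) := by ring
      _ ≤ _ := by linarith
  have k4 : -(c / n) * (1 / (2 * κ)) * W = -(16 / 3 * (γ * L * w)) := by
    rw [hc, hθ, hw]; field_simp; ring
  have k5 : γ * μ * (r + c / n * W) ≤
      γ * μ * r + 2 / 3 * (γ * L * w) := by
    have h1 : γ * μ * (r + c / n * W) = γ * μ * r + c * (γ / n * (μ * W)) := by ring
    have h2 : c * (γ / n * (μ * W)) ≤ 2 / 3 * (γ / n * (L * W)) :=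
      calc c * (γ / n * (μ * W)) ≤ c * (γ / n * (L * W)) := by gcongr
        _ ≤ 2 / 3 * (γ / n * (L * W)) := by gcongr
    have h3 : γ / n * (L * W) = γ * L * w := by rw [hw]; ring
    rw [h1]
    linarith
  have p1 : 0 ≤ γ * L * w := by positivity
  have p2 : 0 ≤ γ * q / L := by positivity
  have p3 : 0 ≤ γ ^ 2 * (κ * ζ ^ 2) := by positivity
  have p4 : 0 ≤ γ ^ 2 * s := by positivity
  rw [k4]
  linarith

open Classical in
/-- In expectation the Lyapunov function decreases at rate `γ μ`, up to a residual that comes from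
the noise and from the heterogeneity of the workers. The generator does not see the constant `K`,
which serves to center the function at the level where the residual balances the decay. -/
theorem gen_lyapunov_le_of_strongConvexOn (ho : IsOracle Q f g) (hn : 0 < n) (hN : chi1 N < ∞)
    (hβ : IsEnergyWeight N p β) (hχ : 0 ≤ p.chi) {μ L s ζ : ℝ} (hμ : 0 < μ) (hL : 0 < L)
    (hconv : ∀ i, StrongConvexOn Set.univ μ (f i)) (hs : ∀ i, IsSmooth L (f i))
    (hnoise : ∀ y : Fin n → EuclideanSpace ℝ (Fin d), noise Q f g y ≤ s)
    {xs : EuclideanSpace ℝ (Fin d)} (hxs : ∇ (objective f) xs = 0)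
    (hhet : heterogeneity f xs ≤ ζ ^ 2) (hγ : 0 < γ) (hγ1 : γ * L * (1 + p.chi) ≤ 1 / 16) (K : ℝ)
    {z : State n d} (hz : z ∈ meanSet n d) :
    (networkFlow N p γ g hg x₀).gen (clockRate N) (markLaw N Q ξ₀)
      (lyapunov N β (32 / 3 * (γ * L * (1 + p.chi)) / n) fun y => ‖y - xs‖ ^ 2 - K)
      (lyapunovDeriv N p β (32 / 3 * (γ * L * (1 + p.chi)) / n)) z
    + γ * μ * (lyapunov N β (32 / 3 * (γ * L * (1 + p.chi)) / n) (fun y => ‖y - xs‖ ^ 2) z) ≤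
      170 * γ ^ 2 * (s + ζ ^ 2 * (1 + p.chi)) := by
  have hn1 : (1 : ℝ) ≤ n := by exact_mod_cast hn
  have hn' : (0 : ℝ) < n := by linarith
  set κ := 1 + p.chi with hκ
  have hκ1 : 1 ≤ κ := by linarith
  set θ := γ * L * κ with hθ
  have hθ0 : 0 < θ := by positivity
  set c := 32 / 3 * θ with hc
  have hc0 : 0 < c := by positivity
  have hgen := gen_lyapunov_le (hg := hg) (x₀ := x₀) (ξ₀ := ξ₀) (γ := γ) ho hn hN hβ (c := c) hc0.le
    (h := fun y => ‖y - xs‖ ^ 2 - K) (by fun_prop) (A := 2 + 2 * ‖xs‖ ^ 2 + |K|) (fun y => by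
      have h1 : ‖y - xs‖ ^ 2 ≤ 2 * ‖y‖ ^ 2 + 2 * ‖xs‖ ^ 2 := by
        have := parallelogram_law_with_norm ℝ y xs
        nlinarith [norm_nonneg (y + xs)]
      have h2 : 0 ≤ (2 * ‖xs‖ ^ 2 + |K|) * ‖y‖ ^ 2 := by positivity
      refine (abs_sub _ _).trans ?_
      rw [abs_of_nonneg (by positivity)]
      linarith) (s := s) (M := 0) le_rfl hs
    (fun y => by simpa using hnoise y) (b := 1) (a := fun y => (2 : ℝ) • (y - xs)) (fun y u => by
      have : y - u - xs = (y - xs) - u := by abel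
      simp only [this]
      rw [norm_sub_sq_real, real_inner_smul_left]
      linarith) hz
  refine (add_le_add_left hgen _).trans ?_
  set W := consensusEnergy N β z with hW
  have hW0 : 0 ≤ W := consensusEnergy_nonneg hβ.nonneg z
  set x := z.1 with hx
  set e : Fin n → EuclideanSpace ℝ (Fin d) := fun i => ∇ (f i) (x i) - ∇ (f i) xs with he
  set Y := energyGradient N β z with hY
  have hgrad : ∀ i, ∇ (f i) (x i) = e i + ∇ (f i) xs := fun i => by simp [he]
  have hsum0 : ∑ i, ∇ (f i) xs = 0 := by
    have h1 := gradient_objective (fun i => (hs i).1) xs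
    rw [hxs] at h1
    exact (smul_eq_zero.1 h1.symm).resolve_left (by positivity)
  have hζ : ∑ i, ‖∇ (f i) xs‖ ^ 2 ≤ n * ζ ^ 2 := by
    simp only [heterogeneity, hxs, sub_zero] at hhet
    rw [one_div, inv_mul_le_iff₀ hn'] at hhet
    exact hhet
  have hD : ∑ i, ‖x i - mean x‖ ^ 2 ≤ W := sum_norm_sub_mean_le hβ.nonneg z
  have hYW : ∑ i, ‖Y i‖ ^ 2 ≤ 2 * W := sum_norm_energyGradient_le hN hβ.nonneg hβ.mul_chi1_le z
  have hμW : μ * W ≤ L * W := mul_consensusEnergy_le (hconv ⟨0, hn⟩) (hs ⟨0, hn⟩) hβ.nonneg z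
  have hjensen : n * ‖mean x - xs‖ ^ 2 ≤ ∑ i, ‖x i - xs‖ ^ 2 := by
    have h1 := norm_mean_sq_le fun i => x i - xs
    have h2 : mean (fun i => x i - xs) = mean x - xs := by
      rw [show (fun i => x i - xs) = x - fun _ => xs from rfl, mean_sub, mean_const hn]
    rw [h2, one_div, ← div_eq_inv_mul, le_div_iff₀ hn'] at h1
    linarith
  -- the progress of the average, half by strong convexity and half by co-coercivity
  have hprog : n * μ * ‖mean x - xs‖ ^ 2 + 4 / (7 * L) * ∑ i, ‖e i‖ ^ 2 - 7 / 3 * L * W ≤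
      ∑ i, ⟪(2 : ℝ) • (mean x - xs), ∇ (f i) (x i)⟫ := by
    have h1 : ∑ i, ⟪(2 : ℝ) • (mean x - xs), ∇ (f i) (x i)⟫ = ∑ i, 2 * ⟪mean x - xs, e i⟫ := by
      simp only [hgrad, inner_add_right, Finset.sum_add_distrib, ← inner_sum, hsum0]
      simp [inner_smul_left, inner_sum]
    rw [h1]
    have h2 : ∀ i, μ * ‖x i - xs‖ ^ 2 + 4 / (7 * L) * ‖e i‖ ^ 2 - 7 / 3 * L * ‖x i - mean x‖ ^ 2 ≤
        2 * ⟪mean x - xs, e i⟫ := fun i => by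
      have h3 := StrongConvexOn.le_inner (hconv i) (hs i).1 (x i) xs
      have h4 := (hs i).cocoercive hL hμ.le (hconv i) (x i) xs
      have h5 := two_mul_inner_le (by positivity : 0 < 7 / 3 * L) (x i - mean x) (e i)
      have h6 : ⟪mean x - xs, e i⟫ = ⟪∇ (f i) (x i) - ∇ (f i) xs, x i - xs⟫
          - ⟪x i - mean x, e i⟫ := by
        rw [real_inner_comm (x i - xs), ← inner_sub_left]
        congr 1; abel
      have h7 : 4 / (7 * L) * ‖e i‖ ^ 2 + 1 / (7 / 3 * L) * ‖e i‖ ^ 2 = 1 / L * ‖e i‖ ^ 2 := by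
        field_simp; ring
      simp only [he] at h4 h5 h6 h7 ⊢
      linarith
    have h3 := Finset.sum_le_sum fun i (_ : i ∈ Finset.univ) => h2 i
    rw [Finset.sum_sub_distrib, Finset.sum_add_distrib, ← Finset.mul_sum, ← Finset.mul_sum,
      ← Finset.mul_sum] at h3
    have h4 := mul_le_mul_of_nonneg_left hjensen hμ.le
    have h5 := mul_le_mul_of_nonneg_left hD (by positivity : 0 ≤ 7 / 3 * L)
    linarith
  -- the effect of the gradient steps on the consensus energy
  have hcons : -(2 * ∑ i, ⟪Y i, ∇ (f i) (x i)⟫) ≤ 10 / 3 * L * W + 3 / (5 * L) * ∑ i, ‖e i‖ ^ 2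
      + L / (10 * c) * W + 20 * c / L * (n * ζ ^ 2) := by
    have h2 : ∀ i, -(2 * ⟪Y i, ∇ (f i) (x i)⟫) ≤ (5 / 3 * L + L / (20 * c)) * ‖Y i‖ ^ 2
        + 3 / (5 * L) * ‖e i‖ ^ 2 + 20 * c / L * ‖∇ (f i) xs‖ ^ 2 := fun i => by
      have h3 := two_mul_inner_le (by positivity : 0 < 5 / 3 * L) (Y i) (-e i)
      have h4 := two_mul_inner_le (by positivity : 0 < L / (20 * c)) (Y i) (-∇ (f i) xs)
      rw [hgrad, inner_add_right]
      rw [inner_neg_right, norm_neg] at h3 h4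
      have h5 : 1 / (5 / 3 * L) = 3 / (5 * L) := by field_simp
      have h6 : 1 / (L / (20 * c)) = 20 * c / L := by field_simp
      rw [h5] at h3
      rw [h6] at h4
      linarith
    have h3 := Finset.sum_le_sum fun i (_ : i ∈ Finset.univ) => h2 i
    rw [Finset.sum_neg_distrib, Finset.sum_add_distrib, Finset.sum_add_distrib, ← Finset.mul_sum,
      ← Finset.mul_sum, ← Finset.mul_sum, ← Finset.mul_sum] at h3
    have h4 := mul_le_mul_of_nonneg_left hYW (by positivity : 0 ≤ 5 / 3 * L + L / (20 * c))
    have h5 := mul_le_mul_of_nonneg_left hζ (by positivity : 0 ≤ 20 * c / L)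
    have h6 : L / (20 * c) * (2 * W) = L / (10 * c) * W := by field_simp; ring
    linarith
  -- the second moment of the gradients
  have hG : ∑ i, ‖∇ (f i) (x i)‖ ^ 2 ≤ 11 / 10 * ∑ i, ‖e i‖ ^ 2 + 11 * (n * ζ ^ 2) := by
    have h2 : ∀ i, ‖∇ (f i) (x i)‖ ^ 2 ≤ 11 / 10 * ‖e i‖ ^ 2 + 11 * ‖∇ (f i) xs‖ ^ 2 := fun i => by
      have h3 := two_mul_inner_le (by norm_num : (0 : ℝ) < 1 / 10) (e i) (∇ (f i) xs)
      rw [hgrad, norm_add_sq_real]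
      have h4 : 1 / (1 / 10 : ℝ) = 10 := by norm_num
      rw [h4] at h3
      linarith
    have h3 := Finset.sum_le_sum fun i (_ : i ∈ Finset.univ) => h2 i
    rw [Finset.sum_add_distrib, ← Finset.mul_sum, ← Finset.mul_sum] at h3
    linarith
  have hns := hnoise x
  have hs0 : 0 ≤ s := (noise_nonneg Q x).trans hns
  have hlyap : lyapunov N β (c / n) (fun y => ‖y - xs‖ ^ 2) z =
      ‖mean x - xs‖ ^ 2 + c / n * W := rfl
  rw [hlyap]
  exact strongConvex_residual_le hn1 hκ1 hL hγ hθ hc hγ1 (by positivity) hW0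
    (by positivity) (noise_nonneg Q x) hns hμW hprog hcons hG

end StronglyConvex

/-! ### Rate of convergence under strong convexity -/

section StronglyConvexRate

variable {Ω Ξ : Type*} [MeasurableSpace Ω] [MeasurableSpace Ξ] {n d : ℕ} {N : Network n}
  {p : Params} {γ β : ℝ}
  {g : Fin n → EuclideanSpace ℝ (Fin d) → Ξ → EuclideanSpace ℝ (Fin d)}
  {hg : ∀ i, Measurable (Function.uncurry (g i))} {x₀ : EuclideanSpace ℝ (Fin d)}
  {f : Fin n → EuclideanSpace ℝ (Fin d) → ℝ} {Q : Measure Ξ} [IsProbabilityMeasure Q] {ξ₀ : Ξ}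
  {P : Measure Ω} [IsProbabilityMeasure P]

theorem norm_sub_sq_le (y z : EuclideanSpace ℝ (Fin d)) :
    ‖y - z‖ ^ 2 ≤ (2 + 2 * ‖z‖ ^ 2) * (1 + ‖y‖ ^ 2) := by
  have h1 := parallelogram_law_with_norm ℝ y z
  have h2 : 0 ≤ ‖z‖ ^ 2 * ‖y‖ ^ 2 := by positivity
  nlinarith [norm_nonneg (y + z)]

open Classical in
/-- Linear convergence of the average, up to a residual that is proportional to the step size. -/
theorem integral_norm_mean_sub_sq_le {D : Ω → Clock N → ℕ → ℝ × Ξ}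
    (hD : IsClockData P (clockRate N) (markLaw N Q ξ₀) D) (ho : IsOracle Q f g) (hn : 0 < n)
    (hN : chi1 N < ∞) (hβ : IsEnergyWeight N p β) (hχ : 0 ≤ p.chi) {μ L s ζ : ℝ} (hμ : 0 < μ)
    (hL : 0 < L) (hconv : ∀ i, StrongConvexOn Set.univ μ (f i)) (hs : ∀ i, IsSmooth L (f i))
    (hnoise : ∀ y : Fin n → EuclideanSpace ℝ (Fin d), noise Q f g y ≤ s)
    {xs : EuclideanSpace ℝ (Fin d)} (hxs : ∇ (objective f) xs = 0)
    (hhet : heterogeneity f xs ≤ ζ ^ 2) (hγ : 0 < γ) (hγ1 : γ * L * (1 + p.chi) ≤ 1 / 16)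
    {T : ℝ} (hT : 0 < T) :
    Integrable (fun ω => ‖mean ((networkFlow N p γ g hg x₀).leftState T (D ω)).1 - xs‖ ^ 2) P ∧
    ∫ ω, ‖mean ((networkFlow N p γ g hg x₀).leftState T (D ω)).1 - xs‖ ^ 2 ∂P ≤
      ‖x₀ - xs‖ ^ 2 * Real.exp (-(γ * μ * T)) + 170 * γ * (s + ζ ^ 2 * (1 + p.chi)) / μ := by
  set S := s + ζ ^ 2 * (1 + p.chi) with hS
  -- the level at which the residual balances the decay
  set K := 170 * γ * S / μ with hK
  have hs0 : 0 ≤ s := (noise_nonneg Q fun _ => 0).trans (hnoise _)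
  have hK0 : 0 ≤ K := by positivity
  set c := 32 / 3 * (γ * L * (1 + p.chi)) with hc
  have hc0 : 0 ≤ c / n := by positivity
  set F := networkFlow N p γ g hg x₀ with hF
  set X : ℝ → Ω → State n d := fun t ω => F.leftState t (D ω) with hX
  obtain ⟨C, hw⟩ := exists_isWeight (N := N) (p := p) (γ := γ) (hg := hg) (x₀ := x₀) (ξ₀ := ξ₀)
    ho hn le_rfl hs (fun y => by simpa using hnoise y)
  have hquad : ∀ y : EuclideanSpace ℝ (Fin d),
      |‖y - xs‖ ^ 2 - K| ≤ (2 + 2 * ‖xs‖ ^ 2 + K) * (1 + ‖y‖ ^ 2) := fun y => by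
    have h1 := norm_sub_sq_le y xs
    have h2 : 0 ≤ K * ‖y‖ ^ 2 := by positivity
    refine (abs_sub _ _).trans ?_
    rw [abs_of_nonneg (by positivity), abs_of_nonneg hK0]
    linarith
  obtain ⟨B, hB1, hB2⟩ := exists_lyapunov_le (p := p) (c := c / n) hn hN hβ hquad
  obtain ⟨hint, hint2, hdyn⟩ := (isTest_lyapunov (N := N) (p := p) (γ := γ) (hg := hg) (x₀ := x₀)
    (β := β) (c := c / n) (h := fun y => ‖y - xs‖ ^ 2 - K)
    (by fun_prop)).integral_leftState_of_weight hw isInvariant_meanSet hD (clockRate_pos N)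
    (fun z _ => hB1 z) (fun z _ => hB2 z) (γ * μ) hT
  have hle : ∫ x : ℝ × Ω, Real.exp (γ * μ * x.1) *
      (γ * μ * lyapunov N β (c / n) (fun y => ‖y - xs‖ ^ 2 - K) (X x.1 x.2) +
        F.gen (clockRate N) (markLaw N Q ξ₀)
          (lyapunov N β (c / n) fun y => ‖y - xs‖ ^ 2 - K) (lyapunovDeriv N p β (c / n))
          (X x.1 x.2)) ∂(timeProd P T) ≤ 0 := by
    refine integral_nonpos fun x => mul_nonpos_of_nonneg_of_nonpos (Real.exp_pos _).le ?_
    have h1 := gen_lyapunov_le_of_strongConvexOn (N := N) (p := p) (hg := hg) (x₀ := x₀)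
      (ξ₀ := ξ₀) ho hn hN hβ hχ hμ hL hconv hs hnoise hxs hhet hγ hγ1 K
      ((isInvariant_meanSet (N := N) (p := p) (γ := γ) (hg := hg)
        (x₀ := x₀)).leftState_mem x.1 (D x.2))
    have h2 : γ * μ * K = 170 * γ ^ 2 * S := by rw [hK]; field_simp
    have h3 : lyapunov N β (c / n) (fun y => ‖y - xs‖ ^ 2 - K) (X x.1 x.2) =
        lyapunov N β (c / n) (fun y => ‖y - xs‖ ^ 2) (X x.1 x.2) - K := by
      simp only [lyapunov]; ring
    rw [h3]
    simp only [← hF, ← hc, ← hS] at h1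
    have h4 : F.leftState x.1 (D x.2) = X x.1 x.2 := rfl
    rw [h4] at h1
    linarith
  have hinit : lyapunov N β (c / n) (fun y => ‖y - xs‖ ^ 2 - K) F.init = ‖x₀ - xs‖ ^ 2 - K := by
    have h1 : F.init = (fun _ => x₀, fun _ => x₀) := rfl
    rw [lyapunov, h1, consensusEnergy_eq_zero, mean_const hn]
    ring
  have hW : ∀ z : State n d, 0 ≤ c / n * consensusEnergy N β z := fun z =>
    mul_nonneg hc0 (consensusEnergy_nonneg hβ.nonneg z)
  have hint' : Integrable (fun ω => ‖mean (X T ω).1 - xs‖ ^ 2) P := by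
    have hmeas : Measurable (X T) := F.measurable_leftState.comp
      (measurable_const.prodMk hD.measurable)
    have hcont : Continuous fun z : State n d => ‖mean z.1 - xs‖ ^ 2 :=
      ((continuous_mean.comp continuous_fst).sub continuous_const).norm.pow 2
    refine (hint.add (integrable_const K)).mono'
      (hcont.measurable.comp hmeas).aestronglyMeasurable (Eventually.of_forall fun ω => ?_)
    rw [Real.norm_of_nonneg (by positivity)]
    simp only [Pi.add_apply, lyapunov]
    have := hW (X T ω)
    simp only [hX] at this ⊢
    linarith
  refine ⟨hint', ?_⟩
  have hmono : ∫ ω, ‖mean (X T ω).1 - xs‖ ^ 2 ∂P - K ≤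
      ∫ ω, lyapunov N β (c / n) (fun y => ‖y - xs‖ ^ 2 - K) (X T ω) ∂P := by
    have h1 : ∫ ω, ‖mean (X T ω).1 - xs‖ ^ 2 ∂P - K =
        ∫ ω, (‖mean (X T ω).1 - xs‖ ^ 2 - K) ∂P := by
      rw [integral_sub hint' (integrable_const K)]; simp
    rw [h1]
    refine integral_mono (hint'.sub (integrable_const K)) hint fun ω => ?_
    have := hW (X T ω)
    simp only [lyapunov, hX] at this ⊢
    linarith
  have hexp : Real.exp (γ * μ * T) * Real.exp (-(γ * μ * T)) = 1 := by
    rw [← Real.exp_add]; simp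
  have hpos := Real.exp_pos (-(γ * μ * T))
  have h1 : Real.exp (γ * μ * T) * (∫ ω, ‖mean (X T ω).1 - xs‖ ^ 2 ∂P - K) ≤
      ‖x₀ - xs‖ ^ 2 - K := by
    refine (mul_le_mul_of_nonneg_left hmono (Real.exp_pos _).le).trans ?_
    rw [hinit] at hdyn
    exact hdyn.trans_le (by linarith)
  have h2 := mul_le_mul_of_nonneg_left h1 hpos.le
  rw [← mul_assoc, mul_comm (Real.exp (-(γ * μ * T))), hexp, one_mul] at h2
  have h3 : 0 ≤ Real.exp (-(γ * μ * T)) * K := by positivity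
  show ∫ ω, ‖mean (X T ω).1 - xs‖ ^ 2 ∂P ≤ _
  linarith

/-- The step size `min (1 / (16 A)) (log (max 2 (μ² r T / S)) / (μ T))` balances the exponential
decay and the residual. -/
theorem exists_stepSize_of_strongConvexOn {μ A S r T : ℝ} (hμ : 0 < μ) (hA : 0 < A) (hS : 0 ≤ S)
    (hr : 0 ≤ r) (hT : 0 < T) : ∃ γ, 0 < γ ∧ γ ≤ 1 / (16 * A) ∧
      r * Real.exp (-(γ * μ * T)) + 170 * γ * S / μ ≤
        172 * (r * Real.exp (-(μ * T / (16 * A))) +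
          S / (μ ^ 2 * T) * Real.log (max 2 (μ ^ 2 * r * T / S))) := by
  have hexp0 : 0 ≤ r * Real.exp (-(μ * T / (16 * A))) := by positivity
  have hexp : 1 / (16 * A) * μ * T = μ * T / (16 * A) := by ring
  rcases hS.eq_or_lt with rfl | hS
  · refine ⟨1 / (16 * A), by positivity, le_rfl, ?_⟩
    rw [hexp]
    simp only [mul_zero, zero_div, zero_mul, add_zero]
    linarith
  set m := max 2 (μ ^ 2 * r * T / S) with hm
  have hm2 : 2 ≤ m := le_max_left _ _
  have hl : 1 / 2 ≤ Real.log m := by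
    have h1 := Real.log_two_gt_d9
    have h2 := Real.log_le_log (by norm_num) hm2
    linarith
  have hU : 0 ≤ S / (μ ^ 2 * T) := by positivity
  rcases le_total (1 / (16 * A)) (Real.log m / (μ * T)) with h | h
  · refine ⟨1 / (16 * A), by positivity, le_rfl, ?_⟩
    rw [hexp]
    have h1 : 170 * (1 / (16 * A)) * S / μ ≤ 170 * (Real.log m / (μ * T)) * S / μ := by gcongr
    have h2 : 170 * (Real.log m / (μ * T)) * S / μ = 170 * (S / (μ ^ 2 * T) * Real.log m) := by
      field_simp
    have h3 : 0 ≤ S / (μ ^ 2 * T) * Real.log m := mul_nonneg hU (by linarith)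
    linarith
  · have hlog : 0 < Real.log m := by linarith
    refine ⟨Real.log m / (μ * T), by positivity, h, ?_⟩
    have h1 : Real.log m / (μ * T) * μ * T = Real.log m := by field_simp
    have h2 : 170 * (Real.log m / (μ * T)) * S / μ = 170 * (S / (μ ^ 2 * T) * Real.log m) := by
      field_simp
    rw [h1, h2, Real.exp_neg, Real.exp_log (by linarith)]
    have h3 : r * m⁻¹ ≤ S / (μ ^ 2 * T) := by
      rw [← div_eq_mul_inv, div_le_iff₀ (by linarith), div_mul_eq_mul_div,
        le_div_iff₀ (by positivity)]
      have h4 : μ ^ 2 * r * T / S ≤ m := le_max_right _ _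
      rw [div_le_iff₀ hS] at h4
      linarith
    have h4 : S / (μ ^ 2 * T) * (1 / 2) ≤ S / (μ ^ 2 * T) * Real.log m := by gcongr
    linarith

end StronglyConvexRate

/-! ### Decrease of the Lyapunov function without convexity -/

section NonConvex

variable {Ω Ξ : Type*} [MeasurableSpace Ω] [MeasurableSpace Ξ] {n d : ℕ} {N : Network n}
  {p : Params} {γ β : ℝ}
  {g : Fin n → EuclideanSpace ℝ (Fin d) → Ξ → EuclideanSpace ℝ (Fin d)}
  {hg : ∀ i, Measurable (Function.uncurry (g i))} {x₀ : EuclideanSpace ℝ (Fin d)}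
  {f : Fin n → EuclideanSpace ℝ (Fin d) → ℝ} {Q : Measure Ξ} [IsProbabilityMeasure Q] {ξ₀ : Ξ}
  {Pr : Measure Ω} [IsProbabilityMeasure Pr]

/-- The numerical part of the estimate of the decrease of the Lyapunov function, for `κ = 1 + χ`: `W`
is the consensus energy, `D` is the squared norm of the gradient at the average, `I` comes from the
progress of the average, `J` from the growth of the consensus energy, and `H` is the sum of the
squared norms of the gradients. For `c = 8 γ L² κ` the consensus energy decays at the rate `4 γ L²`
per unit of `W / n`, which pays for its contributions to the other terms. -/
theorem nonConvex_residual_le {n γ L κ θ c ζ s W D H I J ν P M : ℝ} (hn1 : 1 ≤ n) (hκ1 : 1 ≤ κ)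
    (hL : 0 < L) (hγ : 0 < γ) (hP : 0 ≤ P) (hM : 0 ≤ M) (hθ : θ = γ * L * κ)
    (hc : c = 8 * γ * L ^ 2 * κ) (hγ1 : θ * ((1 + M) * (1 + P)) ≤ 1 / 40) (hD0 : 0 ≤ D)
    (hW0 : 0 ≤ W) (hH0 : 0 ≤ H) (hν0 : 0 ≤ ν) (hs0 : 0 ≤ s) (hns : ν ≤ s + M / n * H)
    (hprog : -I ≤ -(n / 2 * D) + L ^ 2 / 2 * W)
    (hcons : -(2 * J) ≤ 1 / (4 * γ * κ) * W + 8 * γ * κ * H)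
    (hG : H ≤ 2 * L ^ 2 * W + 2 * (n * (ζ ^ 2 + (1 + P) * D))) :
    -(c / n) * (1 / (2 * κ)) * W - γ / n * I - 2 * (c / n) * γ * J
      + (L / 2 * γ ^ 2 / n + 2 * c * γ ^ 2) * (ν + 1 / n * H) ≤
      -(γ / 4 * D) + 5 * (1 + M) * γ ^ 2 * L * (s + κ * ζ ^ 2) := by
  have hn' : 0 < n := by linarith
  have hθ0 : 0 < θ := by rw [hθ]; positivity
  have hc0 : 0 < c := by rw [hc]; positivity
  set w := W / n with hw
  set G := 1 / n * H with hGdef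
  have hw0 : 0 ≤ w := by positivity
  have hG0 : 0 ≤ G := by positivity
  have hMP : 1 ≤ (1 + M) * (1 + P) := by nlinarith
  have hθ1 : θ ≤ 1 / 40 := le_trans (le_mul_of_one_le_right hθ0.le hMP) hγ1
  have hγL : γ * L ≤ θ := by rw [hθ]; exact le_mul_of_one_le_right (by positivity) hκ1
  have k1 : -(γ / n * I) ≤ -(γ / 2 * D) + γ / 2 * (L ^ 2 * w) := by
    have h1 := mul_le_mul_of_nonneg_left hprog (by positivity : 0 ≤ γ / n)
    have h2 : γ / n * (-(n / 2 * D) + L ^ 2 / 2 * W) = -(γ / 2 * D) + γ / 2 * (L ^ 2 * w) := by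
      rw [hw]; field_simp
    linarith
  have k2 : -(2 * (c / n) * γ * J) ≤ 2 * γ * (L ^ 2 * w) + 64 * γ * θ ^ 2 * G := by
    have h1 := mul_le_mul_of_nonneg_left hcons (by positivity : 0 ≤ c / n * γ)
    have h2 : c / n * γ * (1 / (4 * γ * κ) * W + 8 * γ * κ * H) =
        2 * γ * (L ^ 2 * w) + 64 * γ * θ ^ 2 * G := by
      rw [hc, hw, hGdef, hθ]; field_simp; ring
    linarith
  have k4 : -(c / n) * (1 / (2 * κ)) * W = -(4 * γ * (L ^ 2 * w)) := by
    rw [hc, hw]; field_simp; ring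
  have kG : G ≤ 2 * (L ^ 2 * w) + 2 * (1 + P) * D + 2 * ζ ^ 2 := by
    have h1 := mul_le_mul_of_nonneg_left hG (by positivity : 0 ≤ 1 / n)
    have h2 : 1 / n * (2 * L ^ 2 * W + 2 * (n * (ζ ^ 2 + (1 + P) * D))) =
        2 * (L ^ 2 * w) + 2 * (1 + P) * D + 2 * ζ ^ 2 := by rw [hw]; field_simp; ring
    linarith
  have k3 : (L / 2 * γ ^ 2 / n + 2 * c * γ ^ 2) * (ν + G) ≤
      9 / 10 * γ ^ 2 * L * s + 9 / 10 * γ ^ 2 * L * ((1 + M) * G) := by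
    have h1 : L / 2 * γ ^ 2 / n ≤ L / 2 * γ ^ 2 := div_le_self (by positivity) hn1
    have h2 : 2 * c * γ ^ 2 = 16 * θ * (γ ^ 2 * L) := by rw [hc, hθ]; ring
    have h3 : 16 * θ * (γ ^ 2 * L) ≤ 16 * (1 / 40) * (γ ^ 2 * L) := by gcongr
    have h4 : ν + G ≤ s + (1 + M) * G := by
      have : M / n * H = M * G := by rw [hGdef]; ring
      linarith
    calc _ ≤ (9 / 10 * γ ^ 2 * L) * (ν + G) := by
          refine mul_le_mul_of_nonneg_right ?_ (add_nonneg hν0 hG0)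
          linarith
      _ ≤ (9 / 10 * γ ^ 2 * L) * (s + (1 + M) * G) := by gcongr
      _ = _ := by ring
  -- the coefficient of `G`
  set A := 64 * γ * θ ^ 2 + 9 / 10 * γ ^ 2 * L * (1 + M) with hA
  have hA0 : 0 ≤ A := by positivity
  have h64 : 64 * γ * θ ^ 2 ≤ 8 / 5 * (γ * θ) := by
    have : 64 * γ * θ ^ 2 = 64 * (γ * θ) * θ := by ring
    rw [this]
    have : 64 * (γ * θ) * θ ≤ 64 * (γ * θ) * (1 / 40) := by gcongr
    linarith
  have hM1 : γ * θ ≤ γ * θ * (1 + M) := le_mul_of_one_le_right (by positivity) (by linarith)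
  have hA1 : A ≤ 5 / 2 * (γ * θ * (1 + M)) := by
    have h1 : 9 / 10 * γ ^ 2 * L * (1 + M) = 9 / 10 * (γ * (γ * L) * (1 + M)) := by ring
    have h2 : γ * (γ * L) * (1 + M) ≤ γ * θ * (1 + M) := by gcongr
    linarith
  have hA2 : A * (1 + P) ≤ γ / 16 := by
    have h1 : A * (1 + P) ≤ 5 / 2 * (γ * θ * (1 + M)) * (1 + P) := by gcongr
    have h2 : 5 / 2 * (γ * θ * (1 + M)) * (1 + P) = 5 / 2 * γ * (θ * ((1 + M) * (1 + P))) := by ring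
    have h3 : 5 / 2 * γ * (θ * ((1 + M) * (1 + P))) ≤ 5 / 2 * γ * (1 / 40) := by gcongr
    linarith
  have hA3 : A ≤ γ / 16 := le_trans (le_mul_of_one_le_right hA0 (by linarith)) hA2
  have e1 : A * G ≤ A * (2 * (L ^ 2 * w) + 2 * (1 + P) * D + 2 * ζ ^ 2) := by gcongr
  have e2 : A * (L ^ 2 * w) ≤ γ / 16 * (L ^ 2 * w) := by gcongr
  have e3 : A * (1 + P) * D ≤ γ / 16 * D := by gcongr
  have e4 : A * ζ ^ 2 ≤ 5 / 2 * ((1 + M) * γ ^ 2 * L * (κ * ζ ^ 2)) := by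
    have h1 : A * ζ ^ 2 ≤ 5 / 2 * (γ * θ * (1 + M)) * ζ ^ 2 := by gcongr
    have h2 : 5 / 2 * (γ * θ * (1 + M)) * ζ ^ 2 =
      5 / 2 * ((1 + M) * γ ^ 2 * L * (κ * ζ ^ 2)) := by rw [hθ]; ring
    linarith
  have e5 : γ ^ 2 * L * s ≤ (1 + M) * γ ^ 2 * L * s := by
    have : γ ^ 2 * L * s * 1 ≤ γ ^ 2 * L * s * (1 + M) := by gcongr; linarith
    linarith
  have e6 : 64 * γ * θ ^ 2 * G + 9 / 10 * γ ^ 2 * L * ((1 + M) * G) = A * G := by rw [hA]; ring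
  have p1 : 0 ≤ γ * (L ^ 2 * w) := by positivity
  have p2 : 0 ≤ γ * D := by positivity
  have p3 : 0 ≤ (1 + M) * γ ^ 2 * L * s := by positivity
  rw [k4]
  linarith

open Classical in
/-- In expectation the Lyapunov function decreases by a multiple of the squared norm of the gradient
at the average, up to a residual that comes from the noise and the heterogeneity. -/
theorem gen_lyapunov_le_of_isSmooth (ho : IsOracle Q f g) (hn : 0 < n) (hN : chi1 N < ∞)
    (hβ : IsEnergyWeight N p β) (hχ : 0 ≤ p.chi) {L σ ζ P M : ℝ} (hL : 0 < L) (hP : 0 ≤ P)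
    (hM : 0 ≤ M) (hf : NonConvexSetting Q f g L σ ζ P M) {xs : EuclideanSpace ℝ (Fin d)}
    {A : ℝ} (hA : ∀ y, |objective f y - objective f xs| ≤ A * (1 + ‖y‖ ^ 2)) (hγ : 0 < γ)
    (hγ1 : γ * L * (1 + p.chi) * ((1 + M) * (1 + P)) ≤ 1 / 40)
    {z : State n d} (hz : z ∈ meanSet n d) :
    (networkFlow N p γ g hg x₀).gen (clockRate N) (markLaw N Q ξ₀)
      (lyapunov N β (8 * γ * L ^ 2 * (1 + p.chi) / n) fun y => objective f y - objective f xs)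
      (lyapunovDeriv N p β (8 * γ * L ^ 2 * (1 + p.chi) / n)) z ≤
      -(γ / 4 * ‖∇ (objective f) (mean z.1)‖ ^ 2)
        + 5 * (1 + M) * γ ^ 2 * L * (σ ^ 2 + (1 + p.chi) * ζ ^ 2) := by
  have hn1 : (1 : ℝ) ≤ n := by exact_mod_cast hn
  have hn' : (0 : ℝ) < n := by linarith
  have hs := hf.smooth
  have hobj : IsSmooth L (objective f) := isSmooth_objective hn hs
  set c := 8 * γ * L ^ 2 * (1 + p.chi) with hc
  have hc0 : 0 < c := by positivity
  have hgen := gen_lyapunov_le (hg := hg) (x₀ := x₀) (ξ₀ := ξ₀) (γ := γ) ho hn hN hβ (c := c) hc0.le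
    (h := fun y => objective f y - objective f xs) (hobj.1.continuous.sub continuous_const) hA hM hs
    hf.noise_le (b := L / 2) (a := fun y => ∇ (objective f) y) (fun y u => by
      have := hobj.le_add y (-u)
      rw [inner_neg_right, norm_neg, ← sub_eq_add_neg] at this
      linarith) hz
  refine hgen.trans ?_
  set W := consensusEnergy N β z with hW
  have hW0 : 0 ≤ W := consensusEnergy_nonneg hβ.nonneg z
  set x := z.1 with hx
  set Y := energyGradient N β z with hY
  set a := ∇ (objective f) (mean x) with ha
  have hD : ∑ i, ‖x i - mean x‖ ^ 2 ≤ W := sum_norm_sub_mean_le hβ.nonneg z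
  have hYW : ∑ i, ‖Y i‖ ^ 2 ≤ 2 * W := sum_norm_energyGradient_le hN hβ.nonneg hβ.mul_chi1_le z
  have hsum : ∑ i, ∇ (f i) (mean x) = (n : ℝ) • a := by
    rw [ha, gradient_objective fun i => (hs i).1, smul_smul, mul_one_div_cancel hn'.ne', one_smul]
  have hinner : ∑ i, ⟪a, ∇ (f i) (mean x)⟫ = n * ‖a‖ ^ 2 := by
    rw [← inner_sum, hsum, real_inner_smul_right, real_inner_self_eq_norm_sq]
  have hlip : ∑ i, ‖∇ (f i) (x i) - ∇ (f i) (mean x)‖ ^ 2 ≤ L ^ 2 * W := by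
    have h1 : ∀ i, ‖∇ (f i) (x i) - ∇ (f i) (mean x)‖ ^ 2 ≤
        L ^ 2 * ‖x i - mean x‖ ^ 2 := fun i => by
      rw [← mul_pow]
      exact pow_le_pow_left₀ (norm_nonneg _) ((hs i).2 _ _) 2
    refine (Finset.sum_le_sum fun i _ => h1 i).trans ?_
    rw [← Finset.mul_sum]
    gcongr
  -- the progress of the average
  have hprog : -∑ i, ⟪a, ∇ (f i) (x i)⟫ ≤ -(n / 2 * ‖a‖ ^ 2) + L ^ 2 / 2 * W := by
    have h1 : ∀ i, -⟪a, ∇ (f i) (x i)⟫ ≤ -⟪a, ∇ (f i) (mean x)⟫ + 1 / 2 * ‖a‖ ^ 2 +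
        1 / 2 * ‖∇ (f i) (x i) - ∇ (f i) (mean x)‖ ^ 2 := fun i => by
      have h2 := two_mul_inner_le one_pos a (-(∇ (f i) (x i) - ∇ (f i) (mean x)))
      rw [inner_neg_right, norm_neg, inner_sub_right] at h2
      linarith
    have h2 := Finset.sum_le_sum fun i (_ : i ∈ Finset.univ) => h1 i
    rw [Finset.sum_neg_distrib, Finset.sum_add_distrib, Finset.sum_add_distrib,
      Finset.sum_neg_distrib, hinner, ← Finset.mul_sum, ← Finset.mul_sum, Finset.sum_const,
      Finset.card_univ, Fintype.card_fin, nsmul_eq_mul] at h2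
    linarith
  -- the effect of the gradient steps on the consensus energy
  have hcons : -(2 * ∑ i, ⟪Y i, ∇ (f i) (x i)⟫) ≤
      1 / (4 * γ * (1 + p.chi)) * W + 8 * γ * (1 + p.chi) * ∑ i, ‖∇ (f i) (x i)‖ ^ 2 := by
    have hκ : 0 < 1 + p.chi := by linarith
    have h1 : ∀ i, -(2 * ⟪Y i, ∇ (f i) (x i)⟫) ≤ 1 / (8 * γ * (1 + p.chi)) * ‖Y i‖ ^ 2
        + 8 * γ * (1 + p.chi) * ‖∇ (f i) (x i)‖ ^ 2 := fun i => by
      have h2 := two_mul_inner_le (by positivity : 0 < 1 / (8 * γ * (1 + p.chi))) (Y i)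
        (-∇ (f i) (x i))
      rw [inner_neg_right, norm_neg, one_div_one_div] at h2
      linarith
    have h2 := Finset.sum_le_sum fun i (_ : i ∈ Finset.univ) => h1 i
    rw [Finset.sum_neg_distrib, Finset.sum_add_distrib, ← Finset.mul_sum, ← Finset.mul_sum,
      ← Finset.mul_sum] at h2
    have h3 := mul_le_mul_of_nonneg_left hYW (by positivity : 0 ≤ 1 / (8 * γ * (1 + p.chi)))
    have h4 : 1 / (8 * γ * (1 + p.chi)) * (2 * W) = 1 / (4 * γ * (1 + p.chi)) * W := by
      field_simp; ring
    linarith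
  have hhet : ∑ i, ‖∇ (f i) (mean x)‖ ^ 2 ≤ n * (ζ ^ 2 + (1 + P) * ‖a‖ ^ 2) := by
    have h1 := hf.heterogeneity_le (mean x)
    rw [heterogeneity, ← ha, one_div, inv_mul_le_iff₀ hn'] at h1
    have h2 : ∀ i, ‖∇ (f i) (mean x)‖ ^ 2 =
        ‖∇ (f i) (mean x) - a‖ ^ 2 + 2 * ⟪a, ∇ (f i) (mean x)⟫ - ‖a‖ ^ 2 := fun i => by
      rw [norm_sub_sq_real, real_inner_comm]; ring
    have h3 := Finset.sum_congr rfl fun i (_ : i ∈ Finset.univ) => h2 i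
    rw [Finset.sum_sub_distrib, Finset.sum_add_distrib, ← Finset.mul_sum, hinner,
      Finset.sum_const, Finset.card_univ,
      Fintype.card_fin, nsmul_eq_mul] at h3
    rw [h3]
    linarith
  -- the second moment of the gradients
  have hG : ∑ i, ‖∇ (f i) (x i)‖ ^ 2 ≤
      2 * L ^ 2 * W + 2 * (n * (ζ ^ 2 + (1 + P) * ‖a‖ ^ 2)) := by
    have h1 : ∀ i, ‖∇ (f i) (x i)‖ ^ 2 ≤ 2 * ‖∇ (f i) (x i) - ∇ (f i) (mean x)‖ ^ 2 +
        2 * ‖∇ (f i) (mean x)‖ ^ 2 := fun i => by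
      have h2 := two_mul_inner_le one_pos (∇ (f i) (x i) - ∇ (f i) (mean x)) (∇ (f i) (mean x))
      have h3 := norm_add_sq_real (∇ (f i) (x i) - ∇ (f i) (mean x)) (∇ (f i) (mean x))
      rw [sub_add_cancel] at h3
      linarith
    have h2 := Finset.sum_le_sum fun i (_ : i ∈ Finset.univ) => h1 i
    rw [Finset.sum_add_distrib, ← Finset.mul_sum, ← Finset.mul_sum] at h2
    linarith
  exact nonConvex_residual_le hn1 (by linarith) hL hγ hP hM rfl hc hγ1 (by positivity) hW0
    (by positivity) (noise_nonneg Q x) (by positivity) (hf.noise_le x) hprog hcons hG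

open Classical in
/-- The average over time of the squared norm of the gradient, up to a residual that is proportional
to the step size. -/
theorem integral_norm_gradient_sq_le {D : Ω → Clock N → ℕ → ℝ × Ξ}
    (hD : IsClockData Pr (clockRate N) (markLaw N Q ξ₀) D) (ho : IsOracle Q f g) (hn : 0 < n)
    (hN : chi1 N < ∞) (hβ : IsEnergyWeight N p β) (hχ : 0 ≤ p.chi) {L σ ζ P M : ℝ} (hL : 0 < L)
    (hP : 0 ≤ P) (hM : 0 ≤ M) (hf : NonConvexSetting Q f g L σ ζ P M)
    {xs : EuclideanSpace ℝ (Fin d)} (hxs : ∀ y, objective f xs ≤ objective f y) (hγ : 0 < γ)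
    (hγ1 : γ * L * (1 + p.chi) * ((1 + M) * (1 + P)) ≤ 1 / 40) {T : ℝ} (hT : 0 < T) :
    (∀ t, 0 < t → Integrable (fun ω =>
      ‖∇ (objective f) (mean ((networkFlow N p γ g hg x₀).leftState t (D ω)).1)‖ ^ 2) Pr) ∧
    Integrable (fun x : ℝ × Ω => ‖∇ (objective f)
      (mean ((networkFlow N p γ g hg x₀).leftState x.1 (D x.2)).1)‖ ^ 2) (timeProd Pr T) ∧
    ∫ x : ℝ × Ω, ‖∇ (objective f)
      (mean ((networkFlow N p γ g hg x₀).leftState x.1 (D x.2)).1)‖ ^ 2 ∂(timeProd Pr T) ≤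
      4 / γ * (objective f x₀ - objective f xs)
        + 20 * (1 + M) * γ * L * (σ ^ 2 + (1 + p.chi) * ζ ^ 2) * T := by
  have hobj : IsSmooth L (objective f) := isSmooth_objective hn hf.smooth
  have hgrad0 : ∇ (objective f) xs = 0 := gradient_eq_zero_of_forall_le hxs
  set c := 8 * γ * L ^ 2 * (1 + p.chi) with hc
  have hc0 : 0 ≤ c / n := by positivity
  set F := networkFlow N p γ g hg x₀ with hF
  set X : ℝ → Ω → State n d := fun t ω => F.leftState t (D ω) with hX
  set S := 5 * (1 + M) * γ ^ 2 * L * (σ ^ 2 + (1 + p.chi) * ζ ^ 2) with hS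
  clear_value S
  obtain ⟨C, hw⟩ := exists_isWeight (N := N) (p := p) (γ := γ) (hg := hg) (x₀ := x₀) (ξ₀ := ξ₀)
    ho hn hM hf.smooth hf.noise_le
  have hquad : ∀ y : EuclideanSpace ℝ (Fin d), |objective f y - objective f xs| ≤
      L / 2 * (2 + 2 * ‖xs‖ ^ 2) * (1 + ‖y‖ ^ 2) := fun y => by
    have h1 := hobj.le_add xs (y - xs)
    rw [hgrad0, inner_zero_left, add_zero, add_sub_cancel] at h1
    have h2 := mul_le_mul_of_nonneg_left (norm_sub_sq_le y xs) (by positivity : 0 ≤ L / 2)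
    rw [abs_of_nonneg (by linarith [hxs y])]
    linarith
  obtain ⟨B, hB1, hB2⟩ := exists_lyapunov_le (p := p) (c := c / n) hn hN hβ hquad
  obtain ⟨hint, hint2, hdyn⟩ := (isTest_lyapunov (N := N) (p := p) (γ := γ) (hg := hg) (x₀ := x₀)
    (β := β) (c := c / n) (h := fun y => objective f y - objective f xs)
    (hobj.1.continuous.sub continuous_const)).integral_leftState_of_weight hw
    isInvariant_meanSet hD (clockRate_pos N) (fun z _ => hB1 z) (fun z _ => hB2 z) 0 hT
  have hcont : Continuous fun z : State n d => ‖∇ (objective f) (mean z.1)‖ ^ 2 :=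
    (hobj.continuous_gradient.comp (continuous_mean.comp continuous_fst)).norm.pow 2
  have hgw : ∀ z : State n d, ‖‖∇ (objective f) (mean z.1)‖ ^ 2‖ ≤
      L ^ 2 * (2 + 2 * ‖xs‖ ^ 2) * 2 * weight z := fun z => by
    have h1 := pow_le_pow_left₀ (norm_nonneg _) (hobj.2 (mean z.1) xs) 2
    rw [hgrad0, sub_zero, mul_pow] at h1
    have h2 : 1 + ‖mean z.1‖ ^ 2 ≤ 2 * weight z := by
      have := one_le_weight z
      have := norm_mean_sq_le_weight hn z
      linarith
    rw [Real.norm_of_nonneg (by positivity)]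
    calc ‖∇ (objective f) (mean z.1)‖ ^ 2 ≤ L ^ 2 * ‖mean z.1 - xs‖ ^ 2 := h1
      _ ≤ L ^ 2 * ((2 + 2 * ‖xs‖ ^ 2) * (1 + ‖mean z.1‖ ^ 2)) := by
          gcongr; exact norm_sub_sq_le _ _
      _ ≤ L ^ 2 * ((2 + 2 * ‖xs‖ ^ 2) * (2 * weight z)) := by gcongr
      _ = _ := by ring
  have hmeas2 : Measurable fun x : ℝ × Ω => X x.1 x.2 := F.measurable_leftState.comp
    (measurable_fst.prodMk (hD.measurable.comp measurable_snd))
  have hintG : Integrable (fun x : ℝ × Ω => ‖∇ (objective f) (mean (X x.1 x.2).1)‖ ^ 2)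
      (timeProd Pr T) :=
    ((hw.integrable_timeProd isInvariant_meanSet hD (clockRate_pos N) T).const_mul _).mono'
      (hcont.measurable.comp hmeas2).aestronglyMeasurable (Eventually.of_forall fun x => hgw _)
  refine ⟨fun t ht => ?_, hintG, ?_⟩
  · have hmeas : Measurable (X t) := F.measurable_leftState.comp
      (measurable_const.prodMk hD.measurable)
    exact ((hw.integral_le isInvariant_meanSet hD (clockRate_pos N) ht).1.const_mul _).mono'
      (hcont.measurable.comp hmeas).aestronglyMeasurable (Eventually.of_forall fun x => hgw _)
  have hmass : (timeProd Pr T).real Set.univ = T := by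
    simp [timeProd, measureReal_def, ← Set.univ_prod_univ, hT.le]
  have hfin : IsFiniteMeasure (timeProd Pr T) := inferInstance
  have hle : ∫ x : ℝ × Ω, Real.exp (0 * x.1) *
      (0 * lyapunov N β (c / n) (fun y => objective f y - objective f xs) (X x.1 x.2) +
        F.gen (clockRate N) (markLaw N Q ξ₀)
          (lyapunov N β (c / n) fun y => objective f y - objective f xs)
          (lyapunovDeriv N p β (c / n)) (X x.1 x.2)) ∂(timeProd Pr T) ≤
      ∫ x : ℝ × Ω, (S - γ / 4 * ‖∇ (objective f) (mean (X x.1 x.2).1)‖ ^ 2) ∂(timeProd Pr T) := by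
    refine integral_mono hint2 ((integrable_const S).sub (hintG.const_mul _)) fun x => ?_
    have h1 := gen_lyapunov_le_of_isSmooth (N := N) (p := p) (hg := hg) (x₀ := x₀)
      (ξ₀ := ξ₀) ho hn hN hβ hχ hL hP hM hf hquad hγ hγ1
      ((isInvariant_meanSet (N := N) (p := p) (γ := γ) (hg := hg)
        (x₀ := x₀)).leftState_mem x.1 (D x.2))
    simp only [zero_mul, Real.exp_zero, one_mul, zero_add]
    refine h1.trans_eq ?_
    rw [hS]; ring
  rw [integral_sub (integrable_const S) (hintG.const_mul _), integral_const, hmass, smul_eq_mul,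
    integral_const_mul] at hle
  have hinit : lyapunov N β (c / n) (fun y => objective f y - objective f xs) F.init =
      objective f x₀ - objective f xs := by
    have h1 : F.init = (fun _ => x₀, fun _ => x₀) := rfl
    rw [lyapunov, h1, consensusEnergy_eq_zero, mean_const hn]
    ring
  have hpos : 0 ≤ ∫ ω, lyapunov N β (c / n) (fun y => objective f y - objective f xs) (X T ω) ∂Pr :=
    integral_nonneg fun ω => add_nonneg (sub_nonneg.2 (hxs _))
      (mul_nonneg hc0 (consensusEnergy_nonneg hβ.nonneg _))
  rw [hinit, zero_mul, Real.exp_zero, one_mul] at hdyn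
  have h1 : γ / 4 * ∫ x : ℝ × Ω, ‖∇ (objective f) (mean (X x.1 x.2).1)‖ ^ 2 ∂(timeProd Pr T) ≤
      objective f x₀ - objective f xs + T * S := by
    have h0 : 0 ≤ objective f x₀ - objective f xs + (T * S - γ / 4 *
        ∫ x : ℝ × Ω, ‖∇ (objective f) (mean (X x.1 x.2).1)‖ ^ 2 ∂(timeProd Pr T)) :=
      hpos.trans (hdyn.le.trans (add_le_add le_rfl hle))
    linarith
  have h2 := mul_le_mul_of_nonneg_left h1 (by positivity : 0 ≤ 4 / γ)
  have h3 : 4 / γ * (objective f x₀ - objective f xs + T * S) =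
      4 / γ * (objective f x₀ - objective f xs)
        + 20 * (1 + M) * γ * L * (σ ^ 2 + (1 + p.chi) * ζ ^ 2) * T := by
    rw [hS]; field_simp; ring
  have h4 : ∀ I : ℝ, 4 / γ * (γ / 4 * I) = I := fun I => by field_simp
  rw [h3, h4] at h2
  exact h2

/-- The step size `min (b / A) (√(f₀ / (T L S)))` balances the initial error and the residual. -/
theorem exists_stepSize_of_isSmooth {b L A κ S f₀ T M : ℝ} (hb : 0 < b) (hL : 0 < L) (hκ : 1 ≤ κ)
    (hS : 0 ≤ S) (hf₀ : 0 ≤ f₀) (h0 : f₀ = 0 → S = 0) (hT : 0 < T) (hM : 0 ≤ M)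
    (hA : A = L * κ) : ∃ γ, 0 < γ ∧ γ ≤ b / A ∧
      1 / T * (4 / γ * f₀ + 20 * (1 + M) * γ * L * S * T) ≤
        (4 / b + 20 * (1 + M) + 4) * (A / T * f₀ + √(L * f₀ / T * S)) := by
  have hA0 : 0 < A := by rw [hA]; positivity
  have hsq := Real.sqrt_nonneg (L * f₀ / T * S)
  have hdet : 0 ≤ A / T * f₀ := by positivity
  have hfirst : 1 / T * (4 / (b / A) * f₀) = 4 / b * (A / T * f₀) := by field_simp
  have hb4 : 0 ≤ 4 / b := by positivity
  have hprod : 0 ≤ (20 * (1 + M) + 4) * (A / T * f₀) + (4 / b) * √(L * f₀ / T * S) := by positivity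
  rcases hS.eq_or_lt with rfl | hS
  · refine ⟨b / A, by positivity, le_rfl, ?_⟩
    have h2 : 0 ≤ (20 * (1 + M) + 4) * √(L * f₀ / T * 0) := by positivity
    rw [mul_zero, zero_mul, add_zero, hfirst]
    linarith
  have hf₀' : 0 < f₀ := hf₀.lt_of_ne fun h => hS.ne' (h0 h.symm)
  set ρ := √(f₀ / (T * L * S)) with hρ
  have hρ0 : 0 < ρ := Real.sqrt_pos.2 (by positivity)
  have hρ2 : ρ ^ 2 = f₀ / (T * L * S) := Real.sq_sqrt (by positivity)
  -- the two terms agree at `ρ`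
  have hroot : √(L * f₀ / T * S) = ρ * (L * S) := by
    rw [← Real.sqrt_sq (by positivity : 0 ≤ ρ * (L * S)), mul_pow, hρ2]
    congr 1; field_simp
  have hroot2 : 1 / T * (4 / ρ * f₀) = 4 * √(L * f₀ / T * S) := by
    have : f₀ = ρ ^ 2 * (T * L * S) := by rw [hρ2]; field_simp
    rw [hroot]
    nth_rewrite 1 [this]
    field_simp
  have hres : ∀ γ, γ ≤ ρ → 1 / T * (20 * (1 + M) * γ * L * S * T) ≤
      20 * (1 + M) * √(L * f₀ / T * S) := fun γ h => by
    have h1 : 1 / T * (20 * (1 + M) * γ * L * S * T) = 20 * (1 + M) * (γ * (L * S)) := by field_simp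
    rw [h1, hroot]
    gcongr
  rcases le_total (b / A) ρ with h | h
  · refine ⟨b / A, by positivity, le_rfl, ?_⟩
    have := hres _ h
    rw [mul_add, hfirst]
    linarith
  · refine ⟨ρ, hρ0, h, ?_⟩
    have := hres _ le_rfl
    rw [mul_add, hroot2]
    have h2 : 0 ≤ 4 / b * (A / T * f₀) := by positivity
    linarith

end NonConvex

/-! ### The number of steps -/

section Counts

variable {Ω Ξ : Type*} [MeasurableSpace Ω] [MeasurableSpace Ξ] {n : ℕ} {N : Network n}
  {τ : Fin n → ℕ → Ω → ℝ} {ξ : Fin n → ℕ → Ω → Ξ} {θ : Sym2 (Fin n) → ℕ → Ω → ℝ}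
  {Pr : Measure Ω} [IsProbabilityMeasure Pr] {Q : Measure Ξ} [IsProbabilityMeasure Q]

omit [MeasurableSpace Ω] in
theorem arrivals_eq_tsum (τ : ℕ → Ω → ℝ) (T : ℝ) (ω : Ω) :
    (arrivals τ T ω : ℝ≥0∞) = ∑' c, {c | τ c ω ≤ T}.indicator 1 c := by
  rw [arrivals, ← ENNReal.tsum_set_one]
  exact tsum_subtype {k | τ k ω ≤ T} (1 : ℕ → ℝ≥0∞)

theorem measurable_arrivals {τ : ℕ → Ω → ℝ} (h : ∀ k, Measurable (τ k)) (T : ℝ) :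
    Measurable fun ω => (arrivals τ T ω : ℝ≥0∞) := by
  simp only [arrivals_eq_tsum]
  refine Measurable.tsum fun c => ?_
  exact (measurable_const (a := (1 : ℝ≥0∞))).indicator (measurableSet_le (h c) measurable_const)

theorem IsDriving.lintegral_arrivals_grad (h : IsDriving Pr Q N τ ξ θ) (i : Fin n) (T : ℝ) :
    ∫⁻ ω, (arrivals (τ i) T ω : ℝ≥0∞) ∂Pr = ENNReal.ofReal T := by
  classical
  obtain ⟨ξ₀⟩ : Nonempty Ξ := Q.nonempty_of_neZero
  have h1 := (h.isClockData (ξ₀ := ξ₀)).lintegral_tsum_arr_eq (clockRate_pos N) (.inl i) T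
  simp only [arr_clockData_inl, ← arrivals_eq_tsum] at h1
  simpa [clockRate] using h1

theorem IsDriving.lintegral_arrivals_comm (h : IsDriving Pr Q N τ ξ θ) {e : Sym2 (Fin n)}
    (he : e ∈ N.graph.edgeSet) (T : ℝ) :
    ∫⁻ ω, (arrivals (θ e) T ω : ℝ≥0∞) ∂Pr = ENNReal.ofReal (N.rate e * T) := by
  classical
  obtain ⟨ξ₀⟩ : Nonempty Ξ := Q.nonempty_of_neZero
  have h1 := (h.isClockData (ξ₀ := ξ₀)).lintegral_tsum_arr_eq (clockRate_pos N) (.inr ⟨e, he⟩) T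
  simp only [arr_clockData_inr, ← arrivals_eq_tsum] at h1
  exact h1

theorem IsDriving.lintegral_sum_arrivals_grad (h : IsDriving Pr Q N τ ξ θ) (T : ℝ) :
    ∫⁻ ω, ∑ i, (arrivals (τ i) T ω : ℝ≥0∞) ∂Pr = ENNReal.ofReal (n * T) := by
  rw [lintegral_finsetSum _ fun i _ => measurable_arrivals (h.grad i).times.measurable T,
    ENNReal.ofReal_mul (Nat.cast_nonneg n)]
  simp [h.lintegral_arrivals_grad]

open Classical in
theorem IsDriving.lintegral_sum_arrivals_comm (h : IsDriving Pr Q N τ ξ θ) {T : ℝ} (hT : 0 ≤ T) :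
    ∫⁻ ω, ∑ e ∈ N.graph.edgeFinset, (arrivals (θ e) T ω : ℝ≥0∞) ∂Pr =
      ENNReal.ofReal ((laplacian N).trace / 2 * T) := by
  have he : ∀ e ∈ N.graph.edgeFinset, e ∈ N.graph.edgeSet := fun e => by simp
  have htrace : (laplacian N).trace / 2 * T = ∑ e ∈ N.graph.edgeFinset, N.rate e * T := by
    have h1 : (laplacian N).trace = ∑ e ∈ N.graph.edgeFinset, N.rate e * 2 := by
      rw [laplacian, Matrix.trace_sum]
      refine Finset.sum_congr rfl fun e hmem => ?_
      rw [Matrix.trace_smul, edgeMatrix_trace (N.graph.not_isDiag_of_mem_edgeSet (he e hmem)),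
        smul_eq_mul]
    rw [h1, ← Finset.sum_mul, ← Finset.sum_mul]
    ring
  rw [lintegral_finsetSum _ fun e hmem => measurable_arrivals (h.comm e (he e hmem)).measurable T,
    htrace, ENNReal.ofReal_sum_of_nonneg fun e hmem =>
      mul_nonneg (N.rate_pos e (he e hmem)).le hT]
  exact Finset.sum_congr rfl fun e hmem => h.lintegral_arrivals_comm (he e hmem) T

end Counts

/-! ### The guarantees -/

section Guarantees

variable {Ω Ξ : Type*} [MeasurableSpace Ω] [MeasurableSpace Ξ] {n d : ℕ} {N : Network n}
  {p : Params} {γ : ℝ} {g : Fin n → EuclideanSpace ℝ (Fin d) → Ξ → EuclideanSpace ℝ (Fin d)}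
  {x₀ xs : EuclideanSpace ℝ (Fin d)} {f : Fin n → EuclideanSpace ℝ (Fin d) → ℝ} {Q : Measure Ξ}
  [IsProbabilityMeasure Q] {Pr : Measure Ω} [IsProbabilityMeasure Pr]
  {x xt : ℝ → Ω → Fin n → EuclideanSpace ℝ (Fin d)}

theorem IsRun.integral_norm_mean_sub_sq_le (hrun : IsRun Pr Q N p γ g x₀ x xt)
    (ho : IsOracle Q f g) (hn : 0 < n) (hN : chi1 N < ∞)
    (hp : p = nonAccelerated N ∨ p = accelerated N) {μ L s σ ζ : ℝ} (hμ : 0 < μ) (hL : 0 < L)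
    (hf : StronglyConvexSetting Q f g xs μ L σ ζ)
    (hnoise : ∀ y : Fin n → EuclideanSpace ℝ (Fin d), noise Q f g y ≤ s)
    (hxs : ∀ y, objective f xs ≤ objective f y) (hγ : 0 < γ)
    (hγ1 : γ * L * (1 + p.chi) ≤ 1 / 16) {T : ℝ} (hT : 0 < T) :
    Integrable (fun ω => ‖mean (x T ω) - xs‖ ^ 2) Pr ∧
    ∫ ω, ‖mean (x T ω) - xs‖ ^ 2 ∂Pr ≤
      ‖x₀ - xs‖ ^ 2 * Real.exp (-(γ * μ * T)) + 170 * γ * (s + ζ ^ 2 * (1 + p.chi)) / μ := by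
  classical
  obtain ⟨τ, ξ, θ, hd, hsol, h0⟩ := hrun
  obtain ⟨ξ₀⟩ : Nonempty Ξ := Q.nonempty_of_neZero
  obtain ⟨β, hβ⟩ := exists_isEnergyWeight hN hp
  obtain ⟨h1, h2⟩ := Gossip.integral_norm_mean_sub_sq_le (hg := ho.measurable) (x₀ := x₀) (N := N)
    (hd.isClockData (ξ₀ := ξ₀)) ho hn hN hβ (Params.chi_nonneg hp) hμ hL hf.strongConvex hf.smooth
    hnoise (gradient_eq_zero_of_forall_le hxs) hf.heterogeneity_le hγ hγ1 hT
  have heq : ∀ᵐ ω ∂Pr, ‖mean ((networkFlow N p γ g ho.measurable x₀).leftState T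
      (clockData N τ ξ θ ξ₀ ω)).1 - xs‖ ^ 2 = ‖mean (x T ω) - xs‖ ^ 2 := by
    filter_upwards [hsol.ae_eq_leftState ho.measurable ξ₀ hd h0 hT] with ω hω
    rw [← hω]
  exact ⟨h1.congr heq, (integral_congr_ae heq).symm.trans_le h2⟩

/-- With noise at most `s` everywhere, one step size gives the guarantee up to a factor `m`, for
every `m ≥ 1` with `s ≤ m σ²`. -/
theorem exists_stepSize_stronglyConvexGuarantee {Ξ : Type v} [MeasurableSpace Ξ] {Q : Measure Ξ}
    [IsProbabilityMeasure Q] {g : Fin n → EuclideanSpace ℝ (Fin d) → Ξ → EuclideanSpace ℝ (Fin d)}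
    (ho : IsOracle Q f g) (hn : 0 < n) (hN : chi1 N < ∞)
    (hp : p = nonAccelerated N ∨ p = accelerated N) {μ L σ ζ m : ℝ} (hμ : 0 < μ) (hL : 0 < L)
    (hf : StronglyConvexSetting Q f g xs μ L σ ζ) (hm : 1 ≤ m)
    (hnoise : ∀ y : Fin n → EuclideanSpace ℝ (Fin d), noise Q f g y ≤ m * σ ^ 2)
    (hxs : ∀ y, objective f xs ≤ objective f y) {T : ℝ} (hT : 0 < T) :
    ∃ γ : ℝ, 0 < γ ∧ γ ≤ 1 / (16 * L * (1 + p.chi)) ∧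
      ∀ (Ω : Type u) [MeasurableSpace Ω] (Pr : Measure Ω) [IsProbabilityMeasure Pr]
        (x xt : ℝ → Ω → Fin n → EuclideanSpace ℝ (Fin d)), IsRun Pr Q N p γ g x₀ x xt →
          StronglyConvexGuarantee (172 * m) Pr x x₀ xs μ L σ ζ p.chi T := by
  have hχ := Params.chi_nonneg hp
  have hκ : 0 < 1 + p.chi := by linarith
  obtain ⟨γ, hγ, hγ1, hle⟩ := exists_stepSize_of_strongConvexOn (A := L * (1 + p.chi))
    (S := σ ^ 2 + ζ ^ 2 * (1 + p.chi)) (r := ‖x₀ - xs‖ ^ 2) hμ (by positivity) (by positivity)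
    (by positivity) hT
  rw [← mul_assoc] at hγ1 hle
  refine ⟨γ, hγ, hγ1, fun Ω _ Pr _ x xt hrun => ?_⟩
  rw [le_div_iff₀ (by positivity)] at hγ1
  obtain ⟨h1, h2⟩ := hrun.integral_norm_mean_sub_sq_le ho hn hN hp hμ hL hf hnoise hxs hγ
    (by linarith) hT
  refine ⟨h1, h2.trans ?_⟩
  have h3 : ‖x₀ - xs‖ ^ 2 * Real.exp (-(γ * μ * T)) ≤
      m * (‖x₀ - xs‖ ^ 2 * Real.exp (-(γ * μ * T))) := le_mul_of_one_le_left (by positivity) hm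
  have h4 : ζ ^ 2 * (1 + p.chi) ≤ m * (ζ ^ 2 * (1 + p.chi)) :=
    le_mul_of_one_le_left (by positivity) hm
  have h5 : 170 * γ * (m * σ ^ 2 + ζ ^ 2 * (1 + p.chi)) / μ ≤
      170 * γ * (m * (σ ^ 2 + ζ ^ 2 * (1 + p.chi))) / μ := by
    gcongr; linarith
  have h6 : 170 * γ * (m * (σ ^ 2 + ζ ^ 2 * (1 + p.chi))) / μ =
      m * (170 * γ * (σ ^ 2 + ζ ^ 2 * (1 + p.chi)) / μ) := by ring
  have h7 := mul_le_mul_of_nonneg_left hle (by linarith : 0 ≤ m)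
  rw [mul_comm 172 m, mul_assoc m]
  linarith

omit [IsProbabilityMeasure Q] in
/-- The variance of one worker is at most `n` times the noise at consensus, so that a bound at
consensus costs a factor `n` when the workers are at different points. -/
theorem noise_le_mul (hn : 0 < n) {s : ℝ}
    (h : ∀ y : EuclideanSpace ℝ (Fin d), noise Q f g (fun _ => y) ≤ s)
    (y : Fin n → EuclideanSpace ℝ (Fin d)) : noise Q f g y ≤ n * s := by
  have hn' : (0 : ℝ) < n := by positivity
  have h1 : ∀ i, ∫ ξ, ‖g i (y i) ξ - ∇ (f i) (y i)‖ ^ 2 ∂Q ≤ n * s := fun i => by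
    have h2 := h (y i)
    rw [noise, one_div, inv_mul_le_iff₀ hn'] at h2
    exact (Finset.single_le_sum (f := fun j => ∫ ξ, ‖g j (y i) ξ - ∇ (f j) (y i)‖ ^ 2 ∂Q)
      (fun j _ => integral_nonneg fun ξ => by positivity) (Finset.mem_univ i)).trans h2
  rw [noise, one_div, inv_mul_le_iff₀ hn']
  refine (Finset.sum_le_sum fun i _ => h1 i).trans_eq ?_
  simp

theorem IsRun.integral_norm_gradient_sq_le (hrun : IsRun Pr Q N p γ g x₀ x xt)
    (ho : IsOracle Q f g) (hn : 0 < n) (hN : chi1 N < ∞)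
    (hp : p = nonAccelerated N ∨ p = accelerated N) {L σ ζ P M : ℝ} (hL : 0 < L) (hP : 0 ≤ P)
    (hM : 0 ≤ M) (hf : NonConvexSetting Q f g L σ ζ P M)
    (hxs : ∀ y, objective f xs ≤ objective f y) (hγ : 0 < γ)
    (hγ1 : γ * L * (1 + p.chi) * ((1 + M) * (1 + P)) ≤ 1 / 40) {T : ℝ} (hT : 0 < T) :
    (∀ t ∈ Set.Icc 0 T, Integrable (fun ω => ‖∇ (objective f) (mean (x t ω))‖ ^ 2) Pr) ∧
    IntervalIntegrable (fun t => ∫ ω, ‖∇ (objective f) (mean (x t ω))‖ ^ 2 ∂Pr) volume 0 T ∧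
    ∫ t in (0 : ℝ)..T, ∫ ω, ‖∇ (objective f) (mean (x t ω))‖ ^ 2 ∂Pr ≤
      4 / γ * (objective f x₀ - objective f xs)
        + 20 * (1 + M) * γ * L * (σ ^ 2 + (1 + p.chi) * ζ ^ 2) * T := by
  classical
  obtain ⟨τ, ξ, θ, hd, hsol, h0⟩ := hrun
  obtain ⟨ξ₀⟩ : Nonempty Ξ := Q.nonempty_of_neZero
  obtain ⟨β, hβ⟩ := exists_isEnergyWeight hN hp
  obtain ⟨h1, h2, h3⟩ := Gossip.integral_norm_gradient_sq_le (hg := ho.measurable) (x₀ := x₀)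
    (N := N) (hd.isClockData (ξ₀ := ξ₀)) ho hn hN hβ (Params.chi_nonneg hp) hL hP hM hf hxs hγ
    hγ1 hT
  have heq : ∀ t, 0 < t → ∀ᵐ ω ∂Pr, ‖∇ (objective f) (mean
      ((networkFlow N p γ g ho.measurable x₀).leftState t (clockData N τ ξ θ ξ₀ ω)).1)‖ ^ 2 =
      ‖∇ (objective f) (mean (x t ω))‖ ^ 2 := fun t ht => by
    filter_upwards [hsol.ae_eq_leftState ho.measurable ξ₀ hd h0 ht] with ω hω
    rw [← hω]
  have hcongr : Set.EqOn (fun t => ∫ ω, ‖∇ (objective f) (mean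
      ((networkFlow N p γ g ho.measurable x₀).leftState t (clockData N τ ξ θ ξ₀ ω)).1)‖ ^ 2 ∂Pr)
      (fun t => ∫ ω, ‖∇ (objective f) (mean (x t ω))‖ ^ 2 ∂Pr) (Set.Ioc 0 T) := fun t ht =>
    integral_congr_ae (heq t ht.1)
  refine ⟨fun t ht => ?_, ?_, ?_⟩
  · rcases ht.1.eq_or_lt with rfl | ht0
    · refine (integrable_const (‖∇ (objective f) x₀‖ ^ 2)).congr ?_
      filter_upwards [h0] with ω hω
      rw [show x 0 ω = fun _ => x₀ from funext fun i => (hω i).1, mean_const hn]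
    · exact (h1 t ht0).congr (heq t ht0)
  · rw [intervalIntegrable_iff_integrableOn_Ioc_of_le hT.le]
    exact (integrableOn_congr_fun hcongr measurableSet_Ioc).1 h2.integral_prod_left
  · rw [intervalIntegral.integral_of_le hT.le, ← setIntegral_congr_fun measurableSet_Ioc hcongr,
      ← integral_prod _ h2]
    exact h3

/-- The step size is at most `1 / (40 (1 + M) (1 + P) L (1 + χ))`, the range where the Lyapunov
function decreases. -/
theorem exists_stepSize_nonConvexGuarantee {Ξ : Type v} [MeasurableSpace Ξ] {Q : Measure Ξ}
    [IsProbabilityMeasure Q] {g : Fin n → EuclideanSpace ℝ (Fin d) → Ξ → EuclideanSpace ℝ (Fin d)}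
    (ho : IsOracle Q f g) (hn : 0 < n) (hN : chi1 N < ∞)
    (hp : p = nonAccelerated N ∨ p = accelerated N) {L σ ζ P M : ℝ} (hL : 0 < L) (hP : 0 ≤ P)
    (hM : 0 ≤ M) (hf : NonConvexSetting Q f g L σ ζ P M)
    (hxs : ∀ y, objective f xs ≤ objective f y)
    (h0 : objective f x₀ = objective f xs → σ = 0 ∧ ζ = 0) {T : ℝ} (hT : 0 < T) :
    ∃ γ : ℝ, 0 < γ ∧ γ ≤ 1 / (40 * ((1 + M) * (1 + P))) / (L * (p.chi + 1)) ∧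
      ∀ (Ω : Type u) [MeasurableSpace Ω] (Pr : Measure Ω) [IsProbabilityMeasure Pr]
        (x xt : ℝ → Ω → Fin n → EuclideanSpace ℝ (Fin d)), IsRun Pr Q N p γ g x₀ x xt →
          NonConvexGuarantee (4 / (1 / (40 * ((1 + M) * (1 + P)))) + 20 * (1 + M) + 4)
            Pr f x x₀ xs L σ ζ p.chi T := by
  have hχ := Params.chi_nonneg hp
  have hκ : 0 < 1 + p.chi := by linarith
  obtain ⟨γ, hγ, hγ1, hle⟩ := exists_stepSize_of_isSmooth (b := 1 / (40 * ((1 + M) * (1 + P))))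
    (A := L * (1 + p.chi)) (κ := 1 + p.chi) (S := σ ^ 2 + (1 + p.chi) * ζ ^ 2)
    (f₀ := objective f x₀ - objective f xs) (by positivity) hL (by linarith) (by positivity)
    (sub_nonneg.2 (hxs x₀)) (fun h => by
      obtain ⟨rfl, rfl⟩ := h0 (sub_eq_zero.1 h)
      simp) hT hM rfl
  refine ⟨γ, hγ, by rwa [add_comm p.chi], fun Ω _ Pr _ x xt hrun => ?_⟩
  rw [div_div, le_div_iff₀ (by positivity)] at hγ1
  obtain ⟨h1, h2, h3⟩ := hrun.integral_norm_gradient_sq_le ho hn hN hp hL hP hM hf hxs hγ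
    (by linarith) hT
  refine ⟨h1, h2, (mul_le_mul_of_nonneg_left h3 (by positivity)).trans hle⟩

end Guarantees

end Gossip

open Classical in
theorem proposition1 :
    -- `C` is an absolute constant; `c P M` and `B P M` depend only on `P` and `M`
    ∃ (C : ℝ) (c B : ℝ → ℝ → ℝ), (∀ P M : ℝ, 0 ≤ P → 0 ≤ M → 0 < c P M) ∧
    ∀ (n d : ℕ), 0 < n → ∀ (N : Network n), chi1 N < ∞ →
    ∀ (Ξ : Type v) [MeasurableSpace Ξ] (Q : Measure Ξ) [IsProbabilityMeasure Q]
      (f : Fin n → EuclideanSpace ℝ (Fin d) → ℝ)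
      (g : Fin n → EuclideanSpace ℝ (Fin d) → Ξ → EuclideanSpace ℝ (Fin d)), IsOracle Q f g →
    ∀ (xs x₀ : EuclideanSpace ℝ (Fin d)), (∀ y, objective f xs ≤ objective f y) →
    ∀ (L T : ℝ), 0 < L → 0 < T →
    -- `χ` is not larger with acceleration
    (accelerated N).chi ≤ (nonAccelerated N).chi ∧
    -- the guarantees, in both settings
    (∀ p : Params, p = nonAccelerated N ∨ p = accelerated N →
      (∀ μ σ ζ : ℝ, 0 < μ → StronglyConvexSetting Q f g xs μ L σ ζ →
        (∃ γ : ℝ, 0 < γ ∧ γ ≤ 1 / (16 * L * (1 + p.chi)) ∧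
          ∀ (Ω : Type u) [MeasurableSpace Ω] (Pr : Measure Ω) [IsProbabilityMeasure Pr]
            (x xt : ℝ → Ω → Fin n → EuclideanSpace ℝ (Fin d)),
            IsRun Pr Q N p γ g x₀ x xt →
              StronglyConvexGuarantee (C * n) Pr x x₀ xs μ L σ ζ p.chi T) ∧
        -- no factor `n` if the noise is bounded when the workers are at different points
        ((∀ y : Fin n → EuclideanSpace ℝ (Fin d), noise Q f g y ≤ σ ^ 2) →
          ∃ γ : ℝ, 0 < γ ∧ γ ≤ 1 / (16 * L * (1 + p.chi)) ∧
            ∀ (Ω : Type u) [MeasurableSpace Ω] (Pr : Measure Ω) [IsProbabilityMeasure Pr]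
              (x xt : ℝ → Ω → Fin n → EuclideanSpace ℝ (Fin d)),
              IsRun Pr Q N p γ g x₀ x xt →
                StronglyConvexGuarantee C Pr x x₀ xs μ L σ ζ p.chi T)) ∧
      (∀ σ ζ P M : ℝ, 0 ≤ P → 0 ≤ M → NonConvexSetting Q f g L σ ζ P M →
        (objective f x₀ = objective f xs → σ = 0 ∧ ζ = 0) →
        ∃ γ : ℝ, 0 < γ ∧ γ ≤ c P M / (L * (p.chi + 1)) ∧
          ∀ (Ω : Type u) [MeasurableSpace Ω] (Pr : Measure Ω) [IsProbabilityMeasure Pr]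
            (x xt : ℝ → Ω → Fin n → EuclideanSpace ℝ (Fin d)),
            IsRun Pr Q N p γ g x₀ x xt →
              NonConvexGuarantee (B P M) Pr f x x₀ xs L σ ζ p.chi T)) ∧
    -- the expected numbers of gradient steps and of communications up to time `T`
    (∀ (Ω : Type u) [MeasurableSpace Ω] (Pr : Measure Ω) [IsProbabilityMeasure Pr]
      (τ : Fin n → ℕ → Ω → ℝ) (ξ : Fin n → ℕ → Ω → Ξ) (θ : Sym2 (Fin n) → ℕ → Ω → ℝ),
      IsDriving Pr Q N τ ξ θ →
        ∫⁻ ω, ∑ i, (arrivals (τ i) T ω : ℝ≥0∞) ∂Pr = ENNReal.ofReal (n * T) ∧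
        ∫⁻ ω, ∑ e ∈ N.graph.edgeFinset, (arrivals (θ e) T ω : ℝ≥0∞) ∂Pr =
          ENNReal.ofReal ((laplacian N).trace / 2 * T)) := by
  refine ⟨172, fun P M => 1 / (40 * ((1 + M) * (1 + P))),
    fun P M => 4 / (1 / (40 * ((1 + M) * (1 + P)))) + 20 * (1 + M) + 4,
    fun P M hP hM => by positivity, ?_⟩
  intro n d hn N hN Ξ _ Q _ f g ho xs x₀ hxs L T hL hT
  refine ⟨accelerated_chi_le hN, fun p hp => ⟨fun μ σ ζ hμ hf => ⟨?_, fun hnoise => ?_⟩,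
    fun σ ζ P M hP hM hf h0 => ?_⟩, fun Ω _ Pr _ τ ξ θ hd => ⟨?_, ?_⟩⟩
  · exact exists_stepSize_stronglyConvexGuarantee ho hn hN hp hμ hL hf (by exact_mod_cast hn)
      (noise_le_mul hn hf.noise_le) hxs hT
  · obtain ⟨γ, h1, h2, h3⟩ := exists_stepSize_stronglyConvexGuarantee (x₀ := x₀) ho hn hN hp hμ hL
      hf le_rfl (fun y => by simpa using hnoise y) hxs hT
    exact ⟨γ, h1, h2, by simpa using h3⟩
  · exact exists_stepSize_nonConvexGuarantee ho hn hN hp hL hP hM hf hxs h0 hT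
  · exact hd.lintegral_sum_arrivals_grad T
  · exact hd.lintegral_sum_arrivals_comm hT.le
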